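/- Let $\Omega=\mathbb T^2\times(0,1)$ (unit horizontal periods; coordinates $(x,y,z)$), let $\gamma>1$, $\varpi>0$, $p_0>\max\{24,\gamma-1\}$, and write $\nabla_h,\mathrm{div}_h,\Delta_h$ for the horizontal operators, $\mathcal D(v)=\tfrac12(\nabla_hv+(\nabla_hv)^\top)$, $P(\rho)=\rho^\gamma$, $\int=\int_\Omega\cdot\,d\vec x$. **Initial data.** $(\rho_0,m_0)$, with $m_0=\rho_0v_0$ taking values in $\mathbb R^2$, satisfies $\rho_0=\rho_0(x,y)\ge0$ a.e., $\rho_0\in L^1\cap L^\gamma$, $\nabla_h\rho_0^{1/2}\in L^2$, $m_0\in L^{2\gamma/(\gamma+1)}$, $m_0=0$ a.e. on $\{\rho_0=0\}$, and $\rho_0^{-1-\varpi}|m_0|^{2+\varpi},\ \rho_0^{-1}|m_0|^2\in L^1$ (both set to $0$ on $\{\rho_0=0\}$). Put $$\mathfrak E_0=\|\rho_0^{-1}m_0^2\|_{L^1}+\|\rho_0^{-1-\varpi}|m_0|^{2+\varpi}\|_{L^1}+\|\nabla_h\rho_0^{1/2}\|_{L^2}+\|\rho_0\|_{L^1}+\|\rho_0\|_{L^\gamma}^\gamma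 .$$ **Approximating initial data.** For some $\varepsilon_1\in(0,1)$, a family $(\rho_{\varepsilon,0},v_{\varepsilon,0})_{\varepsilon\in(0,\varepsilon_1)}$ such that, as $\varepsilon\to0^+$, $\|\rho_{\varepsilon,0}-\rho_0\|_{L^1}+\|\rho_{\varepsilon,0}-\rho_0\|_{L^\gamma}+\|\nabla_h(\rho_{\varepsilon,0}^{1/2}-\rho_0^{1/2})\|_{L^2}+\|\rho_{\varepsilon,0}v_{\varepsilon,0}^2-\rho_0^{-1}m_0^2\|_{L^1}\to0$, and for each $\varepsilon$: $\varepsilon^{1/p_0+1}<\rho_{\varepsilon,0}<\varepsilon^{-1/p_0-1}$, $\partial_z\rho_{\varepsilon,0}=0$, $\rho_{\varepsilon,0}\in W^{1,4}(\Omega)$, $v_{\varepsilon,0}\in H^1(\Omega)$, and $$\|\rho_{\varepsilon,0}^{1/2}v_{\varepsilon,0}\|_{L^2}^2+\|\rho_{\varepsilon,0}\|_{L^\gamma}^\gamma+\|\rho_{\varepsilon,0}\|_{L^1}+\|\nabla_h\rho_{\varepsilon,0}^{1/2}\|_{L^2}^2+\|\rho_{\varepsilon,0}|v_{\varepsilon,0}|^{2+\varpi}\|_{L^1}+\varepsilon\|\rho_{\varepsilon,0}^{-1}\|_{L^{p_0}}^{p_0}+\varepsilon\|\nabla_h\rho_{\varepsilon,0}^{1/2}\|_{L^4}^4$$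 $$<2\Big(\|\rho_0^{-1}m_0^2\|_{L^1}+\|\rho_0\|_{L^\gamma}^\gamma+\|\rho_0\|_{L^1}+\max\{\|\nabla_h\rho_0^{1/2}\|_{L^2},\|\nabla_h\rho_0^{1/2}\|_{L^2}^2\}+\|\rho_0^{-1-\varpi}|m_0|^{2+\varpi}\|_{L^1}\Big).$$ **Approximating solutions.** An approximating solution on $[0,T)$ with parameter $\varepsilon$ is a pair $(\rho,v)$, $\rho>0$, $v\in\mathbb R^2$, satisfying a.e. in $\Omega\times(0,T)$ $$\partial_t\rho+\mathrm{div}_h(\rho v)+\partial_z(\rho w)=\varepsilon\rho^{1/2}\Delta_h\rho^{1/2}+\varepsilon\rho^{1/2}\mathrm{div}_h(|\nabla_h\rho^{1/2}|^2\nabla_h\rho^{1/2})+\varepsilon\rho^{-p_0},$$ $$\rho\partial_tv+\rho v\cdot\nabla_hv+\rho w\partial_zv+\nabla_hP(\rho)=\mathrm{div}_h(\rho\mathcal D(v))+\partial_z(\rho\partial_zv)+\sqrt\varepsilon\,\mathrm{div}_h(\rho\nabla_hv)+\varepsilon\rho^{1/2}|\nabla_h\rho^{1/2}|^2\nabla_h\rho^{1/2}\cdot\nabla_hv-\varepsilon\rho^{-p_0}v-\varepsilon\rho|v|^3v,$$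 $$\partial_zP(\rho)=0,\qquad w=-\rho^{-1}\int_0^z\mathrm{div}_h\Big(\rho\big(v-\int_0^1v\,dz''\big)\Big)dz'$$ (so that $w|_{z=0,1}=0$), with $\partial_zv|_{z=0,1}=0$ and $(\rho,v)|_{t=0}=(\rho_{\varepsilon,0},v_{\varepsilon,0})$, such that $C^{-1}<\rho<C$ for some constant $C$ and $\rho^{1/2}\in L^\infty(0,T;W^{1,4})\cap L^2(0,T;H^2)$, $\nabla_h\rho\in L^{30}$, $|\nabla_h\rho^{1/2}|^2\nabla_h^2\rho^{1/2}\in L^2$, $\partial_t\rho\in L^2$, $v\in L^\infty(0,T;H^1)\cap L^2(0,T;H^2)\cap L^5\cap L^{10}$, $\nabla v\in L^{10/3}$, $\partial_tv\in L^2$, $\partial_zw\in L^2$ (on $\Omega\times(0,T)$ where no space is named). Here $\rho,v$ denote the representatives in $C([0,T];L^2(\Omega))$. **Proposition.** There is $\varepsilon_0\in(0,1)$, depending only on $\gamma,\varpi,p_0$, such that for every $T\in(0,\infty)$ and every $E\ge0$ there is a constant $C_T>0$, depending only on $T$, $E$, $\gamma,\varpi,p_0$ and in particular not on $\varepsilon$,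 with the following property. For all initial data with $\mathfrak E_0\le E$, all approximating initial data to it, all $\varepsilon\in(0,\min\{\varepsilon_0,\varepsilon_1\})$ and every approximating solution $(\rho_\varepsilon,v_\varepsilon)$ on $[0,T)$ with the initial datum $(\rho_{\varepsilon,0},v_{\varepsilon,0})$, one has: 1. (basic energy) $$\sup_{0\le t\le T}\Big\{\int\rho_\varepsilon|v_\varepsilon|^2+\int\rho_\varepsilon^\gamma+\int\rho_\varepsilon+\varepsilon\int\rho_\varepsilon^{-p_0}\Big\}+\int_0^T\!\!\int\big(\rho_\varepsilon|\mathcal D(v_\varepsilon)|^2+\rho_\varepsilon|\partial_zv_\varepsilon|^2\big)+\varepsilon\int_0^T\!\!\int\big(\rho_\varepsilon^{-p_0}|v_\varepsilon|^2+\rho_\varepsilon|v_\varepsilon|^5+|\nabla_h\rho_\varepsilon^{1/2}|^4|v_\varepsilon|^2+|\nabla_h\rho_\varepsilon^{1/2}|^2|v_\varepsilon|^2+|\nabla_h\rho_\varepsilon^{1/2}|^4\big)+\varepsilon^2\int_0^T\!\!\int\rho_\varepsilon^{-2p_0-1}\le C_T;$$ 2. (Bresch–Desjardins entropy) $\rho_\varepsilon^{1/2}(t)$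 is weakly differentiable in the horizontal variables for every $t\in[0,T]$, and $$\sup_{0\le t\le T}\Big\{\int|\nabla_h\rho_\varepsilon^{1/2}|^2+\varepsilon\int|\nabla_h\rho_\varepsilon^{1/2}|^4\Big\}+\int_0^T\!\!\int\big(\rho_\varepsilon|\nabla_hv_\varepsilon|^2+\rho_\varepsilon|\partial_zw_\varepsilon|^2\big)+\int_0^T\!\!\int\rho_\varepsilon^{\gamma-2}|\nabla_h\rho_\varepsilon|^2+\varepsilon\int_0^T\!\!\int\big(|\Delta_h\rho_\varepsilon^{1/2}|^2+|\nabla_h\rho_\varepsilon^{1/2}|^2|\nabla_h^2\rho_\varepsilon^{1/2}|^2\big)+\varepsilon^2\int_0^T\!\!\int|\nabla_h\rho_\varepsilon^{1/2}|^4|\nabla_h^2\rho_\varepsilon^{1/2}|^2\le C_T;$$ 3. (Mellet–Vasseur) $$\sup_{0\le t\le T}\int\rho_\varepsilon(e+|v_\varepsilon|^2)\log(e+|v_\varepsilon|^2)\le C_T.$$ -/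

import Mathlib

open MeasureTheory Set Filter Topology
open scoped ENNReal

noncomputable section

namespace CPE

/-! ### Domain, test functions and weak derivatives -/

/-- Points `(x, y, z)` of space; the coordinates `0, 1` are horizontal, `2` is vertical. -/
abbrev Sp := Fin 3 → ℝ

/-- Points `(t, (x, y, z))` of space-time. -/
abbrev SpT := ℝ × Sp

/-- The cell `(0,1)² × (0,1)` representing `Ω = 𝕋² × (0,1)`. Functions on `Ω` are represented by
their values on this cell; that the horizontal variables live on the torus is encoded in the test
functions below, which are periodic. -/
def Omega : Set Sp := {x | ∀ i, x i ∈ Ioo (0 : ℝ) 1}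

/-- The cell representing `Ω × (0,T)`. -/
def cyl (T : ℝ) : Set SpT := Ioo (0 : ℝ) T ×ˢ Omega

/-- Lebesgue measure on `Ω`. -/
abbrev muO : Measure Sp := volume.restrict Omega

/-- Lebesgue measure on `Ω × (0,T)`. -/
abbrev muQ (T : ℝ) : Measure SpT := volume.restrict (cyl T)

/-- The horizontal coordinate directions as directions of space. -/
abbrev hor (i : Fin 2) : Fin 3 := i.castSucc

/-- Smooth functions on `𝕋² × ℝ`, compactly supported in `z ∈ (0,1)`. -/
def testO : Set (Sp → ℝ) :=
  {φ | ContDiff ℝ (⊤ : ℕ∞) φ ∧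
    (∀ (i : Fin 2) (x : Sp), φ (x + Pi.single (hor i) 1) = φ x) ∧
    ∃ δ : ℝ, 0 < δ ∧ ∀ x, φ x ≠ 0 → x 2 ∈ Icc δ (1 - δ)}

/-- Smooth functions on `ℝ × (𝕋² × ℝ)`, compactly supported in `t ∈ (0,T)`; no condition at the
lids `z = 0, 1`. -/
def testLid (T : ℝ) : Set (SpT → ℝ) :=
  {φ | ContDiff ℝ (⊤ : ℕ∞) φ ∧
    (∀ (i : Fin 2) (t : ℝ) (x : Sp), φ (t, x + Pi.single (hor i) 1) = φ (t, x)) ∧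
    ∃ δ : ℝ, 0 < δ ∧ ∀ t x, φ (t, x) ≠ 0 → t ∈ Icc δ (T - δ)}

/-- Smooth functions on `ℝ × (𝕋² × ℝ)`, compactly supported in `t ∈ (0,T)` and `z ∈ (0,1)`. -/
def testQ (T : ℝ) : Set (SpT → ℝ) :=
  {φ | φ ∈ testLid T ∧ ∃ δ : ℝ, 0 < δ ∧ ∀ t x, φ (t, x) ≠ 0 → x 2 ∈ Icc δ (1 - δ)}

section Weak

variable {E : Type} [NormedAddCommGroup E] [NormedSpace ℝ E] [MeasureSpace E]

/-- `g` is the weak derivative of `f` on `U` in the direction `e`, tested against the class `S`. -/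
def HasWeakDeriv (U : Set E) (S : Set (E → ℝ)) (e : E) (f g : E → ℝ) : Prop :=
  IntegrableOn f U ∧ IntegrableOn g U ∧
    ∀ φ ∈ S, ∫ x in U, f x * fderiv ℝ φ x e = - ∫ x in U, g x * φ x

open Classical in
/-- The weak derivative (unique up to null sets); the value `0` is used when there is none. -/
def weakDeriv (U : Set E) (S : Set (E → ℝ)) (e : E) (f : E → ℝ) : E → ℝ :=
  if h : ∃ g, HasWeakDeriv U S e f g then h.choose else 0

theorem hasWeakDeriv_weakDeriv {U : Set E} {S : Set (E → ℝ)} {e : E} {f : E → ℝ}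
    (h : ∃ g, HasWeakDeriv U S e f g) : HasWeakDeriv U S e f (weakDeriv U S e f) := by
  unfold weakDeriv
  rw [dif_pos h]
  exact h.choose_spec

end Weak

/-- The weak derivative `∂ᵢ f` on `Ω`. -/
def dO (i : Fin 3) (f : Sp → ℝ) : Sp → ℝ := weakDeriv Omega testO (Pi.single i 1) f

/-- `f` has a weak derivative `∂ᵢ f` in `L¹(Ω)`. -/
def WeakDiffO (i : Fin 3) (f : Sp → ℝ) : Prop :=
  ∃ g, HasWeakDeriv Omega testO (Pi.single i 1) f g

/-- The weak spatial derivative `∂ᵢ f` on `Ω × (0,T)`. -/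
def dQ (T : ℝ) (i : Fin 3) (f : SpT → ℝ) : SpT → ℝ :=
  weakDeriv (cyl T) (testQ T) (0, Pi.single i 1) f

/-- `f` has a weak spatial derivative `∂ᵢ f` in `L¹(Ω × (0,T))`. -/
def WeakDiffQ (T : ℝ) (i : Fin 3) (f : SpT → ℝ) : Prop :=
  ∃ g, HasWeakDeriv (cyl T) (testQ T) (0, Pi.single i 1) f g

/-- The weak time derivative `∂ₜ f` on `Ω × (0,T)`. -/
def dt (T : ℝ) (f : SpT → ℝ) : SpT → ℝ := weakDeriv (cyl T) (testQ T) (1, 0) f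

/-- `f` has a weak time derivative in `L¹(Ω × (0,T))`. -/
def WeakDiffT (T : ℝ) (f : SpT → ℝ) : Prop :=
  ∃ g, HasWeakDeriv (cyl T) (testQ T) (1, 0) f g

/-! ### Function spaces -/

/-- `f ∈ W^{1,p}(Ω)`. -/
def MemW1 (p : ℝ≥0∞) (f : Sp → ℝ) : Prop :=
  MemLp f p muO ∧ ∀ i, WeakDiffO i f ∧ MemLp (dO i f) p muO

/-- `f ∈ L^∞(0,T; L^p(Ω))`, for measurable `f`. -/
def MemLinfLp (T : ℝ) (p : ℝ≥0∞) (f : SpT → ℝ) : Prop :=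
  AEStronglyMeasurable f (muQ T) ∧ ∃ C : ℝ, ∀ᵐ t ∂(volume.restrict (Ioo (0 : ℝ) T)),
    eLpNorm (fun x => f (t, x)) p muO ≤ ENNReal.ofReal C

/-- `f ∈ L^∞(0,T; W^{1,p}(Ω))`. -/
def MemLinfW1 (T : ℝ) (p : ℝ≥0∞) (f : SpT → ℝ) : Prop :=
  MemLinfLp T p f ∧ ∀ i, WeakDiffQ T i f ∧ MemLinfLp T p (dQ T i f)

/-- `f ∈ L²(0,T; H²(Ω))`. -/
def MemL2H2 (T : ℝ) (f : SpT → ℝ) : Prop :=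
  MemLp f 2 (muQ T) ∧ (∀ i, WeakDiffQ T i f ∧ MemLp (dQ T i f) 2 (muQ T)) ∧
    ∀ i j, WeakDiffQ T j (dQ T i f) ∧ MemLp (dQ T j (dQ T i f)) 2 (muQ T)

/-- `f ∈ C([0,T]; L²(Ω))`. -/
def ContL2 (T : ℝ) (f : SpT → ℝ) : Prop :=
  (∀ t ∈ Icc (0 : ℝ) T, MemLp (fun x => f (t, x)) 2 muO) ∧
    ∀ t ∈ Icc (0 : ℝ) T,
      Tendsto (fun s => eLpNorm (fun x => f (s, x) - f (t, x)) 2 muO) (𝓝[Icc 0 T] t) (𝓝 0)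

/-! ### Differential expressions

A horizontal vector field is given by its two components. All derivatives are weak derivatives. -/

/-- Euclidean length of a horizontal vector field. -/
def len {X : Type} (v : Fin 2 → X → ℝ) (p : X) : ℝ := √(∑ j, v j p ^ 2)

/-- `div_h F`. -/
def divh (T : ℝ) (F : Fin 2 → SpT → ℝ) (p : SpT) : ℝ := ∑ i, dQ T (hor i) (F i) p

/-- The components of `∇_h f` on `Ω × (0,T)`. -/
def gradh (T : ℝ) (f : SpT → ℝ) (i : Fin 2) : SpT → ℝ := dQ T (hor i) f

/-- The components of `∇_h f` on `Ω`. -/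
def gradhO (f : Sp → ℝ) (i : Fin 2) : Sp → ℝ := dO (hor i) f

/-- `Δ_h f`. -/
def laph (T : ℝ) (f : SpT → ℝ) : SpT → ℝ := divh T (gradh T f)

/-- `|∇_h² f|²`. -/
def hessSq (T : ℝ) (f : SpT → ℝ) (p : SpT) : ℝ :=
  ∑ i, ∑ j, gradh T (gradh T f i) j p ^ 2

/-- `|∇_h v|²`. -/
def gradSq (T : ℝ) (v : Fin 2 → SpT → ℝ) (p : SpT) : ℝ := ∑ i, ∑ j, gradh T (v j) i p ^ 2

/-- `𝒟(v)ᵢⱼ = (∂ᵢ vⱼ + ∂ⱼ vᵢ) / 2`. -/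
def symGrad (T : ℝ) (v : Fin 2 → SpT → ℝ) (i j : Fin 2) (p : SpT) : ℝ :=
  (gradh T (v j) i p + gradh T (v i) j p) / 2

/-- `|𝒟(v)|²`. -/
def symGradSq (T : ℝ) (v : Fin 2 → SpT → ℝ) (p : SpT) : ℝ := ∑ i, ∑ j, symGrad T v i j p ^ 2

/-- `ρ^{1/2}`. -/
def root {X : Type} (ρ : X → ℝ) (p : X) : ℝ := √(ρ p)

/-- The vertical mean `∫₀¹ f dz`. -/
def zmean (f : SpT → ℝ) (p : SpT) : ℝ := ∫ z in (0 : ℝ)..1, f (p.1, Function.update p.2 2 z)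

/-- The vertical velocity
`w = - ρ⁻¹ ∫₀^z div_h (ρ (v - ∫₀¹ v dz'')) dz'`; it vanishes at `z = 0` and at `z = 1`. -/
def vert (T : ℝ) (ρ : SpT → ℝ) (v : Fin 2 → SpT → ℝ) (p : SpT) : ℝ :=
  - (ρ p)⁻¹ * ∫ z in (0 : ℝ)..(p.2 2),
    divh T (fun i q => ρ q * (v i q - zmean (v i) q)) (p.1, Function.update p.2 2 z)

/-- `G(ρ) = ε ρ^{1/2} Δ_h ρ^{1/2} + ε ρ^{1/2} div_h (|∇_h ρ^{1/2}|² ∇_h ρ^{1/2}) + ε ρ^{-p₀}`. -/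
def Gterm (p₀ ε T : ℝ) (ρ : SpT → ℝ) (p : SpT) : ℝ :=
  ε * root ρ p * laph T (root ρ) p
    + ε * root ρ p *
      divh T (fun i q => len (gradh T (root ρ)) q ^ 2 * gradh T (root ρ) i q) p
    + ε * ρ p ^ (-p₀)

/-- The `j`-th component of `F(v,ρ) = √ε div_h (ρ ∇_h v)
+ ε ρ^{1/2} |∇_h ρ^{1/2}|² ∇_h ρ^{1/2} · ∇_h v - ε ρ^{-p₀} v - ε ρ |v|³ v`. -/
def Fterm (p₀ ε T : ℝ) (ρ : SpT → ℝ) (v : Fin 2 → SpT → ℝ) (j : Fin 2) (p : SpT) : ℝ :=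
  √ε * divh T (fun i q => ρ q * gradh T (v j) i q) p
    + ε * root ρ p * len (gradh T (root ρ)) p ^ 2 *
      (∑ i, gradh T (root ρ) i p * gradh T (v j) i p)
    - ε * ρ p ^ (-p₀) * v j p
    - ε * ρ p * len v p ^ 3 * v j p

/-! ### Initial data -/

/-- The integral over `Ω` of a nonnegative function, as an extended nonnegative number. -/
def intO (f : Sp → ℝ) : ℝ≥0∞ := ∫⁻ x in Omega, ENNReal.ofReal (f x)

/-- The integral over `Ω × (0,T)` of a nonnegative function. -/
def intQ (T : ℝ) (f : SpT → ℝ) : ℝ≥0∞ := ∫⁻ p in cyl T, ENNReal.ofReal (f p)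

/-- Admissible initial data `(ρ₀, m₀)`, `m₀ = ρ₀ v₀`. The quotients below have the value `0` on
the vacuum set, where `m₀ = 0`. -/
structure IsInitialData (γ ϖ : ℝ) (ρ₀ : Sp → ℝ) (m₀ : Fin 2 → Sp → ℝ) : Prop where
  nonneg : ∀ᵐ x ∂muO, 0 ≤ ρ₀ x
  indep_z : HasWeakDeriv Omega testO (Pi.single 2 1) ρ₀ 0
  memL1 : MemLp ρ₀ 1 muO
  memLγ : MemLp ρ₀ (ENNReal.ofReal γ) muO
  grad_root : ∀ i : Fin 2, WeakDiffO (hor i) (root ρ₀) ∧ MemLp (gradhO (root ρ₀) i) 2 muO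
  mom : ∀ j, MemLp (m₀ j) (ENNReal.ofReal (2 * γ / (γ + 1))) muO
  vacuum : ∀ᵐ x ∂muO, ρ₀ x = 0 → ∀ j, m₀ j x = 0
  high : Integrable (fun x => ρ₀ x ^ (-1 - ϖ) * len m₀ x ^ (2 + ϖ)) muO
  kinetic : Integrable (fun x => (ρ₀ x)⁻¹ * len m₀ x ^ 2) muO

/-- `‖∇_h ρ₀^{1/2}‖_{L²(Ω)}`. -/
def gradRootNorm (ρ₀ : Sp → ℝ) : ℝ≥0∞ := eLpNorm (len (gradhO (root ρ₀))) 2 muO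

/-- `‖ρ₀⁻¹ m₀²‖_{L¹} + ‖ρ₀^{-1-ϖ} |m₀|^{2+ϖ}‖_{L¹} + ‖ρ₀‖_{L¹} + ‖ρ₀‖_{L^γ}^γ`. -/
def dataSize' (γ ϖ : ℝ) (ρ₀ : Sp → ℝ) (m₀ : Fin 2 → Sp → ℝ) : ℝ≥0∞ :=
  eLpNorm (fun x => (ρ₀ x)⁻¹ * len m₀ x ^ 2) 1 muO
    + eLpNorm (fun x => ρ₀ x ^ (-1 - ϖ) * len m₀ x ^ (2 + ϖ)) 1 muO
    + eLpNorm ρ₀ 1 muO + eLpNorm ρ₀ (ENNReal.ofReal γ) muO ^ γ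

/-- The size `𝔈₀` of the initial data. -/
def dataSize (γ ϖ : ℝ) (ρ₀ : Sp → ℝ) (m₀ : Fin 2 → Sp → ℝ) : ℝ≥0∞ :=
  dataSize' γ ϖ ρ₀ m₀ + gradRootNorm ρ₀

/-- The conditions on the approximating datum `(r, u)` for one fixed `ε`. The gradient of `ρ₀^{1/2}`
enters the upper bound through the larger one of its `L²` norm and the square of that norm. -/
structure IsApproxDatum (γ ϖ p₀ ε : ℝ) (ρ₀ : Sp → ℝ) (m₀ : Fin 2 → Sp → ℝ)
    (r : Sp → ℝ) (u : Fin 2 → Sp → ℝ) : Prop where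
  bounds : ∀ᵐ x ∂muO, ε ^ (1 / p₀ + 1) < r x ∧ r x < ε ^ (-(1 / p₀) - 1)
  indep_z : HasWeakDeriv Omega testO (Pi.single 2 1) r 0
  dens : MemW1 4 r
  vel : ∀ j, MemW1 2 (u j)
  size :
    intO (fun x => r x * len u x ^ 2) + eLpNorm r (ENNReal.ofReal γ) muO ^ γ + eLpNorm r 1 muO
      + gradRootNorm r ^ 2 + intO (fun x => r x * len u x ^ (2 + ϖ))
      + intO (fun x => ε * r x ^ (-p₀)) + intO (fun x => ε * len (gradhO (root r)) x ^ 4)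
      < 2 * (dataSize' γ ϖ ρ₀ m₀ + max (gradRootNorm ρ₀) (gradRootNorm ρ₀ ^ 2))

/-- A family of approximating initial data `(ρ_{ε,0}, v_{ε,0})`, `ε ∈ (0, ε₁)`, to the data
`(ρ₀, m₀)`. -/
structure IsApproxData (γ ϖ p₀ ε₁ : ℝ) (ρ₀ : Sp → ℝ) (m₀ : Fin 2 → Sp → ℝ)
    (r : ℝ → Sp → ℝ) (u : ℝ → Fin 2 → Sp → ℝ) : Prop where
  datum : ∀ ε ∈ Ioo 0 ε₁, IsApproxDatum γ ϖ p₀ ε ρ₀ m₀ (r ε) (u ε)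
  tendstoL1 : Tendsto (fun ε => eLpNorm (fun x => r ε x - ρ₀ x) 1 muO) (𝓝[>] 0) (𝓝 0)
  tendstoLγ : Tendsto (fun ε => eLpNorm (fun x => r ε x - ρ₀ x) (ENNReal.ofReal γ) muO)
    (𝓝[>] 0) (𝓝 0)
  tendstoGrad : Tendsto
    (fun ε => eLpNorm (len (gradhO (fun x => root (r ε) x - root ρ₀ x))) 2 muO) (𝓝[>] 0) (𝓝 0)
  tendstoKin : Tendsto
    (fun ε => eLpNorm (fun x => r ε x * len (u ε) x ^ 2 - (ρ₀ x)⁻¹ * len m₀ x ^ 2) 1 muO)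
    (𝓝[>] 0) (𝓝 0)

/-! ### Approximating solutions -/

/-- `(ρ, v)` is a strong solution on `Ω × [0,T)` of the approximating problem with parameter `ε`
and initial datum `(r, u)`. Since `∂ₜ ρ, ∂ₜ v ∈ L²`, the functions `ρ, v` have representatives in
`C([0,T]; L²(Ω))`; these are the ones used, and in this sense the initial data are attained. -/
structure IsApproxSolution (γ p₀ ε T : ℝ) (r : Sp → ℝ) (u : Fin 2 → Sp → ℝ)
    (ρ : SpT → ℝ) (v : Fin 2 → SpT → ℝ) : Prop where
  -- regularity of the density
  bounds : ∃ C : ℝ, 0 < C ∧ ∀ᵐ p ∂(muQ T), C⁻¹ < ρ p ∧ ρ p < C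
  root_W14 : MemLinfW1 T 4 (root ρ)
  root_H2 : MemL2H2 T (root ρ)
  grad_L30 : ∀ i : Fin 2, WeakDiffQ T (hor i) ρ ∧ MemLp (gradh T ρ i) 30 (muQ T)
  hess : ∀ i j, MemLp
    (fun p => len (gradh T (root ρ)) p ^ 2 * gradh T (gradh T (root ρ) i) j p) 2 (muQ T)
  dt_dens : WeakDiffT T ρ ∧ MemLp (dt T ρ) 2 (muQ T)
  cont_dens : ContL2 T ρ
  -- regularity of the velocity
  vel_H1 : ∀ j, MemLinfW1 T 2 (v j)
  vel_H2 : ∀ j, MemL2H2 T (v j)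
  vel_L5 : ∀ j, MemLp (v j) 5 (muQ T)
  vel_L10 : ∀ j, MemLp (v j) 10 (muQ T)
  grad_vel : ∀ j i, MemLp (dQ T i (v j)) (10 / 3) (muQ T)
  dt_vel : ∀ j, WeakDiffT T (v j) ∧ MemLp (dt T (v j)) 2 (muQ T)
  cont_vel : ∀ j, ContL2 T (v j)
  vert_vel : WeakDiffQ T 2 (vert T ρ v) ∧ MemLp (dQ T 2 (vert T ρ v)) 2 (muQ T)
  -- the equations
  mass : ∀ᵐ p ∂(muQ T),
    dt T ρ p + divh T (fun i q => ρ q * v i q) p + dQ T 2 (fun q => ρ q * vert T ρ v q) p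
      = Gterm p₀ ε T ρ p
  momentum : ∀ j, ∀ᵐ p ∂(muQ T),
    ρ p * dt T (v j) p + ρ p * (∑ i, v i p * gradh T (v j) i p)
        + ρ p * vert T ρ v p * dQ T 2 (v j) p + gradh T (fun q => ρ q ^ γ) j p
      = divh T (fun i q => ρ q * symGrad T v i j q) p
        + dQ T 2 (fun q => ρ q * dQ T 2 (v j) q) p + Fterm p₀ ε T ρ v j p
  hydrostatic : HasWeakDeriv (cyl T) (testQ T) (0, Pi.single 2 1) (fun q => ρ q ^ γ) 0
  -- `∂_z v = 0` at `z = 0, 1`: integration by parts in `z` produces no boundary term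
  neumann : ∀ j, HasWeakDeriv (cyl T) (testLid T) (0, Pi.single 2 1)
    (dQ T 2 (v j)) (dQ T 2 (dQ T 2 (v j)))
  -- the initial conditions
  init_dens : ∀ᵐ x ∂muO, ρ (0, x) = r x
  init_vel : ∀ j, ∀ᵐ x ∂muO, v j (0, x) = u j x

/-! ### The estimated quantities -/

/-- The quantities in the basic energy bound at time `t`. -/
def basicEnergy (γ p₀ ε : ℝ) (ρ : SpT → ℝ) (v : Fin 2 → SpT → ℝ) (t : ℝ) : ℝ≥0∞ :=
  intO (fun x => ρ (t, x) * len v (t, x) ^ 2) + intO (fun x => ρ (t, x) ^ γ)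
    + intO (fun x => ρ (t, x)) + ENNReal.ofReal ε * intO (fun x => ρ (t, x) ^ (-p₀))

/-- The space-time integrals in the basic energy bound. -/
def basicDissipation (p₀ ε T : ℝ) (ρ : SpT → ℝ) (v : Fin 2 → SpT → ℝ) : ℝ≥0∞ :=
  intQ T (fun p => ρ p * symGradSq T v p + ρ p * (∑ j, dQ T 2 (v j) p ^ 2))
    + ENNReal.ofReal ε * intQ T (fun p => ρ p ^ (-p₀) * len v p ^ 2 + ρ p * len v p ^ 5
        + len (gradh T (root ρ)) p ^ 4 * len v p ^ 2
        + len (gradh T (root ρ)) p ^ 2 * len v p ^ 2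
        + len (gradh T (root ρ)) p ^ 4)
    + ENNReal.ofReal (ε ^ 2) * intQ T (fun p => ρ p ^ (-2 * p₀ - 1))

/-- The quantities in the Bresch–Desjardins entropy bound at time `t`. -/
def bdEntropy (ε : ℝ) (ρ : SpT → ℝ) (t : ℝ) : ℝ≥0∞ :=
  intO (fun x => len (gradhO (fun y => root ρ (t, y))) x ^ 2)
    + ENNReal.ofReal ε * intO (fun x => len (gradhO (fun y => root ρ (t, y))) x ^ 4)

/-- The space-time integrals in the Bresch–Desjardins entropy bound. -/
def bdDissipation (γ ε T : ℝ) (ρ : SpT → ℝ) (v : Fin 2 → SpT → ℝ) : ℝ≥0∞ :=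
  intQ T (fun p => ρ p * gradSq T v p + ρ p * dQ T 2 (vert T ρ v) p ^ 2)
    + intQ T (fun p => ρ p ^ (γ - 2) * len (gradh T ρ) p ^ 2)
    + ENNReal.ofReal ε * intQ T (fun p => laph T (root ρ) p ^ 2
        + len (gradh T (root ρ)) p ^ 2 * hessSq T (root ρ) p)
    + ENNReal.ofReal (ε ^ 2) *
        intQ T (fun p => len (gradh T (root ρ)) p ^ 4 * hessSq T (root ρ) p)

/-- The Mellet–Vasseur quantity `∫ ρ (e + |v|²) log (e + |v|²)` at time `t`. -/
def mvEntropy (ρ : SpT → ℝ) (v : Fin 2 → SpT → ℝ) (t : ℝ) : ℝ≥0∞ :=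
  intO (fun x => ρ (t, x) * (Real.exp 1 + len v (t, x) ^ 2)
    * Real.log (Real.exp 1 + len v (t, x) ^ 2))

end CPE

end

open CPE

noncomputable section

namespace CPE

/-- `g` is the weak derivative of `f` on `Ω × (0,T)` in the `k`-th direction of space. -/
abbrev WQ (T : ℝ) (k : Fin 3) : (SpT → ℝ) → (SpT → ℝ) → Prop :=
  HasWeakDeriv (cyl T) (testQ T) (0, Pi.single k 1)

variable {T : ℝ} {f g φ : SpT → ℝ} {k : Fin 3} {p : SpT}

/-! ### Absolutely continuous functions on an interval `[0, ℓ]` -/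

/-- `F` is absolutely continuous on `[0, ℓ]` with derivative `g` almost everywhere. -/
def AC1 (ℓ : ℝ) (F g : ℝ → ℝ) : Prop :=
  AbsolutelyContinuousOnInterval F 0 ℓ ∧ ∀ᵐ x ∂(volume.restrict (Ioo 0 ℓ)), HasDerivAt F (g x) x

theorem _root_.AbsolutelyContinuousOnInterval.comp_lipschitzOn {φ F : ℝ → ℝ} {a b : ℝ}
    {K : NNReal} {S : Set ℝ} (hφ : LipschitzOnWith K φ S)
    (hF : AbsolutelyContinuousOnInterval F a b) (hS : ∀ x ∈ uIcc a b, F x ∈ S) :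
    AbsolutelyContinuousOnInterval (fun x => φ (F x)) a b := by
  rw [absolutelyContinuousOnInterval_iff] at hF ⊢
  intro ε hε
  obtain ⟨δ, hδ, h⟩ := hF (ε / (K + 1)) (by positivity)
  refine ⟨δ, hδ, fun E hE hl => ?_⟩
  calc ∑ i ∈ Finset.range E.1, dist (φ (F (E.2 i).1)) (φ (F (E.2 i).2))
      ≤ ∑ i ∈ Finset.range E.1, K * dist (F (E.2 i).1) (F (E.2 i).2) := by
        apply Finset.sum_le_sum
        intro i hi
        exact hφ.dist_le_mul _ (hS _ (hE.1 i hi).1) _ (hS _ (hE.1 i hi).2)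
    _ = K * ∑ i ∈ Finset.range E.1, dist (F (E.2 i).1) (F (E.2 i).2) := by
        rw [Finset.mul_sum]
    _ ≤ K * (ε / (K + 1)) := by gcongr; exact (h E hE hl).le
    _ < (K + 1) * (ε / (K + 1)) := by gcongr; linarith
    _ = ε := by field_simp

namespace AC1

variable {ℓ : ℝ} {F G f g h : ℝ → ℝ}

theorem congr (hF : AC1 ℓ F g) (hg : ∀ᵐ x ∂(volume.restrict (Ioo 0 ℓ)), g x = h x) : AC1 ℓ F h :=
  ⟨hF.1, by filter_upwards [hF.2, hg] with x hx hx'; rwa [← hx']⟩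

theorem const (c : ℝ) : AC1 ℓ (fun _ => c) (fun _ => 0) :=
  ⟨(LipschitzWith.const c).lipschitzOnWith.absolutelyContinuousOnInterval (K := 0),
    .of_forall fun x => hasDerivAt_const x c⟩

theorem add (hF : AC1 ℓ F f) (hG : AC1 ℓ G g) : AC1 ℓ (fun x => F x + G x) (fun x => f x + g x) :=
  ⟨hF.1.add hG.1, by filter_upwards [hF.2, hG.2] with x h1 h2 using h1.add h2⟩

theorem sub (hF : AC1 ℓ F f) (hG : AC1 ℓ G g) : AC1 ℓ (fun x => F x - G x) (fun x => f x - g x) :=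
  ⟨hF.1.sub hG.1, by filter_upwards [hF.2, hG.2] with x h1 h2 using h1.sub h2⟩

theorem mul (hF : AC1 ℓ F f) (hG : AC1 ℓ G g) :
    AC1 ℓ (fun x => F x * G x) (fun x => f x * G x + F x * g x) :=
  ⟨hF.1.mul hG.1, by filter_upwards [hF.2, hG.2] with x h1 h2 using h1.mul h2⟩

theorem of_contDiff (hF : ContDiff ℝ 1 F) : AC1 ℓ F (deriv F) :=
  ⟨hF.contDiffOn.absolutelyContinuousOnInterval, .of_forall fun x =>
    (hF.differentiable one_ne_zero x).hasDerivAt⟩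

theorem continuousOn (hℓ : 0 ≤ ℓ) (hF : AC1 ℓ F f) : ContinuousOn F (Icc 0 ℓ) := by
  simpa [uIcc_of_le hℓ] using hF.1.continuousOn

theorem ae_mem_closed {S : Set ℝ} (hℓ : 0 < ℓ) (hF : AC1 ℓ F f) (hS : IsClosed S)
    (h : ∀ᵐ x ∂(volume.restrict (Ioo 0 ℓ)), F x ∈ S) : ∀ x ∈ Icc 0 ℓ, F x ∈ S := by
  have hd : ∀ x ∈ Ioo 0 ℓ, F x ∈ S := by
    intro x hx
    by_contra hn
    have hc : ContinuousAt F x := (hF.continuousOn hℓ.le).continuousAt (Icc_mem_nhds hx.1 hx.2)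
    have hU : ∀ᶠ y in 𝓝 x, F y ∉ S ∧ y ∈ Ioo 0 ℓ :=
      (hc.eventually (hS.isOpen_compl.mem_nhds hn)).and (Ioo_mem_nhds hx.1 hx.2)
    obtain ⟨e, he, hb⟩ := Metric.eventually_nhds_iff_ball.1 hU
    rw [ae_restrict_iff' measurableSet_Ioo] at h
    have h0 : volume (Metric.ball x e) = 0 :=
      measure_mono_null (t := {y | ¬ (y ∈ Ioo 0 ℓ → F y ∈ S)})
        (fun y hy hc => (hb y hy).1 (hc (hb y hy).2)) (ae_iff.1 h)
    exact (Metric.measure_ball_pos volume x he).ne' h0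
  intro x hx
  have hcl : x ∈ closure (Ioo 0 ℓ) := by rwa [closure_Ioo hℓ.ne]
  have : F x ∈ closure (F '' Ioo 0 ℓ) := by
    have hm := (hF.continuousOn hℓ.le x hx).mono (Ioo_subset_Icc_self (a := (0 : ℝ)) (b := ℓ))
    exact hm.mem_closure_image hcl
  exact closure_minimal (by rintro _ ⟨y, hy, rfl⟩; exact hd y hy) hS this

theorem comp {φ φ' : ℝ → ℝ} {S : Set ℝ} (hℓ : 0 < ℓ) (hF : AC1 ℓ F f)
    (hS : ∀ x ∈ Icc 0 ℓ, F x ∈ S) (hφ : ∀ y ∈ S, HasDerivAt φ (φ' y) y) (hc : ContinuousOn φ' S) : AC1 ℓ (fun x => φ (F x)) (fun x => φ' (F x) * f x) := by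
  have hcont := hF.continuousOn hℓ.le
  have hcomp : IsCompact (F '' Icc 0 ℓ) := isCompact_Icc.image_of_continuousOn hcont
  have hconv : Convex ℝ (F '' Icc 0 ℓ) := (isPreconnected_Icc.image _ hcont).ordConnected.convex
  have hsub : F '' Icc 0 ℓ ⊆ S := by rintro _ ⟨y, hy, rfl⟩; exact hS y hy
  obtain ⟨C, hC⟩ := hcomp.exists_bound_of_continuousOn (hc.mono hsub)
  have hlip : LipschitzOnWith (Real.toNNReal C) φ (F '' Icc 0 ℓ) := by
    apply hconv.lipschitzOnWith_of_nnnorm_hasDerivWithin_le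
      (fun y hy => (hφ y (hsub hy)).hasDerivWithinAt)
    intro y hy
    rw [← NNReal.coe_le_coe, coe_nnnorm]
    exact (hC y hy).trans (Real.le_coe_toNNReal C)
  refine ⟨hF.1.comp_lipschitzOn hlip fun x hx => mem_image_of_mem F (by rwa [uIcc_of_le hℓ.le] at hx),
    ?_⟩
  filter_upwards [hF.2, ae_restrict_mem measurableSet_Ioo] with x hx hm
  exact (hφ _ (hS x ⟨hm.1.le, hm.2.le⟩)).comp x hx

theorem integrable (hℓ : 0 ≤ ℓ) (hF : AC1 ℓ F f) : IntervalIntegrable f volume 0 ℓ := by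
  refine hF.1.intervalIntegrable_deriv.congr_ae ?_
  rw [uIoc_of_le hℓ, ← restrict_Ioo_eq_restrict_Ioc]
  filter_upwards [hF.2] with x hx using hx.deriv

theorem mono {b : ℝ} (hb : b ∈ Icc 0 ℓ) (hF : AC1 ℓ F f) : AC1 b F f :=
  ⟨hF.1.mono (by rw [uIcc_of_le hb.1, uIcc_of_le (hb.1.trans hb.2)]; exact Icc_subset_Icc_right hb.2),
    ae_mono (Measure.restrict_mono (Ioo_subset_Ioo_right hb.2) le_rfl) hF.2⟩

theorem integral_eq (hℓ : 0 ≤ ℓ) (hF : AC1 ℓ F f) : ∫ x in (0 : ℝ)..ℓ, f x = F ℓ - F 0 := by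
  rw [← hF.1.integral_deriv_eq_sub]
  apply intervalIntegral.integral_congr_ae_restrict
  rw [uIoc_of_le hℓ, ← restrict_Ioo_eq_restrict_Ioc]
  filter_upwards [hF.2] with x hx using hx.deriv.symm

theorem eq_add (hF : AC1 ℓ F f) {x : ℝ} (hx : x ∈ Icc 0 ℓ) : F x = F 0 + ∫ u in (0 : ℝ)..x, f u := by
  rw [(hF.mono hx).integral_eq hx.1]; ring

theorem primitive (hℓ : 0 ≤ ℓ) (hf : IntervalIntegrable f volume 0 ℓ) (c : ℝ) :
    AC1 ℓ (fun x => c + ∫ u in (0 : ℝ)..x, f u) f := by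
  refine ⟨?_, ?_⟩
  · exact (AC1.const (ℓ := ℓ) c).1.add
      (hf.absolutelyContinuousOnInterval_intervalIntegral left_mem_uIcc)
  · rw [ae_restrict_iff' measurableSet_Ioo]
    filter_upwards [hf.ae_hasDerivAt_integral] with x hx hm
    rw [uIcc_of_le hℓ] at hx
    exact (hx (Ioo_subset_Icc_self hm) 0 ⟨le_rfl, hℓ⟩).const_add c

theorem eqOn_of_ae_eq (hℓ : 0 < ℓ) (hF : AC1 ℓ F f) (hG : AC1 ℓ G g)
    (h : ∀ᵐ x ∂(volume.restrict (Ioo 0 ℓ)), F x = G x) : ∀ x ∈ Icc 0 ℓ, F x = G x := by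
  have := (hF.sub hG).ae_mem_closed hℓ (isClosed_singleton (x := (0 : ℝ)))
    (by filter_upwards [h] with x hx; simp [hx])
  intro x hx
  exact sub_eq_zero.1 (this x hx)

theorem deriv_ae_eq (hF : AC1 ℓ F f) (hG : AC1 ℓ G g) (h : ∀ x ∈ Icc 0 ℓ, F x = G x) : ∀ᵐ x ∂(volume.restrict (Ioo 0 ℓ)), f x = g x := by
  filter_upwards [hF.2, hG.2, ae_restrict_mem measurableSet_Ioo] with x h1 h2 hm
  refine h1.unique (h2.congr_of_eventuallyEq ?_)
  filter_upwards [Ioo_mem_nhds hm.1 hm.2] with y hy using h y ⟨hy.1.le, hy.2.le⟩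

end AC1

/-! ### Coordinate lines in the cell -/

/-- The point on the line through `p` in the `k`-th space direction with `k`-th coordinate `s`. -/
def line (k : Fin 3) (p : SpT) (s : ℝ) : SpT := (p.1, Function.update p.2 k s)

@[simp] theorem line_line (k : Fin 3) (p : SpT) (s s' : ℝ) :
    line k (line k p s) s' = line k p s' := by
  simp [line]

@[simp] theorem line_self (k : Fin 3) (p : SpT) : line k p (p.2 k) = p := by
  simp [line]

/-- Lebesgue measure on `(0,1)`. -/
abbrev muI : Measure ℝ := volume.restrict (Ioo (0 : ℝ) 1)

instance : IsProbabilityMeasure muI := ⟨by simp⟩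

theorem Omega_eq_pi : Omega = Set.pi univ (fun _ : Fin 3 => Ioo (0 : ℝ) 1) := by
  ext x; simp [Omega]

theorem isOpen_Omega : IsOpen Omega := by
  rw [Omega_eq_pi]; exact isOpen_set_pi finite_univ fun _ _ => isOpen_Ioo

theorem measurableSet_Omega : MeasurableSet Omega := isOpen_Omega.measurableSet

theorem isOpen_cyl (T : ℝ) : IsOpen (cyl T) := isOpen_Ioo.prod isOpen_Omega

theorem measurableSet_cyl (T : ℝ) : MeasurableSet (cyl T) := (isOpen_cyl T).measurableSet

theorem muO_eq_pi : muO = Measure.pi (fun _ : Fin 3 => muI) := by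
  rw [muO, Omega_eq_pi, volume_pi, Measure.restrict_pi_pi]

instance : IsProbabilityMeasure muO := by rw [muO_eq_pi]; infer_instance

theorem muQ_eq_prod (T : ℝ) : muQ T = (volume.restrict (Ioo 0 T)).prod muO := by
  rw [muQ, cyl, Measure.prod_restrict]; rfl

instance (T : ℝ) : IsFiniteMeasure (muQ T) := by rw [muQ_eq_prod]; infer_instance

theorem cyl_subset {τ : ℝ} (h : τ ≤ T) : cyl τ ⊆ cyl T :=
  prod_mono (Ioo_subset_Ioo_right h) le_rfl

theorem muQ_mono {τ : ℝ} (h : τ ≤ T) : muQ τ ≤ muQ T :=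
  Measure.restrict_mono (cyl_subset h) le_rfl

theorem measurable_update_pair (k : Fin 3) :
    Measurable (fun q : Sp × ℝ => Function.update q.1 k q.2) := by
  rw [measurable_pi_iff]
  intro i
  by_cases h : i = k
  · subst h; simpa using measurable_snd
  · simp only [Function.update_of_ne h]
    exact (measurable_pi_apply i).comp measurable_fst

theorem measurePreserving_update (k : Fin 3) :
    MeasurePreserving (fun q : Sp × ℝ => Function.update q.1 k q.2) (muO.prod muI) muO := by
  refine ⟨measurable_update_pair k, ?_⟩
  rw [muO_eq_pi]
  symm
  apply Measure.pi_eq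
  intro s hs
  rw [Measure.map_apply (measurable_update_pair k) (MeasurableSet.univ_pi hs)]
  have hpre : (fun q : Sp × ℝ => Function.update q.1 k q.2) ⁻¹' (univ.pi s)
      = (univ.pi (Function.update s k univ)) ×ˢ (s k) := by
    ext q
    simp only [mem_preimage, Set.mem_pi, mem_univ, forall_true_left, mem_prod]
    constructor
    · intro h
      refine ⟨fun i => ?_, by simpa using h k⟩
      by_cases hi : i = k
      · subst hi; simp
      · simpa [Function.update_of_ne hi] using h i
    · rintro ⟨h1, h2⟩ i
      by_cases hi : i = k
      · subst hi; simpa using h2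
      · simpa [Function.update_of_ne hi] using h1 i
  rw [hpre, Measure.prod_prod, Measure.pi_pi]
  rw [← Finset.mul_prod_erase _ _ (Finset.mem_univ k), ← Finset.mul_prod_erase _ (fun i => muI (s i))
    (Finset.mem_univ k)]
  simp only [Function.update_self, measure_univ, one_mul]
  rw [mul_comm]
  congr 1
  apply Finset.prod_congr rfl
  intro i hi
  rw [Function.update_of_ne (Finset.ne_of_mem_erase hi)]

theorem measurePreserving_line (k : Fin 3) (T : ℝ) :
    MeasurePreserving (fun q : SpT × ℝ => line k q.1 q.2) ((muQ T).prod muI) (muQ T) := by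
  rw [muQ_eq_prod]
  exact ((MeasurePreserving.id _).prod (measurePreserving_update k)).comp
    (measurePreserving_prodAssoc _ _ _)

section Fubini

variable {T : ℝ} (k : Fin 3)

theorem ae_line {P : SpT → Prop} (h : ∀ᵐ p ∂muQ T, P p) : ∀ᵐ p ∂muQ T, ∀ᵐ s ∂muI, P (line k p s) :=
  Measure.ae_ae_of_ae_prod ((measurePreserving_line k T).quasiMeasurePreserving.ae h)

theorem integrable_line_prod (hg : Integrable g (muQ T)) :
    Integrable (fun q : SpT × ℝ => g (line k q.1 q.2)) ((muQ T).prod muI) :=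
  (measurePreserving_line k T).integrable_comp_of_integrable hg

theorem ae_integrable_line (hg : Integrable g (muQ T)) :
    ∀ᵐ p ∂muQ T, Integrable (fun s => g (line k p s)) muI :=
  (integrable_line_prod k hg).prod_right_ae

theorem integrable_integral_line (hg : Integrable g (muQ T)) :
    Integrable (fun p => ∫ s, g (line k p s) ∂muI) (muQ T) :=
  (integrable_line_prod k hg).integral_prod_left

theorem integral_line (hg : Integrable g (muQ T)) :
    ∫ p, g p ∂muQ T = ∫ p, ∫ s, g (line k p s) ∂muI ∂muQ T := by
  rw [← integral_prod _ (integrable_line_prod k hg)]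
  have h := (measurePreserving_line k T).map_eq
  conv_lhs => rw [← h]
  rw [integral_map (measurePreserving_line k T).aemeasurable]
  rw [h]; exact hg.1

/-- If a property only involves almost all points of almost all lines, it holds almost
everywhere. -/
theorem ae_of_ae_line {P : SpT → Prop} (hP : MeasurableSet {p | P p})
    (h : ∀ᵐ p ∂muQ T, ∀ᵐ s ∂muI, P (line k p s)) : ∀ᵐ p ∂muQ T, P p := by
  have hm := measurePreserving_line k T
  rw [ae_iff]
  change (muQ T) {p | P p}ᶜ = 0
  rw [← hm.measure_preimage hP.compl.nullMeasurableSet]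
  rw [Measure.measure_prod_null (hm.measurable hP.compl)]
  filter_upwards [h] with p hp
  exact hp

theorem muI_integral (f : ℝ → ℝ) : ∫ s, f s ∂muI = ∫ s in (0 : ℝ)..1, f s := by
  rw [intervalIntegral.integral_of_le zero_le_one, ← restrict_Ioo_eq_restrict_Ioc]

theorem intervalIntegrable_iff_muI {f : ℝ → ℝ} :
    IntervalIntegrable f volume 0 1 ↔ Integrable f muI := by
  rw [intervalIntegrable_iff_integrableOn_Ioo_of_le zero_le_one, IntegrableOn]

end Fubini

/-! ### Functions that are absolutely continuous on almost all lines -/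

/-- On almost every line in direction `k`, `f` agrees almost everywhere with an absolutely
continuous function with derivative `g`, whose end values are related by `c`. -/
def LD (c : ℝ → ℝ → Prop) (k : Fin 3) (T : ℝ) (f g : SpT → ℝ) : Prop :=
  ∀ᵐ p ∂muQ T, ∃ F : ℝ → ℝ, AC1 1 F (fun s => g (line k p s)) ∧
    (∀ᵐ s ∂muI, f (line k p s) = F s) ∧ c (F 0) (F 1)

/-- Periodic functions, for the horizontal directions. -/
abbrev HD := LD (· = ·)
/-- No boundary condition. -/
abbrev VD := LD (fun _ _ => True)
/-- Functions vanishing at both end points. -/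
abbrev VZ := LD (fun a b => a = 0 ∧ b = 0)

namespace LD

variable {c c' c'' : ℝ → ℝ → Prop} {k : Fin 3} {T τ : ℝ} {f f' g g' h : SpT → ℝ}

theorem mono_time (hτ : τ ≤ T) (hf : LD c k T f g) : LD c k τ f g :=
  ae_mono (muQ_mono hτ) hf

theorem imp (hc : ∀ a b, c a b → c' a b) (hf : LD c k T f g) : LD c' k T f g := by
  filter_upwards [hf] with p ⟨F, h1, h2, h3⟩ using ⟨F, h1, h2, hc _ _ h3⟩

theorem congr (hf : LD c k T f g) (h1 : ∀ᵐ p ∂muQ T, f p = f' p) (h2 : ∀ᵐ p ∂muQ T, g p = g' p) : LD c k T f' g' := by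
  filter_upwards [hf, ae_line k h1, ae_line k h2] with p ⟨F, a1, a2, a3⟩ b1 b2
  refine ⟨F, a1.congr b2, ?_, a3⟩
  filter_upwards [a2, b1] with s s1 s2 using s2 ▸ s1

theorem of_eq (hf : LD c k T f g) (h1 : ∀ p, f p = f' p) (h2 : ∀ p, g p = g' p) :
    LD c k T f' g' := by
  have e1 : f = f' := funext h1
  have e2 : g = g' := funext h2
  rwa [← e1, ← e2]

theorem of_eq_right (hf : LD c k T f g) (h2 : ∀ p, g p = g' p) : LD c k T f g' :=
  hf.of_eq (fun _ => rfl) h2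

theorem lift₂ {op : ℝ → ℝ → ℝ} {dop : ℝ → ℝ → ℝ → ℝ → ℝ}
    (hop : ∀ F f G g : ℝ → ℝ, AC1 1 F f → AC1 1 G g →
    AC1 1 (fun x => op (F x) (G x)) (fun x => dop (F x) (f x) (G x) (g x)))
    (hc : ∀ a b a' b', c a b → c' a' b' → c'' (op a a') (op b b')) (hf : LD c k T f g)
    (hf' : LD c' k T f' g') :
    LD c'' k T (fun p => op (f p) (f' p)) (fun p => dop (f p) (g p) (f' p) (g' p)) := by
  filter_upwards [hf, hf'] with p ⟨F, a1, a2, a3⟩ ⟨G, b1, b2, b3⟩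
  refine ⟨fun x => op (F x) (G x), (hop F _ G _ a1 b1).congr ?_, ?_, hc _ _ _ _ a3 b3⟩
  · filter_upwards [a2, b2] with s s1 s2
    rw [s1, s2]
  · filter_upwards [a2, b2] with s s1 s2
    rw [s1, s2]

theorem mul_gen (hc : ∀ a b a' b', c a b → c' a' b' → c'' (a * a') (b * b')) (hf : LD c k T f g)
    (hf' : LD c' k T f' g') : LD c'' k T (fun p => f p * f' p) (fun p => g p * f' p + f p * g' p) :=
  lift₂ (op := fun a b => a * b) (dop := fun a b c d => b * c + a * d)
    (fun _ _ _ _ h1 h2 => h1.mul h2) hc hf hf'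

theorem add_gen (hc : ∀ a b a' b', c a b → c' a' b' → c'' (a + a') (b + b')) (hf : LD c k T f g)
    (hf' : LD c' k T f' g') : LD c'' k T (fun p => f p + f' p) (fun p => g p + g' p) :=
  lift₂ (op := fun a b => a + b) (dop := fun _ b _ d => b + d)
    (fun _ _ _ _ h1 h2 => h1.add h2) hc hf hf'

theorem comp_gen {φ φ' : ℝ → ℝ} {S : Set ℝ} (hS : IsClosed S)
    (hφ : ∀ y ∈ S, HasDerivAt φ (φ' y) y) (hφc : ContinuousOn φ' S)
    (hc : ∀ a b, c a b → c' (φ a) (φ b)) (hf : LD c k T f g) (hm : ∀ᵐ p ∂muQ T, f p ∈ S) :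
    LD c' k T (fun p => φ (f p)) (fun p => φ' (f p) * g p) := by
  filter_upwards [hf, ae_line k hm] with p ⟨F, a1, a2, a3⟩ b
  have hF : ∀ x ∈ Icc (0 : ℝ) 1, F x ∈ S := a1.ae_mem_closed zero_lt_one hS (by
    filter_upwards [a2, b] with s s1 s2 using s1 ▸ s2)
  refine ⟨fun x => φ (F x), (a1.comp zero_lt_one hF hφ hφc).congr ?_, ?_, hc _ _ a3⟩
  · filter_upwards [a2] with s s1
    rw [s1]
  · filter_upwards [a2] with s s1
    rw [s1]

/-- Zero integral of derivatives. -/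
theorem ibp (hc : ∀ a b, c a b → a = b) (hf : LD c k T f g) (hg : Integrable g (muQ T)) :
    ∫ p, g p ∂muQ T = 0 := by
  rw [integral_line k hg]
  apply integral_eq_zero_of_ae
  filter_upwards [hf] with p ⟨F, a1, a2, a3⟩
  rw [muI_integral, a1.integral_eq zero_le_one, hc _ _ a3, sub_self]; rfl

/-- Uniqueness of the derivative. -/
theorem unique (hf : LD c k T f g) (hf' : LD c' k T f g') (hg : AEStronglyMeasurable g (muQ T))
    (hg' : AEStronglyMeasurable g' (muQ T)) : ∀ᵐ p ∂muQ T, g p = g' p := by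
  have key : ∀ᵐ p ∂muQ T, hg.mk g p = hg'.mk g' p := by
    apply ae_of_ae_line k
    · exact measurableSet_eq_fun hg.stronglyMeasurable_mk.measurable
        hg'.stronglyMeasurable_mk.measurable
    · filter_upwards [hf, hf', ae_line k hg.ae_eq_mk, ae_line k hg'.ae_eq_mk] with
        p ⟨F, a1, a2, a3⟩ ⟨G, b1, b2, b3⟩ d1 d2
      have := a1.deriv_ae_eq b1 (a1.eqOn_of_ae_eq zero_lt_one b1 (by
        filter_upwards [a2, b2] with s s1 s2; rw [← s1, s2]))
      filter_upwards [this, d1, d2] with s s1 s2 s3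
      rw [← s2, s1, s3]
  filter_upwards [key, hg.ae_eq_mk, hg'.ae_eq_mk] with p h1 h2 h3
  rw [h2, h1, h3]

end LD

section Rules

variable {k : Fin 3} {T : ℝ} {f f' g g' : SpT → ℝ}

theorem LD.const {c : ℝ → ℝ → Prop} (hc : ∀ a, c a a) (a : ℝ) :
    LD c k T (fun _ => a) (fun _ => 0) :=
  .of_forall fun _ => ⟨fun _ => a, AC1.const a, .of_forall fun _ => rfl, hc a⟩

/-- A function of time only. -/
theorem LD.of_time {c : ℝ → ℝ → Prop} (hc : ∀ a, c a a) (a : ℝ → ℝ) :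
    LD c k T (fun p => a p.1) (fun _ => 0) :=
  .of_forall fun p =>
    ⟨fun _ => a p.1, AC1.const _, .of_forall fun _ => rfl, hc _⟩

theorem HD.mul (hf : HD k T f g) (hf' : HD k T f' g') :
    HD k T (fun p => f p * f' p) (fun p => g p * f' p + f p * g' p) :=
  LD.mul_gen (fun _ _ _ _ h1 h2 => by rw [h1, h2]) hf hf'

theorem HD.add (hf : HD k T f g) (hf' : HD k T f' g') :
    HD k T (fun p => f p + f' p) (fun p => g p + g' p) :=
  LD.add_gen (fun _ _ _ _ h1 h2 => by rw [h1, h2]) hf hf'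

theorem VD.mul (hf : VD k T f g) (hf' : VD k T f' g') :
    VD k T (fun p => f p * f' p) (fun p => g p * f' p + f p * g' p) :=
  LD.mul_gen (fun _ _ _ _ _ _ => trivial) hf hf'

theorem VD.add (hf : VD k T f g) (hf' : VD k T f' g') :
    VD k T (fun p => f p + f' p) (fun p => g p + g' p) :=
  LD.add_gen (fun _ _ _ _ _ _ => trivial) hf hf'

theorem VZ.toVD (hf : VZ k T f g) : VD k T f g := LD.imp (fun _ _ _ => trivial) hf

theorem HD.const_mul (a : ℝ) (hf : HD k T f g) : HD k T (fun p => a * f p) (fun p => a * g p) :=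
  (HD.mul (LD.const (fun _ => rfl) a) hf).of_eq_right fun p => by ring

theorem VD.const_mul (a : ℝ) (hf : VD k T f g) : VD k T (fun p => a * f p) (fun p => a * g p) :=
  (VD.mul (LD.const (fun _ => trivial) a) hf).of_eq_right fun p => by ring

theorem HD.ibp (hf : HD k T f g) (hg : Integrable g (muQ T)) : ∫ p, g p ∂muQ T = 0 :=
  LD.ibp (fun _ _ h => h) hf hg

end Rules

/-! ### Smooth functions with compact support and their partial integrals -/

/-- Smooth functions vanishing off a compact subset of `U`. -/
def CcIn (U : Set SpT) : Set (SpT → ℝ) :=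
  {φ | ContDiff ℝ (⊤ : ℕ∞) φ ∧ ∃ K ⊆ U, IsCompact K ∧ ∀ p, φ p ≠ 0 → p ∈ K}

theorem CcIn.bounded {U : Set SpT} (h : φ ∈ CcIn U) : ∃ C, ∀ p, ‖φ p‖ ≤ C := by
  obtain ⟨h1, K, _, hK, h2⟩ := h
  obtain ⟨C, hC⟩ := hK.exists_bound_of_continuousOn h1.continuous.continuousOn
  refine ⟨max C 0, fun p => ?_⟩
  by_cases hp : φ p = 0
  · simp [hp]
  · exact (hC p (h2 p hp)).trans (le_max_left _ _)

theorem ae_eq_zero_of_CcIn {U : Set SpT} (hU : IsOpen U) {h : SpT → ℝ} (hh : IntegrableOn h U)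
    (H : ∀ φ ∈ CcIn U, ∫ p in U, h p * φ p = 0) : ∀ᵐ p ∂(volume.restrict U), h p = 0 := by
  rw [ae_restrict_iff' hU.measurableSet]
  apply hU.ae_eq_zero_of_integral_contDiff_smul_eq_zero hh.locallyIntegrableOn
  intro φ h1 h2 h3
  have := H φ ⟨h1, tsupport φ, h3, h2, fun p hp => subset_tsupport _ hp⟩
  rw [← this, ← integral_indicator hU.measurableSet]
  congr 1
  ext p
  by_cases hp : p ∈ U
  · simp [hp, mul_comm]
  · have : φ p = 0 := by
      by_contra hn; exact hp (h3 (subset_tsupport _ hn))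
    simp [hp, this]

theorem contDiff_integral_smul_dir {U : Set SpT} {θ : SpT → ℝ} (hθ : θ ∈ CcIn U) {a : ℝ → ℝ}
    (ha : LocallyIntegrable a) (e : SpT) (he : e ≠ 0) :
    ContDiff ℝ (⊤ : ℕ∞) (fun p => ∫ s, a s * θ (p + (-s) • e)) := by
  obtain ⟨h1, K, _, hK, h2⟩ := hθ
  obtain ⟨M, hM⟩ := hK.isBounded.exists_norm_le
  have he' : 0 < ‖e‖ := norm_pos_iff.2 he
  rw [contDiff_iff_contDiffAt]
  intro p0
  set R := ‖p0‖ + 1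
  have hp0 : p0 ∈ Metric.ball (0 : SpT) R := by simp [R]
  have key := contDiffOn_convolution_right_with_param_comp (𝕜 := ℝ) (μ := (volume : Measure ℝ))
    (n := (⊤ : ℕ∞)) (ContinuousLinearMap.mul ℝ ℝ) (s := Metric.ball (0 : SpT) R)
    (v := fun _ => (0 : ℝ)) contDiffOn_const (f := a)
    (g := fun p x => θ (p + x • e)) (k := Metric.closedBall 0 ((M + R) / ‖e‖))
    Metric.isOpen_ball (isCompact_closedBall _ _) ?_ ha ?_
  · have := key.contDiffAt (Metric.isOpen_ball.mem_nhds hp0)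
    refine this.congr_of_eventuallyEq (.of_forall fun p => ?_)
    simp [convolution]
  · intro p x hp hx
    by_contra hn
    apply hx
    rw [mem_closedBall_zero_iff, le_div_iff₀ he', ← norm_smul]
    have e1 := hM _ (h2 _ hn)
    have e2 : ‖p‖ < R := by simpa using hp
    calc ‖x • e‖ = ‖(p + x • e) - p‖ := by simp
      _ ≤ ‖p + x • e‖ + ‖p‖ := norm_sub_le _ _
      _ ≤ M + R := by linarith
  · apply ContDiff.contDiffOn
    apply h1.comp
    exact contDiff_fst.add (contDiff_snd.smul contDiff_const)

theorem integrable_dir {U : Set SpT} {θ : SpT → ℝ} (hθ : θ ∈ CcIn U) (e : SpT) (he : e ≠ 0)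
    (p : SpT) : Integrable (fun s : ℝ => θ (p + s • e)) := by
  obtain ⟨h1, K, _, hK, h2⟩ := hθ
  obtain ⟨M, hM⟩ := hK.isBounded.exists_norm_le
  have he' : 0 < ‖e‖ := norm_pos_iff.2 he
  apply Continuous.integrable_of_hasCompactSupport
  · exact h1.continuous.comp (by fun_prop)
  · apply HasCompactSupport.intro (isCompact_closedBall (0 : ℝ) ((M + ‖p‖) / ‖e‖))
    intro x hx
    by_contra hn
    apply hx
    rw [mem_closedBall_zero_iff, le_div_iff₀ he', ← norm_smul]
    calc ‖x • e‖ = ‖(p + x • e) - p‖ := by simp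
      _ ≤ ‖p + x • e‖ + ‖p‖ := norm_sub_le _ _
      _ ≤ M + ‖p‖ := by linarith [hM _ (h2 _ hn)]

/-- The integral of `θ` over the full line through `p` in direction `e`. -/
def lineInt (e : SpT) (θ : SpT → ℝ) (p : SpT) : ℝ := ∫ s : ℝ, θ (p + s • e)

/-- The integral of `θ` over the half line ending at `p` in direction `e`. -/
def halfInt (e : SpT) (θ : SpT → ℝ) (p : SpT) : ℝ := ∫ s in Iic (0 : ℝ), θ (p + s • e)

section

variable {U : Set SpT} {θ : SpT → ℝ} {e : SpT}

theorem contDiff_lineInt (hθ : θ ∈ CcIn U) (he : e ≠ 0) : ContDiff ℝ (⊤ : ℕ∞) (lineInt e θ) := by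
  have := contDiff_integral_smul_dir hθ (a := fun _ => 1) (locallyIntegrable_const 1) e he
  convert this using 2 with p
  rw [lineInt, ← integral_neg_eq_self]
  simp

theorem contDiff_halfInt (hθ : θ ∈ CcIn U) (he : e ≠ 0) : ContDiff ℝ (⊤ : ℕ∞) (halfInt e θ) := by
  have := contDiff_integral_smul_dir hθ (a := indicator (Ici 0) fun _ => 1)
    ((locallyIntegrable_const (1 : ℝ)).indicator measurableSet_Ici) e he
  convert this using 2 with p
  rw [halfInt, ← integral_indicator measurableSet_Iic, ← integral_neg_eq_self]
  congr 1
  ext s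
  by_cases h : 0 ≤ s
  · simp [indicator, h]
  · simp [indicator, h]

theorem lineInt_add_smul (u : ℝ) (p : SpT) : lineInt e θ (p + u • e) = lineInt e θ p := by
  rw [lineInt, lineInt, ← integral_add_left_eq_self (fun s : ℝ => θ (p + s • e)) u]
  congr 1; ext s; rw [add_smul, add_assoc]

theorem halfInt_add_smul (u : ℝ) (p : SpT) :
    halfInt e θ (p + u • e) = ∫ s in Iic u, θ (p + s • e) := by
  rw [halfInt, ← integral_indicator measurableSet_Iic, ← integral_indicator measurableSet_Iic,
    ← integral_add_left_eq_self (indicator (Iic u) fun s : ℝ => θ (p + s • e)) u]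
  congr 1; ext s
  simp only [indicator, mem_Iic]
  by_cases h : s ≤ 0
  · rw [if_pos h, if_pos (by linarith), add_smul, add_assoc]
  · rw [if_neg h, if_neg (by linarith)]

theorem fderiv_halfInt (hθ : θ ∈ CcIn U) (he : e ≠ 0) (p : SpT) :
    fderiv ℝ (halfInt e θ) p e = θ p := by
  have hd : HasDerivAt (fun u : ℝ => halfInt e θ (p + u • e)) (fderiv ℝ (halfInt e θ) p e) 0 := by
    have h1 : HasFDerivAt (halfInt e θ) (fderiv ℝ (halfInt e θ) p) (p + (0 : ℝ) • e) := by
      rw [zero_smul, add_zero]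
      exact ((contDiff_halfInt hθ he).differentiable (by simp) p).hasFDerivAt
    have h2 : HasDerivAt (fun u : ℝ => p + u • e) e 0 := by
      simpa using ((hasDerivAt_id (0 : ℝ)).smul_const e).const_add p
    exact h1.comp_hasDerivAt (0 : ℝ) h2
  have hi := integrable_dir hθ e he p
  have hcont : Continuous (fun s : ℝ => θ (p + s • e)) := hθ.1.continuous.comp (by fun_prop)
  have hd2 : HasDerivAt (fun u : ℝ => halfInt e θ (p + u • e)) (θ p) 0 := by
    have h3 : HasDerivAt (fun u : ℝ => halfInt e θ p + ∫ s in (0 : ℝ)..u, θ (p + s • e))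
        (θ (p + (0 : ℝ) • e)) 0 :=
      (intervalIntegral.integral_hasDerivAt_right (by simp)
        (hcont.stronglyMeasurableAtFilter _ _) hcont.continuousAt).const_add _
    rw [zero_smul, add_zero] at h3
    refine h3.congr_of_eventuallyEq (.of_forall fun u => ?_)
    change halfInt e θ (p + u • e) = halfInt e θ p + ∫ s in (0 : ℝ)..u, θ (p + s • e)
    rw [← intervalIntegral.integral_Iic_sub_Iic hi.integrableOn hi.integrableOn, halfInt_add_smul,
      halfInt]
    simp
  exact hd.unique hd2

end

/-- A bump function on `(0, ℓ)` with integral one. -/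
theorem exists_bump {ℓ : ℝ} (hℓ : 0 < ℓ) : ∃ χ : ℝ → ℝ, ContDiff ℝ (⊤ : ℕ∞) χ ∧
    (∃ a b, 0 < a ∧ b < ℓ ∧ ∀ s, χ s ≠ 0 → s ∈ Icc a b) ∧ ∫ s, χ s = 1 := by
  let b : ContDiffBump (ℓ / 2) := ⟨ℓ / 8, ℓ / 4, by positivity, by linarith⟩
  refine ⟨b.normed volume, b.contDiff_normed, ⟨ℓ / 4, 3 * ℓ / 4, by positivity, by linarith, ?_⟩,
    b.integral_normed⟩
  intro s hs
  have : s ∈ Function.support (b.normed volume) := hs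
  rw [b.support_normed_eq] at this
  have h2 : |s - ℓ / 2| < ℓ / 4 := by simpa [Real.dist_eq] using this
  rw [abs_lt] at h2
  constructor <;> linarith [h2.1, h2.2]

theorem Integrable.mul_of_bounded {X : Type} [MeasurableSpace X] {μ : Measure X} {f g : X → ℝ}
    (hf : Integrable f μ) (hg : AEStronglyMeasurable g μ) (hb : ∃ C, ∀ᵐ p ∂μ, ‖g p‖ ≤ C) :
    Integrable (fun p => f p * g p) μ := by
  obtain ⟨C, hC⟩ := hb
  exact hf.mul_bdd hg hC

theorem integrable_add' {X : Type} [MeasurableSpace X] {μ : Measure X} {f g : X → ℝ}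
    (hf : Integrable f μ) (hg : Integrable g μ) : Integrable (fun p => f p + g p) μ := hf.add hg

theorem integrable_sub' {X : Type} [MeasurableSpace X] {μ : Measure X} {f g : X → ℝ}
    (hf : Integrable f μ) (hg : Integrable g μ) : Integrable (fun p => f p - g p) μ := hf.sub hg

theorem CcIn.integrable_mul {U : Set SpT} (h : φ ∈ CcIn U) (hf : Integrable f (muQ T)) : Integrable (fun p => f p * φ p) (muQ T) := by
  obtain ⟨C, hC⟩ := CcIn.bounded h
  exact Integrable.mul_of_bounded hf h.1.continuous.aestronglyMeasurable ⟨C, .of_forall hC⟩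

/-- The point on the line through `p` in direction `e` whose coordinate `c` is `s`. -/
def lin (c : SpT →L[ℝ] ℝ) (e p : SpT) (s : ℝ) : SpT := p + (s - c p) • e

section

variable {T ℓ : ℝ} {c : SpT →L[ℝ] ℝ} {e : SpT}

theorem coord_lin (hce : c e = 1) (p : SpT) (s : ℝ) : c (lin c e p s) = s := by
  simp [lin, hce]

theorem lin_lin (hce : c e = 1) (p : SpT) (s s' : ℝ) : lin c e (lin c e p s) s' = lin c e p s' := by
  rw [lin, coord_lin hce, lin, lin]; module

theorem lin_self (p : SpT) : lin c e p (c p) = p := by simp [lin]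

theorem continuous_lin : Continuous (fun q : SpT × ℝ => lin c e q.1 q.2) := by
  unfold lin; fun_prop

theorem integral_lin (hℓ : 0 < ℓ) (hMP : MeasurePreserving (fun q : SpT × ℝ => lin c e q.1 q.2)
    ((muQ T).prod ((ENNReal.ofReal ℓ)⁻¹ • volume.restrict (Ioo 0 ℓ))) (muQ T))
    (hg : Integrable g (muQ T)) :
    ∫ p, g p ∂muQ T = ℓ⁻¹ * ∫ p, (∫ s in Ioo 0 ℓ, g (lin c e p s)) ∂muQ T := by
  have h1 := hMP.integrable_comp_of_integrable hg
  have h2 := integral_prod _ h1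
  have h3 : ∫ p, g p ∂muQ T = ∫ q, g (lin c e q.1 q.2)
      ∂((muQ T).prod ((ENNReal.ofReal ℓ)⁻¹ • volume.restrict (Ioo 0 ℓ))) := by
    have h := hMP.map_eq
    conv_lhs => rw [← h]
    rw [integral_map hMP.aemeasurable]
    rw [h]; exact hg.1
  rw [h3]
  refine h2.trans ?_
  rw [← integral_const_mul]
  refine integral_congr_ae (.of_forall fun p => ?_)
  change ∫ y, g (lin c e p y) ∂((ENNReal.ofReal ℓ)⁻¹ • volume.restrict (Ioo 0 ℓ))
    = ℓ⁻¹ * ∫ s in Ioo 0 ℓ, g (lin c e p s)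
  rw [integral_smul_measure, ENNReal.toReal_inv, ENNReal.toReal_ofReal hℓ.le]
  simp

theorem integrable_lin (hℓ : 0 < ℓ) (hMP : MeasurePreserving (fun q : SpT × ℝ => lin c e q.1 q.2)
    ((muQ T).prod ((ENNReal.ofReal ℓ)⁻¹ • volume.restrict (Ioo 0 ℓ))) (muQ T))
    (hg : Integrable g (muQ T)) : Integrable (fun q : SpT × ℝ => g (lin c e q.1 q.2))
      ((muQ T).prod (volume.restrict (Ioo 0 ℓ))) := by
  have h1 := hMP.integrable_comp_of_integrable hg
  have h0 : ENNReal.ofReal ℓ ≠ 0 := by simpa using hℓ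
  have : (muQ T).prod (volume.restrict (Ioo 0 ℓ)) = ENNReal.ofReal ℓ •
      ((muQ T).prod ((ENNReal.ofReal ℓ)⁻¹ • volume.restrict (Ioo 0 ℓ))) := by
    rw [Measure.prod_smul_right, smul_smul, ENNReal.mul_inv_cancel h0 ENNReal.ofReal_ne_top,
      one_smul]
  rw [this]
  exact h1.smul_measure ENNReal.ofReal_ne_top

/-- If `g` is the distributional derivative of `f` in direction `e`, then `f` is, up to a function
that is constant along lines, a primitive of `g`. -/
theorem exists_primitive_of_test (hℓ : 0 < ℓ) (hce : c e = 1)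
    (hU : ∀ p ∈ cyl T, ∀ s, lin c e p s ∈ cyl T ↔ s ∈ Ioo 0 ℓ)
    (hMP : MeasurePreserving (fun q : SpT × ℝ => lin c e q.1 q.2)
    ((muQ T).prod ((ENNReal.ofReal ℓ)⁻¹ • volume.restrict (Ioo 0 ℓ))) (muQ T))
    (hf : Integrable f (muQ T)) (hg : Integrable g (muQ T))
    (H : ∀ Φ ∈ CcIn (cyl T), ∫ p, f p * fderiv ℝ Φ p e ∂muQ T = - ∫ p, g p * Φ p ∂muQ T) :
    ∃ A : SpT → ℝ, (∀ p s, A (lin c e p s) = A p) ∧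
      ∀ᵐ p ∂muQ T, f p = A p + ∫ u in (0 : ℝ)..(c p), g (lin c e p u) := by
  have he : e ≠ 0 := by rintro rfl; simp at hce
  set L := lin c e with hL
  have hcU : ∀ p ∈ cyl T, c p ∈ Ioo 0 ℓ := fun p hp =>
    (hU p hp (c p)).1 (by rw [hL, lin_self]; exact hp)
  have hmem : ∀ᵐ p ∂muQ T, p ∈ cyl T := ae_restrict_mem (measurableSet_cyl T)
  set G : SpT → ℝ := fun p => ∫ u in (0 : ℝ)..(c p), g (L p u) with hG
  have hGL : ∀ p s, G (L p s) = ∫ u in (0 : ℝ)..s, g (L p u) := by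
    intro p s
    simp only [hG, hL, coord_lin hce, lin_lin hce]
  have hgp := integrable_lin hℓ hMP hg
  have hGi : Integrable G (muQ T) := by
    have hm : MeasurableSet {q : SpT × ℝ | q.2 < c q.1} :=
      measurableSet_lt measurable_snd (c.continuous.measurable.comp measurable_fst)
    refine (hgp.indicator hm).integral_prod_left.congr ?_
    filter_upwards [hmem] with p hp
    have h1 := hcU p hp
    simp only [hG]
    rw [intervalIntegral.integral_of_le h1.1.le, integral_Ioc_eq_integral_Ioo]
    have : (fun y => {q : SpT × ℝ | q.2 < c q.1}.indicator
        (fun q : SpT × ℝ => g (lin c e q.1 q.2)) (p, y))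
        = (Iio (c p)).indicator (fun y => g (L p y)) := by
      ext y; simp only [indicator, mem_ofPred_eq, mem_Iio, hL]
    rw [this, integral_indicator measurableSet_Iio, Measure.restrict_restrict measurableSet_Iio]
    congr 2
    ext y; simp only [mem_inter_iff, mem_Iio, mem_Ioo]
    constructor
    · rintro ⟨a, b, _⟩; exact ⟨b, a⟩
    · rintro ⟨a, b⟩; exact ⟨b, a, b.trans h1.2⟩
  obtain ⟨χ, hχ, ⟨a, b, ha, hb, hab⟩, hχ1⟩ := exists_bump hℓ
  have hχb : ∃ C, ∀ s, ‖χ s‖ ≤ C := by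
    obtain ⟨C, hC⟩ := (isCompact_Icc (a := a) (b := b)).exists_bound_of_continuousOn
      hχ.continuous.continuousOn
    refine ⟨max C 0, fun s => ?_⟩
    by_cases hs : χ s = 0
    · simp [hs]
    · exact (hC s (hab s hs)).trans (le_max_left _ _)
  set h : SpT → ℝ := fun p => f p - G p with hh
  have hhi : Integrable h (muQ T) := hf.sub hGi
  set hbar : SpT → ℝ := fun p => ∫ s in Ioo 0 ℓ, h (L p s) * χ s with hbar_def
  have hbarL : ∀ p s, hbar (L p s) = hbar p := by
    intro p s
    simp only [hbar_def, hL, lin_lin hce]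
  have hbari : Integrable hbar (muQ T) := by
    have := integrable_lin hℓ hMP hhi
    have h2 := Integrable.mul_of_bounded this (g := fun q : SpT × ℝ => χ q.2)
      (hχ.continuous.comp continuous_snd).aestronglyMeasurable
      (by obtain ⟨C, hC⟩ := hχb; exact ⟨C, .of_forall fun q => hC q.2⟩)
    exact h2.integral_prod_left
  refine ⟨hbar, hbarL, ?_⟩
  have key : ∀ᵐ p ∂muQ T, h p - hbar p = 0 := by
    apply ae_eq_zero_of_CcIn (isOpen_cyl T) (hhi.sub hbari)
    intro φ hφ
    set ψ := lineInt e φ with hψ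
    have hψL : ∀ p s, ψ (L p s) = ψ p := fun p s => lineInt_add_smul _ p
    have hψU : ∀ p ∈ cyl T, ψ p = ∫ s in Ioo 0 ℓ, φ (L p s) := by
      intro p hp
      obtain ⟨_, K, hKU, _, hK⟩ := hφ
      rw [← integral_indicator measurableSet_Ioo, hψ, lineInt, ← integral_sub_right_eq_self _ (c p)]
      congr 1; ext s
      by_cases hs : s ∈ Ioo 0 ℓ
      · rw [indicator_of_mem hs]; rfl
      · rw [indicator_of_notMem hs]
        by_contra hn
        exact hs ((hU p hp s).1 (hKU (hK _ hn)))
    set θ : SpT → ℝ := fun p => φ p - ψ p * χ (c p) with hθ_def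
    obtain ⟨K, hKU, hKc, hK⟩ := hφ.2
    obtain ⟨a', b', ha', hb', haa, hbb, hcK⟩ : ∃ a' b', 0 < a' ∧ b' < ℓ ∧ a' ≤ a ∧ b ≤ b' ∧
        ∀ p ∈ K, c p ∈ Icc a' b' := by
      rcases K.eq_empty_or_nonempty with rfl | hne
      · exact ⟨a, b, ha, hb, le_rfl, le_rfl, by simp⟩
      obtain ⟨p1, hp1, hm1⟩ := hKc.exists_isMinOn hne c.continuous.continuousOn
      obtain ⟨p2, hp2, hm2⟩ := hKc.exists_isMaxOn hne c.continuous.continuousOn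
      exact ⟨min a (c p1), max b (c p2), lt_min ha (hcU _ (hKU hp1)).1,
        max_lt hb (hcU _ (hKU hp2)).2, min_le_left _ _, le_max_left _ _,
        fun p hp => ⟨(min_le_right _ _).trans (hm1 hp), (hm2 hp).trans (le_max_right _ _)⟩⟩
    set K' : Set SpT := (fun q : SpT × ℝ => L q.1 q.2) '' (K ×ˢ Icc a' b') with hK'
    have hK'c : IsCompact K' := (hKc.prod isCompact_Icc).image continuous_lin
    have hK'U : K' ⊆ cyl T := by
      rintro _ ⟨⟨p, s⟩, ⟨hp, hs⟩, rfl⟩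
      exact (hU p (hKU hp) s).2 ⟨ha'.trans_le hs.1, hs.2.trans_lt hb'⟩
    have hKK' : K ⊆ K' := fun p hp => ⟨(p, c p), ⟨hp, hcK p hp⟩, lin_self p⟩
    have hsat : ∀ p ∈ K', ∀ s ∈ Icc a' b', L p s ∈ K' := by
      rintro _ ⟨⟨p, s⟩, ⟨hp, hs⟩, rfl⟩ s' hs'
      exact ⟨(p, s'), ⟨hp, hs'⟩, (lin_lin hce p s s').symm⟩
    have hψχ : (fun p => ψ p * χ (c p)) ∈ CcIn (cyl T) := by
      refine ⟨(contDiff_lineInt hφ he).mul (hχ.comp c.contDiff), K', hK'U, hK'c, fun p hp => ?_⟩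
      have h1 : ψ p ≠ 0 := left_ne_zero_of_mul hp
      have h2 := hab _ (right_ne_zero_of_mul hp)
      obtain ⟨s, hs⟩ : ∃ s : ℝ, φ (p + s • e) ≠ 0 := by
        by_contra hn
        push Not at hn
        exact h1 (by simp [hψ, lineInt, hn])
      have h3 := hsat _ (hKK' (hK _ hs)) (c p) ⟨haa.trans h2.1, h2.2.trans hbb⟩
      have h4 : L (p + s • e) (c p) = p := by
        simp only [hL, lin, map_add, map_smul, hce, smul_eq_mul]; module
      rwa [h4] at h3
    have hθs : ∀ p, θ p ≠ 0 → p ∈ K' := by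
      intro p hp
      by_cases hφp : φ p = 0
      · obtain ⟨_, K2, _⟩ := hψχ
        have h1 : ψ p * χ (c p) ≠ 0 := by
          intro h0; exact hp (by simp [hθ_def, hφp, h0])
        have h2 := hab _ (right_ne_zero_of_mul h1)
        obtain ⟨s, hs⟩ : ∃ s : ℝ, φ (p + s • e) ≠ 0 := by
          by_contra hn
          push Not at hn
          exact (left_ne_zero_of_mul h1) (by simp [hψ, lineInt, hn])
        have h3 := hsat _ (hKK' (hK _ hs)) (c p) ⟨haa.trans h2.1, h2.2.trans hbb⟩
        have h4 : L (p + s • e) (c p) = p := by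
          simp only [hL, lin, map_add, map_smul, hce, smul_eq_mul]; module
        rwa [h4] at h3
      · exact hKK' (hK _ hφp)
    have hθ : θ ∈ CcIn (cyl T) := ⟨hφ.1.sub hψχ.1, K', hK'U, hK'c, hθs⟩
    have hcK' : ∀ p ∈ K', c p ∈ Icc a' b' := by
      rintro _ ⟨⟨p, s⟩, ⟨hp, hs⟩, rfl⟩
      simpa [hL, coord_lin hce] using hs
    have hθ0 : ∀ p, lineInt e θ p = 0 := by
      intro p
      have e1 : ∀ s : ℝ, θ (p + s • e) = φ (p + s • e) - ψ p * χ (c p + s) := by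
        intro s
        simp only [hθ_def, hψ, lineInt_add_smul, map_add, map_smul, hce, smul_eq_mul, mul_one]
      have hχi : Integrable χ := by
        by_contra hn; rw [integral_undef hn] at hχ1; exact zero_ne_one hχ1
      rw [lineInt]
      simp only [e1]
      rw [integral_sub (integrable_dir hφ e he p) ((hχi.comp_add_left (c p)).const_mul _),
        integral_const_mul, integral_add_left_eq_self χ (c p), hχ1, mul_one]
      exact sub_self _
    set Φ := halfInt e θ with hΦ_def
    have hΦ : Φ ∈ CcIn (cyl T) := by
      refine ⟨contDiff_halfInt hθ he, K', hK'U, hK'c, fun p hp => ?_⟩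
      have hex : ∃ s ≤ (0 : ℝ), θ (p + s • e) ≠ 0 := by
        by_contra hn
        push Not at hn
        apply hp
        rw [hΦ_def, halfInt]
        exact setIntegral_eq_zero_of_forall_eq_zero fun s hs => hn s hs
      have hex2 : ∃ s > (0 : ℝ), θ (p + s • e) ≠ 0 := by
        by_contra hn
        push Not at hn
        apply hp
        have h1 := hθ0 p
        rw [lineInt, ← integral_add_compl measurableSet_Iic (integrable_dir hθ e he p)] at h1
        rw [setIntegral_eq_zero_of_forall_eq_zero (t := (Iic (0 : ℝ))ᶜ)
          fun s hs => hn s (not_le.1 hs)] at h1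
        rw [add_zero] at h1
        exact h1
      obtain ⟨s1, hs1, h1⟩ := hex
      obtain ⟨s2, hs2, h2⟩ := hex2
      have m1 := hθs _ h1
      have k1 := (hcK' _ m1).1
      have k2 := (hcK' _ (hθs _ h2)).2
      simp only [map_add, map_smul, hce, smul_eq_mul, mul_one] at k1 k2
      have h3 := hsat _ m1 (c p) ⟨by linarith, by linarith⟩
      have h4 : L (p + s1 • e) (c p) = p := by
        simp only [hL, lin, map_add, map_smul, hce, smul_eq_mul]; module
      rwa [h4] at h3
    have hΦd : ∀ p, fderiv ℝ Φ p e = θ p := fderiv_halfInt hθ he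
    have i1 : ∫ p, f p * θ p ∂muQ T = - ∫ p, g p * Φ p ∂muQ T := by
      rw [← H Φ hΦ]; simp only [hΦd]
    have i2 : ∫ p, (g p * Φ p + G p * θ p) ∂muQ T = 0 := by
      rw [integral_lin hℓ hMP (integrable_add' (CcIn.integrable_mul hΦ hg) (CcIn.integrable_mul hθ hGi)),
        mul_eq_zero]
      right
      apply integral_eq_zero_of_ae
      filter_upwards [hgp.prod_right_ae, hmem] with p hp hpU
      have hgi : IntervalIntegrable (fun s => g (L p s)) volume 0 ℓ := by
        rwa [intervalIntegrable_iff_integrableOn_Ioo_of_le hℓ.le]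
      have A1 : AC1 ℓ (fun s => G (L p s)) (fun s => g (L p s)) := by
        have := AC1.primitive hℓ.le hgi 0
        simpa only [hGL, zero_add] using this
      have A2 : AC1 ℓ (fun s => Φ (L p s)) (fun s => θ (L p s)) := by
        have hcd : ContDiff ℝ 1 (fun s => Φ (L p s)) :=
          (hΦ.1.of_le (by exact_mod_cast le_top)).comp (g := Φ) (f := fun s => L p s)
            (by rw [hL]; unfold lin; fun_prop)
        refine (AC1.of_contDiff hcd).congr (.of_forall fun s => ?_)
        have h1 : HasDerivAt (fun s => L p s) e s := by
          simpa [hL, lin] using (((hasDerivAt_id s).sub_const (c p)).smul_const e).const_add p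
        have h2 := ((hΦ.1.differentiable (by simp)) (L p s)).hasFDerivAt.comp_hasDerivAt s h1
        rw [← hΦd]; exact h2.deriv
      have hΦ0 : ∀ s, s ∉ Ioo 0 ℓ → Φ (L p s) = 0 := by
        intro s hs
        obtain ⟨_, K2, hK2, _, hz⟩ := hΦ
        by_contra hn
        exact hs ((hU p hpU s).1 (hK2 (hz _ hn)))
      have := (A1.mul A2).integral_eq hℓ.le
      rw [hΦ0 ℓ (by simp), hΦ0 0 (by simp), mul_zero, mul_zero, sub_zero,
        intervalIntegral.integral_of_le hℓ.le, integral_Ioc_eq_integral_Ioo] at this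
      exact this
    have i3 : ∫ p, h p * θ p ∂muQ T = 0 := by
      rw [integral_add (CcIn.integrable_mul hΦ hg) (CcIn.integrable_mul hθ hGi)] at i2
      have : ∀ p, h p * θ p = f p * θ p - G p * θ p := fun p => by simp only [hh]; ring
      simp only [this]
      rw [integral_sub (CcIn.integrable_mul hθ hf) (CcIn.integrable_mul hθ hGi), i1]
      linarith
    have i4 : ∫ p, h p * (ψ p * χ (c p)) ∂muQ T = ∫ p, hbar p * φ p ∂muQ T := by
      rw [integral_lin hℓ hMP (CcIn.integrable_mul hψχ hhi),
        integral_lin hℓ hMP (CcIn.integrable_mul hφ hbari)]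
      congr 1
      apply integral_congr_ae
      filter_upwards [hmem] with p hp
      have e1 : ∀ s, h (L p s) * (ψ (L p s) * χ (c (L p s))) = ψ p * (h (L p s) * χ s) := by
        intro s; rw [hψL, hL, coord_lin hce]; ring
      have e2 : ∀ s, hbar (L p s) * φ (L p s) = hbar p * φ (L p s) := by
        intro s; rw [hbarL]
      change ∫ s in Ioo 0 ℓ, h (L p s) * (ψ (L p s) * χ (c (L p s)))
        = ∫ s in Ioo 0 ℓ, hbar (L p s) * φ (L p s)
      simp only [e1, e2, integral_const_mul]
      rw [← hψU p hp, mul_comm]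
    have e3 : ∀ p, (h p - hbar p) * φ p = h p * θ p + (h p * (ψ p * χ (c p)) - hbar p * φ p) := by
      intro p; simp only [hθ_def]; ring
    change ∫ p, (h p - hbar p) * φ p ∂muQ T = 0
    simp only [e3]
    rw [integral_add (CcIn.integrable_mul hθ hhi) (integrable_sub' (CcIn.integrable_mul hψχ hhi)
      (CcIn.integrable_mul hφ hbari)), integral_sub (CcIn.integrable_mul hψχ hhi)
      (CcIn.integrable_mul hφ hbari), i3, i4]
    ring
  filter_upwards [key] with p hp
  simp only [hh] at hp
  linarith

end

/-! ### Periodization of test functions -/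

/-- Periodic extension in the `i`-th space variable of the values on `[0,1)`. -/
def periodize (i : Fin 3) (φ : SpT → ℝ) (p : SpT) : ℝ :=
  φ (p.1, Function.update p.2 i (Int.fract (p.2 i)))

/-- `φ` vanishes for `x i` outside a compact subset of `(0,1)`. -/
def CutIn (i : Fin 3) (φ : SpT → ℝ) : Prop :=
  ∃ δ : ℝ, 0 < δ ∧ ∀ p, φ p ≠ 0 → p.2 i ∈ Icc δ (1 - δ)

theorem periodize_eq_on {i : Fin 3} (hp : p.2 i ∈ Ico (0 : ℝ) 1) : periodize i φ p = φ p := by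
  rw [periodize, Int.fract_eq_self.2 hp, Function.update_eq_self]

theorem contDiff_periodize {i : Fin 3} (hφ : ContDiff ℝ (⊤ : ℕ∞) φ) (hc : CutIn i φ) : ContDiff ℝ (⊤ : ℕ∞) (periodize i φ) := by
  obtain ⟨δ, hδ, h⟩ := hc
  rw [contDiff_iff_contDiffAt]
  intro p
  have hcont : ContinuousAt (fun q : SpT => q.2 i) p := by fun_prop
  set n : ℤ := ⌊p.2 i⌋
  rcases eq_or_lt_of_le (Int.floor_le (p.2 i)) with heq | hlt
  · have hz : periodize i φ =ᶠ[𝓝 p] fun _ => 0 := by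
      have hmem : Ioo ((n : ℝ) - min δ 1) (n + min δ 1) ∈ 𝓝 (p.2 i) := by
        rw [← heq]
        apply Ioo_mem_nhds <;> linarith [lt_min hδ one_pos]
      filter_upwards [hcont hmem] with q hq
      have hq1 : (n : ℝ) - min δ 1 < q.2 i := hq.1
      have hq2 : q.2 i < n + min δ 1 := hq.2
      have m1 := min_le_left δ 1
      have m2 := min_le_right δ 1
      by_contra hn
      have hs := h _ hn
      simp only [Function.update_self] at hs
      rcases lt_or_ge (q.2 i) n with hl | hl
      · have : Int.fract (q.2 i) = q.2 i - ((n - 1 : ℤ) : ℝ) := by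
          rw [Int.fract_eq_iff]
          refine ⟨by push_cast; linarith, by push_cast; linarith, n - 1, by ring⟩
        rw [this] at hs
        push_cast at hs
        linarith [hs.2]
      · have : Int.fract (q.2 i) = q.2 i - (n : ℝ) := by
          rw [Int.fract_eq_iff]
          exact ⟨by linarith, by linarith, n, by ring⟩
        rw [this] at hs
        linarith [hs.1]
    exact contDiffAt_const.congr_of_eventuallyEq hz
  · have hmem : Ioo (n : ℝ) (n + 1) ∈ 𝓝 (p.2 i) := Ioo_mem_nhds hlt (Int.lt_floor_add_one _)
    have heq : periodize i φ =ᶠ[𝓝 p] fun q => φ (q - (n : ℝ) • ((0, Pi.single i 1) : SpT)) := by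
      filter_upwards [hcont hmem] with q hq
      have : Int.fract (q.2 i) = q.2 i - (n : ℝ) := by
        rw [Int.fract_eq_iff]
        exact ⟨by linarith [hq.1], by linarith [hq.2], n, by ring⟩
      rw [periodize, this]
      congr 1
      ext j
      · simp
      · by_cases hj : j = i
        · subst hj; simp
        · simp [hj]
    refine ContDiffAt.congr_of_eventuallyEq ?_ heq
    exact (hφ.comp (contDiff_id.sub contDiff_const)).contDiffAt

theorem update_add_single_self {x : Sp} {i : Fin 3} (a b : ℝ) :
    Function.update (x + Pi.single i a) i b = Function.update x i b := by
  ext j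
  by_cases hj : j = i
  · subst hj; simp
  · simp [hj]

theorem update_add_single_ne {x : Sp} {i j : Fin 3} (hij : i ≠ j) (a b : ℝ) :
    Function.update (x + Pi.single j a) i b = Function.update x i b + Pi.single j a := by
  ext m
  by_cases hm : m = i
  · subst hm; simp [hij]
  · simp [hm]

theorem periodize_add_self (i : Fin 3) (φ : SpT → ℝ) (t : ℝ) (x : Sp) :
    periodize i φ (t, x + Pi.single i 1) = periodize i φ (t, x) := by
  simp only [periodize, Pi.add_apply, Pi.single_eq_same, Int.fract_add_one, update_add_single_self]

theorem periodize_add_ne {i j : Fin 3} (hij : i ≠ j) (a : ℝ)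
    (h : ∀ (t : ℝ) (x : Sp), φ (t, x + Pi.single j a) = φ (t, x)) (t : ℝ) (x : Sp) :
    periodize i φ (t, x + Pi.single j a) = periodize i φ (t, x) := by
  simp only [periodize, update_add_single_ne hij, h, Pi.add_apply, Pi.single_eq_of_ne hij, add_zero]

theorem CutIn.periodize {i j : Fin 3} (hij : i ≠ j) (h : CutIn j φ) : CutIn j (periodize i φ) := by
  obtain ⟨δ, hδ, h⟩ := h
  refine ⟨δ, hδ, fun p hp => ?_⟩
  have := h _ hp
  simpa [Function.update_of_ne hij.symm] using this

/-- `φ` vanishes for `t` outside a compact subset of `(0,T)`. -/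
def CutT (T : ℝ) (φ : SpT → ℝ) : Prop :=
  ∃ δ : ℝ, 0 < δ ∧ ∀ p, φ p ≠ 0 → p.1 ∈ Icc δ (T - δ)

theorem CutT.periodize {i : Fin 3} (h : CutT T φ) : CutT T (periodize i φ) := by
  obtain ⟨δ, hδ, h⟩ := h
  exact ⟨δ, hδ, fun p hp => h (p.1, Function.update p.2 i (Int.fract (p.2 i))) hp⟩

theorem exists_cut {K : Set SpT} (hK : IsCompact K) {c : SpT → ℝ} (hc : Continuous c) {ℓ : ℝ}
    (h : ∀ p ∈ K, c p ∈ Ioo 0 ℓ) : ∃ δ : ℝ, 0 < δ ∧ ∀ p ∈ K, c p ∈ Icc δ (ℓ - δ) := by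
  rcases K.eq_empty_or_nonempty with rfl | hne
  · exact ⟨1, one_pos, by simp⟩
  obtain ⟨p1, hp1, hm1⟩ := hK.exists_isMinOn hne hc.continuousOn
  obtain ⟨p2, hp2, hm2⟩ := hK.exists_isMaxOn hne hc.continuousOn
  refine ⟨min (c p1) (ℓ - c p2), lt_min (h _ hp1).1 (by linarith [(h _ hp2).2]), fun p hp => ?_⟩
  have e1 : c p1 ≤ c p := hm1 hp
  have e2 : c p ≤ c p2 := hm2 hp
  exact ⟨(min_le_left _ _).trans e1, by linarith [min_le_right (c p1) (ℓ - c p2)]⟩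

theorem CcIn.cutIn (h : φ ∈ CcIn (cyl T)) (i : Fin 3) : CutIn i φ := by
  obtain ⟨_, K, hKU, hK, hz⟩ := h
  obtain ⟨δ, hδ, h⟩ := exists_cut hK (c := fun p => p.2 i) (by fun_prop)
    (fun p hp => (hKU hp).2 i)
  exact ⟨δ, hδ, fun p hp => h p (hz p hp)⟩

theorem CcIn.cutT (h : φ ∈ CcIn (cyl T)) : CutT T φ := by
  obtain ⟨_, K, hKU, hK, hz⟩ := h
  obtain ⟨δ, hδ, h⟩ := exists_cut hK (c := fun p => p.1) (by fun_prop) (fun p hp => (hKU hp).1)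
  exact ⟨δ, hδ, fun p hp => h p (hz p hp)⟩

theorem fderiv_eq_of_eqOn {U : Set SpT} (hU : IsOpen U) {ψ : SpT → ℝ} (h : ∀ p ∈ U, φ p = ψ p)
    (hp : p ∈ U) : fderiv ℝ φ p = fderiv ℝ ψ p := by
  apply Filter.EventuallyEq.fderiv_eq
  filter_upwards [hU.mem_nhds hp] with q hq using h q hq

theorem periodize_eq_on_cyl (i : Fin 3) (φ : SpT → ℝ) (hp : p ∈ cyl T) :
    periodize i φ p = φ p := periodize_eq_on ⟨(hp.2 i).1.le, (hp.2 i).2⟩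

theorem hor_ne_two (i : Fin 2) : hor i ≠ 2 := by fin_cases i <;> decide

/-- Periodization in both horizontal variables. -/
theorem periodize_mem_testLid (hφ : ContDiff ℝ (⊤ : ℕ∞) φ) (h0 : CutIn 0 φ) (h1 : CutIn 1 φ)
    (ht : CutT T φ) : periodize 1 (periodize 0 φ) ∈ testLid T := by
  refine ⟨contDiff_periodize (contDiff_periodize hφ h0) (h1.periodize (by decide)), ?_, ?_⟩
  · intro i t x
    fin_cases i
    · exact periodize_add_ne (by decide) 1 (periodize_add_self 0 φ) t x
    · exact periodize_add_self 1 _ t x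
  · obtain ⟨δ, hδ, h⟩ := ht.periodize (i := 0) |>.periodize (i := 1)
    exact ⟨δ, hδ, fun t x => h (t, x)⟩

theorem mem_testQ (h : φ ∈ testLid T) (h2 : CutIn 2 φ) : φ ∈ testQ T := by
  obtain ⟨δ, hδ, h2⟩ := h2
  exact ⟨h, δ, hδ, fun t x => h2 (t, x)⟩

theorem periodize_CcIn_mem_testQ (hT : 0 < T) (h : φ ∈ CcIn (cyl T)) :
    periodize 1 (periodize 0 φ) ∈ testQ T :=
  mem_testQ (periodize_mem_testLid h.1 (CcIn.cutIn h 0) (CcIn.cutIn h 1) (CcIn.cutT h))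
    (((CcIn.cutIn h 2).periodize (by decide)).periodize (by decide))

theorem integral_eq_of_eqOn_cyl {ψ : SpT → ℝ} (h : ∀ p ∈ cyl T, φ p = ψ p) (e : SpT) :
    ∫ p, f p * fderiv ℝ φ p e ∂muQ T = ∫ p, f p * fderiv ℝ ψ p e ∂muQ T ∧
    ∫ p, f p * φ p ∂muQ T = ∫ p, f p * ψ p ∂muQ T :=
  ⟨setIntegral_congr_fun (measurableSet_cyl T) fun p hp => by
    rw [fderiv_eq_of_eqOn (isOpen_cyl T) h hp], setIntegral_congr_fun (measurableSet_cyl T)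
    fun p hp => by rw [h p hp]⟩

/-- A weak derivative is a distributional derivative in the open cell. -/
theorem HasWeakDeriv.test_CcIn (hT : 0 < T) {e : SpT} {S : Set (SpT → ℝ)} (hS : testQ T ⊆ S)
    (h : HasWeakDeriv (cyl T) S e f g) : ∀ Φ ∈ CcIn (cyl T),
      ∫ p, f p * fderiv ℝ Φ p e ∂muQ T = - ∫ p, g p * Φ p ∂muQ T := by
  intro Φ hΦ
  have he : ∀ p ∈ cyl T, periodize 1 (periodize 0 Φ) p = Φ p := fun p hp => by
    rw [periodize_eq_on_cyl 1 _ hp, periodize_eq_on_cyl 0 _ hp]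
  have := h.2.2 _ (hS (periodize_CcIn_mem_testQ hT hΦ))
  rw [← (integral_eq_of_eqOn_cyl he e).1, ← (integral_eq_of_eqOn_cyl he e).2]
  exact this

/-! ### The two kinds of directions -/

/-- The `k`-th space coordinate. -/
def spCoord (k : Fin 3) : SpT →L[ℝ] ℝ :=
  (ContinuousLinearMap.proj k).comp (ContinuousLinearMap.snd ℝ ℝ Sp)

theorem lin_space (k : Fin 3) (p : SpT) (s : ℝ) :
    lin (spCoord k) (0, Pi.single k 1) p s = line k p s := by
  ext j
  · simp [lin, line]
  · by_cases hj : j = k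
    · subst hj; simp [lin, line, spCoord]
    · simp [lin, line, spCoord, hj]

theorem mem_cyl_line (hp : p ∈ cyl T) (s : ℝ) : line k p s ∈ cyl T ↔ s ∈ Ioo (0 : ℝ) 1 := by
  constructor
  · intro h; simpa [line] using h.2 k
  · intro h
    refine ⟨hp.1, fun i => ?_⟩
    by_cases hi : i = k
    · subst hi; simpa [line] using h
    · simpa [line, hi] using hp.2 i

theorem measurePreserving_lin_space (k : Fin 3) (T : ℝ) :
    MeasurePreserving (fun q : SpT × ℝ => lin (spCoord k) (0, Pi.single k 1) q.1 q.2)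
      ((muQ T).prod ((ENNReal.ofReal 1)⁻¹ • volume.restrict (Ioo 0 1))) (muQ T) := by
  simp only [lin_space, ENNReal.ofReal_one, inv_one, one_smul]
  exact measurePreserving_line k T

theorem lin_time (p : SpT) (s : ℝ) :
    lin (ContinuousLinearMap.fst ℝ ℝ Sp) (1, 0) p s = (s, p.2) := by
  ext j <;> simp [lin]

theorem measurePreserving_lin_time (hT : 0 < T) :
    MeasurePreserving (fun q : SpT × ℝ => lin (ContinuousLinearMap.fst ℝ ℝ Sp) (1, 0) q.1 q.2)
      ((muQ T).prod ((ENNReal.ofReal T)⁻¹ • volume.restrict (Ioo 0 T))) (muQ T) := by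
  simp only [lin_time]
  have h0 : ENNReal.ofReal T ≠ 0 := by simpa using hT
  rw [muQ_eq_prod]
  have h1 := measurePreserving_prodAssoc (volume.restrict (Ioo 0 T)) muO
    ((ENNReal.ofReal T)⁻¹ • volume.restrict (Ioo 0 T))
  refine ⟨by fun_prop, ?_⟩
  have h2 : (fun q : SpT × ℝ => (q.2, q.1.2)) = Prod.swap ∘ Prod.snd ∘
      (MeasurableEquiv.prodAssoc : (ℝ × Sp) × ℝ ≃ᵐ ℝ × Sp × ℝ) := by
    ext q <;> rfl
  rw [h2, ← Measure.map_map measurable_swap (by fun_prop),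
    ← Measure.map_map measurable_snd (by fun_prop), h1.map_eq, Measure.map_snd_prod,
    Measure.map_smul, Measure.prod_swap, Measure.prod_smul_left, smul_smul]
  simp [ENNReal.mul_inv_cancel h0 ENNReal.ofReal_ne_top]

/-! ### From weak derivatives to absolute continuity on lines -/

variable {T : ℝ}

theorem spCoord_single (k : Fin 3) : spCoord k (0, Pi.single k 1) = 1 := by
  simp [spCoord]

theorem single_ne_zero' (k : Fin 3) : ((0, Pi.single k 1) : SpT) ≠ 0 := by
  intro h
  have := congrArg (spCoord k) h
  rw [spCoord_single] at this
  simp at this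

theorem lineInt_line (k : Fin 3) (φ : SpT → ℝ) (p : SpT) (s : ℝ) :
    lineInt (0, Pi.single k 1) φ (line k p s) = lineInt (0, Pi.single k 1) φ p := by
  rw [← lin_space]; exact lineInt_add_smul _ p

theorem lineInt_eq_on_cyl (hφ : φ ∈ CcIn (cyl T)) (hp : p ∈ cyl T) : lineInt (0, Pi.single k 1) φ p = ∫ s, φ (line k p s) ∂muI := by
  obtain ⟨_, K, hKU, _, hK⟩ := hφ
  rw [← integral_indicator measurableSet_Ioo, lineInt, ← integral_sub_right_eq_self _ (p.2 k)]
  congr 1; ext s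
  have e1 : p + (s - p.2 k) • ((0, Pi.single k 1) : SpT) = line k p s := by
    rw [← lin_space]; rfl
  rw [e1]
  by_cases hs : s ∈ Ioo (0 : ℝ) 1
  · rw [indicator_of_mem hs]
  · rw [indicator_of_notMem hs]
    by_contra hn
    exact hs ((mem_cyl_line hp s).1 (hKU (hK _ hn)))

theorem bounded_on_cyl (h : Continuous φ) : ∃ C, ∀ᵐ p ∂muQ T, ‖φ p‖ ≤ C := by
  have hc : IsCompact (Icc 0 T ×ˢ (Set.pi univ fun _ : Fin 3 => Icc (0 : ℝ) 1)) :=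
    isCompact_Icc.prod (isCompact_univ_pi fun _ => isCompact_Icc)
  obtain ⟨C, hC⟩ := hc.exists_bound_of_continuousOn h.continuousOn
  refine ⟨C, ?_⟩
  filter_upwards [ae_restrict_mem (measurableSet_cyl T)] with p hp
  exact hC p ⟨Ioo_subset_Icc_self hp.1, fun i _ => Ioo_subset_Icc_self (hp.2 i)⟩

theorem integrable_mul_continuous (hf : Integrable f (muQ T)) (h : Continuous φ) :
    Integrable (fun p => f p * φ p) (muQ T) :=
  Integrable.mul_of_bounded hf h.aestronglyMeasurable (bounded_on_cyl h)

/-- If `g` is orthogonal to all line integrals of test functions, its line integrals vanish. -/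
theorem integral_line_eq_zero (hg : Integrable g (muQ T))
    (H : ∀ φ ∈ CcIn (cyl T), ∫ p, g p * lineInt (0, Pi.single k 1) φ p ∂muQ T = 0) :
    ∀ᵐ p ∂muQ T, ∫ s in (0 : ℝ)..1, g (line k p s) = 0 := by
  have key : ∀ᵐ p ∂muQ T, (∫ s, g (line k p s) ∂muI) = 0 := by
    apply ae_eq_zero_of_CcIn (isOpen_cyl T) (integrable_integral_line k hg)
    intro φ hφ
    change ∫ p, (∫ s, g (line k p s) ∂muI) * φ p ∂muQ T = 0
    rw [integral_line k (CcIn.integrable_mul hφ (integrable_integral_line k hg)), ← H φ hφ,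
      integral_line k (integrable_mul_continuous hg (contDiff_lineInt hφ (single_ne_zero' k)).continuous)]
    apply integral_congr_ae
    filter_upwards [ae_restrict_mem (measurableSet_cyl T)] with p hp
    simp only [line_line, lineInt_line, lineInt_eq_on_cyl hφ hp, integral_const_mul,
      integral_mul_const]
  filter_upwards [key] with p hp
  rwa [← muI_integral]

theorem LD.of_weak (hT : 0 < T) {S : Set (SpT → ℝ)} (hS : testQ T ⊆ S)
    (h : HasWeakDeriv (cyl T) S (0, Pi.single k 1) f g) {c : ℝ → ℝ → Prop}
    (hc : ∀ᵐ p ∂muQ T, ∀ F : ℝ → ℝ, AC1 1 F (fun s => g (line k p s)) →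
    (∀ᵐ s ∂muI, f (line k p s) = F s) → c (F 0) (F 1)) : LD c k T f g := by
  obtain ⟨A, hA, hf⟩ := exists_primitive_of_test one_pos (spCoord_single k)
    (fun p hp s => by rw [lin_space]; exact mem_cyl_line hp s) (measurePreserving_lin_space k T)
    h.1 h.2.1 (HasWeakDeriv.test_CcIn hT hS h)
  simp only [lin_space] at hA hf
  filter_upwards [ae_line k hf, ae_integrable_line k h.2.1, hc] with p hp hi hcp
  have h1 : AC1 1 (fun s => A p + ∫ u in (0 : ℝ)..s, g (line k p u)) (fun s => g (line k p s)) :=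
    AC1.primitive zero_le_one (intervalIntegrable_iff_muI.2 hi) _
  have h2 : ∀ᵐ s ∂muI, f (line k p s) = A p + ∫ u in (0 : ℝ)..s, g (line k p u) := by
    filter_upwards [hp] with s hs
    rw [hs, hA]
    congr 1
    have : spCoord k (line k p s) = s := by simp [spCoord, line]
    rw [this]
    simp only [line_line]
  exact ⟨_, h1, h2, hcp _ h1 h2⟩

theorem VD.of_weak (hT : 0 < T) (h : WQ T k f g) : VD k T f g :=
  LD.of_weak hT le_rfl h (.of_forall fun _ _ _ _ => trivial)

theorem fderiv_eq_zero_of_invariant {e : SpT} (hd : Differentiable ℝ φ)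
    (h : ∀ p (u : ℝ), φ (p + u • e) = φ p) (p : SpT) : fderiv ℝ φ p e = 0 := by
  have h1 : HasDerivAt (fun u : ℝ => φ (p + u • e)) (fderiv ℝ φ p e) 0 := by
    have h1 : HasFDerivAt φ (fderiv ℝ φ p) (p + (0 : ℝ) • e) := by
      rw [zero_smul, add_zero]; exact (hd p).hasFDerivAt
    have h2 : HasDerivAt (fun u : ℝ => p + u • e) e 0 := by
      simpa using ((hasDerivAt_id (0 : ℝ)).smul_const e).const_add p
    exact h1.comp_hasDerivAt (0 : ℝ) h2
  simp only [h] at h1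
  exact h1.unique (hasDerivAt_const _ _)

theorem lineInt_cut {j : Fin 3} (hjk : j ≠ k) (hφ : CutIn j φ) :
    CutIn j (lineInt (0, Pi.single k 1) φ) := by
  obtain ⟨δ, hδ, h⟩ := hφ
  refine ⟨δ, hδ, fun p hp => ?_⟩
  obtain ⟨s, hs⟩ : ∃ s : ℝ, φ (p + s • ((0, Pi.single k 1) : SpT)) ≠ 0 := by
    by_contra hn
    push Not at hn
    exact hp (by simp only [lineInt, hn, integral_zero])
  simpa [hjk] using h _ hs

theorem lineInt_cutT (hφ : CutT T φ) : CutT T (lineInt (0, Pi.single k 1) φ) := by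
  obtain ⟨δ, hδ, h⟩ := hφ
  refine ⟨δ, hδ, fun p hp => ?_⟩
  obtain ⟨s, hs⟩ : ∃ s : ℝ, φ (p + s • ((0, Pi.single k 1) : SpT)) ≠ 0 := by
    by_contra hn
    push Not at hn
    exact hp (by simp only [lineInt, hn, integral_zero])
  simpa using h _ hs

theorem exists_other (i : Fin 2) : ∃ j : Fin 2, j ≠ i ∧ ∀ m : Fin 2, m = i ∨ m = j :=
  ⟨i + 1, by fin_cases i <;> decide, by fin_cases i <;> decide⟩

theorem HD.of_weak {i : Fin 2} (hT : 0 < T) (h : WQ T (hor i) f g) : HD (hor i) T f g := by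
  have hz : ∀ᵐ p ∂muQ T, ∫ s in (0 : ℝ)..1, g (line (hor i) p s) = 0 := by
    apply integral_line_eq_zero h.2.1
    intro φ hφ
    set ψ := lineInt (0, Pi.single (hor i) 1) φ with hψ
    have hψc : ContDiff ℝ (⊤ : ℕ∞) ψ := contDiff_lineInt hφ (single_ne_zero' _)
    have hψi : ∀ (a t : ℝ) (x : Sp), ψ (t, x + Pi.single (hor i) a) = ψ (t, x) := by
      intro a t x
      rw [hψ, ← lineInt_add_smul a (t, x)]
      congr 1
      ext m
      · simp
      · simp only [Prod.smul_mk, Prod.mk_add_mk, Pi.add_apply, Pi.smul_apply, smul_eq_mul]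
        by_cases hm : m = hor i
        · subst hm; simp
        · simp [hm]
    obtain ⟨j, hj, hall⟩ := exists_other i
    have hji : hor j ≠ hor i := fun h => hj (Fin.castSucc_injective 2 h)
    have hcj := lineInt_cut hji (CcIn.cutIn hφ (hor j))
    have hc2 := lineInt_cut (hor_ne_two i).symm (CcIn.cutIn hφ 2)
    have hct := lineInt_cutT (k := hor i) (CcIn.cutT hφ)
    have hinv : ∀ (a t : ℝ) (x : Sp), periodize (hor j) ψ (t, x + Pi.single (hor i) a)
        = periodize (hor j) ψ (t, x) := fun a t x => periodize_add_ne hji a (hψi a) t x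
    have hd := contDiff_periodize hψc hcj
    have htest : periodize (hor j) ψ ∈ testQ T := by
      refine mem_testQ ⟨hd, fun m t x => ?_, ?_⟩ (hc2.periodize (hor_ne_two j))
      · rcases hall m with rfl | rfl
        · exact hinv 1 t x
        · exact periodize_add_self _ _ t x
      · obtain ⟨δ, hδ, h⟩ := hct.periodize (i := hor j)
        exact ⟨δ, hδ, fun t x => h (t, x)⟩
    have h1 := h.2.2 _ htest
    have h2 : ∀ p, fderiv ℝ (periodize (hor j) ψ) p (0, Pi.single (hor i) 1) = 0 := by
      apply fderiv_eq_zero_of_invariant (hd.differentiable (by simp))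
      intro p u
      rw [← hinv u p.1 p.2]
      congr 1
      ext m
      · simp
      · by_cases hm : m = hor i
        · subst hm; simp
        · simp [hm]
    simp only [h2, mul_zero, integral_zero] at h1
    have h3 := (integral_eq_of_eqOn_cyl (f := g) (T := T)
      (fun p hp => periodize_eq_on_cyl (hor j) ψ hp) 0).2
    rw [← h3]
    change ∫ p in cyl T, _ = 0
    linarith
  apply LD.of_weak hT le_rfl h
  filter_upwards [hz] with p hp F h1 h2
  have := h1.integral_eq zero_le_one
  rw [hp] at this
  linarith

/-- Testing up to the lids amounts to vanishing boundary values. -/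
theorem VZ.of_weak (hT : 0 < T) (h : HasWeakDeriv (cyl T) (testLid T) (0, Pi.single 2 1) f g) : VZ 2 T f g := by
  have hS : testQ T ⊆ testLid T := fun φ hφ => hφ.1
  have htest : ∀ φ ∈ CcIn (cyl T), ∃ Ψ ∈ testLid T,
      (∀ p (u : ℝ), Ψ (p + u • ((0, Pi.single 2 1) : SpT)) = Ψ p) ∧
      ∀ p ∈ cyl T, Ψ p = lineInt (0, Pi.single 2 1) φ p := by
    intro φ hφ
    refine ⟨periodize 1 (periodize 0 (lineInt (0, Pi.single 2 1) φ)),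
      periodize_mem_testLid (contDiff_lineInt hφ (single_ne_zero' _))
        (lineInt_cut (by decide) (CcIn.cutIn hφ 0)) (lineInt_cut (by decide) (CcIn.cutIn hφ 1))
        (lineInt_cutT (CcIn.cutT hφ)), ?_, ?_⟩
    · intro p u
      have hψi : ∀ (a t : ℝ) (x : Sp), lineInt (0, Pi.single 2 1) φ (t, x + Pi.single 2 a)
          = lineInt (0, Pi.single 2 1) φ (t, x) := by
        intro a t x
        rw [← lineInt_add_smul a (t, x)]
        congr 1
        ext m
        · simp
        · by_cases hm : m = 2
          · subst hm; simp
          · simp [hm]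
      rw [← periodize_add_ne (i := 1) (j := 2) (by decide) u
        (fun t x => periodize_add_ne (by decide) u (hψi u) t x) p.1 p.2]
      congr 1
      ext m
      · simp
      · by_cases hm : m = 2
        · subst hm; simp
        · simp [hm]
    · intro p hp
      rw [periodize_eq_on_cyl 1 _ hp, periodize_eq_on_cyl 0 _ hp]
  have hz : ∀ᵐ p ∂muQ T, ∫ s in (0 : ℝ)..1, g (line 2 p s) = 0 := by
    apply integral_line_eq_zero h.2.1
    intro φ hφ
    obtain ⟨Ψ, h1, h2, h3⟩ := htest φ hφ
    have h4 := h.2.2 Ψ h1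
    have h5 := fderiv_eq_zero_of_invariant (h1.1.differentiable (by simp)) h2
    simp only [h5, mul_zero, integral_zero] at h4
    rw [← (integral_eq_of_eqOn_cyl (f := g) h3 0).2]
    change ∫ p in cyl T, _ = 0
    linarith
  have hzi : Integrable (fun p => g p * p.2 2) (muQ T) :=
    integrable_mul_continuous h.2.1 (by fun_prop)
  have hz2 : ∀ᵐ p ∂muQ T, ∫ s in (0 : ℝ)..1,
      (f (line 2 p s) + g (line 2 p s) * (line 2 p s).2 2) = 0 := by
    apply integral_line_eq_zero (integrable_add' h.1 hzi)
    intro φ hφ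
    obtain ⟨Ψ, h1, h2, h3⟩ := htest φ hφ
    have hΨz : (fun p => p.2 2 * Ψ p) ∈ testLid T := by
      refine ⟨(by fun_prop : ContDiff ℝ (⊤ : ℕ∞) fun p : SpT => p.2 2).mul h1.1,
        fun i t x => ?_, ?_⟩
      · have := h1.2.1 i t x
        simp only [this, Pi.add_apply, Pi.single_eq_of_ne (hor_ne_two i).symm, add_zero]
      · obtain ⟨δ, hδ, h⟩ := h1.2.2
        exact ⟨δ, hδ, fun t x hn => h t x (right_ne_zero_of_mul hn)⟩
    have h4 := h.2.2 _ hΨz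
    have h5 := fderiv_eq_zero_of_invariant (h1.1.differentiable (by simp)) h2
    have h6 : ∀ p, fderiv ℝ (fun p : SpT => p.2 2 * Ψ p) p (0, Pi.single 2 1) = Ψ p := by
      intro p
      have a1 : HasFDerivAt (fun p : SpT => p.2 2) (spCoord 2) p := (spCoord 2).hasFDerivAt
      have a2 := (h1.1.differentiable (by simp) p).hasFDerivAt
      have a3 : HasFDerivAt (fun p : SpT => p.2 2 * Ψ p) _ p := a1.mul a2
      rw [a3.fderiv]
      simp only [_root_.add_apply, _root_.smul_apply, h5 p, spCoord_single, smul_eq_mul]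
      ring
    simp only [h6] at h4
    change ∫ p, _ ∂muQ T = - ∫ p, _ ∂muQ T at h4
    rw [← (integral_eq_of_eqOn_cyl (f := fun p => f p + g p * p.2 2) h3 0).2]
    have h7 : ∀ p, (f p + g p * p.2 2) * Ψ p = f p * Ψ p + g p * (p.2 2 * Ψ p) := fun p => by ring
    simp only [h7]
    rw [integral_add (integrable_mul_continuous h.1 h1.1.continuous)
      (integrable_mul_continuous h.2.1 hΨz.1.continuous), h4]
    ring
  apply LD.of_weak hT hS h
  filter_upwards [hz, hz2] with p hp hp2 F h1 h2
  have e1 := h1.integral_eq zero_le_one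
  rw [hp] at e1
  have e2 : ∫ s in (0 : ℝ)..1, (f (line 2 p s) + g (line 2 p s) * (line 2 p s).2 2)
      = ∫ s in (0 : ℝ)..1, (g (line 2 p s) * s + F s * 1) := by
    rw [← muI_integral, ← muI_integral]
    apply integral_congr_ae
    filter_upwards [h2] with s hs
    simp only [line, Function.update_self] at hs ⊢
    rw [hs]; ring
  have hid : AC1 1 (fun s : ℝ => s) (fun _ => 1) :=
    (AC1.of_contDiff contDiff_id).congr (.of_forall fun s => by simp)
  have e3 := (h1.mul hid).integral_eq zero_le_one
  rw [← e2, hp2] at e3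
  have : F 1 = 0 := by linarith
  exact ⟨by linarith, this⟩

/-! ### From absolute continuity on lines to weak derivatives -/

theorem LD.of_contDiff {c : ℝ → ℝ → Prop} (hφ : ContDiff ℝ 1 φ)
    (hc : ∀ p, c (φ (line k p 0)) (φ (line k p 1))) :
    LD c k T φ (fun p => fderiv ℝ φ p (0, Pi.single k 1)) := by
  refine .of_forall fun p => ⟨fun s => φ (line k p s), ?_, .of_forall fun _ => rfl, hc p⟩
  have hl : ContDiff ℝ 1 (fun s => line k p s) := by
    simp only [← lin_space]; unfold lin; fun_prop
  refine (AC1.of_contDiff (hφ.comp hl)).congr (.of_forall fun s => ?_)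
  have h1 : HasDerivAt (fun s => line k p s) (0, Pi.single k 1) s := by
    simp only [← lin_space]
    simpa [lin] using (((hasDerivAt_id s).sub_const (spCoord k p)).smul_const
      ((0, Pi.single k 1) : SpT)).const_add p
  exact ((hφ.differentiable one_ne_zero (line k p s)).hasFDerivAt.comp_hasDerivAt s h1).deriv

theorem line_one (k : Fin 3) (p : SpT) :
    line k p 1 = ((line k p 0).1, (line k p 0).2 + Pi.single k 1) := by
  ext j
  · rfl
  · by_cases hj : j = k
    · subst hj; simp [line]
    · simp [line, hj]

theorem integral_mul_fderiv {c c' : ℝ → ℝ → Prop} (hf : LD c k T f g) (hfi : Integrable f (muQ T))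
    (hgi : Integrable g (muQ T)) (hφ : ContDiff ℝ 1 φ)
    (hcφ : ∀ p, c' (φ (line k p 0)) (φ (line k p 1)))
    (hcc : ∀ a b a' b', c a b → c' a' b' → a * a' = b * b') :
    ∫ p, f p * fderiv ℝ φ p (0, Pi.single k 1) ∂muQ T = - ∫ p, g p * φ p ∂muQ T := by
  have h1 : HD k T (fun p => f p * φ p)
      (fun p => g p * φ p + f p * fderiv ℝ φ p (0, Pi.single k 1)) :=
    LD.mul_gen hcc hf (LD.of_contDiff hφ hcφ)
  have i1 := integrable_mul_continuous hgi hφ.continuous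
  have i2 := integrable_mul_continuous hfi
    ((hφ.continuous_fderiv one_ne_zero).clm_apply (continuous_const (y := ((0, Pi.single k 1) : SpT))))
  have := h1.ibp (i1.add i2)
  rw [integral_add i1 i2] at this
  linarith

theorem HD.weak {i : Fin 2} (hf : HD (hor i) T f g) (hfi : Integrable f (muQ T))
    (hgi : Integrable g (muQ T)) : WQ T (hor i) f g :=
  ⟨hfi, hgi, fun φ hφ => integral_mul_fderiv hf hfi hgi
    (hφ.1.1.of_le (by exact_mod_cast le_top)) (c' := (· = ·))
    (fun p => by rw [line_one, hφ.1.2.1]) (fun _ _ _ _ h1 h2 => by rw [h1, h2])⟩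

theorem VD.weak (hf : VD 2 T f g) (hfi : Integrable f (muQ T)) (hgi : Integrable g (muQ T)) :
    WQ T 2 f g := by
  refine ⟨hfi, hgi, fun φ hφ => integral_mul_fderiv hf hfi hgi
    (hφ.1.1.of_le (by exact_mod_cast le_top)) (c' := fun a b => a = 0 ∧ b = 0) (fun p => ?_)
    (fun _ _ _ _ _ h2 => by rw [h2.1, h2.2, mul_zero, mul_zero])⟩
  obtain ⟨δ, hδ, h⟩ := hφ.2
  constructor
  · by_contra hn
    have := (h _ _ hn).1
    simp only [Function.update_self] at this
    linarith
  · by_contra hn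
    have := (h _ _ hn).2
    simp only [Function.update_self] at this
    linarith

theorem dQ_hor_eq {i : Fin 2} (hT : 0 < T) (hf : HD (hor i) T f g) (hfi : Integrable f (muQ T))
    (hgi : Integrable g (muQ T)) : ∀ᵐ p ∂muQ T, dQ T (hor i) f p = g p := by
  have h := hasWeakDeriv_weakDeriv ⟨g, hf.weak hfi hgi⟩
  exact LD.unique (HD.of_weak hT h) hf h.2.1.1 hgi.1

theorem dQ_vert_eq (hT : 0 < T) (hf : VD 2 T f g) (hfi : Integrable f (muQ T))
    (hgi : Integrable g (muQ T)) : ∀ᵐ p ∂muQ T, dQ T 2 f p = g p := by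
  have h := hasWeakDeriv_weakDeriv ⟨g, hf.weak hfi hgi⟩
  exact LD.unique (VD.of_weak hT h) hf h.2.1.1 hgi.1

/-! ### Integrability exponents -/

/-- `f ∈ L^{1/a}(Ω × (0,T))`, with `1/0 = ∞`. -/
def Q (T a : ℝ) (f : SpT → ℝ) : Prop := 0 ≤ a ∧ MemLp f (ENNReal.ofReal a)⁻¹ (muQ T)

namespace Q

variable {T τ a b : ℝ} {f g : SpT → ℝ}

theorem mul (hf : Q T a f) (hg : Q T b g) : Q T (a + b) (fun p => f p * g p) := by
  refine ⟨add_nonneg hf.1 hg.1, ?_⟩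
  have : ENNReal.HolderTriple (ENNReal.ofReal a)⁻¹ (ENNReal.ofReal b)⁻¹
      (ENNReal.ofReal (a + b))⁻¹ := ⟨by simp [ENNReal.ofReal_add hf.1 hg.1]⟩
  exact MemLp.mul hg.2 hf.2

theorem mono (hf : Q T a f) (hab : a ≤ b := by norm_num) : Q T b f :=
  ⟨hf.1.trans hab, hf.2.mono_exponent (ENNReal.inv_le_inv.2 (ENNReal.ofReal_le_ofReal hab))⟩

theorem add (hf : Q T a f) (hg : Q T a g) : Q T a (fun p => f p + g p) := ⟨hf.1, hf.2.add hg.2⟩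

theorem add' (hf : Q T a f) (hg : Q T b g) : Q T (max a b) (fun p => f p + g p) :=
  (hf.mono (le_max_left _ _)).add (hg.mono (le_max_right _ _))

theorem sub (hf : Q T a f) (hg : Q T a g) : Q T a (fun p => f p - g p) := ⟨hf.1, hf.2.sub hg.2⟩

theorem const_mul (c : ℝ) (hf : Q T a f) : Q T a (fun p => c * f p) := ⟨hf.1, hf.2.const_mul c⟩

theorem const (c : ℝ) : Q T 0 (fun _ => c) := ⟨le_rfl, by simpa using memLp_top_const c⟩

theorem of_bound (hf : AEStronglyMeasurable f (muQ T)) (C : ℝ) (h : ∀ᵐ p ∂muQ T, |f p| ≤ C) :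
    Q T 0 f := ⟨le_rfl, by simpa using memLp_top_of_bound hf C h⟩

theorem congr (hf : Q T a f) (h : ∀ᵐ p ∂muQ T, f p = g p) : Q T a g :=
  ⟨hf.1, hf.2.ae_eq h⟩

theorem of_eq (hf : Q T a f) (h : ∀ p, f p = g p) : Q T a g := (funext h) ▸ hf

theorem integrable (hf : Q T a f) (ha : a ≤ 1 := by norm_num) : Integrable f (muQ T) := by
  have := (hf.mono ha).2
  rwa [ENNReal.ofReal_one, inv_one, memLp_one_iff_integrable] at this

theorem of_integrable (hf : Integrable f (muQ T)) : Q T 1 f :=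
  ⟨zero_le_one, by rwa [ENNReal.ofReal_one, inv_one, memLp_one_iff_integrable]⟩

theorem of_memLp {q : ℝ} (hq : 0 < q) (hf : MemLp f (ENNReal.ofReal q) (muQ T)) : Q T q⁻¹ f :=
  ⟨by positivity, by rwa [ENNReal.ofReal_inv_of_pos hq, inv_inv]⟩

theorem memLp_two (hf : Q T (1 / 2) f) : MemLp f 2 (muQ T) := by
  have := hf.2
  rwa [one_div, ENNReal.ofReal_inv_of_pos two_pos, inv_inv, ENNReal.ofReal_ofNat] at this

theorem two_of_memLp (hf : MemLp f 2 (muQ T)) : Q T (1 / 2) f := by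
  rw [one_div]; exact of_memLp two_pos (by simpa using hf)

theorem mono_time (hτ : τ ≤ T) (hf : Q T a f) : Q τ a f := ⟨hf.1, hf.2.mono_measure (muQ_mono hτ)⟩

theorem aesm (hf : Q T a f) : AEStronglyMeasurable f (muQ T) := hf.2.1

theorem of_le (hg : Q T a g) (hf : AEStronglyMeasurable f (muQ T))
    (h : ∀ᵐ p ∂muQ T, |f p| ≤ |g p|) : Q T a f := ⟨hg.1, hg.2.mono hf h⟩

theorem abs (hf : Q T a f) : Q T a (fun p => |f p|) :=
  hf.of_le (continuous_abs.comp_aestronglyMeasurable hf.aesm) (.of_forall fun p => by simp)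

theorem sq (hf : Q T a f) : Q T (2 * a) (fun p => f p ^ 2) :=
  (two_mul a).symm ▸ (hf.mul hf).of_eq fun _ => (pow_two _).symm

end Q

/-! ### Functions with integrable derivative and zero integral -/

/-- An integrable function with integral zero. -/
def NullInt (T : ℝ) (g : SpT → ℝ) : Prop := Integrable g (muQ T) ∧ ∫ p, g p ∂muQ T = 0

namespace NullInt

variable {T : ℝ} {f g : SpT → ℝ}

theorem add (hf : NullInt T f) (hg : NullInt T g) : NullInt T (fun p => f p + g p) :=
  ⟨hf.1.add hg.1, by rw [integral_add hf.1 hg.1, hf.2, hg.2, add_zero]⟩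

theorem const_mul (c : ℝ) (hf : NullInt T f) : NullInt T (fun p => c * f p) :=
  ⟨hf.1.const_mul c, by rw [integral_const_mul, hf.2, mul_zero]⟩

theorem of_eq (hf : NullInt T f) (h : ∀ p, f p = g p) : NullInt T g := (funext h) ▸ hf

end NullInt

/-- `LD` together with the integrability exponents of the function and of its derivative. -/
structure DQr (c : ℝ → ℝ → Prop) (k : Fin 3) (T a b : ℝ) (f g : SpT → ℝ) : Prop where
  ld : LD c k T f g
  fn : Q T a f
  dv : Q T b g

abbrev cAny : ℝ → ℝ → Prop := fun _ _ => True
abbrev cZero : ℝ → ℝ → Prop := fun a b => a = 0 ∧ b = 0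

/-- Boundary conditions `c` and `c'` whose product satisfies `c''`. -/
class CMul (c c' : ℝ → ℝ → Prop) (c'' : outParam (ℝ → ℝ → Prop)) : Prop where
  out : ∀ a b a' b', c a b → c' a' b' → c'' (a * a') (b * b')

instance : CMul Eq Eq Eq := ⟨fun _ _ _ _ h1 h2 => by rw [h1, h2]⟩
instance : CMul cAny cAny cAny := ⟨fun _ _ _ _ _ _ => trivial⟩
instance : CMul cZero cAny cZero := ⟨fun _ _ _ _ h _ => by simp [h.1, h.2]⟩

namespace DQr

variable {c c' c'' : ℝ → ℝ → Prop} {k : Fin 3} {T τ a b a' b' : ℝ} {f g f' g' : SpT → ℝ}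

theorem mul [CMul c c' c''] (hf : DQr c k T a b f g) (hf' : DQr c' k T a' b' f' g') :
    DQr c'' k T (a + a') (max (b + a') (a + b')) (fun p => f p * f' p)
      (fun p => g p * f' p + f p * g' p) :=
  ⟨LD.mul_gen CMul.out hf.ld hf'.ld, hf.fn.mul hf'.fn, (hf.dv.mul hf'.fn).add' (hf.fn.mul hf'.dv)⟩

theorem add (hc : ∀ a b a' b', c a b → c a' b' → c (a + a') (b + b')) (hf : DQr c k T a b f g)
    (hf' : DQr c k T a' b' f' g') :
    DQr c k T (max a a') (max b b') (fun p => f p + f' p) (fun p => g p + g' p) :=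
  ⟨LD.add_gen hc hf.ld hf'.ld, hf.fn.add' hf'.fn, hf.dv.add' hf'.dv⟩

theorem addH (hf : DQr Eq k T a b f g) (hf' : DQr Eq k T a' b' f' g') :
    DQr Eq k T (max a a') (max b b') (fun p => f p + f' p) (fun p => g p + g' p) :=
  hf.add (fun _ _ _ _ h1 h2 => by rw [h1, h2]) hf'

theorem addV (hf : DQr cAny k T a b f g) (hf' : DQr cAny k T a' b' f' g') :
    DQr cAny k T (max a a') (max b b') (fun p => f p + f' p) (fun p => g p + g' p) :=
  hf.add (fun _ _ _ _ _ _ => trivial) hf'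

theorem weaken {a₁ b₁ : ℝ} (hf : DQr c k T a b f g) (ha : a ≤ a₁ := by norm_num)
    (hb : b ≤ b₁ := by norm_num) : DQr c k T a₁ b₁ f g := ⟨hf.ld, hf.fn.mono ha, hf.dv.mono hb⟩

theorem of_eq (hf : DQr c k T a b f g) (h1 : ∀ p, f p = f' p) (h2 : ∀ p, g p = g' p) :
    DQr c k T a b f' g' := by
  have e1 : f = f' := funext h1
  have e2 : g = g' := funext h2
  rwa [← e1, ← e2]

theorem congr (hf : DQr c k T a b f g) (h1 : ∀ᵐ p ∂muQ T, f p = f' p)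
    (h2 : ∀ᵐ p ∂muQ T, g p = g' p) : DQr c k T a b f' g' :=
  ⟨hf.ld.congr h1 h2, hf.fn.congr h1, hf.dv.congr h2⟩

theorem mono_time (hτ : τ ≤ T) (hf : DQr c k T a b f g) : DQr c k τ a b f g :=
  ⟨hf.ld.mono_time hτ, hf.fn.mono_time hτ, hf.dv.mono_time hτ⟩

theorem smulH (x : ℝ) (hf : DQr Eq k T a b f g) :
    DQr Eq k T a b (fun p => x * f p) (fun p => x * g p) :=
  ⟨HD.const_mul x hf.ld, hf.fn.const_mul x, hf.dv.const_mul x⟩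

theorem smulV (x : ℝ) (hf : DQr cAny k T a b f g) :
    DQr cAny k T a b (fun p => x * f p) (fun p => x * g p) :=
  ⟨VD.const_mul x hf.ld, hf.fn.const_mul x, hf.dv.const_mul x⟩

theorem null (hf : DQr Eq k T a b f g) (hb : b ≤ 1 := by norm_num) : NullInt T g :=
  ⟨hf.dv.integrable hb, HD.ibp hf.ld (hf.dv.integrable hb)⟩

theorem toV (hf : DQr cZero k T a b f g) : DQr cAny k T a b f g :=
  ⟨VZ.toVD hf.ld, hf.fn, hf.dv⟩

end DQr

/-- Multiplication by a bounded function of time. -/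
theorem NullInt.time_weight {c : ℝ → ℝ → Prop} {a b : ℝ}
    (hc : ∀ (x : ℝ) a b, c a b → x * a = x * b) {w : ℝ → ℝ} (hw : Continuous w)
    (hf : DQr c k T a b f g) (hb : b ≤ 1) : NullInt T (fun p => w p.1 * g p) := by
  have hi : Integrable (fun p => w p.1 * g p) (muQ T) :=
    (integrable_mul_continuous (hf.dv.integrable hb) (hw.comp continuous_fst)).congr
      (.of_forall fun p => by simp [mul_comm])
  refine ⟨hi, ?_⟩
  have h1 : HD k T (fun p => w p.1 * f p) (fun p => 0 * f p + w p.1 * g p) :=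
    LD.mul_gen (c := (· = ·)) (c' := c) (fun a b a' b' h1 h2 => by rw [h1]; exact hc b _ _ h2)
      (LD.of_time (fun _ => rfl) w) hf.ld
  exact HD.ibp (LD.of_eq_right (g' := fun p => w p.1 * g p) h1 (fun p => by ring)) hi

/-! ### Time derivatives -/

/-- `f` is absolutely continuous in time for almost every space point, with derivative `g`, and
all its time slices are the ones given by this representative. -/
def TD (T : ℝ) (f g : SpT → ℝ) : Prop :=
  (∀ᵐ x ∂muO, ∃ F : ℝ → ℝ, AC1 T F (fun s => g (s, x)) ∧ F 0 = f (0, x) ∧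
    ∀ᵐ s ∂volume.restrict (Ioo 0 T), f (s, x) = F s) ∧
  ∀ t ∈ Icc 0 T, ∀ᵐ x ∂muO, f (t, x) = f (0, x) + ∫ s in (0 : ℝ)..t, g (s, x)

theorem ae_time_ae_space {P : SpT → Prop} (h : ∀ᵐ p ∂muQ T, P p) :
    ∀ᵐ t ∂volume.restrict (Ioo 0 T), ∀ᵐ x ∂muO, P (t, x) := by
  rw [muQ_eq_prod] at h
  exact Measure.ae_ae_of_ae_prod h

theorem ae_space_ae_time {P : SpT → Prop} (h : ∀ᵐ p ∂muQ T, P p) :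
    ∀ᵐ x ∂muO, ∀ᵐ t ∂volume.restrict (Ioo 0 T), P (t, x) := by
  rw [muQ_eq_prod] at h
  exact Measure.ae_ae_of_ae_prod (Measure.measurePreserving_swap.quasiMeasurePreserving.ae h)

namespace TD

variable {T : ℝ} {f g f' g' : SpT → ℝ}

theorem lift₂ {op : ℝ → ℝ → ℝ} {dop : ℝ → ℝ → ℝ → ℝ → ℝ}
    (hop : ∀ F f G g : ℝ → ℝ, AC1 T F f → AC1 T G g →
    AC1 T (fun x => op (F x) (G x)) (fun x => dop (F x) (f x) (G x) (g x))) (hf : TD T f g)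
    (hf' : TD T f' g') :
    TD T (fun p => op (f p) (f' p)) (fun p => dop (f p) (g p) (f' p) (g' p)) := by
  have key : ∀ᵐ x ∂muO, ∃ F G : ℝ → ℝ, AC1 T F (fun s => g (s, x)) ∧ AC1 T G (fun s => g' (s, x)) ∧
      F 0 = f (0, x) ∧ G 0 = f' (0, x) ∧
      (∀ᵐ s ∂volume.restrict (Ioo 0 T), f (s, x) = F s) ∧
      (∀ᵐ s ∂volume.restrict (Ioo 0 T), f' (s, x) = G s) ∧
      AC1 T (fun s => op (F s) (G s))
        (fun s => dop (f (s, x)) (g (s, x)) (f' (s, x)) (g' (s, x))) := by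
    filter_upwards [hf.1, hf'.1] with x ⟨F, a1, a2, a3⟩ ⟨G, b1, b2, b3⟩
    refine ⟨F, G, a1, b1, a2, b2, a3, b3, (hop F _ G _ a1 b1).congr ?_⟩
    filter_upwards [a3, b3] with s s1 s2
    rw [s1, s2]
  constructor
  · filter_upwards [key] with x ⟨F, G, _, _, e1, e2, s1, s2, h⟩
    refine ⟨_, h, by rw [e1, e2], ?_⟩
    filter_upwards [s1, s2] with s h1 h2
    rw [h1, h2]
  · intro t ht
    filter_upwards [key, hf.2 t ht, hf'.2 t ht] with x ⟨F, G, a1, b1, e1, e2, _, _, h⟩ h1 h2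
    rw [h1, h2, ← e1, ← e2, ← a1.eq_add ht, ← b1.eq_add ht]
    exact h.eq_add ht

theorem mul (hf : TD T f g) (hf' : TD T f' g') :
    TD T (fun p => f p * f' p) (fun p => g p * f' p + f p * g' p) :=
  lift₂ (op := fun a b => a * b) (dop := fun a b c d => b * c + a * d)
    (fun _ _ _ _ h1 h2 => h1.mul h2) hf hf'

theorem add (hf : TD T f g) (hf' : TD T f' g') : TD T (fun p => f p + f' p) (fun p => g p + g' p) :=
  lift₂ (op := fun a b => a + b) (dop := fun _ b _ d => b + d)
    (fun _ _ _ _ h1 h2 => h1.add h2) hf hf'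

theorem of_eq (hf : TD T f g) (h1 : ∀ p, f p = f' p) (h2 : ∀ p, g p = g' p) : TD T f' g' := by
  have e1 : f = f' := funext h1
  have e2 : g = g' := funext h2
  rwa [← e1, ← e2]

theorem of_time {a a' : ℝ → ℝ} (h : AC1 T a a') : TD T (fun p => a p.1) (fun p => a' p.1) :=
  ⟨.of_forall fun _ => ⟨a, h, rfl, .of_forall fun _ => rfl⟩,
    fun _ ht => .of_forall fun _ => h.eq_add ht⟩

theorem const_mul (x : ℝ) (hf : TD T f g) : TD T (fun p => x * f p) (fun p => x * g p) :=
  ((of_time (AC1.const x)).mul hf).of_eq (fun _ => rfl) (fun _ => by ring)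

theorem comp (hT : 0 < T) {φ φ' : ℝ → ℝ} {S : Set ℝ} (hS : IsClosed S)
    (hφ : ∀ y ∈ S, HasDerivAt φ (φ' y) y) (hφc : ContinuousOn φ' S) (hf : TD T f g)
    (hm : ∀ᵐ p ∂muQ T, f p ∈ S) : TD T (fun p => φ (f p)) (fun p => φ' (f p) * g p) := by
  have hm' := ae_space_ae_time hm
  have key : ∀ᵐ x ∂muO, ∃ F : ℝ → ℝ, AC1 T F (fun s => g (s, x)) ∧ F 0 = f (0, x) ∧
      (∀ᵐ s ∂volume.restrict (Ioo 0 T), f (s, x) = F s) ∧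
      AC1 T (fun s => φ (F s)) (fun s => φ' (f (s, x)) * g (s, x)) := by
    filter_upwards [hf.1, hm'] with x ⟨F, a1, a2, a3⟩ b
    have hF : ∀ s ∈ Icc 0 T, F s ∈ S := a1.ae_mem_closed hT hS (by
      filter_upwards [a3, b] with s s1 s2
      rw [← s1]; exact s2)
    refine ⟨F, a1, a2, a3, (a1.comp hT hF hφ hφc).congr ?_⟩
    filter_upwards [a3] with s s1
    rw [s1]
  constructor
  · filter_upwards [key] with x ⟨F, _, e1, s1, h⟩
    refine ⟨_, h, by rw [e1], ?_⟩
    filter_upwards [s1] with s h1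
    rw [h1]
  · intro t ht
    filter_upwards [key, hf.2 t ht] with x ⟨F, a1, e1, _, h⟩ h1
    rw [h1, ← e1, ← a1.eq_add ht]
    exact h.eq_add ht

/-- Values in a closed set are kept by all time slices. -/
theorem mem_closed (hT : 0 < T) {S : Set ℝ} (hS : IsClosed S) (hf : TD T f g)
    (hm : ∀ᵐ p ∂muQ T, f p ∈ S) {t : ℝ} (ht : t ∈ Icc 0 T) : ∀ᵐ x ∂muO, f (t, x) ∈ S := by
  have hm' := ae_space_ae_time hm
  filter_upwards [hf.1, hm', hf.2 t ht] with x ⟨F, a1, a2, a3⟩ b h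
  rw [h, ← a2, ← a1.eq_add ht]
  refine a1.ae_mem_closed hT hS ?_ t ht
  filter_upwards [a3, b] with s s1 s2
  rw [← s1]; exact s2

end TD

/-! ### Time slices of functions with a weak time derivative -/

theorem lin_time_cyl (hp : p ∈ cyl T) (s : ℝ) : ((s, p.2) : SpT) ∈ cyl T ↔ s ∈ Ioo 0 T :=
  ⟨fun h => h.1, fun h => ⟨h, hp.2⟩⟩

theorem ae_of_time_slices (hT : 0 < T) {P : SpT → Prop} (h : ∀ᵐ p ∂muQ T, P p) {t : ℝ}
    (ht : t ∈ Icc 0 T) : ∃ u : ℕ → ℝ, (∀ n, u n ∈ Ioo 0 T) ∧ Tendsto u atTop (𝓝 t) ∧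
      ∀ n, ∀ᵐ x ∂muO, P (u n, x) := by
  have h1 := ae_time_ae_space h
  rw [ae_restrict_iff' measurableSet_Ioo] at h1
  have hd : Dense {s : ℝ | s ∈ Ioo 0 T → ∀ᵐ x ∂muO, P (s, x)} := Measure.dense_of_ae h1
  have hcl : t ∈ closure (Ioo 0 T ∩ {s : ℝ | s ∈ Ioo 0 T → ∀ᵐ x ∂muO, P (s, x)}) := by
    have : t ∈ closure (Ioo 0 T) := by rwa [closure_Ioo hT.ne]
    exact closure_minimal (hd.open_subset_closure_inter isOpen_Ioo) isClosed_closure this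
  obtain ⟨u, hu, hut⟩ := mem_closure_iff_seq_limit.1 hcl
  exact ⟨u, fun n => (hu n).1, hut, fun n => (hu n).2 (hu n).1⟩

theorem TD.of_weak (hT : 0 < T) (h : HasWeakDeriv (cyl T) (testQ T) (1, 0) f g) (hc : ContL2 T f)
    : TD T f g := by
  obtain ⟨A, hA, hf⟩ := exists_primitive_of_test hT (c := ContinuousLinearMap.fst ℝ ℝ Sp)
    (e := (1, 0)) (by simp)
    (fun p hp s => by rw [lin_time]; exact lin_time_cyl hp s) (measurePreserving_lin_time hT)
    h.1 h.2.1 (HasWeakDeriv.test_CcIn hT le_rfl h)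
  simp only [lin_time, ContinuousLinearMap.coe_fst'] at hA hf
  have hA' : ∀ t x, A (t, x) = A (0, x) := fun t x => (hA (0, x) t)
  have hgi : ∀ᵐ x ∂muO, IntervalIntegrable (fun s => g (s, x)) volume 0 T := by
    have h1 : Integrable g (muQ T) := h.2.1
    rw [muQ_eq_prod] at h1
    filter_upwards [h1.prod_left_ae] with x hx
    rwa [intervalIntegrable_iff_integrableOn_Ioo_of_le hT.le]
  have hAC : ∀ᵐ x ∂muO, AC1 T (fun t => A (0, x) + ∫ s in (0 : ℝ)..t, g (s, x))
      (fun s => g (s, x)) := by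
    filter_upwards [hgi] with x hx using AC1.primitive hT.le hx _
  have hsl : ∀ t ∈ Icc 0 T, ∀ᵐ x ∂muO, f (t, x) = A (0, x) + ∫ s in (0 : ℝ)..t, g (s, x) := by
    intro t ht
    obtain ⟨u, hu, hut, hP⟩ := ae_of_time_slices hT hf ht
    have hlim : Tendsto (fun n => eLpNorm (fun x => f (u n, x) - f (t, x)) 2 muO) atTop (𝓝 0) :=
      (hc.2 t ht).comp (tendsto_nhdsWithin_iff.2
        ⟨hut, .of_forall fun n => Ioo_subset_Icc_self (hu n)⟩)
    have hmeas := tendstoInMeasure_of_tendsto_eLpNorm (p := 2) (μ := muO) two_ne_zero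
      (f := fun n x => f (u n, x)) (g := fun x => f (t, x))
      (fun n => (hc.1 _ (Ioo_subset_Icc_self (hu n))).1) (hc.1 t ht).1 hlim
    obtain ⟨ns, hns, hae⟩ := hmeas.exists_seq_tendsto_ae
    have hP' : ∀ᵐ x ∂muO, ∀ n, f (u n, x) = A (u n, x) + ∫ s in (0 : ℝ)..(u n), g (s, x) :=
      ae_all_iff.2 hP
    filter_upwards [hae, hP', hAC] with x h1 h2 h3
    have h4 := (h3.continuousOn hT.le) t ht
    have h5 : Tendsto (fun n => A (0, x) + ∫ s in (0 : ℝ)..(u (ns n)), g (s, x)) atTop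
        (𝓝 (A (0, x) + ∫ s in (0 : ℝ)..t, g (s, x))) :=
      h4.tendsto.comp (tendsto_nhdsWithin_iff.2 ⟨hut.comp hns.tendsto_atTop,
        .of_forall fun n => Ioo_subset_Icc_self (hu _)⟩)
    refine tendsto_nhds_unique h1 (h5.congr fun n => ?_)
    rw [h2, hA' (u (ns n)) x]
  have h0 : ∀ᵐ x ∂muO, f (0, x) = A (0, x) := by
    filter_upwards [hsl 0 ⟨le_rfl, hT.le⟩] with x hx
    simpa using hx
  constructor
  · filter_upwards [hAC, h0, ae_space_ae_time hf] with x h1 h2 h3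
    refine ⟨_, h1, by simp [h2], ?_⟩
    filter_upwards [h3] with s hs
    rw [hs, hA']
  · intro t ht
    filter_upwards [hsl t ht, h0] with x h1 h2
    rw [h1, h2]

section

variable {T : ℝ} {f g : SpT → ℝ}

theorem integral_muQ (hg : Integrable g (muQ T)) :
    ∫ p, g p ∂muQ T = ∫ x, (∫ t in Ioo 0 T, g (t, x)) ∂muO := by
  rw [muQ_eq_prod] at hg ⊢
  exact integral_prod_symm _ hg

theorem TD.slice_integrable (hT : 0 < T) (h : TD T f g) (hf : Integrable f (muQ T))
    (hg : Integrable g (muQ T)) {t : ℝ} (ht : t ∈ Icc 0 T) :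
    Integrable (fun x => f (t, x)) muO := by
  have hint : ∀ s ∈ Icc 0 T, Integrable (fun x => ∫ u in (0 : ℝ)..s, g (u, x)) muO := by
    intro s hs
    have h1 : Integrable g (muQ s) := hg.mono_measure (muQ_mono hs.2)
    rw [muQ_eq_prod] at h1
    refine h1.integral_prod_right.congr (.of_forall fun x => ?_)
    simp only
    rw [intervalIntegral.integral_of_le hs.1, integral_Ioc_eq_integral_Ioo]
  have h2 := hf
  rw [muQ_eq_prod] at h2
  have h3 := h2.prod_right_ae
  obtain ⟨s, hs1, hs2⟩ : ∃ s ∈ Ioo 0 T, Integrable (fun x => f (s, x)) muO := by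
    rw [ae_restrict_iff' measurableSet_Ioo] at h3
    have hne : (ae (volume.restrict (Ioo 0 T))).NeBot := by
      rw [ae_neBot]; intro h0
      have : (volume.restrict (Ioo 0 T)) univ = 0 := by rw [h0]; simp
      simp at this; linarith
    obtain ⟨s, hs⟩ := (((ae_restrict_iff' measurableSet_Ioo).2 h3).and
      (ae_restrict_mem measurableSet_Ioo)).exists
    exact ⟨s, hs.2, hs.1⟩
  have h0 : Integrable (fun x => f (0, x)) muO := by
    refine (hs2.sub (hint s (Ioo_subset_Icc_self hs1))).congr ?_
    filter_upwards [h.2 s (Ioo_subset_Icc_self hs1)] with x hx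
    simp [hx]
  refine (h0.add (hint t ht)).congr ?_
  filter_upwards [h.2 t ht] with x hx
  simp [hx]

theorem TD.integral_slice (hT : 0 < T) (h : TD T f g) (hf : Integrable f (muQ T))
    (hg : Integrable g (muQ T)) {t : ℝ} (ht : t ∈ Icc 0 T) :
    ∫ x, f (t, x) ∂muO = ∫ x, f (0, x) ∂muO + ∫ p, g p ∂muQ t := by
  have h1 := h.slice_integrable hT hf hg ht
  have h0 := h.slice_integrable hT hf hg (left_mem_Icc.2 hT.le)
  rw [integral_muQ (hg.mono_measure (muQ_mono ht.2)), ← integral_add h0]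
  · apply integral_congr_ae
    filter_upwards [h.2 t ht] with x hx
    rw [hx, intervalIntegral.integral_of_le ht.1, integral_Ioc_eq_integral_Ioo]
  · have h2 : Integrable g (muQ t) := hg.mono_measure (muQ_mono ht.2)
    rw [muQ_eq_prod] at h2
    exact h2.integral_prod_right

end

/-! ### Functions of the space variables only -/

section Space

variable {f g : Sp → ℝ}

instance : IsProbabilityMeasure (volume.restrict (Ioo (0 : ℝ) 1)) := ⟨by simp⟩

theorem quasiMP_snd (T : ℝ) : Measure.QuasiMeasurePreserving (Prod.snd : SpT → Sp) (muQ T) muO := by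
  rw [muQ_eq_prod]; exact Measure.quasiMeasurePreserving_snd

theorem integrable_space (hf : Integrable f muO) : Integrable (fun p : SpT => f p.2) (muQ T) := by
  rw [muQ_eq_prod]; exact hf.comp_snd _

theorem integral_space (f : Sp → ℝ) : ∫ p : SpT, f p.2 ∂muQ 1 = ∫ x, f x ∂muO := by
  rw [muQ_eq_prod, integral_fun_snd]; simp

theorem HasWeakDeriv.space_to_cyl (h : HasWeakDeriv Omega testO (Pi.single k 1) f g) :
    WQ T k (fun p => f p.2) (fun p => g p.2) := by
  have hf : Integrable f muO := h.1
  have hg : Integrable g muO := h.2.1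
  refine ⟨integrable_space hf, integrable_space hg, fun φ hφ => ?_⟩
  have hφc := hφ.1.1
  have hslice : ∀ t, (fun x => φ (t, x)) ∈ testO := by
    intro t
    refine ⟨hφc.comp (by fun_prop : ContDiff ℝ (⊤ : ℕ∞) fun x : Sp => ((t, x) : SpT)),
      fun i x => hφ.1.2.1 i t x, ?_⟩
    obtain ⟨δ, hδ, hz⟩ := hφ.2
    exact ⟨δ, hδ, fun x => hz t x⟩
  have hfd : ∀ t x, fderiv ℝ φ (t, x) (0, Pi.single k 1)
      = fderiv ℝ (fun x => φ (t, x)) x (Pi.single k 1) := by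
    intro t x
    have h1 : HasFDerivAt (fun x : Sp => ((t, x) : SpT)) (ContinuousLinearMap.inr ℝ ℝ Sp) x :=
      hasFDerivAt_prodMk_right t x
    have h2 := (hφc.differentiable (by simp) (t, x)).hasFDerivAt.comp x h1
    have h3 : fderiv ℝ (fun x => φ (t, x)) x = _ := h2.fderiv
    rw [h3]; simp
  change ∫ p, _ ∂muQ T = - ∫ p, _ ∂muQ T
  have i1 : Integrable (fun p : SpT => f p.2 * fderiv ℝ φ p (0, Pi.single k 1)) (muQ T) :=
    integrable_mul_continuous (integrable_space hf) ((hφc.continuous_fderiv (by simp)).clm_apply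
        (continuous_const (y := ((0, Pi.single k 1) : SpT))))
  have i2 : Integrable (fun p : SpT => g p.2 * φ p) (muQ T) :=
    integrable_mul_continuous (integrable_space hg) hφc.continuous
  rw [muQ_eq_prod] at i1 i2 ⊢
  rw [integral_prod _ i1, integral_prod _ i2, ← integral_neg]
  congr 1; ext t
  simp only [hfd]
  exact h.2.2 _ (hslice t)

theorem HD.space_weak {i : Fin 2} (h : HD (hor i) 1 (fun p => f p.2) (fun p => g p.2))
    (hf : Integrable f muO) (hg : Integrable g muO) :
    HasWeakDeriv Omega testO (Pi.single (hor i) 1) f g := by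
  refine ⟨hf, hg, fun φ hφ => ?_⟩
  have hcd : ContDiff ℝ 1 (fun p : SpT => φ p.2) :=
    (hφ.1.of_le (by exact_mod_cast le_top)).comp contDiff_snd
  have h1 := integral_mul_fderiv h (integrable_space hf) (integrable_space hg) hcd
    (c' := (· = ·)) (fun p => by rw [line_one]; exact (hφ.2.1 i _).symm)
    (fun _ _ _ _ h1 h2 => by rw [h1, h2])
  have hfd : ∀ p : SpT, fderiv ℝ (fun p : SpT => φ p.2) p (0, Pi.single (hor i) 1)
      = fderiv ℝ φ p.2 (Pi.single (hor i) 1) := by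
    intro p
    have h2 := (hφ.1.differentiable (by simp) p.2).hasFDerivAt.comp p
      (hasFDerivAt_snd (𝕜 := ℝ) (p := p))
    have h3 : fderiv ℝ (fun p : SpT => φ p.2) p = _ := h2.fderiv
    rw [h3]; simp
  simp only [hfd] at h1
  rw [integral_space (fun x => f x * fderiv ℝ φ x (Pi.single (hor i) 1)),
    integral_space (fun x => g x * φ x)] at h1
  exact h1

theorem dO_eq {i : Fin 2} (h : HasWeakDeriv Omega testO (Pi.single (hor i) 1) f g) :
    ∀ᵐ x ∂muO, dO (hor i) f x = g x := by
  have h' := hasWeakDeriv_weakDeriv ⟨g, h⟩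
  have a1 := HD.of_weak one_pos (h.space_to_cyl (T := 1))
  have a2 := HD.of_weak one_pos (h'.space_to_cyl (T := 1))
  have h3 := LD.unique a2 a1 (integrable_space h'.2.1).1 (integrable_space h.2.1).1
  obtain ⟨t, ht⟩ := (ae_time_ae_space h3).exists
  exact ht

theorem LD.slice {c : ℝ → ℝ → Prop} {f g : SpT → ℝ} (h : LD c k T f g) :
    ∀ᵐ t ∂volume.restrict (Ioo 0 T), ∀ T', LD c k T' (fun p => f (t, p.2)) (fun p => g (t, p.2)) := by
  filter_upwards [ae_time_ae_space h] with t ht T'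
  exact (quasiMP_snd T').ae ht

end Space

/-! ### Translations in `L²` -/

instance : (volume : Measure SpT).IsAddRightInvariant := by
  rw [Measure.volume_eq_prod]; infer_instance


theorem continuous_integral_translate_mul (hf : MemLp f 2 volume) (hg : MemLp g 2 volume)
    (e : SpT) : Continuous (fun h : ℝ => ∫ p, f (p + h • e) * g p) := by
  have hmp : ∀ h : ℝ, MeasurePreserving (fun p : SpT => p + h • e) volume volume :=
    fun h => measurePreserving_add_right volume (h • e)
  let τ : ℝ → C(SpT, SpT) := fun h => ⟨fun p => p + h • e, by fun_prop⟩
  have hτ : Continuous τ := ContinuousMap.continuous_of_continuous_uncurry _ (by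
    simp only [τ, ContinuousMap.coe_mk]; fun_prop)
  have hc : Continuous (fun h : ℝ => Lp.compMeasurePreserving (τ h) (hmp h) (hf.toLp f)) :=
    Continuous.compMeasurePreservingLp continuous_const hτ hmp (by simp)
  have h2 : Continuous (fun h : ℝ => inner ℝ (hg.toLp g)
      (Lp.compMeasurePreserving (τ h) (hmp h) (hf.toLp f))) := continuous_const.inner hc
  refine h2.congr fun h => ?_
  rw [L2.inner_def]
  apply integral_congr_ae
  have e1 := Lp.coeFn_compMeasurePreserving (hf.toLp f) (hmp h)
  have e2 := (hmp h).quasiMeasurePreserving.ae hf.coeFn_toLp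
  filter_upwards [e1, e2, hg.coeFn_toLp] with p h1 h2 h3
  have h1' : (Lp.compMeasurePreserving (τ h) (hmp h) (hf.toLp f) : SpT → ℝ) p
      = (hf.toLp f) (p + h • e) := h1
  rw [h1', h2, h3]
  simp [mul_comm]

theorem measurePreserving_shear (h : ℝ) (e : SpT) :
    MeasurePreserving (fun q : ℝ × SpT => (q.1, q.2 + q.1 • e))
      ((volume.restrict (Ioo 0 h)).prod volume) ((volume.restrict (Ioo 0 h)).prod volume) := by
  refine MeasurePreserving.skew_product (f := id) (g := fun (s : ℝ) (p : SpT) => p + s • e)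
    (MeasurePreserving.id _) (by fun_prop) (.of_forall fun s => ?_)
  exact (measurePreserving_add_right volume (s • e)).map_eq

theorem integrable_translate_mul (hf : MemLp f 2 volume) (hg : MemLp g 2 volume) (e : SpT) (h : ℝ)
    : Integrable (fun q : ℝ × SpT => f (q.2 + q.1 • e) * g q.2)
      ((volume.restrict (Ioo 0 h)).prod volume) := by
  have hs := measurePreserving_shear h e
  have m1 : MemLp (fun q : ℝ × SpT => f q.2) 2 ((volume.restrict (Ioo 0 h)).prod volume) :=
    hf.comp_snd _
  have m2 : MemLp (fun q : ℝ × SpT => g q.2) 2 ((volume.restrict (Ioo 0 h)).prod volume) :=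
    hg.comp_snd _
  exact (m1.comp_measurePreserving hs).integrable_mul m2

theorem integral_average_mul (hf : MemLp f 2 volume) (hg : MemLp g 2 volume) (e : SpT) {h : ℝ}
    (hh : 0 ≤ h) : ∫ p, (∫ s in (0 : ℝ)..h, f (p + s • e)) * g p
      = ∫ s in (0 : ℝ)..h, ∫ p, f (p + s • e) * g p := by
  have hi := integrable_translate_mul hf hg e h
  simp only [intervalIntegral.integral_of_le hh, integral_Ioc_eq_integral_Ioo]
  rw [integral_integral_swap hi]
  congr 1; ext p
  rw [integral_mul_const]

/-- Right derivative at `0` of the primitive of a continuous function. -/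
theorem tendsto_average {c : ℝ → ℝ} (hc : Continuous c) :
    Tendsto (fun h : ℝ => h⁻¹ * ∫ s in (0 : ℝ)..h, c s) (𝓝[>] 0) (𝓝 (c 0)) := by
  have h1 : HasDerivAt (fun u => ∫ s in (0 : ℝ)..u, c s) (c 0) 0 :=
    intervalIntegral.integral_hasDerivAt_right (by simp) (hc.stronglyMeasurableAtFilter _ _)
      hc.continuousAt
  have h2 := h1.tendsto_slope_zero_right
  simpa using h2

/-- Extension by zero. -/
def ext0 (T : ℝ) (f : SpT → ℝ) : SpT → ℝ := (cyl T).indicator f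

theorem ext0_of_mem (hp : p ∈ cyl T) : ext0 T f p = f p :=
  indicator_of_mem hp f

theorem ext0_of_notMem (hp : p ∉ cyl T) : ext0 T f p = 0 :=
  indicator_of_notMem hp f

theorem Q.ext0 (hf : Q T (1 / 2) f) : MemLp (ext0 T f) 2 volume :=
  (memLp_indicator_iff_restrict (measurableSet_cyl T)).2 hf.memLp_two

theorem integral_ext0 : ∫ p, ext0 T f p = ∫ p, f p ∂muQ T :=
  integral_indicator (measurableSet_cyl T)

theorem integral_mul_ext0 : ∫ p, f p * ext0 T g p = ∫ p, f p * g p ∂muQ T := by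
  rw [← integral_ext0]
  congr 1; ext p
  by_cases hp : p ∈ cyl T
  · rw [ext0_of_mem hp, ext0_of_mem hp]
  · rw [ext0_of_notMem hp, ext0_of_notMem hp, mul_zero]

theorem ae_eq_of_ae_line (k : Fin 3) (hf : AEStronglyMeasurable f (muQ T))
    (hg : AEStronglyMeasurable g (muQ T))
    (h : ∀ᵐ p ∂muQ T, ∀ᵐ s ∂muI, f (line k p s) = g (line k p s)) : ∀ᵐ p ∂muQ T, f p = g p := by
  have key : ∀ᵐ p ∂muQ T, hf.mk f p = hg.mk g p := by
    apply ae_of_ae_line k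
    · exact measurableSet_eq_fun hf.stronglyMeasurable_mk.measurable
        hg.stronglyMeasurable_mk.measurable
    · filter_upwards [h, ae_line k hf.ae_eq_mk, ae_line k hg.ae_eq_mk] with p h1 h2 h3
      filter_upwards [h1, h2, h3] with s s1 s2 s3
      rw [← s2, s1, s3]
  filter_upwards [key, hf.ae_eq_mk, hg.ae_eq_mk] with p h1 h2 h3
  rw [h2, h1, h3]

/-! ### Symmetry of `∫ ∂ᵢA ∂ⱼB` -/

/-- The unit vector in the `k`-th space direction. -/
abbrev ev (k : Fin 3) : SpT := (0, Pi.single k 1)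

/-- The periodic translate by `h ∈ [0,1]` in direction `k`, for points of the cell. -/
def pshift (T : ℝ) (k : Fin 3) (h : ℝ) (f : SpT → ℝ) (p : SpT) : ℝ :=
  ext0 T f (p + h • ev k) + ext0 T f (p + (h - 1) • ev k)

theorem ae_translate {P : SpT → Prop} (h : ∀ᵐ p ∂muQ T, P p) (e : SpT) :
    ∀ᵐ p : SpT, p + e ∈ cyl T → P (p + e) := by
  rw [ae_restrict_iff' (measurableSet_cyl T)] at h
  exact (measurePreserving_add_right volume e).quasiMeasurePreserving.ae h

theorem line_add_ev {j : Fin 3} (hjk : j ≠ k) (p : SpT) (h s : ℝ) :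
    line j p s + h • ev k = line j (p + h • ev k) s := by
  ext m
  · simp [line]
  · by_cases hm : m = j
    · subst hm; simp [line, hjk]
    · simp [line, hm]

theorem line_add_ev_self (p : SpT) (h s : ℝ) : line k p s + h • ev k = line k p (s + h) := by
  ext m
  · simp [line]
  · by_cases hm : m = k
    · subst hm; simp [line]
    · simp [line, hm]

theorem HD.ext0_translate {i j : Fin 3} (hij : j ≠ i) (hf : HD j T f g) (h : ℝ) : HD j T (fun p => ext0 T f (p + h • ev i)) (fun p => ext0 T g (p + h • ev i)) := by
  have h1 := ae_mono (Measure.restrict_le_self (s := cyl T)) (ae_translate hf (h • ev i))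
  filter_upwards [h1, ae_restrict_mem (measurableSet_cyl T)] with p hp hpm
  by_cases hm : p + h • ev i ∈ cyl T
  · obtain ⟨F, a1, a2, a3⟩ := hp hm
    refine ⟨F, a1.congr ?_, ?_, a3⟩
    · filter_upwards [ae_restrict_mem measurableSet_Ioo] with s hs
      rw [line_add_ev hij, ext0_of_mem ((mem_cyl_line hm s).2 hs)]
    · filter_upwards [a2, ae_restrict_mem measurableSet_Ioo] with s h2 hs
      rw [line_add_ev hij, ext0_of_mem ((mem_cyl_line hm s).2 hs), h2]
  · have hnot : ∀ s, line j p s + h • ev i ∉ cyl T := by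
      intro s hs
      apply hm
      have := (mem_cyl_line (k := j) hs (p.2 j)).2 (hpm.2 j)
      rwa [line_add_ev hij, line_line, ← line_add_ev hij, line_self] at this
    refine ⟨fun _ => 0, (AC1.const 0).congr ?_, ?_, rfl⟩
    · exact .of_forall fun s => (ext0_of_notMem (hnot s)).symm
    · exact .of_forall fun s => ext0_of_notMem (hnot s)

theorem HD.pshift {i j : Fin 3} (hij : j ≠ i) (hf : HD j T f g) (h : ℝ) : HD j T (pshift T i h f) (pshift T i h g) :=
  HD.add (HD.ext0_translate hij hf h) (HD.ext0_translate hij hf (h - 1))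

theorem memLp_translate (hf : MemLp f 2 volume) (e : SpT) : MemLp (fun p => f (p + e)) 2 volume :=
  hf.comp_measurePreserving (measurePreserving_add_right volume e)

theorem Q.pshift {i : Fin 3} (hf : Q T (1 / 2) f) (h : ℝ) : Q T (1 / 2) (pshift T i h f) :=
  Q.two_of_memLp (((memLp_translate hf.ext0 _).add (memLp_translate hf.ext0 _)).restrict _)

/-- The increment of a periodic absolutely continuous function, written with extensions by zero. -/
theorem AC1.periodic_increment {F g : ℝ → ℝ} (hF : AC1 1 F g) (hp : F 0 = F 1) {s h : ℝ}
    (hs : s ∈ Ioo (0 : ℝ) 1) (hh : h ∈ Ioo (0 : ℝ) 1) (hne : s + h ≠ 1) :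
    (Ioo (0 : ℝ) 1).indicator F (s + h) + (Ioo (0 : ℝ) 1).indicator F (s + (h - 1)) - F s
      = (∫ u in (0 : ℝ)..h, (Ioo (0 : ℝ) 1).indicator g (s + u))
        + ∫ u in (0 : ℝ)..h, (Ioo (0 : ℝ) 1).indicator g (s + (u - 1)) := by
  have hgi := hF.integrable zero_le_one
  have hint : ∀ a b : ℝ, a ∈ Icc (0 : ℝ) 1 → b ∈ Icc (0 : ℝ) 1 → ∫ u in a..b, g u = F b - F a := by
    intro a b ha hb
    have h1 : IntervalIntegrable g volume 0 a := (hF.mono ha).integrable ha.1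
    have h2 : IntervalIntegrable g volume 0 b := (hF.mono hb).integrable hb.1
    rw [← intervalIntegral.integral_interval_sub_left h2 h1, (hF.mono ha).integral_eq ha.1,
      (hF.mono hb).integral_eq hb.1]
    ring
  have hin : ∀ a b : ℝ, 0 ≤ a → a ≤ b → b ≤ 1 →
      ∫ u in a..b, (Ioo (0 : ℝ) 1).indicator g u = F b - F a := by
    intro a b ha hab hb
    rw [← hint a b ⟨ha, hab.trans hb⟩ ⟨ha.trans hab, hb⟩]
    rw [intervalIntegral.integral_of_le hab, intervalIntegral.integral_of_le hab,
      integral_Ioc_eq_integral_Ioo, integral_Ioc_eq_integral_Ioo]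
    apply setIntegral_congr_fun measurableSet_Ioo
    intro x hx
    have hm : x ∈ Ioo (0 : ℝ) 1 := ⟨ha.trans_lt hx.1, hx.2.trans_le hb⟩
    exact indicator_of_mem hm g
  have hout : ∀ a b : ℝ, a ≤ b → (1 ≤ a ∨ b ≤ 0) →
      ∫ u in a..b, (Ioo (0 : ℝ) 1).indicator g u = 0 := by
    intro a b hab h
    rw [intervalIntegral.integral_of_le hab]
    rw [integral_Ioc_eq_integral_Ioo]
    apply setIntegral_eq_zero_of_forall_eq_zero
    intro x hx
    apply indicator_of_notMem
    rintro ⟨h1, h2⟩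
    rcases h with h | h
    · linarith [hx.1]
    · linarith [hx.2]
  have hgI : ∀ a b : ℝ, IntervalIntegrable ((Ioo (0 : ℝ) 1).indicator g) volume a b := by
    intro a b
    apply Integrable.intervalIntegrable
    rw [integrable_indicator_iff measurableSet_Ioo]
    rwa [intervalIntegrable_iff_integrableOn_Ioo_of_le zero_le_one] at hgi
  have e1 : ∫ u in (0 : ℝ)..h, (Ioo (0 : ℝ) 1).indicator g (s + u)
      = ∫ u in s..(s + h), (Ioo (0 : ℝ) 1).indicator g u := by
    rw [intervalIntegral.integral_comp_add_left (fun x => (Ioo (0 : ℝ) 1).indicator g x) s,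
      add_zero]
  have e2 : ∫ u in (0 : ℝ)..h, (Ioo (0 : ℝ) 1).indicator g (s + (u - 1))
      = ∫ u in (s - 1)..(s - 1 + h), (Ioo (0 : ℝ) 1).indicator g u := by
    have : ∀ u, s + (u - 1) = (s - 1) + u := fun u => by ring
    simp only [this]
    rw [intervalIntegral.integral_comp_add_left (fun x => (Ioo (0 : ℝ) 1).indicator g x) (s - 1),
      add_zero]
  rw [e1, e2]
  rcases lt_or_gt_of_ne hne with hlt | hgt
  · have hm : s + h ∈ Ioo (0 : ℝ) 1 := ⟨by linarith [hs.1, hh.1], hlt⟩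
    rw [indicator_of_mem hm,
      indicator_of_notMem (fun hm : s + (h - 1) ∈ Ioo (0 : ℝ) 1 => by linarith [hm.1]),
      hin s (s + h) hs.1.le (by linarith [hh.1]) hlt.le,
      hout (s - 1) (s - 1 + h) (by linarith [hh.1]) (Or.inr (by linarith))]
    ring
  · have hm : s + (h - 1) ∈ Ioo (0 : ℝ) 1 := ⟨by linarith, by linarith [hs.2, hh.2]⟩
    rw [indicator_of_notMem (fun hm : s + h ∈ Ioo (0 : ℝ) 1 => by linarith [hm.2]),
      indicator_of_mem hm,
      ← intervalIntegral.integral_add_adjacent_intervals (hgI s 1) (hgI 1 (s + h)),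
      ← intervalIntegral.integral_add_adjacent_intervals (hgI (s - 1) 0) (hgI 0 (s - 1 + h)),
      hin s 1 hs.1.le hs.2.le le_rfl, hout 1 (s + h) hgt.le (Or.inl le_rfl),
      hout (s - 1) 0 (by linarith [hs.2]) (Or.inr le_rfl),
      hin 0 (s - 1 + h) le_rfl (by linarith) (by linarith [hs.2, hh.2]), hp]
    have : s + (h - 1) = s - 1 + h := by ring
    rw [this]
    ring

theorem memLp_average (hf : MemLp f 2 volume) (e : SpT) {h : ℝ} (hh : 0 ≤ h) :
    AEStronglyMeasurable (fun p => ∫ s in (0 : ℝ)..h, f (p + s • e)) volume := by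
  simp only [intervalIntegral.integral_of_le hh, integral_Ioc_eq_integral_Ioo]
  have hm : AEStronglyMeasurable (fun q : ℝ × SpT => f (q.2 + q.1 • e))
      ((volume.restrict (Ioo 0 h)).prod volume) :=
    (hf.comp_snd (volume.restrict (Ioo 0 h))).1.comp_measurePreserving (measurePreserving_shear h e)
  exact hm.prod_swap.integral_prod_right'

theorem HD.pshift_sub (hf : HD k T f g) (hfQ : Q T (1 / 2) f) (hgQ : Q T (1 / 2) g) {h : ℝ}
    (hh : h ∈ Ioo (0 : ℝ) 1) : ∀ᵐ p ∂muQ T, CPE.pshift T k h f p - f p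
      = (∫ u in (0 : ℝ)..h, CPE.ext0 T g (p + u • ev k))
        + ∫ u in (0 : ℝ)..h, CPE.ext0 T g (p + (u - 1) • ev k) := by
  have hg2 : MemLp (fun p => CPE.ext0 T g (p + (-1 : ℝ) • ev k)) 2 volume :=
    memLp_translate hgQ.ext0 _
  have e0 : ∀ (p : SpT) (u : ℝ), p + u • ev k + (-1 : ℝ) • ev k = p + (u - 1) • ev k := by
    intro p u; module
  have hm2 : AEStronglyMeasurable
      (fun p => ∫ u in (0 : ℝ)..h, CPE.ext0 T g (p + (u - 1) • ev k)) volume := by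
    refine (memLp_average hg2 (ev k) hh.1.le).congr (.of_forall fun p => ?_)
    simp only [e0]
  apply ae_eq_of_ae_line k ((hfQ.pshift h).aesm.sub hfQ.aesm)
    (((memLp_average hgQ.ext0 (ev k) hh.1.le).add hm2).mono_measure Measure.restrict_le_self)
  filter_upwards [hf, ae_restrict_mem (measurableSet_cyl T)] with p ⟨F, a1, a2, a3⟩ hp
  have hext : ∀ (f : SpT → ℝ) (s : ℝ),
      CPE.ext0 T f (line k p s) = (Ioo (0 : ℝ) 1).indicator (fun s => f (line k p s)) s := by
    intro f s
    by_cases hs : s ∈ Ioo (0 : ℝ) 1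
    · rw [ext0_of_mem ((mem_cyl_line hp s).2 hs), indicator_of_mem hs]
    · rw [ext0_of_notMem (fun hm => hs ((mem_cyl_line hp s).1 hm)), indicator_of_notMem hs]
  have hae : ∀ᵐ s : ℝ, (Ioo (0 : ℝ) 1).indicator (fun s => f (line k p s)) s
      = (Ioo (0 : ℝ) 1).indicator F s := by
    rw [ae_restrict_iff' measurableSet_Ioo] at a2
    filter_upwards [a2] with s hs
    by_cases hm : s ∈ Ioo (0 : ℝ) 1
    · rw [indicator_of_mem hm, indicator_of_mem hm, hs hm]
    · rw [indicator_of_notMem hm, indicator_of_notMem hm]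
  have hsh : ∀ a : ℝ, ∀ᵐ s : ℝ, (Ioo (0 : ℝ) 1).indicator (fun s => f (line k p s)) (s + a)
      = (Ioo (0 : ℝ) 1).indicator F (s + a) := fun a =>
    (measurePreserving_add_right volume a).quasiMeasurePreserving.ae hae
  have hne : ∀ᵐ s : ℝ, s ≠ 1 - h := Measure.ae_ne volume (1 - h)
  filter_upwards [a2, ae_restrict_of_ae (hsh h), ae_restrict_of_ae (hsh (h - 1)),
    ae_restrict_of_ae hne, ae_restrict_mem measurableSet_Ioo] with s s1 s2 s3 s4 hs
  change CPE.pshift T k h f (line k p s) - f (line k p s)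
      = (∫ u in (0 : ℝ)..h, CPE.ext0 T g (line k p s + u • ev k))
        + ∫ u in (0 : ℝ)..h, CPE.ext0 T g (line k p s + (u - 1) • ev k)
  simp only [CPE.pshift, line_add_ev_self, hext, s2, s3]
  rw [s1]
  exact a1.periodic_increment a3 hs hh (fun h0 => s4 (by linarith))

theorem Q.integrable_mul (hf : Q T (1 / 2) f) (hg : Q T (1 / 2) g) :
    Integrable (fun p => f p * g p) (muQ T) := (hf.mul hg).integrable

/-- The correlation of `f` and `g` under periodic translations in the direction `i`. -/
def corr (T : ℝ) (i : Fin 3) (f g : SpT → ℝ) (u : ℝ) : ℝ :=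
  (∫ p, ext0 T f (p + u • ev i) * ext0 T g p) +
    ∫ p, ext0 T f (p + u • ev i + (-1 : ℝ) • ev i) * ext0 T g p

section Corr

variable {T : ℝ} {i : Fin 3} {f fi g : SpT → ℝ}

theorem Q.translate (a : ℝ) (hf : Q T (1 / 2) f) :
    MemLp (fun p => CPE.ext0 T f (p + a • ev i)) 2 volume := memLp_translate hf.ext0 _

theorem continuous_corr (hf : Q T (1 / 2) f) (hg : Q T (1 / 2) g) : Continuous (corr T i f g) :=
  (continuous_integral_translate_mul hf.ext0 hg.ext0 (ev i)).add
    (continuous_integral_translate_mul (hf.translate (-1)) hg.ext0 (ev i))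

theorem integral_pshift_mul (hf : Q T (1 / 2) f) (hg : Q T (1 / 2) g) (h : ℝ) :
    ∫ p, pshift T i h f p * g p ∂muQ T = corr T i f g h := by
  have a1 : Integrable (fun p => ext0 T f (p + h • ev i) * ext0 T g p) volume :=
    (hf.translate h).integrable_mul hg.ext0
  have a2 : Integrable (fun p => ext0 T f (p + (h - 1) • ev i) * ext0 T g p) volume :=
    (hf.translate (h - 1)).integrable_mul hg.ext0
  have e0 : ∀ p : SpT, p + h • ev i + (-1 : ℝ) • ev i = p + (h - 1) • ev i := fun p => by module
  simp only [corr, e0]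
  rw [← integral_mul_ext0, ← integral_add a1 a2]
  congr 1; ext p
  simp only [pshift]; ring

theorem corr_zero : corr T i f g 0 = ∫ p, f p * g p ∂muQ T := by
  have h2 : ∀ p, ext0 T f (p + (0 : ℝ) • ev i + (-1 : ℝ) • ev i) * ext0 T g p = 0 := by
    intro p
    by_cases hp : p ∈ cyl T
    · rw [ext0_of_notMem (p := p + (0 : ℝ) • ev i + (-1 : ℝ) • ev i), zero_mul]
      intro hm
      have h3 := (hm.2 i).1
      have h4 := (hp.2 i).2
      simp at h3
      linarith
    · rw [ext0_of_notMem hp, mul_zero]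
  simp only [corr, h2, integral_zero, add_zero]
  simp only [zero_smul, add_zero]
  rw [integral_mul_ext0]
  exact setIntegral_congr_fun (measurableSet_cyl T) fun p hp => by
    rw [ext0_of_mem hp]

theorem corr_one : corr T i f g 1 = ∫ p, f p * g p ∂muQ T := by
  have h1 : ∀ p, ext0 T f (p + (1 : ℝ) • ev i) * ext0 T g p = 0 := by
    intro p
    by_cases hp : p ∈ cyl T
    · rw [ext0_of_notMem (p := p + (1 : ℝ) • ev i), zero_mul]
      intro hm
      have h3 := (hm.2 i).2
      have h4 := (hp.2 i).1
      simp at h3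
      linarith
    · rw [ext0_of_notMem hp, mul_zero]
  have h2 : ∀ p, p + (1 : ℝ) • ev i + (-1 : ℝ) • ev i = p := fun p => by module
  simp only [corr, h1, h2, integral_zero, zero_add]
  rw [integral_mul_ext0]
  exact setIntegral_congr_fun (measurableSet_cyl T) fun p hp => by
    rw [ext0_of_mem hp]

theorem corr_sub_of_mem (hf : DQr Eq i T (1 / 2) (1 / 2) f fi) (hg : Q T (1 / 2) g) {h : ℝ}
    (hh : h ∈ Ioo (0 : ℝ) 1) :
    corr T i f g h - ∫ p, f p * g p ∂muQ T = ∫ u in (0 : ℝ)..h, corr T i fi g u := by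
  have c1 := continuous_integral_translate_mul hf.dv.ext0 hg.ext0 (ev i)
  have c2 := continuous_integral_translate_mul (hf.dv.translate (i := i) (-1)) hg.ext0 (ev i)
  have i1 := (integrable_translate_mul hf.dv.ext0 hg.ext0 (ev i) h).integral_prod_right
  have i2 := (integrable_translate_mul (hf.dv.translate (i := i) (-1)) hg.ext0
    (ev i) h).integral_prod_right
  rw [← integral_pshift_mul hf.fn hg, ← integral_sub ((hf.fn.pshift h).integrable_mul hg)
    (hf.fn.integrable_mul hg)]
  simp only [corr]
  rw [intervalIntegral.integral_add (c1.intervalIntegrable _ _) (c2.intervalIntegrable _ _),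
    ← integral_average_mul hf.dv.ext0 hg.ext0 (ev i) hh.1.le,
    ← integral_average_mul (hf.dv.translate (-1)) hg.ext0 (ev i) hh.1.le, ← integral_add]
  · have e3 : ∀ p, (∫ s in (0 : ℝ)..h, ext0 T fi (p + s • ev i)) * ext0 T g p +
        (∫ s in (0 : ℝ)..h, ext0 T fi (p + s • ev i + (-1 : ℝ) • ev i)) * ext0 T g p
        = ((∫ s in (0 : ℝ)..h, ext0 T fi (p + s • ev i)) +
        ∫ s in (0 : ℝ)..h, ext0 T fi (p + s • ev i + (-1 : ℝ) • ev i)) * ext0 T g p :=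
      fun p => by ring
    simp only [e3]
    rw [integral_mul_ext0]
    apply integral_congr_ae
    filter_upwards [HD.pshift_sub hf.ld hf.fn hf.dv hh] with p hp
    rw [← sub_mul, hp]
    congr 3
    funext u
    congr 1; module
  · refine i1.congr (.of_forall fun p => ?_)
    simp only
    rw [integral_mul_const, intervalIntegral.integral_of_le hh.1.le, integral_Ioc_eq_integral_Ioo]
  · refine i2.congr (.of_forall fun p => ?_)
    simp only
    rw [integral_mul_const, intervalIntegral.integral_of_le hh.1.le, integral_Ioc_eq_integral_Ioo]

theorem corr_sub (hf : DQr Eq i T (1 / 2) (1 / 2) f fi) (hg : Q T (1 / 2) g) {h : ℝ}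
    (hh : h ∈ Icc (0 : ℝ) 1) :
    corr T i f g h - ∫ p, f p * g p ∂muQ T = ∫ u in (0 : ℝ)..h, corr T i fi g u := by
  have hc : Continuous fun h => corr T i f g h - ∫ p, f p * g p ∂muQ T :=
    (continuous_corr hf.fn hg).sub continuous_const
  have hc' : Continuous fun h => ∫ u in (0 : ℝ)..h, corr T i fi g u :=
    intervalIntegral.continuous_primitive
      (fun a b => (continuous_corr hf.dv hg).intervalIntegrable a b) 0
  have : EqOn (fun h => corr T i f g h - ∫ p, f p * g p ∂muQ T)
      (fun h => ∫ u in (0 : ℝ)..h, corr T i fi g u) (closure (Ioo 0 1)) :=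
    EqOn.closure (fun h hh => corr_sub_of_mem hf hg hh) hc hc'
  rw [closure_Ioo zero_ne_one] at this
  exact this hh

/-- Periodic translation is moved to the other factor. -/
theorem corr_comm (h : ℝ) : corr T i f g h = corr T i g f (1 - h) := by
  have move : ∀ (f g : SpT → ℝ) (a : ℝ), ∫ p, ext0 T f (p + a • ev i) * ext0 T g p
      = ∫ p, ext0 T g (p + (-a) • ev i) * ext0 T f p := by
    intro f g a
    rw [← integral_add_right_eq_self (μ := volume)
      (fun p : SpT => ext0 T g (p + (-a) • ev i) * ext0 T f p) (a • ev i)]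
    congr 1; ext p
    have : p + a • ev i + (-a) • ev i = p := by module
    rw [this, mul_comm]
  have e0 : ∀ (u : ℝ) (p : SpT), p + u • ev i + (-1 : ℝ) • ev i = p + (u - 1) • ev i :=
    fun u p => by module
  simp only [corr, e0]
  rw [move f g h, move f g (h - 1)]
  have e1 : -h = 1 - h - 1 := by ring
  have e2 : -(h - 1) = 1 - h := by ring
  rw [e1, e2, add_comm]

theorem tendsto_diffQuot (hf : DQr Eq i T (1 / 2) (1 / 2) f fi) (hg : Q T (1 / 2) g) :
    Tendsto (fun h => h⁻¹ * ∫ p, (pshift T i h f p - f p) * g p ∂muQ T) (𝓝[>] 0)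
      (𝓝 (∫ p, fi p * g p ∂muQ T)) := by
  have h1 := tendsto_average (continuous_corr (i := i) hf.dv hg)
  rw [corr_zero] at h1
  refine h1.congr' ?_
  filter_upwards [Ioo_mem_nhdsGT (zero_lt_one (α := ℝ))] with h hh
  rw [← corr_sub hf hg ⟨hh.1.le, hh.2.le⟩, ← integral_pshift_mul hf.fn hg,
    ← integral_sub ((hf.fn.pshift h).integrable_mul hg) (hf.fn.integrable_mul hg)]
  simp only [sub_mul]

theorem tendsto_diffQuot_right (hf : DQr Eq i T (1 / 2) (1 / 2) f fi) (hg : Q T (1 / 2) g) :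
    Tendsto (fun h => h⁻¹ * ∫ p, f p * (pshift T i h g p - g p) ∂muQ T) (𝓝[>] 0)
      (𝓝 (- ∫ p, fi p * g p ∂muQ T)) := by
  have hc := continuous_corr (i := i) hf.dv hg
  have h1 := tendsto_average (c := fun u => corr T i fi g (1 - u))
    (hc.comp (continuous_const.sub continuous_id))
  rw [sub_zero, corr_one] at h1
  refine h1.neg.congr' ?_
  filter_upwards [Ioo_mem_nhdsGT (zero_lt_one (α := ℝ))] with h hh
  rw [intervalIntegral.integral_comp_sub_left (fun u => corr T i fi g u), sub_zero]
  have e1 := corr_sub hf hg (h := 1) ⟨zero_le_one, le_rfl⟩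
  have e2 := corr_sub hf hg (h := 1 - h) ⟨by linarith [hh.2], by linarith [hh.1]⟩
  rw [← intervalIntegral.integral_interval_sub_left (hc.intervalIntegrable 0 1)
    (hc.intervalIntegrable 0 (1 - h)), ← e1, ← e2, corr_one, corr_comm (1 - h), sub_sub_cancel,
    ← integral_pshift_mul hg hf.fn]
  have e3 : ∫ p, f p * (pshift T i h g p - g p) ∂muQ T
      = ∫ p, pshift T i h g p * f p ∂muQ T - ∫ p, f p * g p ∂muQ T := by
    rw [← integral_sub ((hg.pshift h).integrable_mul hf.fn) (hf.fn.integrable_mul hg)]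
    congr 1; ext p; ring
  rw [e3]; ring

end Corr

/-- Mixed products of first derivatives may be transposed. -/
theorem nullInt_transpose {i j : Fin 3} (hij : i ≠ j) {A B ai aj bi bj : SpT → ℝ}
    (hAi : DQr Eq i T (1 / 2) (1 / 2) A ai) (hAj : DQr Eq j T (1 / 2) (1 / 2) A aj)
    (hBi : DQr Eq i T (1 / 2) (1 / 2) B bi) (hBj : DQr Eq j T (1 / 2) (1 / 2) B bj) :
    NullInt T (fun p => ai p * bj p - aj p * bi p) := by
  have hib : ∀ {f g fj gj : SpT → ℝ}, HD j T f fj → HD j T g gj → Q T (1 / 2) f → Q T (1 / 2) g →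
      Q T (1 / 2) fj → Q T (1 / 2) gj →
      ∫ p, f p * gj p ∂muQ T = - ∫ p, fj p * g p ∂muQ T := by
    intro f g fj gj h1 h2 q1 q2 q3 q4
    have := HD.ibp (HD.mul h1 h2) ((q3.integrable_mul q2).add (q1.integrable_mul q4))
    rw [integral_add (q3.integrable_mul q2) (q1.integrable_mul q4)] at this
    linarith
  have t1 := tendsto_diffQuot hAi hBj.dv
  have t2 := tendsto_diffQuot_right hBi hAj.dv
  have key : ∫ p, ai p * bj p ∂muQ T = ∫ p, bi p * aj p ∂muQ T := by
    rw [← neg_neg (∫ p, bi p * aj p ∂muQ T)]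
    refine tendsto_nhds_unique t1 (t2.neg.congr fun h => ?_)
    have hd : HD j T (fun p => pshift T i h A p - A p) (fun p => pshift T i h aj p - aj p) :=
      (HD.add (HD.pshift hij.symm hAj.ld h) (HD.const_mul (-1) hAj.ld)).of_eq
        (fun p => by ring) (fun p => by ring)
    rw [hib hd hBj.ld ((hAj.fn.pshift h).sub hAj.fn) hBj.fn ((hAj.dv.pshift h).sub hAj.dv) hBj.dv]
    simp only [mul_comm (B _), mul_neg]
  refine ⟨(hAi.dv.integrable_mul hBj.dv).sub (hAj.dv.integrable_mul hBi.dv), ?_⟩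
  rw [integral_sub (hAi.dv.integrable_mul hBj.dv) (hAj.dv.integrable_mul hBi.dv), key, sub_eq_zero]
  exact integral_congr_ae (.of_forall fun p => mul_comm _ _)

/-! ### Time slices and chain rules for integral functionals -/

theorem MemLp.slice {p : ℝ≥0∞} (h0 : p ≠ 0) (hf : MemLp f p (muQ T)) :
    ∀ᵐ t ∂volume.restrict (Ioo 0 T), MemLp (fun x => f (t, x)) p muO := by
  have hm : ∀ᵐ t ∂volume.restrict (Ioo 0 T), AEStronglyMeasurable (fun x => f (t, x)) muO := by
    have := hf.1
    rw [muQ_eq_prod] at this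
    exact this.prodMk_left
  by_cases ht : p = ∞
  · subst ht
    have h1 : ∀ᵐ q ∂muQ T, ‖f q‖ ≤ (eLpNormEssSup f (muQ T)).toReal := by
      have h2 : eLpNormEssSup f (muQ T) ≠ ∞ := by
        have := hf.2.ne; rwa [eLpNorm_exponent_top] at this
      filter_upwards [enorm_ae_le_eLpNormEssSup f (muQ T)] with q hq
      rw [← toReal_enorm]
      exact ENNReal.toReal_mono h2 hq
    filter_upwards [hm, ae_time_ae_space h1] with t h2 h3
    exact memLp_top_of_bound h2 _ h3
  · have h1 : Integrable (fun q => ‖f q‖ ^ p.toReal) (muQ T) := hf.integrable_norm_rpow h0 ht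
    rw [muQ_eq_prod] at h1
    filter_upwards [hm, h1.prod_right_ae] with t h2 h3
    exact (integrable_norm_rpow_iff h2 h0 ht).1 h3

theorem MemLp.frozen {T' : ℝ} {f : Sp → ℝ} {p : ℝ≥0∞} (hf : MemLp f p muO) :
    MemLp (fun q : SpT => f q.2) p (muQ T') := by
  rw [muQ_eq_prod]; exact hf.comp_snd _

theorem Q.frozen {T' a : ℝ} (hf : Q T a f) :
    ∀ᵐ t ∂volume.restrict (Ioo 0 T), Q T' a (fun p => f (t, p.2)) := by
  filter_upwards [MemLp.slice (ENNReal.inv_ne_zero.2 ENNReal.ofReal_ne_top) hf.2] with t ht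
  exact ⟨hf.1, MemLp.frozen ht⟩

theorem DQr.frozen {T' a b : ℝ} {c : ℝ → ℝ → Prop} (h : DQr c k T a b f g) : ∀ᵐ t ∂volume.restrict (Ioo 0 T),
      DQr c k T' a b (fun p => f (t, p.2)) (fun p => g (t, p.2)) := by
  filter_upwards [LD.slice h.ld, Q.frozen h.fn, Q.frozen h.dv] with t h1 h2 h3
  exact ⟨h1 T', h2, h3⟩

/-- Extension by zero from `ℝ × Ω`. -/
def extO (f : SpT → ℝ) : SpT → ℝ := (Prod.snd ⁻¹' Omega).indicator f

theorem extO_of_mem (hp : p.2 ∈ Omega) : extO f p = f p :=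
  indicator_of_mem (by exact hp) f

theorem extO_of_notMem (hp : p.2 ∉ Omega) : extO f p = 0 :=
  indicator_of_notMem (by exact hp) f

/-- Periodic translation in a space direction, for functions on `ℝ × Ω`. -/
def sshift (k : Fin 3) (h : ℝ) (f : SpT → ℝ) (p : SpT) : ℝ :=
  extO f (p + h • ev k) + extO f (p + (h - 1) • ev k)

theorem pshift_eq_sshift {h : ℝ} (hp : p.1 ∈ Ioo 0 T) : pshift T k h f p = sshift k h f p := by
  have key : ∀ a : ℝ, ext0 T f (p + a • ev k) = extO f (p + a • ev k) := by
    intro a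
    by_cases hm : (p + a • ev k).2 ∈ Omega
    · have h1 : (p + a • ev k).1 ∈ Ioo 0 T := by simpa using hp
      rw [extO_of_mem hm, ext0_of_mem ⟨h1, hm⟩]
    · rw [extO_of_notMem hm, ext0_of_notMem (fun h => hm h.2)]
  simp only [pshift, sshift, key]

theorem pshift_frozen {τ h : ℝ} (hp : p.1 ∈ Ioo 0 T) :
    pshift T k h (fun p => f (τ, p.2)) p = sshift k h f (τ, p.2) := by
  rw [pshift_eq_sshift hp]
  have key : ∀ a : ℝ, extO (fun p => f (τ, p.2)) (p + a • ev k) = extO f ((τ, p.2) + a • ev k) := by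
    intro a
    by_cases hm : (p + a • ev k).2 ∈ Omega
    · have h1 : (((τ, p.2) : SpT) + a • ev k).2 ∈ Omega := hm
      rw [extO_of_mem hm, extO_of_mem h1]
      simp
    · have h1 : (((τ, p.2) : SpT) + a • ev k).2 ∉ Omega := hm
      rw [extO_of_notMem hm, extO_of_notMem h1]
  simp only [sshift, key]

theorem ae_translate_space {P : Sp → Prop} (h : ∀ᵐ x ∂muO, P x) (e : Sp) :
    ∀ᵐ x ∂muO, x + e ∈ Omega → P (x + e) := by
  rw [muO, ae_restrict_iff' measurableSet_Omega] at h
  exact ae_restrict_of_ae ((measurePreserving_add_right volume e).quasiMeasurePreserving.ae h)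

theorem TD.extO_translate (hf : TD T f g) (e : Sp) :
    TD T (fun p => extO f (p + (0, e))) (fun p => extO g (p + (0, e))) := by
  have hin : ∀ (f : SpT → ℝ) (s : ℝ) (x : Sp), x + e ∈ Omega →
      extO f ((s, x) + (0, e)) = f (s, x + e) := by
    intro f s x hx
    have : (((s, x) : SpT) + (0, e)).2 ∈ Omega := hx
    rw [extO_of_mem this]; simp
  have hout : ∀ (f : SpT → ℝ) (s : ℝ) (x : Sp), x + e ∉ Omega →
      extO f ((s, x) + (0, e)) = 0 := fun f s x hx =>
    extO_of_notMem (show (((s, x) : SpT) + (0, e)).2 ∉ Omega from hx)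
  refine ⟨?_, fun t ht => ?_⟩
  · filter_upwards [ae_translate_space hf.1 e] with x hx
    by_cases hm : x + e ∈ Omega
    · obtain ⟨F, h1, h2, h3⟩ := hx hm
      simp only [hin _ _ _ hm]
      exact ⟨F, h1, h2, h3⟩
    · simp only [hout _ _ _ hm]
      exact ⟨fun _ => 0, AC1.const 0, rfl, .of_forall fun _ => rfl⟩
  · filter_upwards [ae_translate_space (hf.2 t ht) e] with x hx
    by_cases hm : x + e ∈ Omega
    · simp only [hin _ _ _ hm]
      exact hx hm
    · simp only [hout _ _ _ hm]
      simp

theorem TD.sshift (hf : TD T f g) (k : Fin 3) (h : ℝ) : TD T (sshift k h f) (sshift k h g) := by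
  have e : ∀ a : ℝ, a • ev k = ((0, a • Pi.single k 1) : SpT) := fun a => by ext <;> simp
  have := (hf.extO_translate (h • Pi.single k 1)).add (hf.extO_translate ((h - 1) • Pi.single k 1))
  refine this.of_eq (fun p => ?_) (fun p => ?_) <;> simp only [CPE.sshift, e]

/-- The derivative in time of `∫ f ∂ᵢ g`. -/
theorem TD.cross {i : Fin 3} {ft fi gt gi : SpT → ℝ} {g0 : Sp → ℝ} (hT : 0 < T) (hf : TD T f ft)
    (hg : TD T g gt) (Hf : DQr Eq i T (1 / 2) (1 / 2) f fi) (Hg : DQr Eq i T (1 / 2) (1 / 2) g gi)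
    (hft : Q T (1 / 2) ft) (hgt : Q T (1 / 2) gt) (hf0 : Q 1 (1 / 2) (fun p => f (0, p.2)))
    (hg0 : DQr Eq i 1 (1 / 2) (1 / 2) (fun p => g (0, p.2)) (fun p => g0 p.2)) :
    ∀ᵐ τ ∂volume.restrict (Ioo 0 T), ∫ x, f (τ, x) * gi (τ, x) ∂muO
        = ∫ x, f (0, x) * g0 x ∂muO + ∫ p, (ft p * gi p - fi p * gt p) ∂muQ τ := by
  filter_upwards [Hg.frozen (T' := 1), Q.frozen (T' := 1) Hf.fn,
    ae_restrict_mem measurableSet_Ioo] with τ hgτ hfτ hτ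
  have mτ {a : ℝ} {f : SpT → ℝ} (h : Q T a f) : Q τ a f := h.mono_time hτ.2.le
  have hid : ∀ h : ℝ, ∫ p, (pshift 1 i h (fun p => g (τ, p.2)) p - g (τ, p.2)) * f (τ, p.2) ∂muQ 1
        = ∫ p, (pshift 1 i h (fun p => g (0, p.2)) p - g (0, p.2)) * f (0, p.2) ∂muQ 1
          + (∫ p, (pshift τ i h g p - g p) * ft p ∂muQ τ
            + ∫ p, f p * (pshift τ i h gt p - gt p) ∂muQ τ) := by
    intro h
    have hTD := hf.mul ((hg.sshift i h).add (hg.const_mul (-1)))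
    have eqs : ∀ {T : ℝ} (g : SpT → ℝ), ∀ᵐ p ∂muQ T, CPE.pshift T i h g p = CPE.sshift i h g p :=
      fun g => by
        filter_upwards [ae_restrict_mem (measurableSet_cyl _)] with p hp
        exact pshift_eq_sshift hp.1
    have q1 : Q T (1 / 2) (fun p => CPE.sshift i h g p + -1 * g p) :=
      ((Hg.fn.pshift h).congr (eqs g)).add (Hg.fn.const_mul (-1))
    have q2 : Q T (1 / 2) (fun p => CPE.sshift i h gt p + -1 * gt p) :=
      ((hgt.pshift h).congr (eqs gt)).add (hgt.const_mul (-1))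
    have key := hTD.integral_slice hT (Hf.fn.integrable_mul q1)
      (integrable_add' (hft.integrable_mul q1) (Hf.fn.integrable_mul q2))
      (Ioo_subset_Icc_self hτ)
    rw [integral_add ((mτ hft).integrable_mul (mτ q1)) ((mτ Hf.fn).integrable_mul (mτ q2)),
      ← integral_space (fun x => f (τ, x) * _), ← integral_space (fun x => f (0, x) * _)] at key
    have conv : ∀ s : ℝ, ∫ p : SpT, f (s, p.2) * (CPE.sshift i h g (s, p.2) + -1 * g (s, p.2)) ∂muQ 1
        = ∫ p, (CPE.pshift 1 i h (fun p => g (s, p.2)) p - g (s, p.2)) * f (s, p.2) ∂muQ 1 := by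
      intro s
      apply integral_congr_ae
      filter_upwards [ae_restrict_mem (measurableSet_cyl 1)] with p hp
      rw [pshift_frozen hp.1]; ring
    rw [conv τ, conv 0] at key
    rw [key]
    congr 2
    · apply integral_congr_ae
      filter_upwards [eqs g] with p hp
      rw [hp]; ring
    · apply integral_congr_ae
      filter_upwards [eqs gt] with p hp
      rw [hp]; ring
  have t1 := tendsto_diffQuot hgτ hfτ
  have t2 := tendsto_diffQuot hg0 hf0
  have t3 := tendsto_diffQuot (Hg.mono_time hτ.2.le) (mτ hft)
  have t4 := tendsto_diffQuot_right (Hf.mono_time hτ.2.le) (mτ hgt)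
  have t5 := t2.add (t3.add t4)
  have := tendsto_nhds_unique t1 (t5.congr fun h => by rw [hid h]; ring)
  rw [integral_space (fun x => gi (τ, x) * f (τ, x)), integral_space (fun x => g0 x * f (0, x))]
    at this
  rw [integral_sub ((mτ hft).integrable_mul (mτ Hg.dv)) ((mτ Hf.dv).integrable_mul (mτ hgt))]
  simp only [mul_comm (gi _), mul_comm (g0 _)] at this
  rw [this]; ring

theorem tendsto_slope_left {J : ℝ → ℝ} {j τ : ℝ} (h : HasDerivAt J j τ) :
    Tendsto (fun h : ℝ => h⁻¹ * (J τ - J (τ - h))) (𝓝[>] 0) (𝓝 j) := by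
  have h1 := h.tendsto_slope_zero_left
  have h2 : Tendsto (fun h : ℝ => -h) (𝓝[>] 0) (𝓝[<] 0) := by
    have := tendsto_neg_nhdsGT (a := (0 : ℝ))
    rwa [neg_zero] at this
  refine (h1.comp h2).congr fun h => ?_
  simp only [Function.comp, smul_eq_mul, ← sub_eq_add_neg, inv_neg]
  ring

/-- A functional which is dominated along time increments by a linear functional of the increments. -/
theorem TD.functional_le {j : ℝ → ℝ} {j0 : ℝ} {S b : SpT → ℝ} {G : ℝ → Prop} (hT : 0 < T)
    (hS : TD T S b) (hφ : Q T (1 / 2) φ) (hb : Q T (1 / 2) b) (hj : IntegrableOn j (Ioo 0 T))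
    (hG : ∀ᵐ t ∂volume.restrict (Ioo 0 T), G t) (hjj : ∀ t ∈ Ioo 0 T, ∀ t' ∈ Ioo 0 T, G t → G t' →
    j t - j t' ≤ ∫ x, φ (t, x) * (S (t, x) - S (t', x)) ∂muO)
    (h0 : ∀ t ∈ Ioo 0 T, G t → j t - j0 ≤ ∫ x, φ (t, x) * (S (t, x) - S (0, x)) ∂muO) :
    ∀ᵐ τ ∂volume.restrict (Ioo 0 T), j τ - j0 ≤ ∫ p, φ p * b p ∂muQ τ := by
  have hjI : IntervalIntegrable j volume 0 T :=
    (intervalIntegrable_iff_integrableOn_Ioo_of_le hT.le).2 hj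
  have hprim := AC1.primitive hT.le hjI 0
  filter_upwards [hprim.2, ae_restrict_mem measurableSet_Ioo] with τ hd hτ
  simp only [zero_add] at hd
  let e : SpT := (-1, 0)
  let c : ℝ → ℝ := fun u => ∫ p, ext0 T b (p + u • e) * ext0 τ φ p
  have hφτ : Q τ (1 / 2) φ := hφ.mono_time hτ.2.le
  have hc : Continuous c := continuous_integral_translate_mul hb.ext0 hφτ.ext0 e
  have hc0 : c 0 = ∫ p, φ p * b p ∂muQ τ := by
    simp only [c, zero_smul, add_zero]
    rw [integral_mul_ext0]
    exact setIntegral_congr_fun (measurableSet_cyl τ) fun p hp => by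
      rw [ext0_of_mem (cyl_subset hτ.2.le hp), mul_comm]
  have t1 := (tendsto_slope_left hd).sub_const j0
  have t2 := tendsto_average hc
  rw [hc0] at t2
  refine le_of_tendsto_of_tendsto t1 t2 ?_
  filter_upwards [Ioo_mem_nhdsGT hτ.1] with h hh
  have hinc : ∀ t ∈ Ioo 0 τ, ∀ᵐ x ∂muO,
      ∫ u in (0 : ℝ)..h, ext0 T b ((t, x) + u • e) = S (t, x) - S (max (t - h) 0, x) := by
    intro t ht
    have htT : t ∈ Icc 0 T := ⟨ht.1.le, (ht.2.trans hτ.2).le⟩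
    have hm : max (t - h) 0 ∈ Icc 0 T := ⟨le_max_right _ _, max_le (by linarith [hh.1, htT.2]) hT.le⟩
    have hbi : ∀ᵐ x ∂muO, Integrable (fun s => b (s, x)) (volume.restrict (Ioo 0 T)) := by
      have := hb.integrable
      rw [muQ_eq_prod] at this
      exact this.prod_left_ae
    filter_upwards [hS.2 t htT, hS.2 _ hm, hbi, ae_restrict_mem measurableSet_Omega]
      with x x1 x2 x3 hx
    have hB : ∀ u : ℝ, ext0 T b ((t, x) + u • e) = (Ioo 0 T).indicator (fun s => b (s, x)) (t - u) := by
      intro u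
      have e1 : ((t, x) : SpT) + u • e = (t - u, x) := by
        ext <;> simp [e, sub_eq_add_neg]
      rw [e1]
      by_cases hu : t - u ∈ Ioo 0 T
      · have : ((t - u, x) : SpT) ∈ cyl T := ⟨hu, hx⟩
        rw [ext0_of_mem this, indicator_of_mem hu]
      · rw [ext0_of_notMem (fun hm => hu hm.1), indicator_of_notMem hu]
    have hBi : ∀ a b' : ℝ, IntervalIntegrable ((Ioo 0 T).indicator (fun s => b (s, x))) volume a b' :=
      fun a b' => ((integrable_indicator_iff measurableSet_Ioo).2 x3).intervalIntegrable
    have hin : ∀ a ∈ Icc 0 T, ∫ s in (0 : ℝ)..a, (Ioo 0 T).indicator (fun s => b (s, x)) s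
        = ∫ s in (0 : ℝ)..a, b (s, x) := by
      intro a ha
      rw [intervalIntegral.integral_of_le ha.1, intervalIntegral.integral_of_le ha.1,
        integral_Ioc_eq_integral_Ioo, integral_Ioc_eq_integral_Ioo]
      refine setIntegral_congr_fun measurableSet_Ioo fun s hs => ?_
      have : s ∈ Ioo 0 T := ⟨hs.1, hs.2.trans_le ha.2⟩
      exact indicator_of_mem this _
    simp only [hB]
    rw [intervalIntegral.integral_comp_sub_left
      (fun s => (Ioo 0 T).indicator (fun s => b (s, x)) s) t, sub_zero]
    have hneg : ∫ s in (t - h)..(max (t - h) 0), (Ioo 0 T).indicator (fun s => b (s, x)) s = 0 := by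
      rw [intervalIntegral.integral_of_le (le_max_left _ _)]
      apply setIntegral_eq_zero_of_forall_eq_zero
      intro s hs
      apply indicator_of_notMem
      intro hs'
      rcases le_total (t - h) 0 with h1 | h1
      · rw [max_eq_right h1] at hs; linarith [hs.2, hs'.1]
      · rw [max_eq_left h1] at hs; linarith [hs.1, hs.2]
    rw [← intervalIntegral.integral_add_adjacent_intervals (hBi (t - h) (max (t - h) 0)) (hBi _ t),
      hneg, zero_add, ← intervalIntegral.integral_interval_sub_left (hBi 0 t) (hBi 0 _),
      hin t htT, hin _ hm, x1, x2]
    ring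
  let jt : ℝ → ℝ := fun t => if t ≤ 0 then j0 else j t
  let D : ℝ → ℝ := fun t => ∫ x, (∫ u in (0 : ℝ)..h, ext0 T b ((t, x) + u • e)) * φ (t, x) ∂muO
  have hGτ : ∀ᵐ t ∂(volume.restrict (Ioo 0 τ)), G t :=
    ae_mono (Measure.restrict_mono (Ioo_subset_Ioo_right hτ.2.le) le_rfl) hG
  have hG' : ∀ᵐ t : ℝ, t - h ∈ Ioo 0 T → G (t - h) := by
    rw [ae_restrict_iff' measurableSet_Ioo] at hG
    exact (measurePreserving_sub_right volume h).quasiMeasurePreserving.ae hG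
  have hle : ∀ᵐ t ∂(volume.restrict (Ioo 0 τ)), j t - jt (t - h) ≤ D t := by
    filter_upwards [hGτ, ae_restrict_of_ae hG', ae_restrict_mem measurableSet_Ioo] with t g1 g2 ht
    have htT : t ∈ Ioo 0 T := ⟨ht.1, ht.2.trans hτ.2⟩
    have hD : D t = ∫ x, φ (t, x) * (S (t, x) - S (max (t - h) 0, x)) ∂muO := by
      apply integral_congr_ae
      filter_upwards [hinc t ht] with x hx
      rw [hx, mul_comm]
    rw [hD]
    by_cases h1 : t - h ≤ 0
    · simp only [jt, if_pos h1, max_eq_right h1]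
      exact h0 t htT g1
    · push Not at h1
      have h2 : t - h ∈ Ioo 0 T := ⟨h1, by linarith [htT.2, hh.1]⟩
      simp only [jt, if_neg h1.not_ge, max_eq_left h1.le]
      exact hjj t htT (t - h) h2 g1 (g2 h2)
  have hI : Integrable (fun p => (∫ u in (0 : ℝ)..h, ext0 T b (p + u • e)) * φ p) (muQ τ) := by
    have h1 := (integrable_translate_mul hb.ext0 hφτ.ext0 e h).integral_prod_right
    have h2 : Integrable (fun p => (∫ u in (0 : ℝ)..h, ext0 T b (p + u • e)) * ext0 τ φ p)
        (muQ τ) := by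
      refine h1.restrict.congr (.of_forall fun p => ?_)
      simp only
      rw [integral_mul_const, intervalIntegral.integral_of_le hh.1.le, integral_Ioc_eq_integral_Ioo]
    refine h2.congr ?_
    filter_upwards [ae_restrict_mem (measurableSet_cyl τ)] with p hp
    rw [ext0_of_mem hp]
  have hDI : Integrable D (volume.restrict (Ioo 0 τ)) := by
    rw [muQ_eq_prod] at hI
    exact hI.integral_prod_left
  have hDeq : ∫ t in Ioo 0 τ, D t = ∫ u in (0 : ℝ)..h, c u := by
    rw [← integral_average_mul hb.ext0 hφτ.ext0 e hh.1.le, integral_mul_ext0, muQ_eq_prod,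
      integral_prod]
    rwa [← muQ_eq_prod]
  have hjτ : IntegrableOn j (Ioo 0 τ) := hj.mono_set (Ioo_subset_Ioo_right hτ.2.le)
  have hji : ∀ a ∈ Icc 0 T, IntervalIntegrable j volume 0 a := fun a ha =>
    hjI.mono_set (by rw [uIcc_of_le ha.1, uIcc_of_le hT.le]; exact Icc_subset_Icc_right ha.2)
  have hjt1 : IntervalIntegrable jt volume (-h) 0 := by
    refine (intervalIntegrable_const (c := j0)).congr_ae ?_
    rw [uIoc_of_le (by linarith [hh.1])]
    filter_upwards [ae_restrict_mem measurableSet_Ioc] with t ht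
    simp only [jt, if_pos ht.2]
  have hmem : τ - h ∈ Icc 0 T := ⟨by linarith [hh.2], by linarith [hτ.2, hh.1]⟩
  have hjt2 : IntervalIntegrable jt volume 0 (τ - h) := by
    refine (hji _ hmem).congr_ae ?_
    rw [uIoc_of_le hmem.1]
    filter_upwards [ae_restrict_mem measurableSet_Ioc] with t ht
    simp only [jt, if_neg ht.1.not_ge]
  have hjtI : IntervalIntegrable (fun t => jt (t - h)) volume 0 τ := by
    have := (hjt1.trans hjt2).comp_sub_right h
    simpa using this
  have hjtE : ∫ t in (0 : ℝ)..τ, jt (t - h) = h * j0 + ∫ t in (0 : ℝ)..(τ - h), j t := by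
    rw [intervalIntegral.integral_comp_sub_right jt h, zero_sub,
      ← intervalIntegral.integral_add_adjacent_intervals hjt1 hjt2]
    congr 1
    · rw [intervalIntegral.integral_congr_ae (g := fun _ => j0)]
      · simp
      · rw [uIoc_of_le (by linarith [hh.1])]
        refine .of_forall fun t ht => ?_
        simp only [jt, if_pos ht.2]
    · apply intervalIntegral.integral_congr_ae
      rw [uIoc_of_le hmem.1]
      refine .of_forall fun t ht => ?_
      simp only [jt, if_neg ht.1.not_ge]
  have hfin : (∫ t in (0 : ℝ)..τ, j t) - ∫ t in (0 : ℝ)..τ, jt (t - h) ≤ ∫ u in (0 : ℝ)..h, c u := by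
    rw [← hDeq, ← intervalIntegral.integral_sub (hji τ ⟨hτ.1.le, hτ.2.le⟩) hjtI,
      intervalIntegral.integral_of_le hτ.1.le, integral_Ioc_eq_integral_Ioo]
    refine integral_mono_ae (hjτ.sub ?_) hDI hle
    rwa [intervalIntegrable_iff_integrableOn_Ioo_of_le hτ.1.le] at hjtI
  rw [hjtE] at hfin
  have hpos : 0 < h := hh.1
  have e1 : h⁻¹ * ((∫ t in (0 : ℝ)..τ, j t) - ∫ t in (0 : ℝ)..(τ - h), j t) - j0
      = h⁻¹ * ((∫ t in (0 : ℝ)..τ, j t) - (h * j0 + ∫ t in (0 : ℝ)..(τ - h), j t)) := by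
    field_simp; ring
  change h⁻¹ * ((∫ t in (0 : ℝ)..τ, j t) - ∫ t in (0 : ℝ)..(τ - h), j t) - j0 ≤ _
  rw [e1]
  exact mul_le_mul_of_nonneg_left hfin (inv_nonneg.2 hpos.le)

/-! ### Commuting derivatives, vertical means -/

theorem testQ_fderiv (h : φ ∈ testQ T) (e : SpT) : (fun p => fderiv ℝ φ p e) ∈ testQ T := by
  obtain ⟨⟨h1, h2, δ, hδ, h3⟩, δ', hδ', h4⟩ := h
  have hs : ContDiff ℝ (⊤ : ℕ∞) (fun p => fderiv ℝ φ p e) :=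
    (h1.fderiv_right (m := (⊤ : ℕ∞)) (by simp)).clm_apply contDiff_const
  have hsupp : ∀ {S : Set SpT}, IsClosed S → (∀ p, φ p ≠ 0 → p ∈ S) →
      ∀ p, fderiv ℝ φ p e ≠ 0 → p ∈ S := by
    intro S hS h p hp
    by_contra hm
    apply hp
    have : φ =ᶠ[𝓝 p] fun _ => 0 := by
      filter_upwards [hS.isOpen_compl.mem_nhds hm] with q hq
      by_contra h0
      exact hq (h q h0)
    rw [this.fderiv_eq]; simp
  refine ⟨⟨hs, ?_, δ, hδ, ?_⟩, δ', hδ', ?_⟩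
  · intro i t x
    have e1 : (fun p : SpT => φ (p + (0, Pi.single (hor i) 1))) = φ := by
      funext ⟨t, x⟩
      simpa using h2 i t x
    have e2 := fderiv_comp_add_right (𝕜 := ℝ) (f := φ) (x := (t, x)) ((0, Pi.single (hor i) 1) : SpT)
    rw [e1] at e2
    have e3 : ((t, x) : SpT) + (0, Pi.single (hor i) 1) = (t, x + Pi.single (hor i) 1) := by simp
    rw [e3] at e2
    change fderiv ℝ φ (t, x + Pi.single (hor i) 1) e = fderiv ℝ φ (t, x) e
    rw [e2]
  · intro t x hp
    exact hsupp (S := {p | p.1 ∈ Icc δ (T - δ)}) (isClosed_Icc.preimage continuous_fst)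
      (fun p hp => h3 p.1 p.2 hp) (t, x) hp
  · intro t x hp
    exact hsupp (S := {p | p.2 2 ∈ Icc δ' (1 - δ')})
      (isClosed_Icc.preimage ((continuous_apply 2).comp continuous_snd))
      (fun p hp => h4 p.1 p.2 hp) (t, x) hp

theorem fderiv_comm (h : ContDiff ℝ (⊤ : ℕ∞) φ) (e e' p : SpT) :
    fderiv ℝ (fun p => fderiv ℝ φ p e) p e' = fderiv ℝ (fun p => fderiv ℝ φ p e') p e := by
  have hd : Differentiable ℝ (fderiv ℝ φ) :=
    (h.fderiv_right (m := (⊤ : ℕ∞)) (by simp)).differentiable (by simp)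
  have key : ∀ e e' : SpT, fderiv ℝ (fun p => fderiv ℝ φ p e) p e' = fderiv ℝ (fderiv ℝ φ) p e' e := by
    intro e e'
    rw [fderiv_clm_apply (hd p) (differentiableAt_const e)]
    simp
  rw [key, key]
  have : IsSymmSndFDerivAt ℝ φ p := (h.contDiffAt).isSymmSndFDerivAt
      (by rw [minSmoothness_of_isRCLikeNormedField]
          exact WithTop.coe_le_coe.2 (le_top : (2 : ℕ∞) ≤ ⊤))
  exact this e' e

/-- If `g = ∂ₑ f` and `∂ₑ ∂ₑ' f` exists, then the latter is `∂ₑ' g`. -/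
theorem HasWeakDeriv.comm {e e' : SpT} {g' h : SpT → ℝ}
    (h1 : HasWeakDeriv (cyl T) (testQ T) e f g) (h2 : HasWeakDeriv (cyl T) (testQ T) e' f g')
    (h3 : HasWeakDeriv (cyl T) (testQ T) e g' h) : HasWeakDeriv (cyl T) (testQ T) e' g h := by
  refine ⟨h1.2.1, h3.2.1, fun φ hφ => ?_⟩
  have a1 := h1.2.2 _ (testQ_fderiv hφ e')
  have a2 := h2.2.2 _ (testQ_fderiv hφ e)
  have a3 := h3.2.2 φ hφ
  simp only [fderiv_comm hφ.1.1 e' e] at a1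
  linarith

theorem line_comm {j : Fin 3} (hjk : j ≠ k) (p : SpT) (s z : ℝ) :
    line j (line k p z) s = line k (line j p s) z := by
  simp only [line]
  rw [Function.update_comm hjk]

theorem zmean_eq (f : SpT → ℝ) (p : SpT) : zmean f p = ∫ z, f (line 2 p z) ∂muI := by
  rw [muI_integral]; rfl

theorem zmean_line (f : SpT → ℝ) (p : SpT) (s : ℝ) : zmean f (line 2 p s) = zmean f p := by
  simp only [zmean_eq, line_line]

theorem VD.zmean (f : SpT → ℝ) : VD 2 T (zmean f) (fun _ => 0) :=
  .of_forall fun p => ⟨fun _ => CPE.zmean f p, AC1.const _,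
    .of_forall fun s => zmean_line f p s, trivial⟩

theorem integrable_zmean (hf : Integrable f (muQ T)) : Integrable (zmean f) (muQ T) :=
  (integrable_integral_line (k := 2) hf).congr (.of_forall fun p => (zmean_eq f p).symm)

theorem sq_integral_le {X : Type} [MeasurableSpace X] {μ : Measure X} [IsProbabilityMeasure μ]
    {f : X → ℝ} (h : MemLp f 2 μ) : (∫ x, f x ∂μ) ^ 2 ≤ ∫ x, f x ^ 2 ∂μ := by
  have h1 : Integrable f μ := h.integrable (by norm_num)
  have h2 : Integrable (fun x => f x ^ 2) μ := h.integrable_sq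
  set a := ∫ x, f x ∂μ with ha
  have h3 : 0 ≤ ∫ x, (f x - a) ^ 2 ∂μ := integral_nonneg fun x => sq_nonneg _
  have h4 : ∀ x, (f x - a) ^ 2 = f x ^ 2 - 2 * a * f x + a ^ 2 := fun x => by ring
  simp only [h4] at h3
  rw [integral_add (integrable_sub' h2 (h1.const_mul (2 * a))) (integrable_const _),
    integral_sub h2 (h1.const_mul (2 * a)), integral_const_mul, ← ha] at h3
  simp at h3
  nlinarith

theorem ae_memLp_line (hg : Q T (1 / 2) g) :
    ∀ᵐ p ∂muQ T, MemLp (fun s => g (line k p s)) 2 muI := by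
  have h2 := hg.memLp_two
  filter_upwards [ae_integrable_line (k := k) hg.integrable,
    ae_integrable_line (k := k) h2.integrable_sq] with p h3 h4
  exact (memLp_two_iff_integrable_sq h3.1).2 h4

theorem Q.zmean (hf : Q T (1 / 2) f) : Q T (1 / 2) (zmean f) := by
  have hm := (integrable_zmean hf.integrable).1
  apply Q.two_of_memLp
  rw [memLp_two_iff_integrable_sq hm]
  refine (integrable_zmean hf.memLp_two.integrable_sq).mono' (hm.pow 2) ?_
  filter_upwards [ae_memLp_line (k := 2) hf] with p hp
  rw [Real.norm_of_nonneg (sq_nonneg _), zmean_eq, zmean_eq]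
  exact sq_integral_le hp

theorem HD.zmean {i : Fin 2} (hT : 0 < T) (h : HD (hor i) T f g) (hf : Integrable f (muQ T))
    (hg : Integrable g (muQ T)) : HD (hor i) T (zmean f) (zmean g) := by
  apply HD.of_weak hT
  refine ⟨integrable_zmean hf, integrable_zmean hg, fun φ hφ => ?_⟩
  have hc1 : ContDiff ℝ 1 φ := hφ.1.1.of_le (by exact_mod_cast le_top)
  have hper : ∀ p, φ (line (hor i) p 0) = φ (line (hor i) p 1) := by
    intro p
    rw [line_one]
    exact (hφ.1.2.1 i _ _).symm
  have fub : ∀ {f ψ : SpT → ℝ}, Integrable f (muQ T) → Continuous ψ →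
      ∫ p, CPE.zmean f p * ψ p ∂muQ T = ∫ z, ∫ p, f (line 2 p z) * ψ p ∂muQ T ∂muI := by
    intro f ψ hf hψ
    obtain ⟨C, hC⟩ := bounded_on_cyl (T := T) hψ
    have hi : Integrable (fun q : SpT × ℝ => f (line 2 q.1 q.2) * ψ q.1) ((muQ T).prod muI) := by
      apply Integrable.mul_of_bounded (integrable_line_prod (k := 2) hf)
      · exact (hψ.comp continuous_fst).aestronglyMeasurable
      · exact ⟨C, Measure.quasiMeasurePreserving_fst.ae hC⟩
    rw [← integral_integral_swap hi]
    congr 1; ext p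
    rw [zmean_eq, integral_mul_const]
  change ∫ p, CPE.zmean f p * _ ∂muQ T = - ∫ p, CPE.zmean g p * _ ∂muQ T
  rw [fub hf ((hφ.1.1.continuous_fderiv (by simp)).clm_apply continuous_const),
    fub hg hφ.1.1.continuous, ← integral_neg]
  have hswap : ∀ᵐ z ∂muI, ∀ᵐ p ∂muQ T, ∃ F : ℝ → ℝ,
      AC1 1 F (fun s => g (line (hor i) (line 2 p z) s)) ∧
      (∀ᵐ s ∂muI, f (line (hor i) (line 2 p z) s) = F s) ∧ F 0 = F 1 := by
    have h1 : ∀ᵐ q ∂((muQ T).prod muI), ∃ F : ℝ → ℝ,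
      AC1 1 F (fun s => g (line (hor i) (line 2 q.1 q.2) s)) ∧
      (∀ᵐ s ∂muI, f (line (hor i) (line 2 q.1 q.2) s) = F s) ∧ F 0 = F 1 :=
      (measurePreserving_line 2 T).quasiMeasurePreserving.ae h
    have h2 := (Measure.measurePreserving_swap (μ := muI) (ν := muQ T)).quasiMeasurePreserving.ae h1
    exact Measure.ae_ae_of_ae_prod h2
  have hi1 : ∀ {f : SpT → ℝ}, Integrable f (muQ T) →
      ∀ᵐ z ∂muI, Integrable (fun p => f (line 2 p z)) (muQ T) := fun hf =>
    (integrable_line_prod (k := 2) hf).prod_left_ae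
  apply integral_congr_ae
  filter_upwards [hswap, hi1 hf, hi1 hg] with z h1 h2 h3
  refine integral_mul_fderiv (c := Eq) (c' := Eq) (k := hor i) ?_ h2 h3 hc1 hper
    (fun a b a' b' h h' => by rw [h, h'])
  filter_upwards [h1] with p hp
  simpa only [line_comm (hor_ne_two i)] using hp

theorem VZ.memLp_two (h : VZ k T f g) (hf : AEStronglyMeasurable f (muQ T)) (hg : Q T (1 / 2) g) : Q T (1 / 2) f := by
  have hg2 := integrable_integral_line (k := k) hg.memLp_two.integrable_sq
  have hG : AEStronglyMeasurable (fun p => ∫ s, g (line k p s) ^ 2 ∂muI) (muQ T) := hg2.1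
  apply Q.two_of_memLp
  rw [memLp_two_iff_integrable_sq hf]
  refine hg2.mono' (hf.pow 2) ?_
  have hmeas : NullMeasurableSet {p | ‖f p ^ 2‖ ≤ ∫ s, g (line k p s) ^ 2 ∂muI} (muQ T) :=
    nullMeasurableSet_le (hf.pow 2).norm.aemeasurable hG.aemeasurable
  obtain ⟨A, hA1, hA2, hA3⟩ := hmeas.exists_measurable_subset_ae_eq
  have : ∀ᵐ p ∂muQ T, p ∈ A := by
    apply ae_of_ae_line (k := k) hA2
    have hA4 := ae_line (k := k) (eventuallyEq_set.1 hA3)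
    filter_upwards [h, hA4, ae_memLp_line (k := k) hg] with p ⟨F, a1, a2, a3, a4⟩ hp hgp
    filter_upwards [a2, hp, ae_restrict_mem measurableSet_Ioo] with s s1 s2 hs
    refine s2.2 ?_
    change ‖f (line k p s) ^ 2‖ ≤ ∫ s', g (line k (line k p s) s') ^ 2 ∂muI
    simp only [line_line]
    rw [s1, Real.norm_of_nonneg (sq_nonneg _), a1.eq_add ⟨hs.1.le, hs.2.le⟩, a3, zero_add]
    have hi : Integrable (fun s => |g (line k p s)|) muI := (hgp.integrable (by norm_num)).abs
    have h1 : |∫ u in (0 : ℝ)..s, g (line k p u)| ≤ ∫ u, |g (line k p u)| ∂muI := by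
      rw [muI_integral]
      refine (intervalIntegral.abs_integral_le_integral_abs hs.1.le).trans ?_
      refine intervalIntegral.integral_mono_interval le_rfl hs.1.le hs.2.le
        (.of_forall fun u => abs_nonneg _) (intervalIntegrable_iff_muI.2 hi)
    have h2 := sq_integral_le hgp.abs
    simp only [Pi.abs_apply, sq_abs] at h2
    calc _ = |∫ u in (0 : ℝ)..s, g (line k p u)| ^ 2 := (sq_abs _).symm
      _ ≤ (∫ u, |g (line k p u)| ∂muI) ^ 2 := by gcongr
      _ ≤ _ := h2
  filter_upwards [this] with p hp using hA1 hp

/-! ### The vertical velocity -/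

theorem VD.const_line (h : VD 2 T f (fun _ => 0)) :
    ∀ᵐ p ∂muQ T, ∃ a : ℝ, ∀ᵐ s ∂muI, f (line 2 p s) = a := by
  filter_upwards [h] with p ⟨F, h1, h2, _⟩
  refine ⟨F 0, ?_⟩
  filter_upwards [h2, ae_restrict_mem measurableSet_Ioo] with s hs hm
  rw [hs, h1.eq_add ⟨hm.1.le, hm.2.le⟩]
  simp

theorem vert_structure (hT : 0 < T) {ρ wz : SpT → ℝ} {v ri V : Fin 2 → SpT → ℝ}
    (hv : ∀ i, DQr Eq (hor i) T (1 / 2) (1 / 2) (v i) (V i))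
    (hρ : ∀ i, DQr Eq (hor i) T 0 (1 / 30) ρ (ri i)) (hpos : ∀ᵐ p ∂muQ T, 0 < ρ p)
    (hρz : VD 2 T ρ (fun _ => 0)) (hriz : ∀ i, VD 2 T (ri i) (fun _ => 0))
    (hw : VD 2 T (vert T ρ v) wz) (hwz : Q T (1 / 2) wz) : VZ 2 T (vert T ρ v) wz ∧ ∀ᵐ p ∂muQ T,
      ρ p * wz p = - ∑ i, (ri i p * (v i p - zmean (v i) p) + ρ p * (V i p - zmean (V i) p)) := by
  have hint : ∀ {f : SpT → ℝ}, Q T (1 / 2) f → Integrable f (muQ T) := fun h =>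
    h.integrable
  have hz : ∀ i, DQr Eq (hor i) T (1 / 2) (1 / 2) (fun p => v i p - zmean (v i) p)
      (fun p => V i p - zmean (V i) p) := fun i =>
    ⟨(HD.add (hv i).ld (HD.const_mul (-1) (HD.zmean hT (hv i).ld (hint (hv i).fn) (hint (hv i).dv)))).of_eq
      (fun p => by ring) (fun p => by ring), (hv i).fn.sub (hv i).fn.zmean, (hv i).dv.sub (hv i).dv.zmean⟩
  have hprod := fun i => (hρ i).mul (hz i)
  set g : SpT → ℝ := divh T (fun i q => ρ q * (v i q - zmean (v i) q)) with hg
  set g' : SpT → ℝ := fun p =>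
    ∑ i, (ri i p * (v i p - zmean (v i) p) + ρ p * (V i p - zmean (V i) p)) with hg'
  have hgg : ∀ᵐ p ∂muQ T, g p = g' p := by
    have h1 : ∀ i, ∀ᵐ p ∂muQ T, dQ T (hor i) (fun q => ρ q * (v i q - zmean (v i) q)) p
        = ri i p * (v i p - zmean (v i) p) + ρ p * (V i p - zmean (V i) p) := fun i =>
      dQ_hor_eq hT (hprod i).ld (hprod i).fn.integrable (hprod i).dv.integrable
    filter_upwards [h1 0, h1 1] with p p0 p1
    simp only [hg, hg', divh, Fin.sum_univ_two, p0, p1]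
  have hg'i : Integrable g' (muQ T) := integrable_finsetSum _ fun i _ => (hprod i).dv.integrable
  have main : ∀ᵐ p ∂muQ T, (∃ F : ℝ → ℝ, AC1 1 F (fun s => wz (line 2 p s)) ∧
      (∀ᵐ s ∂muI, vert T ρ v (line 2 p s) = F s) ∧ F 0 = 0 ∧ F 1 = 0) ∧
      ∀ᵐ s ∂muI, ρ (line 2 p s) * wz (line 2 p s) = - g' (line 2 p s) := by
    filter_upwards [hw, hρz.const_line, (hriz 0).const_line, (hriz 1).const_line, ae_line (k := 2) hgg,
      ae_integrable_line (k := 2) hg'i, ae_line (k := 2) hpos,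
      ae_integrable_line (k := 2) (hint (hv 0).fn), ae_integrable_line (k := 2) (hint (hv 1).fn),
      ae_integrable_line (k := 2) (hint (hv 0).dv), ae_integrable_line (k := 2) (hint (hv 1).dv)]
      with p ⟨F, f1, f2, _⟩ ⟨a, ha⟩ ⟨b0, hb0⟩ ⟨b1, hb1⟩ hgl hgi hp i0 i1 j0 j1
    have hgi' : Integrable (fun s => g (line 2 p s)) muI := hgi.congr (by
      filter_upwards [hgl] with s hs using hs.symm)
    have hgI := intervalIntegrable_iff_muI.2 hgi'
    have hK := (AC1.primitive zero_le_one hgI 0).mul (AC1.const (ℓ := 1) (-a⁻¹))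
    have hwl : ∀ s, vert T ρ v (line 2 p s)
        = -(ρ (line 2 p s))⁻¹ * ∫ z in (0 : ℝ)..s, g (line 2 p z) := by
      intro s
      simp only [vert, line, Function.update_self, Function.update_idem, hg]
    have heq := f1.eqOn_of_ae_eq one_pos hK (by
      filter_upwards [f2, ha] with s s1 s2
      rw [← s1, hwl, s2]; ring)
    have hder := f1.deriv_ae_eq hK heq
    have e0 : F 0 = 0 := by rw [heq 0 (by simp)]; simp
    have hI : ∫ z in (0 : ℝ)..1, g (line 2 p z) = 0 := by
      have h1 : ∫ z in (0 : ℝ)..1, g (line 2 p z)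
          = ∫ z, (b0 * (v 0 (line 2 p z) - zmean (v 0) p) + a * (V 0 (line 2 p z) - zmean (V 0) p)
            + (b1 * (v 1 (line 2 p z) - zmean (v 1) p)
              + a * (V 1 (line 2 p z) - zmean (V 1) p))) ∂muI := by
        rw [← muI_integral]
        apply integral_congr_ae
        filter_upwards [hgl, ha, hb0, hb1] with z z1 z2 z3 z4
        rw [z1]
        simp only [hg', Fin.sum_univ_two, z2, z3, z4, zmean_line]
      have k : ∀ {f : ℝ → ℝ} (c d : ℝ), Integrable f muI → Integrable (fun z => c * (f z - d)) muI :=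
        fun c d h => (h.sub (integrable_const d)).const_mul c
      have k2 : ∀ {f : SpT → ℝ} (c : ℝ), Integrable (fun s => f (line 2 p s)) muI →
          ∫ z, c * (f (line 2 p z) - zmean f p) ∂muI = 0 := by
        intro f c h
        rw [integral_const_mul, integral_sub h (integrable_const _), ← zmean_eq]
        simp
      rw [h1, integral_add (integrable_add' (k _ _ i0) (k _ _ j0)) (integrable_add' (k _ _ i1) (k _ _ j1)),
        integral_add (k _ _ i0) (k _ _ j0), integral_add (k _ _ i1) (k _ _ j1),
        k2 b0 i0, k2 a j0, k2 b1 i1, k2 a j1]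
      simp
    have e1 : F 1 = 0 := by rw [heq 1 (by simp), hI]; simp
    refine ⟨⟨F, f1, f2, e0, e1⟩, ?_⟩
    filter_upwards [hder, ha, hgl, hp] with s s1 s2 s3 s4
    rw [s2] at s4
    rw [s1, s2, s3]
    field_simp
    ring
  refine ⟨?_, ?_⟩
  · filter_upwards [main] with p hp using hp.1
  · apply ae_eq_of_ae_line 2 ((hρ 0).fn.aesm.mul hwz.aesm) hg'i.1.neg
    filter_upwards [main] with p hp using hp.2

/-! ### Regular solutions -/

/-- The unknowns of the approximating problem and their derivatives. -/
structure Fld where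
  ρ : SpT → ℝ
  s : SpT → ℝ
  ρt : SpT → ℝ
  w : SpT → ℝ
  wz : SpT → ℝ
  m : SpT → ℝ
  v : Fin 2 → SpT → ℝ
  vt : Fin 2 → SpT → ℝ
  q : Fin 2 → SpT → ℝ
  Z : Fin 2 → SpT → ℝ
  ZZ : Fin 2 → SpT → ℝ
  H : Fin 2 → Fin 2 → SpT → ℝ
  V : Fin 2 → Fin 2 → SpT → ℝ
  VV : Fin 2 → Fin 2 → Fin 2 → SpT → ℝ

namespace Fld

variable (u : Fld)

/-- `|∇ρ^{1/2}|²`. -/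
def qq (p : SpT) : ℝ := u.q 0 p ^ 2 + u.q 1 p ^ 2

/-- `|v|²`. -/
def vv (p : SpT) : ℝ := u.v 0 p ^ 2 + u.v 1 p ^ 2

/-- The symmetric gradient. -/
def D (i j : Fin 2) (p : SpT) : ℝ := (u.V j i p + u.V i j p) / 2

/-- `|∇ρ^{1/2}|² ∂ᵢρ^{1/2}`. -/
def X (i : Fin 2) (p : SpT) : ℝ := u.qq p * u.q i p

/-- The derivatives of `X`. -/
def DX (i j : Fin 2) (p : SpT) : ℝ :=
  u.qq p * u.H i j p + 2 * (u.q 0 p * u.H 0 j p + u.q 1 p * u.H 1 j p) * u.q i p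

/-- The divergence of `ρ v`. -/
def divρv (p : SpT) : ℝ :=
  2 * u.s p * (u.q 0 p * u.v 0 p + u.q 1 p * u.v 1 p) + u.ρ p * (u.V 0 0 p + u.V 1 1 p)

/-- The right-hand side of the mass equation. -/
def G (p₀ ε : ℝ) (p : SpT) : ℝ :=
  ε * u.s p * (u.H 0 0 p + u.H 1 1 p) + ε * u.s p * (u.DX 0 0 p + u.DX 1 1 p) + ε * u.ρ p ^ (-p₀)

end Fld

/-- The properties of an approximating solution used in the estimates. -/
structure Reg (γ p₀ ε T : ℝ) (u : Fld) : Prop where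
  bd : ∃ C : ℝ, 0 < C ∧ ∀ᵐ p ∂muQ T, C⁻¹ < u.ρ p ∧ u.ρ p < C
  sdef : ∀ p, u.s p = √(u.ρ p)
  Ds : ∀ i, DQr Eq (hor i) T 0 (1 / 30) u.s (u.q i)
  Dq : ∀ i j, DQr Eq (hor j) T (1 / 30) (1 / 2) (u.q i) (u.H i j)
  Dsz : DQr cAny 2 T 0 0 u.s (fun _ => 0)
  Dqz : ∀ i, DQr cAny 2 T (1 / 30) 0 (u.q i) (fun _ => 0)
  DHz : ∀ i j, DQr cAny 2 T (1 / 2) 0 (u.H i j) (fun _ => 0)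
  hess : ∀ i j, Q T (1 / 2) (fun p => u.qq p * u.H i j p)
  Hsymm : ∀ᵐ p ∂muQ T, u.H 1 0 p = u.H 0 1 p
  Dv : ∀ j i, DQr Eq (hor i) T (1 / 10) (3 / 10) (u.v j) (u.V j i)
  DV : ∀ j i k, DQr Eq (hor k) T (3 / 10) (1 / 2) (u.V j i) (u.VV j i k)
  Vsymm : ∀ j, ∀ᵐ p ∂muQ T, u.VV j 1 0 p = u.VV j 0 1 p
  Dvz : ∀ j, DQr cAny 2 T (1 / 10) (3 / 10) (u.v j) (u.Z j)
  DZ : ∀ j, DQr cZero 2 T (3 / 10) (1 / 2) (u.Z j) (u.ZZ j)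
  Dw : DQr cZero 2 T (1 / 2) (1 / 2) u.w u.wz
  Dm : DQr cAny 2 T (1 / 2) 0 u.m (fun _ => 0)
  m_eq : ∀ᵐ p ∂muQ T, u.m p = u.ρ p * u.wz p + u.divρv p
  tρ : TD T u.ρ u.ρt
  tv : ∀ j, TD T (u.v j) (u.vt j)
  qρt : Q T (1 / 2) u.ρt
  qvt : ∀ j, Q T (1 / 2) (u.vt j)
  mass : ∀ᵐ p ∂muQ T, u.ρt p + u.divρv p + u.ρ p * u.wz p = u.G p₀ ε p
  mom : ∀ j, ∀ᵐ p ∂muQ T, u.ρ p * u.vt j p + u.ρ p * (u.v 0 p * u.V j 0 p + u.v 1 p * u.V j 1 p)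
        + u.ρ p * u.w p * u.Z j p + γ * u.ρ p ^ (γ - 1) * (2 * u.s p * u.q j p)
      = 2 * u.s p * (u.q 0 p * u.D 0 j p + u.q 1 p * u.D 1 j p)
        + u.ρ p * ((u.VV j 0 0 p + u.VV 0 j 0 p) / 2 + (u.VV j 1 1 p + u.VV 1 j 1 p) / 2)
        + u.ρ p * u.ZZ j p
        + (√ε * (2 * u.s p * (u.q 0 p * u.V j 0 p + u.q 1 p * u.V j 1 p)
            + u.ρ p * (u.VV j 0 0 p + u.VV j 1 1 p))
          + ε * u.s p * u.qq p * (u.q 0 p * u.V j 0 p + u.q 1 p * u.V j 1 p)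
          - ε * u.ρ p ^ (-p₀) * u.v j p - ε * u.ρ p * √(u.vv p) ^ 3 * u.v j p)

/-- Composition with a function of class `C¹` on the range. -/
theorem DQr.comp {c : ℝ → ℝ → Prop} {b lo hi : ℝ} {φ φ' : ℝ → ℝ}
    (hc : ∀ a b, c a b → c (φ a) (φ b)) (hφ : ∀ y ∈ Icc lo hi, HasDerivAt φ (φ' y) y)
    (hφc : ContinuousOn φ' (Icc lo hi)) (hf : DQr c k T 0 b f g)
    (hm : ∀ᵐ p ∂muQ T, f p ∈ Icc lo hi) :
    DQr c k T 0 b (fun p => φ (f p)) (fun p => φ' (f p) * g p) := by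
  have hbd : ∀ {ψ : ℝ → ℝ}, ContinuousOn ψ (Icc lo hi) → Q T 0 (fun p => ψ (f p)) := by
    intro ψ hψ
    obtain ⟨C, hC⟩ := isCompact_Icc.exists_bound_of_continuousOn hψ
    have hae : AEMeasurable f (muQ T) := hf.fn.aesm.aemeasurable
    refine Q.of_bound ?_ C ?_
    · have h1 : Measurable ((Icc lo hi).indicator ψ) := by
        classical
        have := (hψ.measurable_piecewise (g := fun _ => 0) continuousOn_const measurableSet_Icc)
        convert this using 1
        funext x; by_cases hx : x ∈ Icc lo hi <;> simp [hx]
      refine (h1.comp_aemeasurable hae).aestronglyMeasurable.congr ?_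
      filter_upwards [hm] with p hp
      exact indicator_of_mem hp ψ
    · filter_upwards [hm] with p hp using hC _ hp
  refine ⟨LD.comp_gen isClosed_Icc hφ hφc hc hf.ld hm,
    hbd fun y hy => (hφ y hy).continuousAt.continuousWithinAt, ?_⟩
  simpa using (hbd hφc).mul hf.dv

theorem DQr.of_weakH {a b : ℝ} {i : Fin 2} (hT : 0 < T) (h : WQ T (hor i) f g) (hf : Q T a f)
    (hg : Q T b g) : DQr Eq (hor i) T a b f g := ⟨HD.of_weak hT h, hf, hg⟩

theorem DQr.of_weakV {a b : ℝ} (hT : 0 < T) (h : WQ T 2 f g) (hf : Q T a f) (hg : Q T b g) :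
    DQr cAny 2 T a b f g := ⟨VD.of_weak hT h, hf, hg⟩

theorem DQr.weakV {a b : ℝ} (h : DQr cAny 2 T a b f g) (ha : a ≤ 1) (hb : b ≤ 1) : WQ T 2 f g :=
  VD.weak h.ld (h.fn.integrable ha) (h.dv.integrable hb)

theorem DQr.dQ_eq {a b : ℝ} {i : Fin 2} (hT : 0 < T) (h : DQr Eq (hor i) T a b f g)
    (ha : a ≤ 1 := by norm_num) (hb : b ≤ 1 := by norm_num) : ∀ᵐ p ∂muQ T, dQ T (hor i) f p = g p :=
  dQ_hor_eq hT h.ld (h.fn.integrable ha) (h.dv.integrable hb)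

/-! ### Approximating solutions are regular -/

theorem len_sq {X : Type} (f : Fin 2 → X → ℝ) (p : X) : len f p ^ 2 = f 0 p ^ 2 + f 1 p ^ 2 := by
  rw [len, Real.sq_sqrt (Finset.sum_nonneg fun j _ => sq_nonneg _), Fin.sum_univ_two]

theorem len_eq {X : Type} (f : Fin 2 → X → ℝ) (p : X) : len f p = √(f 0 p ^ 2 + f 1 p ^ 2) := by
  rw [len, Fin.sum_univ_two]

theorem Fld.DX_reg {u : Fld} (Dq : ∀ i j, DQr Eq (hor j) T (1 / 30) (1 / 2) (u.q i) (u.H i j))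
    (hess : ∀ i j, Q T (1 / 2) (fun p => u.qq p * u.H i j p)) (i j : Fin 2) :
    DQr Eq (hor j) T (1 / 10) (1 / 2) (u.X i) (u.DX i j) := by
  have h0 := (((Dq 0 j).mul (Dq 0 j)).addH ((Dq 1 j).mul (Dq 1 j))).mul (Dq i j)
  have hq : ∀ k, Q T (1 / 30) (u.q k) := fun k => (Dq k j).fn
  refine ⟨h0.ld.of_eq (fun p => ?_) (fun p => ?_), ?_, ?_⟩
  · simp only [Fld.X, Fld.qq]; ring
  · simp only [Fld.DX, Fld.qq]; ring
  · refine h0.fn.mono.of_eq fun p => ?_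
    simp only [Fld.X, Fld.qq]; ring
  · have hk : ∀ k, Q T (1 / 2) (fun p => u.q k p * u.q i p * u.H k j p) := by
      intro k
      refine (hess k j).of_le (((hq k).aesm.mul (hq i).aesm).mul (Dq k j).dv.aesm)
        (.of_forall fun p => ?_)
      rw [abs_mul, abs_mul, abs_mul, abs_of_nonneg (show 0 ≤ u.qq p by unfold Fld.qq; positivity)]
      refine mul_le_mul_of_nonneg_right ?_ (abs_nonneg _)
      have h1 : ∀ l, |u.q l p| ^ 2 ≤ u.qq p := by
        intro l
        rw [sq_abs]
        fin_cases l <;> simp [Fld.qq] <;> positivity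
      nlinarith [h1 k, h1 i, sq_nonneg (|u.q k p| - |u.q i p|)]
    exact ((hess i j).add (((hk 0).add (hk 1)).const_mul 2)).of_eq fun p => by
      simp only [Fld.DX]; ring

/-- The fields belonging to a solution `(ρ, v)`. -/
def fld (T : ℝ) (ρ : SpT → ℝ) (v : Fin 2 → SpT → ℝ) : Fld where
  ρ := ρ
  s := root ρ
  ρt := dt T ρ
  w := vert T ρ v
  wz := dQ T 2 (vert T ρ v)
  m := fun p => ρ p * dQ T 2 (vert T ρ v) p
    + (2 * root ρ p * (gradh T (root ρ) 0 p * v 0 p + gradh T (root ρ) 1 p * v 1 p)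
      + ρ p * (gradh T (v 0) 0 p + gradh T (v 1) 1 p))
  v := v
  vt := fun j => dt T (v j)
  q := gradh T (root ρ)
  Z := fun j => dQ T 2 (v j)
  ZZ := fun j => dQ T 2 (dQ T 2 (v j))
  H := fun i j => gradh T (gradh T (root ρ) i) j
  V := fun j i => gradh T (v j) i
  VV := fun j i k => gradh T (gradh T (v j) i) k

theorem hwd {i : Fin 3} (h : WeakDiffQ T i f) : WQ T i f (dQ T i f) := hasWeakDeriv_weakDeriv h

theorem HasWeakDeriv.uniqueH (hT : 0 < T) {i : Fin 2} {g' : SpT → ℝ} (h : WQ T (hor i) f g)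
    (h' : WQ T (hor i) f g') : ∀ᵐ p ∂muQ T, g p = g' p :=
  LD.unique (HD.of_weak hT h) (HD.of_weak hT h') h.2.1.1 h'.2.1.1

theorem Q.of_memLp' {a q : ℝ} {r : ℝ≥0∞} (hf : MemLp f r (muQ T)) (hq : 0 < q)
    (hr : r = ENNReal.ofReal q) (ha : q⁻¹ = a) : Q T a f := by
  subst hr; subst ha; exact Q.of_memLp hq hf

section Solution

variable {γ p₀ ε T : ℝ} {r : Sp → ℝ} {u0 : Fin 2 → Sp → ℝ} {ρ : SpT → ℝ} {v : Fin 2 → SpT → ℝ}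

theorem IsApproxSolution.indep_z (hT : 0 < T) (hγ : 1 < γ)
    (h : IsApproxSolution γ p₀ ε T r u0 ρ v) : VD 2 T ρ (fun _ => 0) := by
  obtain ⟨C, hC, hb⟩ := h.bounds
  have h1 := VD.of_weak hT h.hydrostatic
  have hC1 : (0 : ℝ) < C⁻¹ ^ γ := by positivity
  have h2 : VD 2 T (fun p => (ρ p ^ γ) ^ γ⁻¹) (fun p => γ⁻¹ * (ρ p ^ γ) ^ (γ⁻¹ - 1) * 0) := by
    refine LD.comp_gen (φ := fun x => x ^ γ⁻¹) (φ' := fun x => γ⁻¹ * x ^ (γ⁻¹ - 1))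
      (S := Icc (C⁻¹ ^ γ) (C ^ γ)) isClosed_Icc ?_ ?_ (fun _ _ _ => trivial) h1 ?_
    · intro y hy
      exact Real.hasDerivAt_rpow_const (Or.inl (hC1.trans_le hy.1).ne')
    · refine continuousOn_const.mul (continuousOn_id.rpow_const fun y hy => ?_)
      exact Or.inl (hC1.trans_le hy.1).ne'
    · filter_upwards [hb] with p hp
      have : 0 < C⁻¹ := inv_pos.2 hC
      exact ⟨Real.rpow_le_rpow this.le hp.1.le (by linarith),
        Real.rpow_le_rpow (this.trans hp.1).le hp.2.le (by linarith)⟩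
  refine LD.congr h2 ?_ (.of_forall fun p => by ring)
  filter_upwards [hb] with p hp
  have : 0 < ρ p := (inv_pos.2 hC).trans hp.1
  rw [← Real.rpow_mul this.le, mul_inv_cancel₀ (by linarith), Real.rpow_one]

theorem IsApproxSolution.reg (hT : 0 < T) (hγ : 1 < γ) (h : IsApproxSolution γ p₀ ε T r u0 ρ v) : Reg γ p₀ ε T (fld T ρ v) := by
  obtain ⟨C, hC, hb⟩ := h.bounds
  have hC1 : 0 < C⁻¹ := inv_pos.2 hC
  have hpos : ∀ᵐ p ∂muQ T, 0 < ρ p := by filter_upwards [hb] with p hp using hC1.trans hp.1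
  have hss : ∀ᵐ p ∂muQ T, root ρ p * root ρ p = ρ p := by
    filter_upwards [hpos] with p hp using Real.mul_self_sqrt hp.le
  -- the density
  have wq : ∀ i : Fin 3, WQ T i (root ρ) (dQ T i (root ρ)) := fun i => hwd (h.root_W14.2 i).1
  have sm : AEStronglyMeasurable (root ρ) (muQ T) := (wq 0).1.1
  have sQ : Q T 0 (root ρ) := by
    refine Q.of_bound sm (√C) ?_
    filter_upwards [hb] with p hp
    rw [root, abs_of_nonneg (Real.sqrt_nonneg _)]
    exact Real.sqrt_le_sqrt hp.2.le
  have ρQ : Q T 0 ρ := by simpa using (sQ.mul sQ).congr hss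
  have sinv : Q T 0 (fun p => (2 * root ρ p)⁻¹) := by
    refine Q.of_bound ((sm.aemeasurable.const_mul 2).inv).aestronglyMeasurable ((2 * √C⁻¹)⁻¹) ?_
    filter_upwards [hb] with p hp
    have h1 : √C⁻¹ ≤ root ρ p := Real.sqrt_le_sqrt hp.1.le
    have h2 : 0 < √C⁻¹ := Real.sqrt_pos.2 hC1
    have h3 : 0 ≤ root ρ p := h2.le.trans h1
    rw [abs_of_nonneg (by positivity)]
    gcongr
  have q2 : ∀ i : Fin 2, Q T (1 / 2) (gradh T (root ρ) i) := fun i =>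
    Q.two_of_memLp (h.root_H2.2.1 (hor i)).2
  have Ds2 : ∀ i : Fin 2, DQr Eq (hor i) T 0 (1 / 2) (root ρ) (gradh T (root ρ) i) := fun i =>
    DQr.of_weakH hT (wq (hor i)) sQ (q2 i)
  have gρ : ∀ i : Fin 2, Q T (1 / 30) (gradh T ρ i) := fun i =>
    Q.of_memLp' (q := 30) (h.grad_L30 i).2 (by norm_num) (by simp) (by norm_num)
  have Dρ' : ∀ i : Fin 2, DQr Eq (hor i) T 0 (1 / 30) ρ (gradh T ρ i) := fun i =>
    DQr.of_weakH hT (hwd (h.grad_L30 i).1) ρQ (gρ i)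
  have hgr : ∀ i : Fin 2, ∀ᵐ p ∂muQ T, gradh T ρ i p = 2 * root ρ p * gradh T (root ρ) i p := by
    intro i
    have h1 := (Ds2 i).mul (Ds2 i)
    have h2 := LD.unique (Dρ' i).ld (h1.ld.congr hss (.of_forall fun p => rfl))
      (gρ i).aesm h1.dv.aesm
    filter_upwards [h2] with p hp
    rw [hp]; ring
  have Qq : ∀ i : Fin 2, Q T (1 / 30) (gradh T (root ρ) i) := by
    intro i
    have h1 : Q T (1 / 30) (fun p => gradh T ρ i p * (2 * root ρ p)⁻¹) := by
      simpa using (gρ i).mul sinv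
    refine h1.congr ?_
    filter_upwards [hgr i, hpos] with p hp hp'
    have : root ρ p ≠ 0 := (Real.sqrt_pos.2 hp').ne'
    rw [hp]; field_simp
  have Ds : ∀ i : Fin 2, DQr Eq (hor i) T 0 (1 / 30) (root ρ) (gradh T (root ρ) i) := fun i =>
    ⟨(Ds2 i).ld, sQ, Qq i⟩
  have Dρ : ∀ i : Fin 2, DQr Eq (hor i) T 0 (1 / 30) ρ (fun p => 2 * root ρ p * gradh T (root ρ) i p) :=
    fun i => (Dρ' i).congr (.of_forall fun _ => rfl) (hgr i)
  have wH : ∀ i j : Fin 2, WQ T (hor j)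
      (gradh T (root ρ) i) (gradh T (gradh T (root ρ) i) j) := fun i j =>
    hwd (h.root_H2.2.2 (hor i) (hor j)).1
  have QH : ∀ i j : Fin 2, Q T (1 / 2) (gradh T (gradh T (root ρ) i) j) := fun i j =>
    Q.two_of_memLp (h.root_H2.2.2 (hor i) (hor j)).2
  have Dq : ∀ i j : Fin 2, DQr Eq (hor j) T (1 / 30) (1 / 2) (gradh T (root ρ) i)
      (gradh T (gradh T (root ρ) i) j) := fun i j => DQr.of_weakH hT (wH i j) (Qq i) (QH i j)
  have hess : ∀ i j : Fin 2, Q T (1 / 2)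
      (fun p => (fld T ρ v).qq p * gradh T (gradh T (root ρ) i) j p) := by
    intro i j
    refine (Q.two_of_memLp (h.hess i j)).of_eq fun p => ?_
    rw [len_sq]; rfl
  have hρz := h.indep_z hT hγ
  have Dsz : DQr cAny 2 T 0 0 (root ρ) (fun _ => 0) := by
    refine ⟨(LD.comp_gen (φ := fun x => √x) (φ' := fun x => 1 / (2 * √x)) (S := Icc C⁻¹ C)
      isClosed_Icc ?_ ?_ (fun _ _ _ => trivial) hρz ?_).of_eq (fun _ => rfl) (fun p => by simp),
      sQ, Q.const 0⟩
    · intro y hy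
      exact Real.hasDerivAt_sqrt (hC1.trans_le hy.1).ne'
    · refine continuousOn_const.div (continuousOn_const.mul Real.continuous_sqrt.continuousOn) ?_
      intro y hy
      have := Real.sqrt_pos.2 (hC1.trans_le hy.1)
      positivity
    · filter_upwards [hb] with p hp using ⟨hp.1.le, hp.2.le⟩
  have w0 : ∀ e : SpT, HasWeakDeriv (cyl T) (testQ T) e (fun _ => 0) (fun _ => 0) := fun e =>
    ⟨integrable_zero _ _ _, integrable_zero _ _ _, fun φ _ => by simp⟩
  have wsz := Dsz.weakV zero_le_one zero_le_one
  have wqz : ∀ i : Fin 2, WQ T 2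
      (gradh T (root ρ) i) (fun _ => 0) := fun i => (wq (hor i)).comm wsz (w0 _)
  have wHz : ∀ i j : Fin 2, WQ T 2
      (gradh T (gradh T (root ρ) i) j) (fun _ => 0) := fun i j => (wH i j).comm (wqz i) (w0 _)
  have Dqz : ∀ i : Fin 2, DQr cAny 2 T (1 / 30) 0 (gradh T (root ρ) i) (fun _ => 0) := fun i =>
    DQr.of_weakV hT (wqz i) (Qq i) (Q.const 0)
  -- the velocity
  have Qv : ∀ j, Q T (1 / 10) (v j) := fun j =>
    Q.of_memLp' (q := 10) (h.vel_L10 j) (by norm_num) (by simp) (by norm_num)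
  have QV : ∀ j i, Q T (3 / 10) (dQ T i (v j)) := fun j i =>
    Q.of_memLp' (q := 10 / 3) (h.grad_vel j i) (by norm_num)
      (by rw [ENNReal.ofReal_div_of_pos (by norm_num)]; simp) (by norm_num)
  have Dv : ∀ j i : Fin 2, DQr Eq (hor i) T (1 / 10) (3 / 10) (v j) (gradh T (v j) i) := fun j i =>
    DQr.of_weakH hT (hwd ((h.vel_H2 j).2.1 (hor i)).1) (Qv j) (QV j (hor i))
  have wVV : ∀ j i k : Fin 2, WQ T (hor k)
      (gradh T (v j) i) (gradh T (gradh T (v j) i) k) := fun j i k =>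
    hwd ((h.vel_H2 j).2.2 (hor i) (hor k)).1
  have DV : ∀ j i k : Fin 2, DQr Eq (hor k) T (3 / 10) (1 / 2) (gradh T (v j) i)
      (gradh T (gradh T (v j) i) k) := fun j i k =>
    DQr.of_weakH hT (wVV j i k) (QV j (hor i)) (Q.two_of_memLp ((h.vel_H2 j).2.2 (hor i) (hor k)).2)
  have Dvz : ∀ j, DQr cAny 2 T (1 / 10) (3 / 10) (v j) (dQ T 2 (v j)) := fun j =>
    DQr.of_weakV hT (hwd ((h.vel_H2 j).2.1 2).1) (Qv j) (QV j 2)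
  have DZ : ∀ j, DQr cZero 2 T (3 / 10) (1 / 2) (dQ T 2 (v j)) (dQ T 2 (dQ T 2 (v j))) := fun j =>
    ⟨VZ.of_weak hT (h.neumann j), QV j 2, Q.two_of_memLp ((h.vel_H2 j).2.2 2 2).2⟩
  -- the vertical velocity
  have Qwz : Q T (1 / 2) (dQ T 2 (vert T ρ v)) := Q.two_of_memLp h.vert_vel.2
  have ww := hwd h.vert_vel.1
  have hriz : ∀ i : Fin 2, VD 2 T (fun p => 2 * root ρ p * gradh T (root ρ) i p) (fun _ => 0) :=
    fun i => ((Dsz.smulV 2).mul (Dqz i)).ld.of_eq (fun _ => rfl) (fun p => by ring)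
  obtain ⟨hVZ, hwz⟩ := vert_structure hT (fun i => (Dv i i).weaken)
    Dρ hpos hρz hriz (VD.of_weak hT ww) Qwz
  have Dw : DQr cZero 2 T (1 / 2) (1 / 2) (vert T ρ v) (dQ T 2 (vert T ρ v)) :=
    ⟨hVZ, hVZ.memLp_two ww.1.1 Qwz, Qwz⟩
  have hm : ∀ᵐ p ∂muQ T, (fld T ρ v).m p = ∑ i, (2 * root ρ p * gradh T (root ρ) i p * zmean (v i) p
        + ρ p * zmean (gradh T (v i) i) p) := by
    filter_upwards [hwz] with p hp
    simp only [fld, hp, Fin.sum_univ_two]; ring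
  have Dm : DQr cAny 2 T (1 / 2) 0 (fld T ρ v).m (fun _ => 0) := by
    refine ⟨?_, ?_, Q.const 0⟩
    · have h1 : ∀ i : Fin 2, VD 2 T (fun p => 2 * root ρ p * gradh T (root ρ) i p * zmean (v i) p
        + ρ p * zmean (gradh T (v i) i) p) (fun _ => 0) := fun i =>
        (VD.add (VD.mul (hriz i) (VD.zmean (v i))) (VD.mul hρz (VD.zmean (gradh T (v i) i)))).of_eq
          (fun _ => rfl) (fun p => by ring)
      refine LD.congr (VD.add (h1 0) (h1 1)) ?_ (.of_forall fun p => by ring)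
      filter_upwards [hm] with p hp
      rw [hp, Fin.sum_univ_two]
    · have h1 : Q T (1 / 2) (fun p => ρ p * dQ T 2 (vert T ρ v) p) := by simpa using ρQ.mul Qwz
      have h2 : ∀ i : Fin 2, Q T (1 / 2) (fun p => 2 * root ρ p * (gradh T (root ρ) i p * v i p)) :=
        fun i => ((sQ.const_mul 2).mul ((Qq i).mul (Qv i))).mono
      have h3 : ∀ i : Fin 2, Q T (1 / 2) (fun p => ρ p * gradh T (v i) i p) := fun i =>
        (ρQ.mul (QV i (hor i))).mono
      exact (h1.add (((h2 0).add (h2 1)).add ((h3 0).add (h3 1)))).of_eq fun p => by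
        simp only [fld]; ring
  have hDX := Fld.DX_reg (u := fld T ρ v) Dq hess
  have sγ : ∀ {f : SpT → ℝ} {a : ℝ}, a ≤ 1 → Q T a f → Integrable f (muQ T) := fun ha h => h.integrable ha
  have vert_prod : ∀ {f g : SpT → ℝ} {a b : ℝ}, DQr cZero 2 T a b f g → a ≤ 1 → b ≤ 1 → 0 ≤ b →
      ∀ᵐ p ∂muQ T, dQ T 2 (fun q => ρ q * f q) p = ρ p * g p := by
    intro f g a b hf ha hb hb0
    have h1 : VD 2 T (fun p => ρ p * f p) (fun p => ρ p * g p) :=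
      (VD.mul hρz hf.toV.ld).of_eq (fun _ => rfl) (fun p => by ring)
    exact dQ_vert_eq hT h1 ((ρQ.mul hf.fn).integrable (by linarith))
      ((ρQ.mul hf.dv).integrable (by linarith))
  have DHz : ∀ i j : Fin 2, DQr cAny 2 T (1 / 2) 0 (gradh T (gradh T (root ρ) i) j) (fun _ => 0) :=
    fun i j => DQr.of_weakV hT (wHz i j) (QH i j) (Q.const 0)
  refine ⟨⟨C, hC, hb⟩, fun _ => rfl, Ds, Dq, Dsz, Dqz, DHz, hess, ?_, Dv, DV, ?_, Dvz, DZ, Dw, Dm,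
    .of_forall fun p => rfl, TD.of_weak hT (hasWeakDeriv_weakDeriv h.dt_dens.1) h.cont_dens,
    fun j => TD.of_weak hT (hasWeakDeriv_weakDeriv (h.dt_vel j).1) (h.cont_vel j),
    Q.two_of_memLp h.dt_dens.2, fun j => Q.two_of_memLp (h.dt_vel j).2, ?_, ?_⟩
  · exact HasWeakDeriv.uniqueH hT ((wq (hor 0)).comm (wq (hor 1)) (wH 1 0)) (wH 0 1)
  · intro j
    have wV : ∀ i : Fin 2, WQ T (hor i) (v j)
        (gradh T (v j) i) := fun i => hwd ((h.vel_H2 j).2.1 (hor i)).1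
    exact HasWeakDeriv.uniqueH hT ((wV 0).comm (wV 1) (wVV j 1 0)) (wVV j 0 1)
  · have h1 : ∀ i : Fin 2, ∀ᵐ p ∂muQ T, dQ T (hor i) (fun q => ρ q * v i q) p
        = 2 * root ρ p * gradh T (root ρ) i p * v i p + ρ p * gradh T (v i) i p := fun i =>
      ((Dρ i).mul (Dv i i)).dQ_eq hT
    have h2 := vert_prod Dw (by norm_num) (by norm_num) (by norm_num)
    have h3 : ∀ i : Fin 2, ∀ᵐ p ∂muQ T,
        dQ T (hor i) (fun q => len (gradh T (root ρ)) q ^ 2 * gradh T (root ρ) i q) p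
          = (fld T ρ v).DX i i p := by
      intro i
      have : (fun q => len (gradh T (root ρ)) q ^ 2 * gradh T (root ρ) i q) = (fld T ρ v).X i := by
        funext q; rw [len_sq]; rfl
      rw [this]
      exact (hDX i i).dQ_eq hT
    filter_upwards [h.mass, h1 0, h1 1, h2, h3 0, h3 1] with p hp a0 a1 a2 a3 a4
    simp only [divh, Gterm, laph, Fin.sum_univ_two, a0, a1, a2, a3, a4] at hp
    simp only [Fld.divρv, Fld.G]
    simp only [fld] at *
    simp only [gradh] at *
    linarith
  · intro j
    have hγρ : ∀ᵐ p ∂muQ T, gradh T (fun q => ρ q ^ γ) j p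
        = γ * ρ p ^ (γ - 1) * (2 * root ρ p * gradh T (root ρ) j p) := by
      have h1 : DQr Eq (hor j) T 0 (1 / 30) (fun p => ρ p ^ γ)
          (fun p => γ * ρ p ^ (γ - 1) * (2 * root ρ p * gradh T (root ρ) j p)) := by
        refine DQr.comp (φ := fun x => x ^ γ) (φ' := fun x => γ * x ^ (γ - 1)) (lo := C⁻¹) (hi := C)
          (fun a b h => by rw [h]) ?_ ?_ (Dρ j) ?_
        · intro y hy
          exact Real.hasDerivAt_rpow_const (Or.inl (hC1.trans_le hy.1).ne')
        · refine continuousOn_const.mul (continuousOn_id.rpow_const fun y hy => ?_)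
          exact Or.inl (hC1.trans_le hy.1).ne'
        · filter_upwards [hb] with p hp using ⟨hp.1.le, hp.2.le⟩
      exact h1.dQ_eq hT
    have h1 : ∀ i : Fin 2, ∀ᵐ p ∂muQ T, dQ T (hor i) (fun q => ρ q * symGrad T v i j q) p
        = 2 * root ρ p * gradh T (root ρ) i p * symGrad T v i j p
          + ρ p * ((gradh T (gradh T (v j) i) i p + gradh T (gradh T (v i) j) i p) / 2) := by
      intro i
      have h2 : DQr Eq (hor i) T (3 / 10) (1 / 2) (symGrad T v i j)
          (fun p => (gradh T (gradh T (v j) i) i p + gradh T (gradh T (v i) j) i p) / 2) :=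
        ((((DV j i i).addH (DV i j i)).smulH (1 / 2)).of_eq
          (fun p => by simp only [symGrad]; ring) (fun p => by ring)).weaken
      exact ((Dρ i).mul h2).dQ_eq hT
    have h2 := vert_prod (DZ j) (by norm_num) (by norm_num) (by norm_num)
    have h3 : ∀ i : Fin 2, ∀ᵐ p ∂muQ T, dQ T (hor i) (fun q => ρ q * gradh T (v j) i q) p
        = 2 * root ρ p * gradh T (root ρ) i p * gradh T (v j) i p
          + ρ p * gradh T (gradh T (v j) i) i p := fun i =>
      ((Dρ i).mul (DV j i i)).dQ_eq hT
    filter_upwards [h.momentum j, hγρ, h1 0, h1 1, h2, h3 0, h3 1] with p hp a0 a1 a2 a3 a4 a5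
    simp only [divh, Fterm, Fin.sum_univ_two, a0, a1, a2, a3, a4, a5, len_sq, len_eq v] at hp
    simp only [Fld.D, Fld.qq, Fld.vv]
    simp only [fld] at *
    simp only [symGrad] at hp
    rw [hp]
    ring

end Solution

/-! ### Exact derivatives and derived fields -/

/-- Functions whose integral against every continuous weight in time vanishes. -/
def WNull (T : ℝ) (g : SpT → ℝ) : Prop :=
  ∀ τ ≤ T, ∀ w : ℝ → ℝ, Continuous w → NullInt τ (fun p => w p.1 * g p)

namespace WNull

variable {T : ℝ} {f g : SpT → ℝ}

theorem add (hf : WNull T f) (hg : WNull T g) : WNull T (fun p => f p + g p) :=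
  fun τ hτ w hw => ((hf τ hτ w hw).add (hg τ hτ w hw)).of_eq fun p => by ring

theorem const_mul (c : ℝ) (hf : WNull T f) : WNull T (fun p => c * f p) :=
  fun τ hτ w hw => ((hf τ hτ w hw).const_mul c).of_eq fun p => by ring

theorem null (hf : WNull T f) {τ : ℝ} (hτ : τ ≤ T) : NullInt τ f :=
  (hf τ hτ (fun _ => 1) continuous_const).of_eq fun _ => one_mul _

end WNull

theorem DQr.wnull {a b : ℝ} (hf : DQr Eq k T a b f g) (hb : b ≤ 1 := by norm_num) :
    WNull T g := fun _ hτ _ hw =>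
  NullInt.time_weight (fun x a b h => by rw [h]) hw (hf.mono_time hτ) hb

theorem DQr.wnullZ {a b : ℝ} (hf : DQr cZero k T a b f g) (hb : b ≤ 1 := by norm_num) :
    WNull T g := fun _ hτ _ hw =>
  NullInt.time_weight (fun x a b h => by rw [h.1, h.2]) hw (hf.mono_time hτ) hb

/-- Divergences of horizontal fields have integral zero. -/
theorem WNull.div {a b : ℝ} {F G : Fin 2 → SpT → ℝ} (h : ∀ i, DQr Eq (hor i) T a b (F i) (G i))
    (hb : b ≤ 1 := by norm_num) : WNull T (fun p => G 0 p + G 1 p) := ((h 0).wnull hb).add ((h 1).wnull hb)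

namespace Fld

variable (u : Fld)

/-- `ρ^{-1/2}`. -/
def R (p : SpT) : ℝ := (u.s p)⁻¹

/-- Powers of the density. -/
def pw (a : ℝ) (p : SpT) : ℝ := u.ρ p ^ a

/-- `½ ∂ᵢ |v|²`. -/
def vV (i : Fin 2) (p : SpT) : ℝ := u.v 0 p * u.V 0 i p + u.v 1 p * u.V 1 i p

/-- `½ ∂_z |v|²`. -/
def vZ (p : SpT) : ℝ := u.v 0 p * u.Z 0 p + u.v 1 p * u.Z 1 p

/-- `∂ₖ 𝒟ᵢⱼ`. -/
def DD (i j k : Fin 2) (p : SpT) : ℝ := (u.VV j i k p + u.VV i j k p) / 2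

end Fld

namespace Reg

variable {γ p₀ ε T : ℝ} {u : Fld}

theorem pos (h : Reg γ p₀ ε T u) : ∀ᵐ p ∂muQ T, 0 < u.s p ∧ u.ρ p = u.s p ^ 2 ∧ u.R p * u.s p = 1 := by
  obtain ⟨C, hC, hb⟩ := h.bd
  filter_upwards [hb] with p hp
  have h1 : 0 < u.ρ p := (inv_pos.2 hC).trans hp.1
  have h2 : 0 < u.s p := by rw [h.sdef]; exact Real.sqrt_pos.2 h1
  refine ⟨h2, ?_, inv_mul_cancel₀ h2.ne'⟩
  rw [h.sdef, Real.sq_sqrt h1.le]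

theorem bds (h : Reg γ p₀ ε T u) : ∃ c C : ℝ, 0 < c ∧ ∀ᵐ p ∂muQ T, u.s p ∈ Icc c C := by
  obtain ⟨C, hC, hb⟩ := h.bd
  refine ⟨√C⁻¹, √C, Real.sqrt_pos.2 (inv_pos.2 hC), ?_⟩
  filter_upwards [hb] with p hp
  rw [h.sdef]
  exact ⟨Real.sqrt_le_sqrt hp.1.le, Real.sqrt_le_sqrt hp.2.le⟩

theorem Dρ (h : Reg γ p₀ ε T u) (i : Fin 2) :
    DQr Eq (hor i) T 0 (1 / 30) u.ρ (fun p => 2 * u.s p * u.q i p) := by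
  refine (((h.Ds i).mul (h.Ds i)).weaken).congr ?_ ?_
  · filter_upwards [h.pos] with p hp
    rw [hp.2.1]; ring
  · exact .of_forall fun p => by ring

theorem Dρz (h : Reg γ p₀ ε T u) : DQr cAny 2 T 0 0 u.ρ (fun _ => 0) := by
  refine ((h.Dsz.mul h.Dsz).weaken).congr ?_ ?_
  · filter_upwards [h.pos] with p hp
    rw [hp.2.1]; ring
  · exact .of_forall fun p => by ring

theorem comp_s {c : ℝ → ℝ → Prop} {b : ℝ} {φ φ' : ℝ → ℝ} (h : Reg γ p₀ ε T u)
    (hc : ∀ a b, c a b → c (φ a) (φ b)) (hφ : ∀ y, 0 < y → HasDerivAt φ (φ' y) y)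
    (hφc : ContinuousOn φ' (Ioi 0)) (hf : DQr c k T 0 b u.s g) : DQr c k T 0 b (fun p => φ (u.s p)) (fun p => φ' (u.s p) * g p) := by
  obtain ⟨c, C, hc0, hb⟩ := h.bds
  exact DQr.comp hc (fun y hy => hφ y (hc0.trans_le hy.1))
    (hφc.mono fun y hy => hc0.trans_le hy.1) hf hb

theorem cont_rpow (a : ℝ) : ContinuousOn (fun x : ℝ => x ^ a) (Ioi 0) :=
  continuousOn_id.rpow_const fun _ hy => Or.inl (ne_of_gt hy)

theorem pw_eq (h : Reg γ p₀ ε T u) (a : ℝ) : ∀ᵐ p ∂muQ T, u.s p ^ (2 * a) = u.pw a p := by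
  filter_upwards [h.pos] with p hp
  rw [Fld.pw, hp.2.1, Real.rpow_mul hp.1.le, Real.rpow_two]

theorem pw_deriv (h : Reg γ p₀ ε T u) (a : ℝ) (g : SpT → ℝ) :
    ∀ᵐ p ∂muQ T, 2 * a * u.s p ^ (2 * a - 1) * g p = 2 * a * u.pw a p * u.R p * g p := by
  filter_upwards [h.pos, h.pw_eq a] with p hp hp'
  rw [Real.rpow_sub_one hp.1.ne', hp', Fld.R]; ring

theorem Dpw (h : Reg γ p₀ ε T u) (a : ℝ) (i : Fin 2) :
    DQr Eq (hor i) T 0 (1 / 30) (u.pw a) (fun p => 2 * a * u.pw a p * u.R p * u.q i p) :=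
  (h.comp_s (φ := fun x => x ^ (2 * a)) (φ' := fun x => 2 * a * x ^ (2 * a - 1))
    (fun a b h => by rw [h]) (fun y hy => Real.hasDerivAt_rpow_const (Or.inl hy.ne'))
    (continuousOn_const.mul (cont_rpow _)) (h.Ds i)).congr (h.pw_eq a) (h.pw_deriv a _)

theorem Dpwz (h : Reg γ p₀ ε T u) (a : ℝ) : DQr cAny 2 T 0 0 (u.pw a) (fun _ => 0) :=
  (h.comp_s (φ := fun x => x ^ (2 * a)) (φ' := fun x => 2 * a * x ^ (2 * a - 1))
    (fun _ _ _ => trivial) (fun y hy => Real.hasDerivAt_rpow_const (Or.inl hy.ne'))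
    (continuousOn_const.mul (cont_rpow _)) h.Dsz).congr (h.pw_eq a)
    (.of_forall fun p => by ring)

theorem DR (h : Reg γ p₀ ε T u) (i : Fin 2) :
    DQr Eq (hor i) T 0 (1 / 30) u.R (fun p => - u.R p ^ 2 * u.q i p) :=
  (h.comp_s (φ := fun x => x⁻¹) (φ' := fun x => -(x ^ 2)⁻¹)
    (fun a b h => by rw [h]) (fun y hy => hasDerivAt_inv hy.ne')
    ((continuousOn_id.pow 2).inv₀ fun y hy => pow_ne_zero 2 (ne_of_gt hy)).neg (h.Ds i)).of_eq
    (fun _ => rfl) (fun p => by simp only [Fld.R, inv_pow])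

theorem DRz (h : Reg γ p₀ ε T u) : DQr cAny 2 T 0 0 u.R (fun _ => 0) :=
  (h.comp_s (φ := fun x => x⁻¹) (φ' := fun x => -(x ^ 2)⁻¹)
    (fun _ _ _ => trivial) (fun y hy => hasDerivAt_inv hy.ne')
    ((continuousOn_id.pow 2).inv₀ fun y hy => pow_ne_zero 2 (ne_of_gt hy)).neg h.Dsz).of_eq
    (fun _ => rfl) (fun p => by ring)

theorem DX (h : Reg γ p₀ ε T u) (i j : Fin 2) :
    DQr Eq (hor j) T (1 / 10) (1 / 2) (u.X i) (u.DX i j) := Fld.DX_reg h.Dq h.hess i j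

theorem Dvv (h : Reg γ p₀ ε T u) (i : Fin 2) :
    DQr Eq (hor i) T (1 / 5) (2 / 5) u.vv (fun p => 2 * u.vV i p) :=
  ((((h.Dv 0 i).mul (h.Dv 0 i)).addH ((h.Dv 1 i).mul (h.Dv 1 i))).of_eq
    (fun p => by simp only [Fld.vv]; ring) (fun p => by simp only [Fld.vV]; ring)).weaken

theorem Dvvz (h : Reg γ p₀ ε T u) : DQr cAny 2 T (1 / 5) (2 / 5) u.vv (fun p => 2 * u.vZ p) :=
  ((((h.Dvz 0).mul (h.Dvz 0)).addV ((h.Dvz 1).mul (h.Dvz 1))).of_eq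
    (fun p => by simp only [Fld.vv]; ring) (fun p => by simp only [Fld.vZ]; ring)).weaken

theorem DD (h : Reg γ p₀ ε T u) (i j k : Fin 2) :
    DQr Eq (hor k) T (3 / 10) (1 / 2) (u.D i j) (u.DD i j k) :=
  ((((h.DV j i k).addH (h.DV i j k)).smulH (1 / 2)).of_eq
    (fun p => by simp only [Fld.D]; ring) (fun p => by simp only [Fld.DD]; ring)).weaken

theorem Dqq (h : Reg γ p₀ ε T u) (j : Fin 2) : DQr Eq (hor j) T (1 / 15) (8 / 15) u.qq
      (fun p => 2 * (u.q 0 p * u.H 0 j p + u.q 1 p * u.H 1 j p)) :=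
  ((((h.Dq 0 j).mul (h.Dq 0 j)).addH ((h.Dq 1 j).mul (h.Dq 1 j))).of_eq
    (fun p => by simp only [Fld.qq]; ring) (fun p => by ring)).weaken

/-- `|v|`. -/
theorem Qlen (h : Reg γ p₀ ε T u) : Q T (1 / 10) (fun p => √(u.vv p)) := by
  have h1 : ∀ j, Q T (1 / 10) (u.v j) := fun j => (h.Dv j 0).fn
  have h2 : Q T (1 / 10) (fun p => |u.v 0 p| + |u.v 1 p|) := (h1 0).abs.add (h1 1).abs
  refine h2.of_le ?_ (.of_forall fun p => ?_)
  · exact (Real.continuous_sqrt.comp_aestronglyMeasurable (h.Dvv 0).fn.aesm)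
  · rw [abs_of_nonneg (Real.sqrt_nonneg _), abs_of_nonneg (by positivity)]
    apply Real.sqrt_le_iff.2
    refine ⟨by positivity, ?_⟩
    have h3 := sq_abs (u.v 0 p)
    have h4 := sq_abs (u.v 1 p)
    have h5 := mul_nonneg (abs_nonneg (u.v 0 p)) (abs_nonneg (u.v 1 p))
    simp only [Fld.vv]
    nlinarith

/-- `∂ₜ ρᵃ`. -/
theorem Tpw (h : Reg γ p₀ ε T u) (hT : 0 < T) (a : ℝ) :
    TD T (u.pw a) (fun p => a * u.pw (a - 1) p * u.ρt p) := by
  obtain ⟨C, hC, hb⟩ := h.bd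
  have hC1 : 0 < C⁻¹ := inv_pos.2 hC
  refine TD.comp hT (φ := fun x => x ^ a) (φ' := fun x => a * x ^ (a - 1)) (S := Icc C⁻¹ C)
    isClosed_Icc ?_ ?_ h.tρ ?_
  · intro y hy
    exact Real.hasDerivAt_rpow_const (Or.inl (hC1.trans_le hy.1).ne')
  · refine continuousOn_const.mul ((cont_rpow _).mono fun y hy => hC1.trans_le hy.1)
  · filter_upwards [hb] with p hp using ⟨hp.1.le, hp.2.le⟩

theorem pw_sub_one (h : Reg γ p₀ ε T u) (a : ℝ) :
    ∀ᵐ p ∂muQ T, u.pw (a - 1) p = u.pw a p * u.R p ^ 2 ∧ 0 < u.pw a p := by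
  filter_upwards [h.pos] with p ⟨h1, h2, _⟩
  have h3 : 0 < u.ρ p := by rw [h2]; positivity
  refine ⟨?_, Real.rpow_pos_of_pos h3 a⟩
  rw [Fld.pw, Fld.pw, Real.rpow_sub_one h3.ne', Fld.R, h2, inv_pow, div_eq_mul_inv]

theorem posAll (h : Reg γ p₀ ε T u) (hT : 0 < T) {t : ℝ} (ht : t ∈ Icc 0 T) :
    ∃ c C : ℝ, 0 < c ∧ ∀ᵐ x ∂muO, u.ρ (t, x) ∈ Icc c C := by
  obtain ⟨C, hC, hb⟩ := h.bd
  refine ⟨C⁻¹, C, inv_pos.2 hC, h.tρ.mem_closed hT isClosed_Icc ?_ ht⟩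
  filter_upwards [hb] with p hp using ⟨hp.1.le, hp.2.le⟩

end Reg

/-! ### The basic energy -/

namespace Fld

variable (u : Fld)

/-- `|𝒟(v)|²`. -/
def D2 (p : SpT) : ℝ := u.D 0 0 p ^ 2 + u.D 0 1 p ^ 2 + u.D 1 0 p ^ 2 + u.D 1 1 p ^ 2

/-- `|∂_z v|²`. -/
def Z2 (p : SpT) : ℝ := u.Z 0 p ^ 2 + u.Z 1 p ^ 2

/-- The dissipation in the energy balance. -/
def eDiss (p₀ ε : ℝ) (p : SpT) : ℝ :=
  u.ρ p * u.D2 p + u.ρ p * u.Z2 p + ε / 4 * (u.qq p * u.vv p) + ε / 2 * (u.qq p ^ 2 * u.vv p)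
    + ε / 2 * (u.pw (-p₀) p * u.vv p) + ε * (u.ρ p * √(u.vv p) ^ 3 * u.vv p)
    + p₀ / 2 * (ε ^ 2 * (u.pw (-p₀) p ^ 2 * u.R p ^ 2)) + ε * (u.qq p + u.qq p ^ 2)

/-- The weight of the kinetic and internal energies. -/
def eK (p₀ : ℝ) : ℝ := 1 + (1 + p₀) ^ 2 / p₀

/-- The energy density. -/
def eY (γ p₀ ε : ℝ) (p : SpT) : ℝ :=
  eK p₀ * (1 / 2 * (u.ρ p * u.vv p) + (γ - 1)⁻¹ * u.pw γ p) + ε * u.pw (-p₀) p + u.ρ p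

/-- The time derivative of the energy density. -/
def eYt (γ p₀ ε : ℝ) (p : SpT) : ℝ :=
  eK p₀ * (1 / 2 * (u.ρt p * u.vv p + u.ρ p * (2 * (u.v 0 p * u.vt 0 p + u.v 1 p * u.vt 1 p)))
    + (γ - 1)⁻¹ * (γ * u.pw (γ - 1) p * u.ρt p))
    + ε * (-p₀ * u.pw (-p₀ - 1) p * u.ρt p) + u.ρt p

/-- The Gronwall exponent. -/
def eL (γ p₀ : ℝ) : ℝ := eK p₀ * (γ / (γ - 1)) + 1

end Fld

namespace Reg

variable {γ p₀ ε T : ℝ} {u : Fld}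

theorem energy_kinetic (h : Reg γ p₀ ε T u) : ∃ N : SpT → ℝ, WNull T N ∧ ∀ᵐ p ∂muQ T,
      1 / 2 * (u.ρt p * u.vv p + u.ρ p * (2 * (u.v 0 p * u.vt 0 p + u.v 1 p * u.vt 1 p)))
          + γ * u.pw (γ - 1) p * (2 * u.s p * (u.q 0 p * u.v 0 p + u.q 1 p * u.v 1 p))
        = N p - (u.ρ p * u.D2 p + u.ρ p * u.Z2 p
          + √ε * u.ρ p * (u.V 0 0 p ^ 2 + u.V 0 1 p ^ 2 + u.V 1 0 p ^ 2 + u.V 1 1 p ^ 2)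
          + ε / 2 * (u.qq p * u.vv p) + ε / 2 * (u.qq p ^ 2 * u.vv p)
          + ε / 2 * (u.pw (-p₀) p * u.vv p) + ε * (u.ρ p * √(u.vv p) ^ 3 * u.vv p))
          - ε * u.s p * (u.q 0 p * u.vV 0 p + u.q 1 p * u.vV 1 p) := by
  have n1 := WNull.div (fun i => (h.Dρ i).mul ((h.Dv i i).mul (h.Dvv i)))
  have n1z := ((h.Dw.mul h.Dρz).mul h.Dvvz).wnullZ
  have n2 := fun j => WNull.div (fun i => (h.Dρ i).mul ((h.DD i j i).mul (h.Dv j i)))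
  have n3 := fun j => (((h.DZ j).mul h.Dρz).mul (h.Dvz j)).wnullZ
  have n4 := fun j => WNull.div (fun i => (h.Dρ i).mul ((h.DV j i i).mul (h.Dv j i)))
  have n5 := WNull.div (fun i => (h.Ds i).mul ((h.Dq i i).mul (h.Dvv i)))
  have n6 := WNull.div (fun i => (h.Ds i).mul ((h.DX i i).mul (h.Dvv i)))
  have hN := ((((((n1.add n1z).const_mul (-1 / 2)).add ((n2 0).add (n2 1))).add
    ((n3 0).add (n3 1))).add (((n4 0).add (n4 1)).const_mul √ε)).add ((n5.add n6).const_mul (ε / 2)))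
  refine ⟨_, hN, ?_⟩
  filter_upwards [h.mass, h.mom 0, h.mom 1, h.pos] with p mass m0 m1 ⟨hs, hρ, _⟩
  have hA : u.ρ p ^ (γ - 1) = u.pw (γ - 1) p := rfl
  have hB : u.ρ p ^ (-p₀) = u.pw (-p₀) p := rfl
  simp only [Fld.G, Fld.divρv, hA, hB] at mass m0 m1
  rw [hρ] at mass m0 m1 ⊢
  generalize u.pw (γ - 1) p = A at *
  generalize u.pw (-p₀) p = B at *
  generalize √(u.vv p) = l at *
  simp only [Fld.D2, Fld.Z2, Fld.X, Fld.DX, Fld.qq, Fld.vv, Fld.vV, Fld.vZ, Fld.DD, Fld.D] at *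
  linear_combination u.v 0 p * m0 + u.v 1 p * m1 + (1 / 2 * (u.v 0 p ^ 2 + u.v 1 p ^ 2)) * mass

theorem energy_internal (hγ : 1 < γ) (h : Reg γ p₀ ε T u) : ∃ N : SpT → ℝ, WNull T N ∧ ∀ᵐ p ∂muQ T,
      (γ - 1)⁻¹ * (γ * u.pw (γ - 1) p * u.ρt p)
          - γ * u.pw (γ - 1) p * (2 * u.s p * (u.q 0 p * u.v 0 p + u.q 1 p * u.v 1 p))
        = N p - γ / (γ - 1) * (2 * γ - 1) * ε * (u.pw (γ - 1) p * (u.qq p + u.qq p ^ 2))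
          + γ / (γ - 1) * ε * (u.pw (γ - 1) p * u.pw (-p₀) p) := by
  have n7 := WNull.div (fun i => (h.Dρ i).mul ((h.Dpw (γ - 1) i).mul (h.Dv i i)))
  have n7z := ((h.Dw.mul h.Dρz).mul (h.Dpwz (γ - 1))).wnullZ
  have n8 := WNull.div (fun i => (h.Ds i).mul ((h.Dpw (γ - 1) i).mul (h.Dq i i)))
  have n8x := WNull.div (fun i => (h.Ds i).mul ((h.Dpw (γ - 1) i).mul (h.DX i i)))
  have hN := ((n7.add n7z).const_mul (-(γ / (γ - 1)))).add
    ((n8.add n8x).const_mul (γ / (γ - 1) * ε))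
  refine ⟨_, hN, ?_⟩
  filter_upwards [h.mass, h.pos] with p mass ⟨hs, hρ, hR⟩
  have hB : u.ρ p ^ (-p₀) = u.pw (-p₀) p := rfl
  simp only [Fld.G, Fld.divρv, hB] at mass
  rw [hρ] at mass ⊢
  obtain ⟨g, hg⟩ : ∃ g, g = γ / (γ - 1) := ⟨_, rfl⟩
  have hg1 : g * (γ - 1) = γ := by rw [hg]; exact div_mul_cancel₀ _ (by linarith)
  have hg2 : (γ - 1)⁻¹ * γ = g := by rw [hg]; ring
  rw [← hg, ← mul_assoc, ← mul_assoc, hg2]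
  generalize u.pw (γ - 1) p = A at *
  generalize u.pw (-p₀) p = B at *
  simp only [Fld.X, Fld.DX, Fld.qq] at *
  linear_combination (g * A) * mass
    + (2 * A * u.s p * (u.q 0 p * u.v 0 p + u.q 1 p * u.v 1 p)) * hg1
    + (g * 2 * (γ - 1) * A * u.s p * (u.q 0 p * u.v 0 p + u.q 1 p * u.v 1 p)
      - g * ε * 2 * (γ - 1) * A * (u.q 0 p ^ 2 + u.q 1 p ^ 2 + (u.q 0 p ^ 2 + u.q 1 p ^ 2) ^ 2)) * hR

theorem energy_pressure (h : Reg γ p₀ ε T u) : ∃ N : SpT → ℝ, WNull T N ∧ ∀ᵐ p ∂muQ T,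
      ε * (-p₀ * u.pw (-p₀ - 1) p * u.ρt p) + u.ρt p
        = N p + ε * (1 + p₀) * (u.pw (-p₀) p * (u.V 0 0 p + u.V 1 1 p))
          - p₀ * ε ^ 2 * (2 * p₀ + 1) * (u.pw (-p₀) p * u.R p ^ 2 * (u.qq p + u.qq p ^ 2))
          - p₀ * ε ^ 2 * (u.pw (-p₀) p ^ 2 * u.R p ^ 2)
          - ε * (u.qq p + u.qq p ^ 2) + ε * u.pw (-p₀) p := by
  have n9 := WNull.div (fun i => (h.Dpw (-p₀) i).mul (h.Dv i i))
  have n9z := (h.Dw.mul (h.Dpwz (-p₀))).wnullZ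
  have n10 := WNull.div (fun i => (h.Dpw (-p₀) i).mul ((h.DR i).mul (h.Dq i i)))
  have n10x := WNull.div (fun i => (h.Dpw (-p₀) i).mul ((h.DR i).mul (h.DX i i)))
  have n11 := WNull.div (fun i => (h.Dρ i).mul (h.Dv i i))
  have n11z := (h.Dw.mul h.Dρz).wnullZ
  have n12 := WNull.div (fun i => (h.Ds i).mul (h.Dq i i))
  have n12x := WNull.div (fun i => (h.Ds i).mul (h.DX i i))
  have hN := ((((n9.const_mul (-ε)).add (n9z.const_mul (ε * p₀))).add
    ((n10.add n10x).const_mul (-(p₀ * ε ^ 2)))).add ((n11.add n11z).const_mul (-1))).add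
    ((n12.add n12x).const_mul ε)
  refine ⟨_, hN, ?_⟩
  filter_upwards [h.mass, h.pos, h.pw_sub_one (-p₀)] with p mass ⟨hs, hρ, hR⟩ ⟨hB1, _⟩
  have hB : u.ρ p ^ (-p₀) = u.pw (-p₀) p := rfl
  simp only [Fld.G, Fld.divρv, hB] at mass
  rw [hB1]
  rw [hρ] at mass ⊢
  generalize u.pw (-p₀) p = B at *
  simp only [Fld.X, Fld.DX, Fld.qq] at *
  have hR2 : u.R p ^ 2 * u.s p ^ 2 = 1 := by rw [← mul_pow, hR, one_pow]
  have hR3 : u.R p ^ 2 * u.s p = u.R p := by rw [sq, mul_assoc, hR, mul_one]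
  linear_combination (1 - p₀ * ε * B * u.R p ^ 2) * mass
    + (p₀ * ε * B * (u.V 0 0 p + u.V 1 1 p + u.wz p)) * hR2
    + (2 * p₀ * ε * B * (u.q 0 p * u.v 0 p + u.q 1 p * u.v 1 p)
      - p₀ * ε ^ 2 * B * (u.H 0 0 p + u.H 1 1 p
        + ((u.q 0 p ^ 2 + u.q 1 p ^ 2) * (u.H 0 0 p + u.H 1 1 p)
          + 2 * (u.q 0 p * u.H 0 0 p + u.q 1 p * u.H 1 0 p) * u.q 0 p
          + 2 * (u.q 0 p * u.H 0 1 p + u.q 1 p * u.H 1 1 p) * u.q 1 p))) * hR3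

theorem pw_interp {x a b : ℝ} (hx : 0 < x) (ha : 0 ≤ a) (hab : a ≤ b) :
    x ^ a * x ^ (-b) ≤ 1 + x ^ (-b) := by
  rw [← Real.rpow_add hx]
  rcases le_total 1 x with h | h
  · have h1 := Real.rpow_le_one_of_one_le_of_nonpos h (show a + -b ≤ 0 by linarith)
    have h2 := Real.rpow_nonneg hx.le (-b)
    linarith
  · have h1 := Real.rpow_le_rpow_of_exponent_ge hx h (show -b ≤ a + -b by linarith)
    linarith

theorem energy_ineq (hγ : 1 < γ) (hp : 0 < p₀) (hpγ : γ - 1 < p₀) (hε : 0 < ε) (hε1 : ε ≤ 1 / 4)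
    (h : Reg γ p₀ ε T u) : ∃ N : SpT → ℝ, WNull T N ∧ ∀ᵐ p ∂muQ T,
      u.eYt γ p₀ ε p ≤ N p - u.eDiss p₀ ε p + Fld.eL γ p₀ * (1 + ε * u.pw (-p₀) p) := by
  obtain ⟨N1, hN1, e1⟩ := h.energy_kinetic
  obtain ⟨N2, hN2, e2⟩ := h.energy_internal hγ
  obtain ⟨N3, hN3, e3⟩ := h.energy_pressure
  refine ⟨_, ((hN1.add hN2).const_mul (Fld.eK p₀)).add hN3, ?_⟩
  filter_upwards [e1, e2, e3, h.pos, h.pw_sub_one (-p₀), h.pw_sub_one (γ - 1)]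
    with p a1 a2 a3 ⟨hs, hρ, hR⟩ ⟨_, hB⟩ ⟨_, hA⟩
  have hAB : u.pw (γ - 1) p * u.pw (-p₀) p ≤ 1 + u.pw (-p₀) p :=
    pw_interp (by rw [hρ]; positivity) (by linarith) hpγ.le
  have hK1 : 1 ≤ Fld.eK p₀ := by unfold Fld.eK; have : 0 ≤ (1 + p₀) ^ 2 / p₀ := by positivity
                                 linarith
  have hl : 0 ≤ √(u.vv p) := Real.sqrt_nonneg _
  have hqq : 0 ≤ u.qq p := by unfold Fld.qq; positivity
  have hvv : 0 ≤ u.vv p := by unfold Fld.vv; positivity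
  have hZ : 0 ≤ u.Z2 p := by unfold Fld.Z2; positivity
  have hD : 0 ≤ u.D2 p := by unfold Fld.D2; positivity
  have hκ : 0 ≤ √ε := Real.sqrt_nonneg _
  have hκ2 : √ε ^ 2 = ε := Real.sq_sqrt hε.le
  have hκ1 : √ε ≤ 1 / 2 := by
    rw [Real.sqrt_le_left (by norm_num)]; linarith
  set W := u.V 0 0 p ^ 2 + u.V 0 1 p ^ 2 + u.V 1 0 p ^ 2 + u.V 1 1 p ^ 2 with hW
  have hW0 : 0 ≤ W := by positivity
  clear_value W
  -- the cross term of the artificial viscosities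
  have cross : -(ε * u.s p * (u.q 0 p * u.vV 0 p + u.q 1 p * u.vV 1 p))
      ≤ √ε * u.ρ p * W + ε / 4 * (u.qq p * u.vv p) := by
    have h1 : 0 ≤ √ε / 2 * ((u.s p * u.V 0 0 p + √ε * u.q 0 p * u.v 0 p) ^ 2
      + (u.s p * u.V 0 1 p + √ε * u.q 1 p * u.v 0 p) ^ 2
      + (u.s p * u.V 1 0 p + √ε * u.q 0 p * u.v 1 p) ^ 2
      + (u.s p * u.V 1 1 p + √ε * u.q 1 p * u.v 1 p) ^ 2) := by positivity
    have h2 : √ε / 2 * ((u.s p * u.V 0 0 p + √ε * u.q 0 p * u.v 0 p) ^ 2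
      + (u.s p * u.V 0 1 p + √ε * u.q 1 p * u.v 0 p) ^ 2
      + (u.s p * u.V 1 0 p + √ε * u.q 0 p * u.v 1 p) ^ 2
      + (u.s p * u.V 1 1 p + √ε * u.q 1 p * u.v 1 p) ^ 2)
      = √ε / 2 * (u.s p ^ 2 * W) + √ε ^ 2 * u.s p * (u.q 0 p * u.vV 0 p + u.q 1 p * u.vV 1 p)
        + √ε ^ 2 / 2 * √ε * (u.qq p * u.vv p) := by
      rw [hW]; simp only [Fld.vV, Fld.qq, Fld.vv]; ring
    rw [hκ2] at h2
    rw [h2] at h1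
    have h3 : ε / 2 * √ε * (u.qq p * u.vv p) ≤ ε / 2 * (1 / 2) * (u.qq p * u.vv p) := by gcongr
    have h4 : 0 ≤ √ε / 2 * (u.s p ^ 2 * W) := by positivity
    rw [hρ]
    linarith only [h1, h3, h4]
  -- the singular pressure
  have hdiv : (u.V 0 0 p + u.V 1 1 p) ^ 2 ≤ 2 * u.D2 p := by
    have h1 : 2 * u.D2 p = (u.V 0 0 p + u.V 1 1 p) ^ 2 + ((u.V 0 0 p - u.V 1 1 p) ^ 2
        + (u.V 0 1 p + u.V 1 0 p) ^ 2) := by simp only [Fld.D2, Fld.D]; ring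
    rw [h1]
    exact le_add_of_nonneg_right (by positivity)
  have press : ε * (1 + p₀) * (u.pw (-p₀) p * (u.V 0 0 p + u.V 1 1 p))
      ≤ p₀ / 2 * (ε ^ 2 * (u.pw (-p₀) p ^ 2 * u.R p ^ 2))
        + (1 + p₀) ^ 2 / p₀ * (u.ρ p * u.D2 p) := by
    have h1 : 0 ≤ p₀ / 2 * (ε * u.pw (-p₀) p * u.R p
        - (1 + p₀) / p₀ * (u.s p * (u.V 0 0 p + u.V 1 1 p))) ^ 2 := by positivity
    have h2 : p₀ / 2 * (ε * u.pw (-p₀) p * u.R p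
        - (1 + p₀) / p₀ * (u.s p * (u.V 0 0 p + u.V 1 1 p))) ^ 2
        = p₀ / 2 * (ε ^ 2 * (u.pw (-p₀) p ^ 2 * u.R p ^ 2))
          - ε * (1 + p₀) * (u.pw (-p₀) p * (u.V 0 0 p + u.V 1 1 p)) * (u.R p * u.s p)
          + (1 + p₀) ^ 2 / p₀ / 2 * (u.s p ^ 2 * (u.V 0 0 p + u.V 1 1 p) ^ 2) := by
      field_simp; ring
    rw [hR, mul_one] at h2
    rw [h2] at h1
    have h3 : (1 + p₀) ^ 2 / p₀ / 2 * (u.s p ^ 2 * (u.V 0 0 p + u.V 1 1 p) ^ 2)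
        ≤ (1 + p₀) ^ 2 / p₀ / 2 * (u.s p ^ 2 * (2 * u.D2 p)) := by gcongr
    rw [hρ]
    linarith only [h1, h3]
  have hg : 0 < γ / (γ - 1) := div_pos (by linarith) (by linarith)
  have hg2 : 0 ≤ γ / (γ - 1) * (2 * γ - 1) * ε * (u.pw (γ - 1) p * (u.qq p + u.qq p ^ 2)) := by
    have : 0 ≤ 2 * γ - 1 := by linarith
    positivity
  have hb2 : 0 ≤ p₀ * ε ^ 2 * (2 * p₀ + 1) * (u.pw (-p₀) p * u.R p ^ 2 * (u.qq p + u.qq p ^ 2)) := by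
    positivity
  have hAB' : γ / (γ - 1) * ε * (u.pw (γ - 1) p * u.pw (-p₀) p)
      ≤ γ / (γ - 1) * (1 + ε * u.pw (-p₀) p) := by
    calc _ ≤ γ / (γ - 1) * ε * (1 + u.pw (-p₀) p) := by gcongr
      _ = γ / (γ - 1) * (ε + ε * u.pw (-p₀) p) := by ring
      _ ≤ _ := by gcongr; linarith
  have hρ0 : 0 ≤ u.ρ p := by rw [hρ]; positivity
  have kin : 1 / 2 * (u.ρt p * u.vv p + u.ρ p * (2 * (u.v 0 p * u.vt 0 p + u.v 1 p * u.vt 1 p)))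
      + (γ - 1)⁻¹ * (γ * u.pw (γ - 1) p * u.ρt p)
      ≤ N1 p + N2 p - (u.ρ p * u.D2 p + u.ρ p * u.Z2 p + ε / 4 * (u.qq p * u.vv p)
        + ε / 2 * (u.qq p ^ 2 * u.vv p) + ε / 2 * (u.pw (-p₀) p * u.vv p)
        + ε * (u.ρ p * √(u.vv p) ^ 3 * u.vv p)) + γ / (γ - 1) * (1 + ε * u.pw (-p₀) p) := by
    linarith only [a1, a2, cross, hg2, hAB']
  set P := u.ρ p * u.Z2 p + ε / 4 * (u.qq p * u.vv p)
        + ε / 2 * (u.qq p ^ 2 * u.vv p) + ε / 2 * (u.pw (-p₀) p * u.vv p)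
        + ε * (u.ρ p * √(u.vv p) ^ 3 * u.vv p) with hP
  have hP0 : 0 ≤ P := by positivity
  clear_value P
  have hKP : P ≤ Fld.eK p₀ * P := le_mul_of_one_le_left hP0 hK1
  have kin' := mul_le_mul_of_nonneg_left kin (zero_le_one.trans hK1)
  have hKd : Fld.eK p₀ * (u.ρ p * u.D2 p) = u.ρ p * u.D2 p + (1 + p₀) ^ 2 / p₀ * (u.ρ p * u.D2 p) := by
    unfold Fld.eK; ring
  have hLs : Fld.eL γ p₀ * (1 + ε * u.pw (-p₀) p)
      = Fld.eK p₀ * (γ / (γ - 1) * (1 + ε * u.pw (-p₀) p)) + (1 + ε * u.pw (-p₀) p) := by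
    unfold Fld.eL; ring
  have hεB : 0 ≤ ε * u.pw (-p₀) p := by positivity
  have e4 : Fld.eK p₀ * (N1 p + N2 p - (u.ρ p * u.D2 p + u.ρ p * u.Z2 p + ε / 4 * (u.qq p * u.vv p)
        + ε / 2 * (u.qq p ^ 2 * u.vv p) + ε / 2 * (u.pw (-p₀) p * u.vv p)
        + ε * (u.ρ p * √(u.vv p) ^ 3 * u.vv p)) + γ / (γ - 1) * (1 + ε * u.pw (-p₀) p))
      = Fld.eK p₀ * (N1 p + N2 p) - Fld.eK p₀ * (u.ρ p * u.D2 p) - Fld.eK p₀ * P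
        + Fld.eK p₀ * (γ / (γ - 1) * (1 + ε * u.pw (-p₀) p)) := by rw [hP]; ring
  rw [e4] at kin'
  have a3' : ∀ x : ℝ, x + ε * (-p₀ * u.pw (-p₀ - 1) p * u.ρt p) + u.ρt p = x + (N3 p
      + ε * (1 + p₀) * (u.pw (-p₀) p * (u.V 0 0 p + u.V 1 1 p))
      - p₀ * ε ^ 2 * (2 * p₀ + 1) * (u.pw (-p₀) p * u.R p ^ 2 * (u.qq p + u.qq p ^ 2))
      - p₀ * ε ^ 2 * (u.pw (-p₀) p ^ 2 * u.R p ^ 2)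
      - ε * (u.qq p + u.qq p ^ 2) + ε * u.pw (-p₀) p) := fun x => by rw [← a3]; ring
  simp only [Fld.eYt, Fld.eDiss]
  rw [hLs, a3']
  linarith only [kin', hKP, hKd, press, hb2, hεB, hε1, hP]

end Reg

/-! ### The integrated energy inequality -/

theorem Q.integral_mono (hf : Q T 1 f) (hg : Q T 1 g) (h : ∀ᵐ p ∂muQ T, f p ≤ g p) : ∫ p, f p ∂muQ T ≤ ∫ p, g p ∂muQ T :=
  integral_mono_ae hf.integrable hg.integrable h

theorem Q.time_mul {a : ℝ} {w : ℝ → ℝ} (hf : Q T a f) (hw : Continuous w) :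
    Q T a (fun p => w p.1 * f p) := by
  have h1 : Q T 0 (fun p : SpT => w p.1) := by
    obtain ⟨C, hC⟩ := bounded_on_cyl (T := T) (hw.comp continuous_fst)
    exact Q.of_bound (hw.comp continuous_fst).aestronglyMeasurable C hC
  simpa using h1.mul hf

theorem AC1.exp_mul {ℓ : ℝ} (c : ℝ) :
    AC1 ℓ (fun s => Real.exp (c * s)) (fun s => c * Real.exp (c * s)) := by
  have h1 : ContDiff ℝ 1 fun s : ℝ => Real.exp (c * s) := by fun_prop
  refine (AC1.of_contDiff h1).congr (.of_forall fun s => ?_)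
  have h2 : HasDerivAt (fun s : ℝ => Real.exp (c * s)) (Real.exp (c * s) * (c * 1)) s :=
    ((hasDerivAt_id s).const_mul c).exp
  rw [h2.deriv]; ring

namespace Reg

variable {γ p₀ ε T : ℝ} {u : Fld}

theorem Qpw (h : Reg γ p₀ ε T u) (a : ℝ) : Q T 0 (u.pw a) := (h.Dpw a 0).fn
theorem QR (h : Reg γ p₀ ε T u) : Q T 0 u.R := (h.DR 0).fn
theorem Qρ (h : Reg γ p₀ ε T u) : Q T 0 u.ρ := (h.Dρ 0).fn
theorem Qv (h : Reg γ p₀ ε T u) (i : Fin 2) : Q T (1 / 10) (u.v i) := (h.Dv i 0).fn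
theorem Qvv (h : Reg γ p₀ ε T u) : Q T (1 / 5) u.vv := (h.Dvv 0).fn
theorem Qqq (h : Reg γ p₀ ε T u) : Q T (1 / 15) u.qq := (h.Dqq 0).fn

theorem QD2 (h : Reg γ p₀ ε T u) : Q T (3 / 5) u.D2 := by
  have hD : ∀ i j, Q T (3 / 5) (fun p => u.D i j p ^ 2) := fun i j =>
    ((h.DD i j 0).fn.sq).mono
  exact (((hD 0 0).add (hD 0 1)).add (hD 1 0)).add (hD 1 1)

theorem QZ2 (h : Reg γ p₀ ε T u) : Q T (3 / 5) u.Z2 := by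
  have hD : ∀ j, Q T (3 / 5) (fun p => u.Z j p ^ 2) := fun j => ((h.DZ j).fn.sq).mono
  exact (hD 0).add (hD 1)

theorem Qlen3 (h : Reg γ p₀ ε T u) : Q T (1 / 2) (fun p => u.ρ p * √(u.vv p) ^ 3 * u.vv p) := by
  have h1 : Q T (3 / 10) (fun p => √(u.vv p) ^ 3) :=
    (h.Qlen.mul h.Qlen.sq).mono.of_eq fun p => by ring
  exact ((h.Qρ.mul h1).mul h.Qvv).mono

theorem QeDiss (h : Reg γ p₀ ε T u) : Q T 1 (u.eDiss p₀ ε) := by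
  have m : ∀ {a : ℝ} {f : SpT → ℝ}, a ≤ 1 → Q T a f → Q T 1 f := fun ha hf => hf.mono ha
  have t1 := m (by norm_num) (h.Qρ.mul h.QD2)
  have t2 := m (by norm_num) (h.Qρ.mul h.QZ2)
  have t3 := m (by norm_num) ((h.Qqq.mul h.Qvv).const_mul (ε / 4))
  have t4 := m (by norm_num) ((h.Qqq.sq.mul h.Qvv).const_mul (ε / 2))
  have t5 := m (by norm_num) (((h.Qpw (-p₀)).mul h.Qvv).const_mul (ε / 2))
  have t6 := m (by norm_num) (h.Qlen3.const_mul ε)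
  have t7 := m (by norm_num) ((((h.Qpw (-p₀)).sq.mul h.QR.sq).const_mul (ε ^ 2)).const_mul (p₀ / 2))
  have t8 := m (by norm_num) ((h.Qqq.add' h.Qqq.sq).const_mul ε)
  exact ((((((t1.add t2).add t3).add t4).add t5).add t6).add t7).add t8

theorem QeY (h : Reg γ p₀ ε T u) : Q T (1 / 5) (u.eY γ p₀ ε) := by
  have t1 := ((h.Qρ.mul h.Qvv).const_mul (1 / 2)).mono (b := 1 / 5)
  have t2 := ((h.Qpw γ).const_mul (γ - 1)⁻¹).mono (b := 1 / 5)
  have t3 := ((h.Qpw (-p₀)).const_mul ε).mono (b := 1 / 5)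
  exact (((t1.add t2).const_mul (Fld.eK p₀)).add t3).add h.Qρ.mono

theorem QeYt (h : Reg γ p₀ ε T u) : Q T 1 (u.eYt γ p₀ ε) := by
  have m : ∀ {a : ℝ} {f : SpT → ℝ}, a ≤ 1 → Q T a f → Q T 1 f := fun ha hf => hf.mono ha
  have t1 := m (by norm_num) (h.qρt.mul h.Qvv)
  have t2 := m (by norm_num) (h.Qρ.mul
    ((((h.Qv 0).mul (h.qvt 0)).add ((h.Qv 1).mul (h.qvt 1))).const_mul 2))
  have t3 := m (by norm_num) ((((h.Qpw (γ - 1)).const_mul γ).mul h.qρt).const_mul (γ - 1)⁻¹)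
  have t4 := m (by norm_num) ((((h.Qpw (-p₀ - 1)).const_mul (-p₀)).mul h.qρt).const_mul ε)
  exact (((((t1.add t2).const_mul (1 / 2)).add t3).const_mul (Fld.eK p₀)).add t4).add h.qρt.mono

theorem TeY (h : Reg γ p₀ ε T u) (hT : 0 < T) : TD T (u.eY γ p₀ ε) (u.eYt γ p₀ ε) := by
  have tvv := ((h.tv 0).mul (h.tv 0)).add ((h.tv 1).mul (h.tv 1))
  have := (((((h.tρ.mul tvv).const_mul (1 / 2)).add ((h.Tpw hT γ).const_mul (γ - 1)⁻¹)).const_mul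
    (Fld.eK p₀)).add ((h.Tpw hT (-p₀)).const_mul ε)).add h.tρ
  exact this.of_eq (fun p => by simp only [Fld.eY, Fld.vv]; ring)
    (fun p => by simp only [Fld.eYt, Fld.vv]; ring)

theorem eK_pos (hp : 0 < p₀) : 1 ≤ Fld.eK p₀ := by
  unfold Fld.eK
  have : 0 ≤ (1 + p₀) ^ 2 / p₀ := by positivity
  linarith

theorem eY_ge (hγ : 1 < γ) (hp : 0 < p₀) (hρ : 0 ≤ u.ρ p) :
    u.ρ p * u.vv p / 2 + (γ - 1)⁻¹ * u.pw γ p + ε * u.pw (-p₀) p + u.ρ p ≤ u.eY γ p₀ ε p := by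
  have h1 : 0 ≤ u.vv p := by unfold Fld.vv; positivity
  have h2 : ∀ a, 0 ≤ u.pw a p := fun a => Real.rpow_nonneg hρ a
  have h3 : 0 ≤ (γ - 1)⁻¹ := inv_nonneg.2 (by linarith)
  have h4 : 0 ≤ 1 / 2 * (u.ρ p * u.vv p) + (γ - 1)⁻¹ * u.pw γ p := by
    have := h2 γ; positivity
  have := le_mul_of_one_le_left h4 (eK_pos hp)
  unfold Fld.eY
  linarith

theorem eY_nonneg (hγ : 1 < γ) (hp : 0 < p₀) (hε : 0 < ε) (hρ : 0 ≤ u.ρ p) :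
    0 ≤ u.eY γ p₀ ε p ∧ ε * u.pw (-p₀) p ≤ u.eY γ p₀ ε p := by
  have h0 := eY_ge (ε := ε) hγ hp hρ
  have h1 : 0 ≤ u.vv p := by unfold Fld.vv; positivity
  have h2 : ∀ a, 0 ≤ u.pw a p := fun a => Real.rpow_nonneg hρ a
  have h3 : 0 ≤ (γ - 1)⁻¹ := inv_nonneg.2 (by linarith)
  have h4 : 0 ≤ u.ρ p * u.vv p / 2 := by positivity
  have h5 := mul_nonneg h3 (h2 γ)
  have h6 := mul_nonneg hε.le (h2 (-p₀))
  exact ⟨by linarith, by linarith⟩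

theorem eDiss_nonneg (hp : 0 < p₀) (hε : 0 < ε) (hρ : 0 ≤ u.ρ p) : 0 ≤ u.eDiss p₀ ε p := by
  have h1 : 0 ≤ u.vv p := by unfold Fld.vv; positivity
  have h2 : 0 ≤ u.pw (-p₀) p := Real.rpow_nonneg hρ _
  have h3 : 0 ≤ u.qq p := by unfold Fld.qq; positivity
  have h4 : 0 ≤ u.D2 p := by unfold Fld.D2; positivity
  have h5 : 0 ≤ u.Z2 p := by unfold Fld.Z2; positivity
  unfold Fld.eDiss
  positivity

theorem ρ_nonneg (h : Reg γ p₀ ε T u) : ∀ᵐ p ∂muQ T, 0 ≤ u.ρ p := by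
  filter_upwards [h.pos] with p hp
  rw [hp.2.1]; positivity

theorem eY_integrable (h : Reg γ p₀ ε T u) (hT : 0 < T) {t : ℝ} (ht : t ∈ Icc 0 T) :
    Integrable (fun x => u.eY γ p₀ ε (t, x)) muO :=
  (h.TeY hT).slice_integrable hT h.QeY.integrable h.QeYt.integrable ht

theorem energy_split {K t : ℝ} (hT : 0 < T) (hγ : 1 < γ) (hp : 0 < p₀) (hε : 0 < ε)
    (h : Reg γ p₀ ε T u)
    (hK : ∀ t ∈ Icc 0 T, ∫ x, u.eY γ p₀ ε (t, x) ∂muO + ∫ p, u.eDiss p₀ ε p ∂muQ t ≤ K)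
    (ht : t ∈ Icc 0 T) : (∀ᵐ x ∂muO, 0 ≤ u.ρ (t, x)) ∧ 0 ≤ ∫ x, u.eY γ p₀ ε (t, x) ∂muO ∧
    ∫ x, u.eY γ p₀ ε (t, x) ∂muO ≤ K ∧ ∫ p, u.eDiss p₀ ε p ∂muQ t ≤ K := by
  obtain ⟨c, C, hc, hb⟩ := h.posAll hT ht
  have h1 : ∀ᵐ x ∂muO, 0 ≤ u.ρ (t, x) := hb.mono fun x hx => hc.le.trans hx.1
  have h2 : 0 ≤ ∫ x, u.eY γ p₀ ε (t, x) ∂muO :=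
    integral_nonneg_of_ae (h1.mono fun x hx => (eY_nonneg hγ hp hε hx).1)
  have h3 : 0 ≤ ∫ p, u.eDiss p₀ ε p ∂muQ t := integral_nonneg_of_ae
    (ae_mono (muQ_mono ht.2) (h.ρ_nonneg.mono fun p hp' => eDiss_nonneg hp hε hp'))
  exact ⟨h1, h2, by linarith [hK t ht], by linarith [hK t ht]⟩

theorem energy (hT : 0 < T) (hγ : 1 < γ) (hp : 0 < p₀) (hpγ : γ - 1 < p₀) (hε : 0 < ε)
    (hε1 : ε ≤ 1 / 4) (h : Reg γ p₀ ε T u) {t : ℝ} (ht : t ∈ Icc 0 T) :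
    ∫ x, u.eY γ p₀ ε (t, x) ∂muO + ∫ p, u.eDiss p₀ ε p ∂muQ t
      ≤ Real.exp (Fld.eL γ p₀ * T) * (∫ x, u.eY γ p₀ ε (0, x) ∂muO + 1) := by
  obtain ⟨N, hN, hle⟩ := h.energy_ineq hγ hp hpγ hε hε1
  set L := Fld.eL γ p₀ with hL
  have hL0 : 0 ≤ L := by
    have h1 := eK_pos hp
    have h2 : 0 < γ / (γ - 1) := div_pos (by linarith) (by linarith)
    have h3 : 0 ≤ Fld.eK p₀ * (γ / (γ - 1)) := by positivity
    rw [hL]; unfold Fld.eL; linarith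
  have hw : Continuous fun s : ℝ => Real.exp (-L * s) := by fun_prop
  have hwT : TD T (fun p => Real.exp (-L * p.1)) (fun p => -L * Real.exp (-L * p.1)) :=
    TD.of_time (a := fun s => Real.exp (-L * s)) (a' := fun s => -L * Real.exp (-L * s))
      (AC1.exp_mul (-L))
  have one : TD T (fun _ => (1 : ℝ)) (fun _ => 0) :=
    TD.of_time (a := fun _ => 1) (a' := fun _ => 0) (AC1.const 1)
  have hTD := hwT.mul ((h.TeY hT).add one)
  have q1 : Q T (1 / 5) (fun p => u.eY γ p₀ ε p + 1) := h.QeY.add (Q.const 1).mono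
  have qY := (q1.time_mul hw).mono (b := 1)
  have qYt : Q T 1 (fun p => -L * Real.exp (-L * p.1) * (u.eY γ p₀ ε p + 1)
      + Real.exp (-L * p.1) * (u.eYt γ p₀ ε p + 0)) :=
    ((qY.const_mul (-L)).add (h.QeYt.time_mul hw)).of_eq fun p => by ring
  have key := hTD.integral_slice hT qY.integrable qYt.integrable ht
  have hpt : ∀ᵐ p ∂muQ T, -L * Real.exp (-L * p.1) * (u.eY γ p₀ ε p + 1)
      + Real.exp (-L * p.1) * (u.eYt γ p₀ ε p + 0)
      ≤ Real.exp (-L * p.1) * N p - Real.exp (-L * T) * u.eDiss p₀ ε p := by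
    filter_upwards [hle, h.ρ_nonneg, ae_restrict_mem (measurableSet_cyl T)] with p h1 h2 h3
    have e1 := (eY_nonneg hγ hp hε h2).2
    have e2 := eDiss_nonneg hp hε h2
    have e3 : Real.exp (-L * T) ≤ Real.exp (-L * p.1) := by
      apply Real.exp_le_exp.2
      have : p.1 ≤ T := h3.1.2.le
      nlinarith
    have e4 := mul_le_mul_of_nonneg_right e3 e2
    have e5 : u.eYt γ p₀ ε p - L * (u.eY γ p₀ ε p + 1) ≤ N p - u.eDiss p₀ ε p := by
      have := mul_le_mul_of_nonneg_left e1 hL0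
      linarith
    have e6 := mul_le_mul_of_nonneg_left e5 (Real.exp_pos (-L * p.1)).le
    linarith
  have hNw := hN t ht.2 _ hw
  have mt : ∀ {f : SpT → ℝ}, Q T 1 f → Q t 1 f := fun hf => hf.mono_time ht.2
  have hint : ∫ p, (-L * Real.exp (-L * p.1) * (u.eY γ p₀ ε p + 1)
      + Real.exp (-L * p.1) * (u.eYt γ p₀ ε p + 0)) ∂muQ t
      ≤ - (Real.exp (-L * T) * ∫ p, u.eDiss p₀ ε p ∂muQ t) := by
    refine (Q.integral_mono (mt qYt) ((Q.of_integrable hNw.1).sub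
      ((mt h.QeDiss).const_mul (Real.exp (-L * T)))) (ae_mono (muQ_mono ht.2) hpt)).trans ?_
    rw [integral_sub hNw.1 ((mt h.QeDiss).integrable.const_mul _), hNw.2,
      integral_const_mul, zero_sub]
  simp only [mul_zero, Real.exp_zero, one_mul] at key
  rw [integral_const_mul, integral_add (h.eY_integrable hT ht) (integrable_const _),
    integral_add (h.eY_integrable hT (left_mem_Icc.2 hT.le)) (integrable_const _)] at key
  simp only [integral_const, smul_eq_mul, mul_one, probReal_univ] at key
  have hY0 : 0 ≤ ∫ x, u.eY γ p₀ ε (t, x) ∂muO := by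
    apply integral_nonneg_of_ae
    obtain ⟨c, C, hc, hb⟩ := h.posAll hT ht
    filter_upwards [hb] with x hx using (eY_nonneg hγ hp hε (hc.le.trans hx.1)).1
  have hexp : Real.exp (-L * T) ≤ Real.exp (-L * t) := by
    apply Real.exp_le_exp.2
    nlinarith [ht.2]
  have h2 := mul_le_mul_of_nonneg_right hexp (show 0 ≤ ∫ x, u.eY γ p₀ ε (t, x) ∂muO + 1 by linarith)
  have h3 : Real.exp (-L * T) * (∫ x, u.eY γ p₀ ε (t, x) ∂muO + ∫ p, u.eDiss p₀ ε p ∂muQ t)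
      ≤ ∫ x, u.eY γ p₀ ε (0, x) ∂muO + 1 := by
    have := Real.exp_pos (-L * T)
    linarith
  have h4 := mul_le_mul_of_nonneg_left h3 (Real.exp_pos (L * T)).le
  rw [← mul_assoc, ← Real.exp_add] at h4
  simpa using h4

end Reg

/-! ### The Bresch–Desjardins identity -/

/-- Functions with vanishing integral over all shorter cylinders. -/
def Nul (T : ℝ) (g : SpT → ℝ) : Prop := ∀ τ ≤ T, NullInt τ g

namespace Nul

variable {T : ℝ} {f g : SpT → ℝ}

theorem add (hf : Nul T f) (hg : Nul T g) : Nul T (fun p => f p + g p) :=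
  fun τ hτ => (hf τ hτ).add (hg τ hτ)

theorem const_mul (c : ℝ) (hf : Nul T f) : Nul T (fun p => c * f p) :=
  fun τ hτ => (hf τ hτ).const_mul c

end Nul

theorem WNull.nul (h : WNull T f) : Nul T f := fun _ hτ => h.null hτ

theorem Nul.transpose {a b a' b' : ℝ} {A B a0 a1 b0 b1 : SpT → ℝ} (h0 : DQr Eq (hor 0) T a b A a0)
    (h1 : DQr Eq (hor 1) T a b A a1) (h2 : DQr Eq (hor 0) T a' b' B b0)
    (h3 : DQr Eq (hor 1) T a' b' B b1) (ha : a ≤ 1 / 2 := by norm_num)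
    (hb : b ≤ 1 / 2 := by norm_num) (ha' : a' ≤ 1 / 2 := by norm_num)
    (hb' : b' ≤ 1 / 2 := by norm_num) : Nul T (fun p => a0 p * b1 p - a1 p * b0 p) := fun τ hτ => by
  have w {k : Fin 3} {a b : ℝ} {f g : SpT → ℝ} (h : DQr Eq k T a b f g) (ha : a ≤ 1 / 2)
      (hb : b ≤ 1 / 2) : DQr Eq k τ (1 / 2) (1 / 2) f g := (h.mono_time hτ).weaken ha hb
  exact nullInt_transpose (by decide) (w h0 ha hb) (w h1 ha hb) (w h2 ha' hb') (w h3 ha' hb')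

namespace Fld

variable (u : Fld)

/-- `|∇²ρ^{1/2}|²`. -/
def H2 (p : SpT) : ℝ := u.H 0 0 p ^ 2 + u.H 0 1 p ^ 2 + u.H 1 0 p ^ 2 + u.H 1 1 p ^ 2

/-- `|∇v|²`. -/
def V2 (p : SpT) : ℝ := u.V 0 0 p ^ 2 + u.V 0 1 p ^ 2 + u.V 1 0 p ^ 2 + u.V 1 1 p ^ 2

/-- `Δρ^{1/2}`. -/
def lap (p : SpT) : ℝ := u.H 0 0 p + u.H 1 1 p

/-- `div v`. -/
def dv (p : SpT) : ℝ := u.V 0 0 p + u.V 1 1 p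

/-- `div X`. -/
def dX (p : SpT) : ℝ := u.DX 0 0 p + u.DX 1 1 p

/-- The components of `∇²ρ^{1/2} ∇ρ^{1/2}`. -/
def Hq (i : Fin 2) (p : SpT) : ℝ := u.H i 0 p * u.q 0 p + u.H i 1 p * u.q 1 p

/-- `∇ρ^{1/2} · 𝒟(v) ∇ρ^{1/2}`. -/
def qDq (p : SpT) : ℝ :=
  u.q 0 p ^ 2 * u.D 0 0 p + 2 * (u.q 0 p * u.q 1 p * u.D 0 1 p) + u.q 1 p ^ 2 * u.D 1 1 p

/-- `∇²ρ^{1/2} : 𝒟(v)`. -/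
def HD (p : SpT) : ℝ :=
  u.H 0 0 p * u.D 0 0 p + u.H 0 1 p * u.D 0 1 p + u.H 1 0 p * u.D 0 1 p + u.H 1 1 p * u.D 1 1 p

/-- The time derivative of the Bresch–Desjardins functional. -/
def bdI (ε : ℝ) (p : SpT) : ℝ :=
  2 * u.s p * (u.q 0 p * u.vt 0 p + u.q 1 p * u.vt 1 p) - u.dv p * u.ρt p
    - 2 * u.R p * (u.lap p + ε * u.dX p) * u.ρt p

end Fld

namespace Reg

variable {γ p₀ ε T : ℝ} {u : Fld}

theorem DRq (h : Reg γ p₀ ε T u) (j l : Fin 2) :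
    DQr Eq (hor l) T (1 / 30) (1 / 2) (fun p => u.R p * u.q j p)
      (fun p => - u.R p ^ 2 * u.q l p * u.q j p + u.R p * u.H j l p) :=
  ((h.DR l).mul (h.Dq j l)).weaken

theorem DP (h : Reg γ p₀ ε T u) (i k l : Fin 2) :
    DQr Eq (hor l) T (3 / 10) (3 / 5) (fun p => 2 * u.s p * u.q k p * u.v i p + u.ρ p * u.V i k p)
      (fun p => 2 * (u.q l p * u.q k p * u.v i p + u.s p * u.H k l p * u.v i p
        + u.s p * u.q k p * u.V i l p) + 2 * u.s p * u.q l p * u.V i k p + u.ρ p * u.VV i k l p) :=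
  ((((((h.Ds l).mul (h.Dq k l)).mul (h.Dv i l)).smulH 2).addH ((h.Dρ l).mul (h.DV i k l))).of_eq
    (fun p => by ring) (fun p => by ring)).weaken

theorem bd_viscous (h : Reg γ p₀ ε T u) : ∃ N, Nul T N ∧ ∀ᵐ p ∂muQ T,
    2 * u.R p * u.q 0 p * (2 * u.s p * (u.q 0 p * u.D 0 0 p + u.q 1 p * u.D 1 0 p)
        + u.ρ p * (u.DD 0 0 0 p + u.DD 1 0 1 p))
      + 2 * u.R p * u.q 1 p * (2 * u.s p * (u.q 0 p * u.D 0 1 p + u.q 1 p * u.D 1 1 p)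
        + u.ρ p * (u.DD 0 1 0 p + u.DD 1 1 1 p))
      + 2 * u.R p * u.lap p * u.divρv p = N p := by
  have n1 := fun j => WNull.div (fun i => (h.Dρ i).mul ((h.DD i j i).mul (h.DRq j i)))
  have n2 := ((h.DRq 1 1).mul (h.DP 0 0 1)).wnull
  have n3 := ((h.DRq 1 0).mul (h.DP 0 1 0)).wnull
  have n4 := ((h.DRq 0 0).mul (h.DP 1 1 0)).wnull
  have n5 := ((h.DRq 0 1).mul (h.DP 1 0 1)).wnull
  have n6 := WNull.div (fun i => (h.Dqq i).mul (h.Dv i i))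
  refine ⟨_, ((((((n1 0).add (n1 1)).const_mul 2).add
    ((n2.add (n3.const_mul (-1))).const_mul 2)).add
    ((n4.add (n5.const_mul (-1))).const_mul 2)).add (n6.const_mul 2)).nul, ?_⟩
  filter_upwards [h.pos, h.Hsymm, h.Vsymm 0, h.Vsymm 1] with p ⟨hs, hρ, hR⟩ hH hV0 hV1
  simp only [Fld.D, Fld.DD, Fld.lap, Fld.divρv, Fld.qq]
  rw [hρ, hH, hV0, hV1]
  simp only [Fld.R]
  field_simp
  ring

theorem bd_artificial (h : Reg γ p₀ ε T u) : ∃ N, Nul T N ∧ ∀ᵐ p ∂muQ T,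
    2 * u.R p * u.q 0 p * (2 * u.s p * (u.q 0 p * u.V 0 0 p + u.q 1 p * u.V 0 1 p)
        + u.ρ p * (u.VV 0 0 0 p + u.VV 0 1 1 p))
      + 2 * u.R p * u.q 1 p * (2 * u.s p * (u.q 0 p * u.V 1 0 p + u.q 1 p * u.V 1 1 p)
        + u.ρ p * (u.VV 1 0 0 p + u.VV 1 1 1 p))
      = N p - 2 * (u.s p * u.HD p - u.qDq p) := by
  have n1 := fun j => WNull.div (fun i => (h.Dρ i).mul ((h.DV j i i).mul (h.DRq j i)))
  refine ⟨_, (((n1 0).add (n1 1)).const_mul 2).nul, ?_⟩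
  filter_upwards [h.pos, h.Hsymm] with p ⟨hs, hρ, hR⟩ hH
  simp only [Fld.D, Fld.HD, Fld.qDq]
  rw [hρ, hH]
  simp only [Fld.R]
  field_simp
  ring

theorem bd_convective (h : Reg γ p₀ ε T u) : ∃ N, Nul T N ∧ ∀ᵐ p ∂muQ T,
    u.dv p * u.divρv p - 2 * u.s p * (u.q 0 p * (u.v 0 p * u.V 0 0 p + u.v 1 p * u.V 0 1 p)
        + u.q 1 p * (u.v 0 p * u.V 1 0 p + u.v 1 p * u.V 1 1 p))
      = N p + u.ρ p * (2 * u.D2 p - u.V2 p) := by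
  have n1 := ((h.DV 0 0 1).mul ((h.Dρ 1).mul (h.Dv 1 1))).wnull
  have n2 := ((h.DV 0 1 0).mul ((h.Dρ 0).mul (h.Dv 1 0))).wnull
  have n3 := ((h.DV 1 1 0).mul ((h.Dρ 0).mul (h.Dv 0 0))).wnull
  have n4 := ((h.DV 1 0 1).mul ((h.Dρ 1).mul (h.Dv 0 1))).wnull
  refine ⟨_, ((n1.add (n2.const_mul (-1))).add (n3.add (n4.const_mul (-1)))).nul, ?_⟩
  filter_upwards [h.Vsymm 0, h.Vsymm 1] with p hV0 hV1
  simp only [Fld.D2, Fld.V2, Fld.D, Fld.dv, Fld.divρv]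
  rw [hV0, hV1]
  ring

theorem bd_vertical (h : Reg γ p₀ ε T u) : ∃ N, Nul T N ∧ ∀ᵐ p ∂muQ T,
    u.dv p * (u.ρ p * u.wz p) - 2 * u.s p * u.w p * (u.q 0 p * u.Z 0 p + u.q 1 p * u.Z 1 p)
      + 2 * u.R p * u.ρ p * (u.q 0 p * u.ZZ 0 p + u.q 1 p * u.ZZ 1 p)
      + 2 * u.R p * (u.lap p + ε * u.dX p) * (u.ρ p * u.wz p)
      = N p - u.ρ p * u.wz p ^ 2 := by
  have hXz : ∀ i j, DQr cAny 2 T (1 / 2) 0 (u.DX i j) (fun _ => 0) := by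
    intro i j
    have hqq := (((h.Dqz 0).mul (h.Dqz 0)).addV ((h.Dqz 1).mul (h.Dqz 1))).mul (h.DHz i j)
    have hHq := ((((h.Dqz 0).mul (h.DHz 0 j)).addV ((h.Dqz 1).mul (h.DHz 1 j))).smulV 2).mul (h.Dqz i)
    refine ⟨(hqq.addV hHq).ld.of_eq (fun p => ?_) (fun p => by ring), (h.DX i j).dv, Q.const 0⟩
    simp only [Fld.DX, Fld.qq]; ring
  have n1 := fun j => (((h.Dw.mul h.Dρz).mul (h.Dvz j)).mul ((h.Dqz j).mul h.DRz)).wnullZ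
  have n2 := (h.Dw.mul h.Dm).wnullZ
  have n3 := fun j => (((h.DZ j).mul h.Dρz).mul ((h.Dqz j).mul h.DRz)).wnullZ
  have n4 := fun i => ((h.Dw.mul h.Dsz).mul (h.DHz i i)).wnullZ
  have n5 := fun i => ((h.Dw.mul h.Dsz).mul (hXz i i)).wnullZ
  refine ⟨_, (((((((n1 0).add (n1 1)).const_mul (-2)).add n2).add
    (((n3 0).add (n3 1)).const_mul 2)).add (((n4 0).add (n4 1)).const_mul 2)).add
    (((n5 0).add (n5 1)).const_mul (2 * ε))).nul, ?_⟩
  filter_upwards [h.pos, h.m_eq] with p ⟨hs, hρ, hR⟩ hm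
  rw [hm]
  simp only [Fld.dv, Fld.divρv, Fld.lap, Fld.dX]
  rw [hρ]
  generalize u.DX 0 0 p = x0
  generalize u.DX 1 1 p = x1
  simp only [Fld.R]
  field_simp
  ring

theorem bd_quartic (h : Reg γ p₀ ε T u) : ∃ N, Nul T N ∧ ∀ᵐ p ∂muQ T,
    2 * u.R p * u.dX p * u.divρv p
      = N p - 4 * u.qq p * u.qDq p + u.qq p ^ 2 * u.dv p + 2 * u.s p * u.dX p * u.dv p := by
  have Dqv := fun j => ((h.Dq 0 j).mul (h.Dv 0 j)).addH ((h.Dq 1 j).mul (h.Dv 1 j))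
  have n1 := WNull.div (fun i => (h.DX i i).mul (Dqv i))
  have n2 := WNull.div (fun i => ((h.Dqq i).mul (h.Dqq i)).mul (h.Dv i i))
  refine ⟨_, ((n1.const_mul 4).add (n2.const_mul (-1))).nul, ?_⟩
  filter_upwards [h.pos, h.Hsymm] with p ⟨hs, hρ, hR⟩ hH
  simp only [Fld.dX, Fld.DX, Fld.X, Fld.qq, Fld.qDq, Fld.D, Fld.dv, Fld.divρv]
  rw [hρ, hH]
  simp only [Fld.R]
  field_simp
  ring

theorem bd_singular (h : Reg γ p₀ ε T u) (hp : 0 < p₀) : ∃ N, Nul T N ∧ ∀ᵐ p ∂muQ T,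
    -(2 * u.R p * u.pw (-p₀) p * (u.q 0 p * u.v 0 p + u.q 1 p * u.v 1 p))
      = N p - 1 / p₀ * (u.pw (-p₀) p * u.dv p) := by
  have n1 := WNull.div (fun i => (h.Dpw (-p₀) i).mul (h.Dv i i))
  refine ⟨_, (n1.const_mul (1 / p₀)).nul, .of_forall fun p => ?_⟩
  simp only [Fld.dv]
  field_simp
  ring

theorem bd_hessian (h : Reg γ p₀ ε T u) : ∃ N, Nul T N ∧ ∀ᵐ p ∂muQ T,
    -(2 * (u.lap p + ε * u.dX p) * (ε * (u.lap p + u.dX p) + ε * u.R p * u.pw (-p₀) p))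
      = N p - 2 * ε * u.H2 p
        - 2 * ε * (1 + ε) * (u.qq p * u.H2 p + 2 * (u.Hq 0 p ^ 2 + u.Hq 1 p ^ 2))
        - 2 * ε ^ 2 * (u.qq p ^ 2 * u.H2 p + 4 * u.qq p * (u.Hq 0 p ^ 2 + u.Hq 1 p ^ 2)
          + 4 * (u.q 0 p * u.Hq 0 p + u.q 1 p * u.Hq 1 p) ^ 2)
        - 2 * ε * (2 * p₀ + 1) * (u.pw (-p₀) p * u.R p ^ 2 * (u.qq p + ε * u.qq p ^ 2)) := by
  have n1 := Nul.transpose (h.Dq 0 0) (h.Dq 0 1) (h.Dq 1 0) (h.Dq 1 1)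
  have n2 := Nul.transpose (h.Dq 0 0) (h.Dq 0 1) (h.DX 1 0) (h.DX 1 1)
  have n3 := Nul.transpose (h.DX 0 0) (h.DX 0 1) (h.Dq 1 0) (h.Dq 1 1)
  have n4 := Nul.transpose (h.DX 0 0) (h.DX 0 1) (h.DX 1 0) (h.DX 1 1)
  have n5 := (WNull.div (fun i => (h.Dpw (-p₀) i).mul ((h.DR i).mul (h.Dq i i)))).nul
  have n6 := (WNull.div (fun i => (h.Dpw (-p₀) i).mul ((h.DR i).mul (h.DX i i)))).nul
  refine ⟨_, ((((n1.const_mul (-(4 * ε))).add ((n2.add n3).const_mul (-(2 * ε * (1 + ε))))).add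
    (n4.const_mul (-(4 * ε ^ 2)))).add (n5.const_mul (-(2 * ε)))).add (n6.const_mul (-(2 * ε ^ 2))), ?_⟩
  filter_upwards [h.Hsymm] with p hH
  generalize u.pw (-p₀) p = B
  generalize u.R p = R
  simp only [Fld.lap, Fld.dX, Fld.DX, Fld.X, Fld.qq, Fld.H2, Fld.Hq]
  rw [hH]
  ring

end Reg

/-! ### The Bresch–Desjardins inequality -/

theorem le_add_of_sq_le_mul {x y z : ℝ} (hy : 0 ≤ y) (hz : 0 ≤ z) (h : x ^ 2 ≤ 4 * (y * z)) :
    x ≤ y + z :=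
  (abs_le_of_sq_le_sq' (by nlinarith [sq_nonneg (y - z)]) (by positivity)).2

/-- Young's inequality for the quintic damping against the artificial viscosity. -/
theorem pow_four_mul_le {x y : ℝ} (hx : 0 ≤ x) (hy : 0 ≤ y) :
    x ^ 4 * y ≤ x ^ 5 + 1 / 72 * y ^ 6 + 72 ^ 5 := by
  rcases le_total y x with h | h
  · have : x ^ 4 * y ≤ x ^ 4 * x := mul_le_mul_of_nonneg_left h (by positivity)
    nlinarith [pow_nonneg hy 6]
  · have h1 : x ^ 4 * y ≤ y ^ 4 * y := by gcongr
    have h2 := pow_nonneg hx 5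
    rcases le_total y 72 with h3 | h3
    · have : y ^ 4 * y ≤ 72 ^ 4 * 72 := by gcongr
      nlinarith [pow_nonneg hy 6]
    · have : y ^ 5 * 72 ≤ y ^ 5 * y := mul_le_mul_of_nonneg_left h3 (by positivity)
      nlinarith

namespace Fld

variable (u : Fld)

/-- The dissipation in the Bresch–Desjardins inequality. -/
def bdDiss (γ ε : ℝ) (p : SpT) : ℝ :=
  u.ρ p * u.V2 p + u.ρ p * u.wz p ^ 2 + 4 * γ * u.pw (γ - 1) p * u.qq p + ε / 2 * u.H2 p
    + ε * (u.qq p * u.H2 p) + ε ^ 2 * (u.qq p ^ 2 * u.H2 p)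

/-- The terms controlled by the basic energy. -/
def bdErr (p₀ ε : ℝ) (p : SpT) : ℝ :=
  u.ρ p * u.D2 p + ε ^ 2 * (u.pw (-p₀) p ^ 2 * u.R p ^ 2)
    + ε * (u.ρ p * √(u.vv p) ^ 3 * u.vv p) + ε * (1 + u.pw (-p₀) p)

/-- `q · Hq`. -/
def qHq (p : SpT) : ℝ := u.q 0 p * u.Hq 0 p + u.q 1 p * u.Hq 1 p

theorem HD_sq (p : SpT) : u.HD p ^ 2 ≤ u.H2 p * u.D2 p := by
  have hD : u.D 1 0 p = u.D 0 1 p := by simp only [Fld.D]; ring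
  simp only [HD, H2, D2]
  rw [hD]
  generalize u.D 0 0 p = a; generalize u.D 0 1 p = b; generalize u.D 1 1 p = c
  generalize u.H 0 0 p = x; generalize u.H 0 1 p = y; generalize u.H 1 0 p = z
  generalize u.H 1 1 p = w
  nlinarith [sq_nonneg (x * b - y * a), sq_nonneg (x * b - z * a), sq_nonneg (x * c - w * a),
    sq_nonneg (y * b - z * b), sq_nonneg (y * c - w * b), sq_nonneg (z * c - w * b)]

theorem qDq_sq (p : SpT) : u.qDq p ^ 2 ≤ u.qq p ^ 2 * u.D2 p := by
  have hD : u.D 1 0 p = u.D 0 1 p := by simp only [Fld.D]; ring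
  simp only [qDq, qq, D2]
  rw [hD]
  generalize u.D 0 0 p = a; generalize u.D 0 1 p = b; generalize u.D 1 1 p = c
  generalize u.q 0 p = x; generalize u.q 1 p = y
  nlinarith [sq_nonneg (x ^ 2 * b - x * y * a), sq_nonneg (x ^ 2 * c - y ^ 2 * a),
    sq_nonneg (x * y * c - y ^ 2 * b)]

theorem dv_sq (p : SpT) : u.dv p ^ 2 ≤ 2 * u.D2 p := by
  have h0 : u.V 0 0 p = u.D 0 0 p := by simp only [Fld.D]; ring
  have h1 : u.V 1 1 p = u.D 1 1 p := by simp only [Fld.D]; ring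
  simp only [dv, D2]
  rw [h0, h1]
  nlinarith [sq_nonneg (u.D 0 0 p - u.D 1 1 p), sq_nonneg (u.D 0 1 p), sq_nonneg (u.D 1 0 p)]

theorem lap_sq (p : SpT) : u.lap p ^ 2 ≤ 2 * u.H2 p := by
  simp only [lap, H2]
  nlinarith [sq_nonneg (u.H 0 0 p - u.H 1 1 p), sq_nonneg (u.H 0 1 p), sq_nonneg (u.H 1 0 p)]

theorem Hq_sq (p : SpT) : u.Hq 0 p ^ 2 + u.Hq 1 p ^ 2 ≤ u.qq p * u.H2 p := by
  simp only [Hq, H2, qq]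
  nlinarith [sq_nonneg (u.H 0 0 p * u.q 1 p - u.H 0 1 p * u.q 0 p),
    sq_nonneg (u.H 1 0 p * u.q 1 p - u.H 1 1 p * u.q 0 p)]

theorem qHq_sq (p : SpT) : u.qHq p ^ 2 ≤ u.qq p ^ 2 * u.H2 p := by
  have h1 : u.qHq p ^ 2 ≤ u.qq p * (u.Hq 0 p ^ 2 + u.Hq 1 p ^ 2) := by
    simp only [qHq, qq]
    nlinarith [sq_nonneg (u.q 0 p * u.Hq 1 p - u.q 1 p * u.Hq 0 p)]
  have h2 : 0 ≤ u.qq p := by simp only [qq]; positivity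
  nlinarith [mul_le_mul_of_nonneg_left (u.Hq_sq p) h2]

theorem H2_nonneg (p : SpT) : 0 ≤ u.H2 p := by simp only [H2]; positivity
theorem D2_nonneg (p : SpT) : 0 ≤ u.D2 p := by simp only [D2]; positivity
theorem V2_nonneg (p : SpT) : 0 ≤ u.V2 p := by simp only [V2]; positivity
theorem qq_nonneg (p : SpT) : 0 ≤ u.qq p := by simp only [qq]; positivity
theorem vv_nonneg (p : SpT) : 0 ≤ u.vv p := by simp only [vv]; positivity

theorem qv_sq (p : SpT) : (u.q 0 p * u.v 0 p + u.q 1 p * u.v 1 p) ^ 2 ≤ u.qq p * u.vv p := by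
  simp only [qq, vv]
  nlinarith [sq_nonneg (u.q 0 p * u.v 1 p - u.q 1 p * u.v 0 p)]

end Fld

theorem sq_combine {a x y c d M : ℝ} (hx : x ^ 2 ≤ c * M) (hy : y ^ 2 ≤ d * M) :
    (a * x + y) ^ 2 ≤ 2 * (a ^ 2 * c + d) * M := by
  nlinarith [sq_nonneg (a * x - y), mul_le_mul_of_nonneg_left hx (sq_nonneg a)]

namespace Reg

variable {γ p₀ ε T : ℝ} {u : Fld}

theorem dX_eq (h : Reg γ p₀ ε T u) : ∀ᵐ p ∂muQ T, u.dX p = u.qq p * u.lap p + 2 * u.qHq p := by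
  filter_upwards [h.Hsymm] with p hH
  simp only [Fld.dX, Fld.DX, Fld.qq, Fld.lap, Fld.qHq, Fld.Hq]
  rw [hH]; ring

theorem interp_one (h : Reg γ p₀ ε T u) : ∃ N, Nul T N ∧ ∀ᵐ p ∂muQ T,
    u.R p ^ 2 * u.qq p ^ 2 ≤ N p + 12 * u.H2 p := by
  have n := WNull.div (fun i => (h.DR i).mul (h.DX i i))
  refine ⟨_, (n.const_mul (-2)).nul, ?_⟩
  filter_upwards [h.dX_eq] with p hX
  have hH := u.H2_nonneg p
  have h1 : (u.R p * u.dX p) ^ 2 ≤ 4 * ((1 / 2 * (u.R p ^ 2 * u.qq p ^ 2)) * (6 * u.H2 p)) := by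
    have := sq_combine (a := u.qq p) (u.lap_sq p) (y := 2 * u.qHq p) (d := 4 * u.qq p ^ 2)
      (by nlinarith [u.qHq_sq p])
    rw [← hX] at this
    nlinarith [mul_le_mul_of_nonneg_left this (sq_nonneg (u.R p))]
  have h2 := le_add_of_sq_le_mul (by positivity) (by positivity) h1
  have h3 : -u.R p ^ 2 * u.q 0 p * u.X 0 p + u.R p * u.DX 0 0 p
      + (-u.R p ^ 2 * u.q 1 p * u.X 1 p + u.R p * u.DX 1 1 p)
      = -(u.R p ^ 2 * u.qq p ^ 2) + u.R p * u.dX p := by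
    simp only [Fld.X, Fld.qq, Fld.dX]; ring
  linarith

theorem interp_two (h : Reg γ p₀ ε T u) : ∃ N, Nul T N ∧ ∀ᵐ p ∂muQ T,
    u.R p ^ 2 * u.qq p ^ 3 ≤ N p + 36 * (u.qq p * u.H2 p) := by
  have n := WNull.div (fun i => (h.DR i).mul ((h.Dqq i).mul (h.DX i i)))
  refine ⟨_, (n.const_mul (-2)).nul, ?_⟩
  filter_upwards [h.dX_eq, h.Hsymm] with p hX hs
  have hH := u.H2_nonneg p
  have hq := u.qq_nonneg p
  have h1 : (u.R p * (u.qq p * (u.qq p * u.lap p + 4 * u.qHq p))) ^ 2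
      ≤ 4 * ((1 / 2 * (u.R p ^ 2 * u.qq p ^ 3)) * (18 * (u.qq p * u.H2 p))) := by
    have := sq_combine (a := u.qq p) (u.lap_sq p) (y := 4 * u.qHq p) (d := 16 * u.qq p ^ 2)
      (by nlinarith [u.qHq_sq p])
    nlinarith [mul_le_mul_of_nonneg_left this (sq_nonneg (u.R p * u.qq p))]
  have h2 := le_add_of_sq_le_mul (by positivity) (by positivity) h1
  have h3 : -u.R p ^ 2 * u.q 0 p * (u.qq p * u.X 0 p)
        + u.R p * (2 * (u.q 0 p * u.H 0 0 p + u.q 1 p * u.H 1 0 p) * u.X 0 p + u.qq p * u.DX 0 0 p)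
      + (-u.R p ^ 2 * u.q 1 p * (u.qq p * u.X 1 p)
        + u.R p * (2 * (u.q 0 p * u.H 0 1 p + u.q 1 p * u.H 1 1 p) * u.X 1 p + u.qq p * u.DX 1 1 p))
      = -(u.R p ^ 2 * u.qq p ^ 3) + u.R p * (u.qq p * (u.qq p * u.lap p + 4 * u.qHq p)) := by
    have : u.R p * (u.qq p * (u.qq p * u.lap p + 4 * u.qHq p))
        = u.R p * u.qq p * (u.dX p + 2 * u.qHq p) := by rw [hX]; ring
    rw [this]
    simp only [Fld.X, Fld.dX, Fld.qHq, Fld.Hq, hs]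
    generalize u.DX 0 0 p = x0
    generalize u.DX 1 1 p = x1
    simp only [Fld.qq]
    ring
  linarith

theorem interp_three (h : Reg γ p₀ ε T u) : ∃ N, Nul T N ∧ ∀ᵐ p ∂muQ T,
    u.R p ^ 2 * u.qq p ^ 4 ≤ N p + 76 * (u.qq p ^ 2 * u.H2 p) := by
  have n := WNull.div (fun i => (h.DR i).mul (((h.Dqq i).mul (h.Dqq i)).mul (h.DX i i)))
  refine ⟨_, (n.const_mul (-2)).nul, ?_⟩
  filter_upwards [h.dX_eq, h.Hsymm] with p hX hs
  have hH := u.H2_nonneg p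
  have hq := u.qq_nonneg p
  have h1 : (u.R p * (u.qq p ^ 2 * (u.qq p * u.lap p + 6 * u.qHq p))) ^ 2
      ≤ 4 * ((1 / 2 * (u.R p ^ 2 * u.qq p ^ 4)) * (38 * (u.qq p ^ 2 * u.H2 p))) := by
    have := sq_combine (a := u.qq p) (u.lap_sq p) (y := 6 * u.qHq p) (d := 36 * u.qq p ^ 2)
      (by nlinarith [u.qHq_sq p])
    nlinarith [mul_le_mul_of_nonneg_left this (sq_nonneg (u.R p * u.qq p ^ 2))]
  have h2 := le_add_of_sq_le_mul (by positivity) (by positivity) h1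
  have h3 : -u.R p ^ 2 * u.q 0 p * (u.qq p * u.qq p * u.X 0 p)
        + u.R p * ((2 * (u.q 0 p * u.H 0 0 p + u.q 1 p * u.H 1 0 p) * u.qq p
            + u.qq p * (2 * (u.q 0 p * u.H 0 0 p + u.q 1 p * u.H 1 0 p))) * u.X 0 p
          + u.qq p * u.qq p * u.DX 0 0 p)
      + (-u.R p ^ 2 * u.q 1 p * (u.qq p * u.qq p * u.X 1 p)
        + u.R p * ((2 * (u.q 0 p * u.H 0 1 p + u.q 1 p * u.H 1 1 p) * u.qq p
            + u.qq p * (2 * (u.q 0 p * u.H 0 1 p + u.q 1 p * u.H 1 1 p))) * u.X 1 p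
          + u.qq p * u.qq p * u.DX 1 1 p))
      = -(u.R p ^ 2 * u.qq p ^ 4) + u.R p * (u.qq p ^ 2 * (u.qq p * u.lap p + 6 * u.qHq p)) := by
    have : u.R p * (u.qq p ^ 2 * (u.qq p * u.lap p + 6 * u.qHq p))
        = u.R p * u.qq p ^ 2 * (u.dX p + 4 * u.qHq p) := by rw [hX]; ring
    rw [this]
    simp only [Fld.X, Fld.dX, Fld.qHq, Fld.Hq, hs]
    generalize u.DX 0 0 p = x0
    generalize u.DX 1 1 p = x1
    simp only [Fld.qq]
    ring
  linarith

theorem bd_identity (h : Reg γ p₀ ε T u) (hp : 0 < p₀) : ∃ N, Nul T N ∧ ∀ᵐ p ∂muQ T,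
    u.bdI ε p = N p + u.ρ p * (2 * u.D2 p - u.V2 p) - u.ρ p * u.wz p ^ 2
      - 4 * γ * u.pw (γ - 1) p * u.qq p - 2 * √ε * (u.s p * u.HD p - u.qDq p)
      + ε * (-(2 * u.qq p * u.qDq p) + u.qq p ^ 2 * u.dv p) + ε * u.s p * u.dX p * u.dv p
      - ε * u.s p * u.lap p * u.dv p - ε * (1 + 1 / p₀) * u.pw (-p₀) p * u.dv p
      - 2 * ε * u.s p * √(u.vv p) ^ 3 * (u.q 0 p * u.v 0 p + u.q 1 p * u.v 1 p)
      - 2 * ε * u.H2 p - 2 * ε * (1 + ε) * (u.qq p * u.H2 p + 2 * (u.Hq 0 p ^ 2 + u.Hq 1 p ^ 2))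
      - 2 * ε ^ 2 * (u.qq p ^ 2 * u.H2 p + 4 * u.qq p * (u.Hq 0 p ^ 2 + u.Hq 1 p ^ 2)
          + 4 * (u.q 0 p * u.Hq 0 p + u.q 1 p * u.Hq 1 p) ^ 2)
      - 2 * ε * (2 * p₀ + 1) * (u.pw (-p₀) p * u.R p ^ 2 * (u.qq p + ε * u.qq p ^ 2)) := by
  obtain ⟨N1, n1, e1⟩ := h.bd_viscous
  obtain ⟨N2, n2, e2⟩ := h.bd_artificial
  obtain ⟨N3, n3, e3⟩ := h.bd_convective
  obtain ⟨N4, n4, e4⟩ := h.bd_vertical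
  obtain ⟨N5, n5, e5⟩ := h.bd_quartic
  obtain ⟨N6, n6, e6⟩ := h.bd_singular hp
  obtain ⟨N7, n7, e7⟩ := h.bd_hessian
  refine ⟨_, ((((((n1.add (n2.const_mul (√ε))).add n3).add n4).add (n5.const_mul ε)).add
    (n6.const_mul ε)).add n7), ?_⟩
  filter_upwards [e1, e2, e3, e4, e5, e6, e7, h.pos, h.mass, h.mom 0, h.mom 1]
    with p e1 e2 e3 e4 e5 e6 e7 ⟨hs, hρ, hR⟩ mass m0 m1
  have hRρ : u.R p * u.ρ p = u.s p := by rw [hρ]; linear_combination u.s p * hR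
  have hD : u.D 1 0 p = u.D 0 1 p := by simp only [Fld.D]; ring
  have hG : u.G p₀ ε p = ε * u.s p * u.lap p + ε * u.s p * u.dX p + ε * u.pw (-p₀) p := rfl
  have hqD : u.q 0 p * (u.q 0 p * u.V 0 0 p + u.q 1 p * u.V 0 1 p)
      + u.q 1 p * (u.q 0 p * u.V 1 0 p + u.q 1 p * u.V 1 1 p) = u.qDq p := by
    simp only [Fld.qDq, Fld.D]; ring
  rw [hG] at mass
  change _ + _ + _ + γ * u.pw (γ - 1) p * _ = _ + _ + _ + (_ + _ - ε * u.pw (-p₀) p * _ - _) at m0 m1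
  have hqq : u.qq p = u.q 0 p ^ 2 + u.q 1 p ^ 2 := rfl
  simp only [Fld.DD] at e1
  simp only [Fld.bdI]
  linear_combination 2 * u.R p * u.q 0 p * m0 + 2 * u.R p * u.q 1 p * m1
    + (-u.dv p - 2 * u.R p * (u.lap p + ε * u.dX p)) * mass + e1 + √ε * e2 + e3 + e4 + ε * e5
    + ε * e6 + e7 + 2 * ε * u.qq p * hqD + 4 * γ * u.pw (γ - 1) p * hqq
    + (-2 * (u.q 0 p * u.vt 0 p + u.q 1 p * u.vt 1 p)
      - 2 * (u.q 0 p * (u.v 0 p * u.V 0 0 p + u.v 1 p * u.V 0 1 p)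
        + u.q 1 p * (u.v 0 p * u.V 1 0 p + u.v 1 p * u.V 1 1 p))
      - 2 * u.w p * (u.q 0 p * u.Z 0 p + u.q 1 p * u.Z 1 p)
      - 2 * ε * √(u.vv p) ^ 3 * (u.q 0 p * u.v 0 p + u.q 1 p * u.v 1 p)) * hRρ
    + (-4 * γ * u.pw (γ - 1) p * (u.q 0 p ^ 2 + u.q 1 p ^ 2)
      + 2 * ε * u.qq p * (u.q 0 p * (u.q 0 p * u.V 0 0 p + u.q 1 p * u.V 0 1 p)
      + u.q 1 p * (u.q 0 p * u.V 1 0 p + u.q 1 p * u.V 1 1 p))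
      - 2 * ε * (u.lap p + ε * u.dX p) * (u.lap p + u.dX p)) * hR

theorem R_pow_eight_le (h : Reg γ p₀ ε T u) (hp : 4 ≤ p₀) :
    ∀ᵐ p ∂muQ T, u.R p ^ 8 ≤ 1 + u.pw (-p₀) p := by
  filter_upwards [h.pos] with p ⟨hs, hρ, hR⟩
  have hρ0 : 0 < u.ρ p := by rw [hρ]; positivity
  have h1 : u.R p ^ 8 = u.ρ p ^ (-4 : ℝ) := by
    rw [Real.rpow_neg hρ0.le, hρ]
    simp only [Fld.R]
    rw [inv_pow]; norm_cast; ring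
  rw [h1]
  have h2 : 0 ≤ u.pw (-p₀) p := Real.rpow_nonneg hρ0.le _
  rcases le_total 1 (u.ρ p) with h3 | h3
  · linarith [Real.rpow_le_one_of_one_le_of_nonpos h3 (by norm_num : (-4 : ℝ) ≤ 0)]
  · have : u.ρ p ^ (-4 : ℝ) ≤ u.ρ p ^ (-p₀) := Real.rpow_le_rpow_of_exponent_ge hρ0 h3 (by linarith)
    simp only [Fld.pw] at h2 ⊢
    linarith

/-- The quintic damping tested with the gradient of the density. -/
theorem bd_damping (h : Reg γ p₀ ε T u) (hp : 4 ≤ p₀) : ∀ᵐ p ∂muQ T,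
    -(u.s p * √(u.vv p) ^ 3 * (u.q 0 p * u.v 0 p + u.q 1 p * u.v 1 p))
      ≤ u.ρ p * √(u.vv p) ^ 3 * u.vv p + 1 / 72 * (u.R p ^ 2 * u.qq p ^ 3)
        + 72 ^ 5 * (1 + u.pw (-p₀) p) := by
  filter_upwards [h.pos, h.R_pow_eight_le hp] with p ⟨hs, hρ, hR⟩ h8
  have hvv := u.vv_nonneg p
  have hqq := u.qq_nonneg p
  set l := √(u.vv p) with hl
  set r := √(u.qq p) with hr
  have hl2 : l ^ 2 = u.vv p := Real.sq_sqrt hvv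
  have hr2 : r ^ 2 = u.qq p := Real.sq_sqrt hqq
  have hl0 : 0 ≤ l := Real.sqrt_nonneg _
  have hr0 : 0 ≤ r := Real.sqrt_nonneg _
  have h1 : |u.q 0 p * u.v 0 p + u.q 1 p * u.v 1 p| ≤ r * l := by
    apply abs_le_of_sq_le_sq _ (by positivity)
    rw [mul_pow, hl2, hr2]; exact u.qv_sq p
  have h2 : -(u.s p * l ^ 3 * (u.q 0 p * u.v 0 p + u.q 1 p * u.v 1 p)) ≤ u.s p * l ^ 4 * r := by
    have := mul_le_mul_of_nonneg_left ((neg_le_abs _).trans h1) (by positivity : 0 ≤ u.s p * l ^ 3)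
    linarith only [this]
  refine h2.trans ?_
  have hR0 : 0 < u.R p := by simp only [Fld.R]; positivity
  have h3 := pow_four_mul_le (x := u.s p ^ 2 * l) (y := u.s p * r) (by positivity) (by positivity)
  have h4 := mul_le_mul_of_nonneg_left h3 (by positivity : 0 ≤ u.R p ^ 8)
  have hs1 : u.s p = (u.R p)⁻¹ := by simp [Fld.R]
  have e1 : u.R p ^ 8 * ((u.s p ^ 2 * l) ^ 4 * (u.s p * r)) = u.s p * l ^ 4 * r := by
    rw [hs1]; field_simp
  have e2 : u.R p ^ 8 * ((u.s p ^ 2 * l) ^ 5 + 1 / 72 * (u.s p * r) ^ 6 + 72 ^ 5)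
      = u.ρ p * l ^ 3 * u.vv p + 1 / 72 * (u.R p ^ 2 * u.qq p ^ 3) + 72 ^ 5 * u.R p ^ 8 := by
    rw [hρ, ← hl2, ← hr2, hs1]; field_simp
  rw [e1, e2] at h4
  have h5 := mul_le_mul_of_nonneg_left h8 (by norm_num : (0 : ℝ) ≤ 72 ^ 5)
  linarith only [h4, h5]

/-- The constant in the Bresch–Desjardins inequality. -/
def bdC : ℝ := 2 * 72 ^ 5 + 508

set_option maxHeartbeats 1000000 in
theorem bd_le (h : Reg γ p₀ ε T u) (hp : 24 < p₀) (hε : 0 < ε) (hε1 : ε ≤ 1 / 4) :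
    ∃ N, Nul T N ∧ ∀ᵐ p ∂muQ T, u.bdI ε p + u.bdDiss γ ε p ≤ N p + bdC * u.bdErr p₀ ε p := by
  have hp0 : 0 < 2 * p₀ + 1 := by linarith
  have hp1 : (1 + 1 / p₀) ^ 2 ≤ 4 := by
    have h1 : 1 / p₀ ≤ 1 := by rw [div_le_one (by linarith)]; linarith
    have h2 : 0 ≤ 1 / p₀ := div_nonneg zero_le_one (by linarith)
    nlinarith
  obtain ⟨N, n, e⟩ := h.bd_identity (by linarith)
  obtain ⟨N1, n1, e1⟩ := h.interp_one
  obtain ⟨N2, n2, e2⟩ := h.interp_two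
  obtain ⟨N3, n3, e3⟩ := h.interp_three
  refine ⟨_, ((n.add (n1.const_mul (ε / 32))).add (n2.const_mul (ε / 36))).add
    (n3.const_mul (ε ^ 2 / 152)), ?_⟩
  filter_upwards [e, e1, e2, e3, h.dX_eq, h.pos, h.bd_damping (by linarith)]
    with p e e1 e2 e3 hX ⟨hs, hρ, hR⟩ dmp
  have hρ0 : 0 < u.ρ p := by rw [hρ]; positivity
  have hB : 0 ≤ u.pw (-p₀) p := Real.rpow_nonneg hρ0.le _
  have hsq : √ε ^ 2 = ε := Real.sq_sqrt hε.le
  have hR2 : u.R p ^ 2 * u.ρ p = 1 := by rw [hρ, ← mul_pow, hR, one_pow]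
  have hH := u.H2_nonneg p
  have hD := u.D2_nonneg p
  have hqq := u.qq_nonneg p
  have t1 : -(2 * √ε * (u.s p * u.HD p)) ≤ ε / 2 * u.H2 p + 2 * (u.ρ p * u.D2 p) := by
    refine le_add_of_sq_le_mul (by positivity) (by positivity) ?_
    have := mul_le_mul_of_nonneg_left (u.HD_sq p) (by positivity : 0 ≤ 4 * ε * u.ρ p)
    calc _ = 4 * √ε ^ 2 * u.s p ^ 2 * u.HD p ^ 2 := by ring
      _ = 4 * ε * u.ρ p * u.HD p ^ 2 := by rw [hsq, hρ]
      _ ≤ _ := by linarith only [this]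
  have t2 : 2 * √ε * u.qDq p ≤ 1 / 32 * ε * (u.R p ^ 2 * u.qq p ^ 2) + 32 * (u.ρ p * u.D2 p) := by
    refine le_add_of_sq_le_mul (by positivity) (by positivity) ?_
    have := mul_le_mul_of_nonneg_left (u.qDq_sq p) (by positivity : 0 ≤ 4 * ε)
    calc _ = 4 * √ε ^ 2 * u.qDq p ^ 2 := by ring
      _ ≤ 4 * ε * (u.qq p ^ 2 * u.D2 p) * (u.R p ^ 2 * u.ρ p) := by rw [hsq, hR2, mul_one]; exact this
      _ = _ := by ring
  have t3 : ε * (-(2 * u.qq p * u.qDq p) + u.qq p ^ 2 * u.dv p)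
      ≤ 1 / 152 * ε ^ 2 * (u.R p ^ 2 * u.qq p ^ 4) + 456 * (u.ρ p * u.D2 p) := by
    refine le_add_of_sq_le_mul (by positivity) (by positivity) ?_
    have h1 : (-(2 * u.qq p * u.qDq p) + u.qq p ^ 2 * u.dv p) ^ 2 ≤ 12 * (u.qq p ^ 4 * u.D2 p) := by
      have := mul_le_mul_of_nonneg_left (u.qDq_sq p) (by positivity : 0 ≤ 8 * u.qq p ^ 2)
      have h2 := mul_le_mul_of_nonneg_left (u.dv_sq p) (by positivity : 0 ≤ 2 * u.qq p ^ 4)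
      have h3 := sq_nonneg (2 * u.qq p * u.qDq p + u.qq p ^ 2 * u.dv p)
      linarith only [this, h2, h3]
    have := mul_le_mul_of_nonneg_left h1 (by positivity : 0 ≤ ε ^ 2)
    calc _ = ε ^ 2 * (-(2 * u.qq p * u.qDq p) + u.qq p ^ 2 * u.dv p) ^ 2 := by ring
      _ ≤ ε ^ 2 * (12 * (u.qq p ^ 4 * u.D2 p)) * (u.R p ^ 2 * u.ρ p) := by rw [hR2, mul_one]; exact this
      _ = _ := by ring
  have t4 : ε * u.s p * u.dX p * u.dv p
      ≤ ε ^ 2 / 2 * (u.qq p ^ 2 * u.H2 p) + 12 * (u.ρ p * u.D2 p) := by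
    refine le_add_of_sq_le_mul (by positivity) (by positivity) ?_
    have h1 := sq_combine (a := u.qq p) (u.lap_sq p) (y := 2 * u.qHq p) (d := 4 * u.qq p ^ 2)
      (by linarith only [u.qHq_sq p])
    rw [← hX] at h1
    have h2 : u.dX p ^ 2 * u.dv p ^ 2 ≤ (12 * (u.qq p ^ 2 * u.H2 p)) * (2 * u.D2 p) := by
      refine mul_le_mul (by linarith only [h1]) (u.dv_sq p) (sq_nonneg _) (by positivity)
    have := mul_le_mul_of_nonneg_left h2 (by positivity : 0 ≤ ε ^ 2 * u.ρ p)
    calc _ = ε ^ 2 * u.s p ^ 2 * (u.dX p ^ 2 * u.dv p ^ 2) := by ring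
      _ = ε ^ 2 * u.ρ p * (u.dX p ^ 2 * u.dv p ^ 2) := by rw [hρ]
      _ ≤ _ := by linarith only [this]
  have t5 : -(ε * u.s p * u.lap p * u.dv p) ≤ ε / 2 * u.H2 p + 2 * ε * (u.ρ p * u.D2 p) := by
    refine le_add_of_sq_le_mul (by positivity) (by positivity) ?_
    have h2 : u.lap p ^ 2 * u.dv p ^ 2 ≤ (2 * u.H2 p) * (2 * u.D2 p) :=
      mul_le_mul (u.lap_sq p) (u.dv_sq p) (sq_nonneg _) (by positivity)
    have := mul_le_mul_of_nonneg_left h2 (by positivity : 0 ≤ ε ^ 2 * u.ρ p)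
    calc _ = ε ^ 2 * u.s p ^ 2 * (u.lap p ^ 2 * u.dv p ^ 2) := by ring
      _ = ε ^ 2 * u.ρ p * (u.lap p ^ 2 * u.dv p ^ 2) := by rw [hρ]
      _ ≤ _ := by linarith only [this]
  have t6 : -(ε * (1 + 1 / p₀) * u.pw (-p₀) p * u.dv p)
      ≤ ε ^ 2 * (u.pw (-p₀) p ^ 2 * u.R p ^ 2) + 2 * (u.ρ p * u.D2 p) := by
    refine le_add_of_sq_le_mul (by positivity) (by positivity) ?_
    have h2 : (1 + 1 / p₀) ^ 2 * u.dv p ^ 2 ≤ 4 * (2 * u.D2 p) :=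
      mul_le_mul hp1 (u.dv_sq p) (sq_nonneg _) (by norm_num)
    have := mul_le_mul_of_nonneg_left h2 (by positivity : 0 ≤ ε ^ 2 * u.pw (-p₀) p ^ 2)
    calc _ = ε ^ 2 * u.pw (-p₀) p ^ 2 * ((1 + 1 / p₀) ^ 2 * u.dv p ^ 2) := by ring
      _ ≤ ε ^ 2 * u.pw (-p₀) p ^ 2 * (4 * (2 * u.D2 p)) * (u.R p ^ 2 * u.ρ p) := by
        rw [hR2, mul_one]; exact this
      _ = _ := by ring
  have t7 := mul_le_mul_of_nonneg_left dmp (by positivity : 0 ≤ 2 * ε)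
  have i1 := mul_le_mul_of_nonneg_left e1 (by positivity : 0 ≤ ε / 32)
  have i2 := mul_le_mul_of_nonneg_left e2 (by positivity : 0 ≤ ε / 36)
  have i3 := mul_le_mul_of_nonneg_left e3 (by positivity : 0 ≤ ε ^ 2 / 152)
  have g1 : 0 ≤ ε * (1 + ε) * (u.Hq 0 p ^ 2 + u.Hq 1 p ^ 2) := by positivity
  have g2 : 0 ≤ ε ^ 2 * (u.qq p * (u.Hq 0 p ^ 2 + u.Hq 1 p ^ 2)) := by positivity
  have g3 : 0 ≤ ε ^ 2 * (u.q 0 p * u.Hq 0 p + u.q 1 p * u.Hq 1 p) ^ 2 := by positivity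
  have g4 : 0 ≤ 2 * ε * (2 * p₀ + 1) * (u.pw (-p₀) p * u.R p ^ 2 * (u.qq p + ε * u.qq p ^ 2)) := by
    positivity
  have g5 : 0 ≤ ε ^ 2 * (u.qq p * u.H2 p) := by positivity
  have g6 : 0 ≤ ε * u.H2 p := by positivity
  have g7 : 0 ≤ ε ^ 2 * (u.pw (-p₀) p ^ 2 * u.R p ^ 2) := by positivity
  have g8 : 0 ≤ ε * (u.ρ p * √(u.vv p) ^ 3 * u.vv p) := by
    have := u.vv_nonneg p; positivity
  have g9 : 0 ≤ ε * (1 + u.pw (-p₀) p) := by positivity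
  have g10 : 0 ≤ u.ρ p * u.D2 p := by positivity
  have g11 : ε * (u.ρ p * u.D2 p) ≤ 1 / 4 * (u.ρ p * u.D2 p) := mul_le_mul_of_nonneg_right hε1 g10
  simp only [Fld.bdDiss, Fld.bdErr, bdC]
  rw [e]
  clear e e1 e2 e3 hX dmp
  linarith only [t1, t2, t3, t4, t5, t6, t7, i1, i2, i3, g1, g2, g3, g4, g5, g6, g7, g8, g9, g10, g11]

end Reg

/-! ### The Bresch–Desjardins functional in time -/

/-- The initial values of the density root and of the velocity. -/
structure Ini (u : Fld) (q0 : Fin 2 → Sp → ℝ) : Prop where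
  Ds : ∀ i, DQr Eq (hor i) 1 0 (1 / 4) (fun p => u.s (0, p.2)) (fun p => q0 i p.2)
  Qv : ∀ j, Q 1 (1 / 2) (fun p => u.v j (0, p.2))

namespace Fld

variable (u : Fld)

/-- The density of the convex part of the Bresch–Desjardins functional. -/
def bdY (ε : ℝ) (p : SpT) : ℝ := 2 * u.qq p + ε * u.qq p ^ 2

/-- `2 ∇ρ^{1/2} · ρ^{1/2} v`. -/
def bdX (p : SpT) : ℝ := 2 * u.s p * (u.q 0 p * u.v 0 p + u.q 1 p * u.v 1 p)

end Fld

theorem quartic_convex {ε : ℝ} (hε : 0 ≤ ε) (a b c d : ℝ) :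
    (2 * (a ^ 2 + b ^ 2) + ε * (a ^ 2 + b ^ 2) ^ 2) - (2 * (c ^ 2 + d ^ 2) + ε * (c ^ 2 + d ^ 2) ^ 2)
      ≤ 4 * (a + ε * ((a ^ 2 + b ^ 2) * a)) * (a - c)
        + 4 * (b + ε * ((a ^ 2 + b ^ 2) * b)) * (b - d) := by
  have h1 : (a ^ 2 + b ^ 2) ^ 2 - (c ^ 2 + d ^ 2) ^ 2
      ≤ 4 * (a ^ 2 + b ^ 2) * (a * (a - c) + b * (b - d)) := by
    nlinarith [sq_nonneg (a ^ 2 + b ^ 2 - c ^ 2 - d ^ 2),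
      mul_nonneg (add_nonneg (sq_nonneg a) (sq_nonneg b))
        (add_nonneg (sq_nonneg (a - c)) (sq_nonneg (b - d)))]
  have h2 := mul_le_mul_of_nonneg_left h1 hε
  nlinarith [sq_nonneg (a - c), sq_nonneg (b - d)]

theorem integrable_of_Q_space {a : ℝ} {f : Sp → ℝ} (h : Q 1 a (fun p => f p.2)) (ha : a ≤ 1) :
    Integrable f muO := by
  have h1 : Integrable (fun p : SpT => f p.2) (muQ 1) := h.integrable ha
  rw [muQ_eq_prod] at h1
  exact (h1.prod_right_ae).exists.choose_spec

/-- Convexity of the Bresch–Desjardins functional and integration by parts. -/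
theorem bdY_slice_le {ε t : ℝ} {u : Fld} {s' : Sp → ℝ} {q' : Fin 2 → Sp → ℝ} (hε : 0 ≤ ε)
    (hq : ∀ i, DQr Eq (hor i) 1 (1 / 30) (1 / 2) (fun p => u.q i (t, p.2)) (fun p => u.H i i (t, p.2)))
    (hX : ∀ i, DQr Eq (hor i) 1 (1 / 10) (1 / 2) (fun p => u.X i (t, p.2)) (fun p => u.DX i i (t, p.2)))
    (hs : ∀ i, DQr Eq (hor i) 1 0 (1 / 30) (fun p => u.s (t, p.2)) (fun p => u.q i (t, p.2)))
    (h' : ∀ i, DQr Eq (hor i) 1 0 (1 / 4) (fun p => s' p.2) (fun p => q' i p.2)) :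
    ∫ x, u.bdY ε (t, x) ∂muO - ∫ x, (2 * (q' 0 x ^ 2 + q' 1 x ^ 2)
        + ε * (q' 0 x ^ 2 + q' 1 x ^ 2) ^ 2) ∂muO
      ≤ ∫ x, -4 * (u.lap (t, x) + ε * u.dX (t, x)) * (u.s (t, x) - s' x) ∂muO := by
  have hd : ∀ i, DQr Eq (hor i) 1 0 (1 / 4) (fun p => u.s (t, p.2) + -1 * s' p.2)
      (fun p => u.q i (t, p.2) + -1 * q' i p.2) := fun i =>
    ((hs i).addH ((h' i).smulH (-1))).weaken
  have hY : ∀ i, DQr Eq (hor i) 1 (1 / 10) (1 / 2)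
      (fun p => 4 * (u.q i (t, p.2) + ε * u.X i (t, p.2)))
      (fun p => 4 * (u.H i i (t, p.2) + ε * u.DX i i (t, p.2))) := fun i =>
    (((hq i).addH ((hX i).smulH ε)).smulH 4).weaken
  have n := fun i => ((hY i).mul (hd i)).null
  have nn := ((n 0).add (n 1)).2
  have hqq' : Q 1 (1 / 2) (fun p => q' 0 p.2 ^ 2 + q' 1 p.2 ^ 2) :=
    ((h' 0).dv.sq.add (h' 1).dv.sq).mono
  have hqq : Q 1 (1 / 15) (fun p => u.qq (t, p.2)) := ((hq 0).fn.sq.add (hq 1).fn.sq).mono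
  have I1 : Integrable (fun p : SpT => u.bdY ε (t, p.2)) (muQ 1) :=
    (((hqq.const_mul 2).add' (hqq.sq.const_mul ε))).integrable
  have I2 : Integrable (fun p : SpT => 2 * (q' 0 p.2 ^ 2 + q' 1 p.2 ^ 2)
      + ε * (q' 0 p.2 ^ 2 + q' 1 p.2 ^ 2) ^ 2) (muQ 1) :=
    ((hqq'.const_mul 2).add' (hqq'.sq.const_mul ε)).integrable
  have qφ : Q 1 (1 / 2) (fun p => 4 * (u.H 0 0 (t, p.2) + ε * u.DX 0 0 (t, p.2))
      + 4 * (u.H 1 1 (t, p.2) + ε * u.DX 1 1 (t, p.2))) := (hY 0).dv.add (hY 1).dv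
  have I3 : Integrable (fun p : SpT => -4 * (u.lap (t, p.2) + ε * u.dX (t, p.2))
      * (u.s (t, p.2) - s' p.2)) (muQ 1) := by
    refine ((qφ.mul (hd 0).fn).const_mul (-1)).integrable |>.congr (.of_forall fun p => ?_)
    simp only [Fld.lap, Fld.dX]; ring
  rw [← integral_space, ← integral_space, ← integral_space, ← integral_sub I1 I2]
  have e : ∫ p : SpT, -4 * (u.lap (t, p.2) + ε * u.dX (t, p.2)) * (u.s (t, p.2) - s' p.2) ∂muQ 1
      = ∫ p : SpT, (-4 * (u.lap (t, p.2) + ε * u.dX (t, p.2)) * (u.s (t, p.2) - s' p.2)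
        + ((4 * (u.H 0 0 (t, p.2) + ε * u.DX 0 0 (t, p.2)) * (u.s (t, p.2) + -1 * s' p.2)
          + 4 * (u.q 0 (t, p.2) + ε * u.X 0 (t, p.2)) * (u.q 0 (t, p.2) + -1 * q' 0 p.2))
        + (4 * (u.H 1 1 (t, p.2) + ε * u.DX 1 1 (t, p.2)) * (u.s (t, p.2) + -1 * s' p.2)
          + 4 * (u.q 1 (t, p.2) + ε * u.X 1 (t, p.2)) * (u.q 1 (t, p.2) + -1 * q' 1 p.2)))) ∂muQ 1 := by
    rw [integral_add I3 ((n 0).add (n 1)).1, nn, add_zero]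
  rw [e]
  refine integral_mono (I1.sub I2) (I3.add ((n 0).add (n 1)).1) fun p => ?_
  have := quartic_convex hε (u.q 0 (t, p.2)) (u.q 1 (t, p.2)) (q' 0 p.2) (q' 1 p.2)
  simp only [Fld.bdY, Fld.lap, Fld.dX, Fld.X, Fld.qq] at this ⊢
  linarith only [this]

namespace Reg

variable {γ p₀ ε T : ℝ} {u : Fld} {q0 : Fin 2 → Sp → ℝ}

theorem Ts (h : Reg γ p₀ ε T u) (hT : 0 < T) : TD T u.s (fun p => 1 / 2 * (u.R p * u.ρt p)) := by
  obtain ⟨C, hC, hb⟩ := h.bd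
  have hC' : 0 < C⁻¹ := inv_pos.2 hC
  refine (TD.comp hT (φ := Real.sqrt) (φ' := fun y => 1 / (2 * √y)) (S := Icc C⁻¹ C) isClosed_Icc
    (fun y hy => Real.hasDerivAt_sqrt (hC'.trans_le hy.1).ne') ?_ h.tρ ?_).of_eq
    (fun p => (h.sdef p).symm) fun p => ?_
  · refine continuousOn_const.div (by fun_prop) fun y hy => ?_
    have := Real.sqrt_pos.2 (hC'.trans_le hy.1)
    positivity
  · filter_upwards [hb] with p hp using ⟨hp.1.le, hp.2.le⟩
  · simp only [Fld.R, h.sdef p]; field_simp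

theorem bdY_evolution (hT : 0 < T) (hε : 0 < ε) (h : Reg γ p₀ ε T u) (hi : Ini u q0) :
    ∀ᵐ τ ∂volume.restrict (Ioo 0 T), ∫ x, u.bdY ε (τ, x) ∂muO
      - ∫ x, (2 * (q0 0 x ^ 2 + q0 1 x ^ 2) + ε * (q0 0 x ^ 2 + q0 1 x ^ 2) ^ 2) ∂muO
      ≤ ∫ p, -4 * (u.lap p + ε * u.dX p) * (1 / 2 * (u.R p * u.ρt p)) ∂muQ τ := by
  have hQ : Q T (1 / 15) u.qq := ((h.Dq 0 0).fn.sq.add (h.Dq 1 0).fn.sq).mono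
  have qφ : Q T (1 / 2) (fun p => -4 * (u.lap p + ε * u.dX p)) :=
    ((((h.Dq 0 0).dv.add (h.Dq 1 1).dv).add (((h.DX 0 0).dv.add (h.DX 1 1).dv).const_mul ε)).const_mul
      (-4))
  have qb : Q T (1 / 2) (fun p => 1 / 2 * (u.R p * u.ρt p)) :=
    ((((h.DR 0).fn.mul h.qρt).const_mul (1 / 2))).mono
  have hj : Integrable (u.bdY ε) (muQ T) := ((hQ.const_mul 2).add' (hQ.sq.const_mul ε)).integrable
  rw [muQ_eq_prod] at hj
  refine TD.functional_le (G := fun t => ∀ i,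
      DQr Eq (hor i) 1 (1 / 30) (1 / 2) (fun p => u.q i (t, p.2)) (fun p => u.H i i (t, p.2)) ∧
      DQr Eq (hor i) 1 (1 / 10) (1 / 2) (fun p => u.X i (t, p.2)) (fun p => u.DX i i (t, p.2)) ∧
      DQr Eq (hor i) 1 0 (1 / 30) (fun p => u.s (t, p.2)) (fun p => u.q i (t, p.2)))
    hT (h.Ts hT) qφ qb hj.integral_prod_left ?_ ?_ ?_
  · rw [ae_all_iff]
    intro i
    filter_upwards [DQr.frozen (T' := 1) (h.Dq i i), DQr.frozen (T' := 1) (h.DX i i),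
      DQr.frozen (T' := 1) (h.Ds i)] with t h1 h2 h3 using ⟨h1, h2, h3⟩
  · intro t _ t' _ hG hG'
    exact bdY_slice_le hε.le (fun i => (hG i).1) (fun i => (hG i).2.1) (fun i => (hG i).2.2)
      (s' := fun x => u.s (t', x)) (q' := fun i x => u.q i (t', x))
      (fun i => (hG' i).2.2.weaken)
  · intro t _ hG
    exact bdY_slice_le hε.le (fun i => (hG i).1) (fun i => (hG i).2.1) (fun i => (hG i).2.2)
      (s' := fun x => u.s (0, x)) hi.Ds

theorem bdX_evolution (hT : 0 < T) (h : Reg γ p₀ ε T u) (hi : Ini u q0) (j : Fin 2) :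
    ∀ᵐ τ ∂volume.restrict (Ioo 0 T), ∫ x, u.v j (τ, x) * (2 * u.s (τ, x) * u.q j (τ, x)) ∂muO
      = ∫ x, u.v j (0, x) * (2 * u.s (0, x) * q0 j x) ∂muO
        + ∫ p, (u.vt j p * (2 * u.s p * u.q j p) - u.V j j p * u.ρt p) ∂muQ τ := by
  refine TD.cross (i := hor j) (g0 := fun x => 2 * u.s (0, x) * q0 j x) hT (h.tv j) h.tρ
    ((h.Dv j j).weaken) ((h.Dρ j).weaken)
    (h.qvt j) h.qρt (hi.Qv j) ?_
  obtain ⟨c, C, hc, hb⟩ := h.posAll hT (left_mem_Icc.2 hT.le)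
  have hb' := (quasiMP_snd 1).ae hb
  refine (((hi.Ds j).mul (hi.Ds j)).congr ?_ (.of_forall fun p => ?_)).weaken
  · filter_upwards [hb'] with p hp
    rw [h.sdef]; exact Real.mul_self_sqrt (hc.le.trans hp.1)
  · ring

theorem bd_evolution (hT : 0 < T) (hε : 0 < ε) (h : Reg γ p₀ ε T u) (hi : Ini u q0) :
    ∀ᵐ τ ∂volume.restrict (Ioo 0 T), ∫ x, u.bdX (τ, x) ∂muO + ∫ x, u.bdY ε (τ, x) ∂muO
      ≤ ∫ x, 2 * u.s (0, x) * (q0 0 x * u.v 0 (0, x) + q0 1 x * u.v 1 (0, x)) ∂muO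
        + ∫ x, (2 * (q0 0 x ^ 2 + q0 1 x ^ 2) + ε * (q0 0 x ^ 2 + q0 1 x ^ 2) ^ 2) ∂muO
        + ∫ p, u.bdI ε p ∂muQ τ := by
  have qsum : ∀ j, Q T 1 (fun p => u.v j p * (2 * u.s p * u.q j p)) := fun j =>
    ((h.Dv j j).fn.mul (((h.Ds j).fn.mul (h.Dq j j).fn).const_mul 2)).mono
      |>.of_eq fun p => by ring
  have q0sum : ∀ j, Q 1 1 (fun p => u.v j (0, p.2) * (2 * u.s (0, p.2) * q0 j p.2)) := fun j =>
    ((hi.Qv j).mul (((hi.Ds j).fn.mul (hi.Ds j).dv).const_mul 2)).mono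
      |>.of_eq fun p => by ring
  have qi : ∀ j, Q T 1 (fun p => u.vt j p * (2 * u.s p * u.q j p) - u.V j j p * u.ρt p) := fun j =>
    (((h.qvt j).mul (((h.Ds j).fn.mul (h.Dq j j).fn).const_mul 2)).mono
      |>.of_eq fun p => by ring : Q T 1 (fun p => u.vt j p * (2 * u.s p * u.q j p))).sub
      (((h.Dv j j).dv.mul h.qρt).mono)
  have qr : Q T 1 (fun p => -4 * (u.lap p + ε * u.dX p) * (1 / 2 * (u.R p * u.ρt p))) := by
    have qφ : Q T (1 / 2) (fun p => -4 * (u.lap p + ε * u.dX p)) :=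
      ((((h.Dq 0 0).dv.add (h.Dq 1 1).dv).add (((h.DX 0 0).dv.add (h.DX 1 1).dv).const_mul ε)).const_mul
        (-4))
    exact (qφ.mul (((h.DR 0).fn.mul h.qρt).const_mul (1 / 2))).mono
  filter_upwards [h.bdY_evolution hT hε hi, h.bdX_evolution hT hi 0, h.bdX_evolution hT hi 1,
    Q.frozen (T' := 1) (qsum 0), Q.frozen (T' := 1) (qsum 1), ae_restrict_mem measurableSet_Ioo]
    with τ h1 h2 h3 h4 h5 hτ
  have e1 : ∫ x, u.bdX (τ, x) ∂muO = ∫ x, u.v 0 (τ, x) * (2 * u.s (τ, x) * u.q 0 (τ, x)) ∂muO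
      + ∫ x, u.v 1 (τ, x) * (2 * u.s (τ, x) * u.q 1 (τ, x)) ∂muO := by
    rw [← integral_add (integrable_of_Q_space h4 le_rfl) (integrable_of_Q_space h5 le_rfl)]
    refine integral_congr_ae (.of_forall fun x => ?_)
    simp only [Fld.bdX]; ring
  have e2 : ∫ x, 2 * u.s (0, x) * (q0 0 x * u.v 0 (0, x) + q0 1 x * u.v 1 (0, x)) ∂muO
      = ∫ x, u.v 0 (0, x) * (2 * u.s (0, x) * q0 0 x) ∂muO
      + ∫ x, u.v 1 (0, x) * (2 * u.s (0, x) * q0 1 x) ∂muO := by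
    rw [← integral_add (integrable_of_Q_space (q0sum 0) le_rfl)
      (integrable_of_Q_space (q0sum 1) le_rfl)]
    refine integral_congr_ae (.of_forall fun x => ?_)
    ring
  have m := fun j => ((qi j).mono_time hτ.2.le).integrable
  have e3 : ∫ p, u.bdI ε p ∂muQ τ
      = ∫ p, (u.vt 0 p * (2 * u.s p * u.q 0 p) - u.V 0 0 p * u.ρt p) ∂muQ τ
      + ∫ p, (u.vt 1 p * (2 * u.s p * u.q 1 p) - u.V 1 1 p * u.ρt p) ∂muQ τ
      + ∫ p, -4 * (u.lap p + ε * u.dX p) * (1 / 2 * (u.R p * u.ρt p)) ∂muQ τ := by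
    rw [← integral_add' (m 0) (m 1),
      ← integral_add' ((m 0).add (m 1)) ((qr.mono_time hτ.2.le).integrable)]
    refine integral_congr_ae (.of_forall fun p => ?_)
    simp only [Fld.bdI, Fld.dv, Pi.add_apply]; ring
  rw [e1, e2, e3, h2, h3]
  linarith only [h1]

end Reg

/-! ### The Bresch–Desjardins bound -/

theorem exists_seq_of_ae_Ioo (hT : 0 < T) {P : ℝ → Prop}
    (h : ∀ᵐ t ∂volume.restrict (Ioo 0 T), P t) {t : ℝ} (ht : t ∈ Icc 0 T) :
    ∃ u : ℕ → ℝ, (∀ n, u n ∈ Ioo 0 T ∧ P (u n)) ∧ Tendsto u atTop (𝓝 t) := by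
  rw [ae_restrict_iff' measurableSet_Ioo] at h
  have hd : Dense {s : ℝ | s ∈ Ioo 0 T → P s} := Measure.dense_of_ae h
  have hcl : t ∈ closure (Ioo 0 T ∩ {s : ℝ | s ∈ Ioo 0 T → P s}) := by
    have : t ∈ closure (Ioo 0 T) := by rwa [closure_Ioo hT.ne]
    exact closure_minimal (hd.open_subset_closure_inter isOpen_Ioo) isClosed_closure this
  obtain ⟨u, hu, hut⟩ := mem_closure_iff_seq_limit.1 hcl
  exact ⟨u, fun n => ⟨(hu n).1, (hu n).2 (hu n).1⟩, hut⟩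

theorem integral_muQ_time (hg : Integrable g (muQ T)) :
    ∫ p, g p ∂muQ T = ∫ t in Ioo 0 T, ∫ x, g (t, x) ∂muO := by
  rw [muQ_eq_prod] at hg ⊢
  exact integral_prod _ hg

theorem continuousOn_integral_muQ (hg : Integrable g (muQ T)) :
    ContinuousOn (fun t => ∫ p, g p ∂muQ t) (Icc 0 T) := by
  have h1 : IntegrableOn (fun t => ∫ x, g (t, x) ∂muO) (Icc 0 T) := by
    rw [integrableOn_Icc_iff_integrableOn_Ioo]
    have := hg
    rw [muQ_eq_prod] at this
    exact this.integral_prod_left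
  refine (intervalIntegral.continuousOn_primitive h1).congr fun t ht => ?_
  simp only
  rw [integral_muQ_time (hg.mono_measure (muQ_mono ht.2)), integral_Ioc_eq_integral_Ioo]

theorem integral_muQ_le_of_slices {K : ℝ} (hT : 0 < T) (hg : Integrable g (muQ T))
    (h : ∀ᵐ t ∂volume.restrict (Ioo 0 T), ∫ x, g (t, x) ∂muO ≤ K) : ∫ p, g p ∂muQ T ≤ T * K := by
  rw [integral_muQ_time hg]
  rw [muQ_eq_prod] at hg
  refine (integral_mono_ae hg.integral_prod_left (integrable_const K) h).trans (le_of_eq ?_)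
  rw [integral_const, smul_eq_mul, measureReal_restrict_apply_univ, Real.volume_real_Ioo_of_le hT.le,
    sub_zero]

theorem integral_muQ_mono {τ : ℝ} (hτ : τ ≤ T) (hg : Integrable g (muQ T))
    (h : ∀ᵐ p ∂muQ T, 0 ≤ g p) : ∫ p, g p ∂muQ τ ≤ ∫ p, g p ∂muQ T :=
  integral_mono_measure (muQ_mono hτ) h hg

namespace Reg

variable {γ p₀ ε T : ℝ} {u : Fld} {q0 : Fin 2 → Sp → ℝ}

theorem QbdI (h : Reg γ p₀ ε T u) : Q T 1 (u.bdI ε) := by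
  have a : ∀ j, Q T 1 (fun p => 2 * (u.s p * u.q j p) * u.vt j p) := fun j =>
    ((((h.Ds j).fn.mul (h.Dq j j).fn).const_mul 2).mul (h.qvt j)).mono
  have b : Q T 1 (fun p => u.dv p * u.ρt p) := (((h.Dv 0 0).dv.add (h.Dv 1 1).dv).mul h.qρt).mono
  have c : Q T 1 (fun p => 2 * u.R p * (u.lap p + ε * u.dX p) * u.ρt p) :=
    ((((h.DR 0).fn.const_mul 2).mul (((h.Dq 0 0).dv.add (h.Dq 1 1).dv).add
      (((h.DX 0 0).dv.add (h.DX 1 1).dv).const_mul ε))).mul h.qρt).mono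
  refine ((((a 0).add (a 1)).sub b).sub c).of_eq fun p => ?_
  simp only [Fld.bdI]; ring

theorem QH2 (h : Reg γ p₀ ε T u) : Q T 1 u.H2 :=
  ((((h.Dq 0 0).dv.sq.add (h.Dq 0 1).dv.sq).add (h.Dq 1 0).dv.sq).add (h.Dq 1 1).dv.sq).mono

theorem QqqH2 (h : Reg γ p₀ ε T u) : Q T 1 (fun p => u.qq p * u.H2 p) := by
  have a := fun i j => (h.hess i j).mul (h.Dq i j).dv
  refine ((((a 0 0).add (a 0 1)).add (a 1 0)).add (a 1 1)).mono (b := 1) |>.of_eq fun p => ?_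
  simp only [Fld.H2]; ring

theorem Qqq2H2 (h : Reg γ p₀ ε T u) : Q T 1 (fun p => u.qq p ^ 2 * u.H2 p) := by
  have a := fun i j => (h.hess i j).sq
  refine ((((a 0 0).add (a 0 1)).add (a 1 0)).add (a 1 1)).mono (b := 1) |>.of_eq fun p => ?_
  simp only [Fld.H2]; ring

theorem QV2 (h : Reg γ p₀ ε T u) : Q T (3 / 5) u.V2 :=
  ((((h.Dv 0 0).dv.sq.add (h.Dv 0 1).dv.sq).add (h.Dv 1 0).dv.sq).add (h.Dv 1 1).dv.sq).mono

theorem QbdDiss (h : Reg γ p₀ ε T u) : Q T 1 (u.bdDiss γ ε) := by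
  have hρ := (h.Dρ 0).fn
  have a1 := (hρ.mul h.QV2).mono (b := 1)
  have a2 := (hρ.mul h.Dw.dv.sq).mono (b := 1)
  have a3 := (((h.Qpw (γ - 1)).const_mul (4 * γ)).mul h.Qqq).mono (b := 1)
  exact ((((a1.add a2).add a3).add (h.QH2.const_mul _)).add (h.QqqH2.const_mul _)).add
    (h.Qqq2H2.const_mul _)

theorem bdDiss_nonneg (hγ : 1 < γ) (hε : 0 < ε) (hρ : 0 ≤ u.ρ p) : 0 ≤ u.bdDiss γ ε p := by
  have h1 := u.H2_nonneg p
  have h2 := u.V2_nonneg p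
  have h3 := u.qq_nonneg p
  have h4 : 0 ≤ u.pw (γ - 1) p := Real.rpow_nonneg hρ _
  have h5 : 0 < γ := by linarith
  unfold Fld.bdDiss
  positivity

theorem QbdErr (h : Reg γ p₀ ε T u) : Q T 1 (u.bdErr p₀ ε) := by
  have a1 := ((h.Dρ 0).fn.mul h.QD2).mono (b := 1)
  have a2 := ((((h.Qpw (-p₀)).sq.mul (h.DR 0).fn.sq)).const_mul (ε ^ 2)).mono (b := 1)
  have a3 := (h.Qlen3.const_mul ε).mono (b := 1)
  have a4 := (((Q.const 1).add (h.Qpw (-p₀))).const_mul ε).mono (b := 1)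
  exact ((a1.add a2).add a3).add a4

theorem bdErr_le (hp : 24 < p₀) (hγ : 1 < γ) (hε : 0 < ε) (hε1 : ε ≤ 1 / 4) (hρ : 0 ≤ u.ρ p) : u.bdErr p₀ ε p ≤ u.eDiss p₀ ε p + (1 + u.eY γ p₀ ε p) := by
  have h1 := u.D2_nonneg p
  have h2 := u.vv_nonneg p
  have h3 := u.qq_nonneg p
  have h4 : 0 ≤ u.pw (-p₀) p := Real.rpow_nonneg hρ _
  have h5 := (eY_nonneg hγ (by linarith : 0 < p₀) hε hρ).2
  have h6 : 0 ≤ u.Z2 p := by unfold Fld.Z2; positivity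
  have g1 : 0 ≤ u.ρ p * u.Z2 p := by positivity
  have g2 : 0 ≤ ε / 4 * (u.qq p * u.vv p) := by positivity
  have g3 : 0 ≤ ε / 2 * (u.qq p ^ 2 * u.vv p) := by positivity
  have g4 : 0 ≤ ε / 2 * (u.pw (-p₀) p * u.vv p) := by positivity
  have g5 : 0 ≤ ε * (u.qq p + u.qq p ^ 2) := by positivity
  have g6 : ε ^ 2 * (u.pw (-p₀) p ^ 2 * u.R p ^ 2)
      ≤ p₀ / 2 * (ε ^ 2 * (u.pw (-p₀) p ^ 2 * u.R p ^ 2)) :=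
    le_mul_of_one_le_left (by positivity) (by linarith)
  unfold Fld.bdErr Fld.eDiss
  linarith only [g1, g2, g3, g4, g5, g6, h5, hε1]

/-- The Bresch–Desjardins bound at almost every time. -/
theorem bd_bound {K A : ℝ} (hT : 0 < T) (hγ : 1 < γ) (hp : 24 < p₀) (hε : 0 < ε) (hε1 : ε ≤ 1 / 4)
    (h : Reg γ p₀ ε T u) (hi : Ini u q0)
    (hK : ∀ t ∈ Icc 0 T, ∫ x, u.eY γ p₀ ε (t, x) ∂muO + ∫ p, u.eDiss p₀ ε p ∂muQ t ≤ K)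
    (hA : ∫ x, 2 * u.s (0, x) * (q0 0 x * u.v 0 (0, x) + q0 1 x * u.v 1 (0, x)) ∂muO
    + ∫ x, (2 * (q0 0 x ^ 2 + q0 1 x ^ 2) + ε * (q0 0 x ^ 2 + q0 1 x ^ 2) ^ 2) ∂muO ≤ A) :
    ∀ᵐ τ ∂volume.restrict (Ioo 0 T),
      ∫ x, (u.qq (τ, x) + ε * u.qq (τ, x) ^ 2) ∂muO + ∫ p, u.bdDiss γ ε p ∂muQ τ
        ≤ A + 2 * K + bdC * (K + T * (1 + K)) := by
  obtain ⟨N, hN, hle⟩ := h.bd_le hp hε hε1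
  have hp0 : 0 < p₀ := by linarith
  have hρ := h.ρ_nonneg
  have hes := fun t ht => h.energy_split hT hγ hp0 hε hK (t := t) ht
  have qY : Q T 1 (fun p => 1 + u.eY γ p₀ ε p) := ((Q.const 1).add' h.QeY).mono
  have hYint : ∫ p, (1 + u.eY γ p₀ ε p) ∂muQ T ≤ T * (1 + K) := by
    refine integral_muQ_le_of_slices hT qY.integrable ?_
    filter_upwards [ae_restrict_mem measurableSet_Ioo] with t ht
    have ht' := Ioo_subset_Icc_self ht
    rw [integral_add (integrable_const _) (h.eY_integrable hT ht')]
    simp only [integral_const, smul_eq_mul, mul_one, probReal_univ]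
    linarith [(hes t ht').2.2.1]
  filter_upwards [h.bd_evolution hT hε hi, ae_restrict_mem measurableSet_Ioo,
    Q.frozen (T' := 1) h.Qqq, Q.frozen (T' := 1) (h.Ds 0).fn,
    ae_all_iff.2 fun j => Q.frozen (T' := 1) (h.Dv j j).fn,
    ae_all_iff.2 fun j => Q.frozen (T' := 1) (h.Dq j j).fn] with τ h1 hτ' fq fs fv fqj
  have hτ := Ioo_subset_Icc_self hτ'
  have mt : ∀ {f : SpT → ℝ}, Q T 1 f → Q τ 1 f := fun hf => hf.mono_time hτ.2
  have hErr : ∫ p, u.bdErr p₀ ε p ∂muQ τ ≤ K + T * (1 + K) := by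
    have e1 := Q.integral_mono (mt h.QbdErr) ((mt h.QeDiss).add (mt qY)) (ae_mono (muQ_mono hτ.2)
      (by filter_upwards [hρ] with p hp' using bdErr_le hp hγ hε hε1 hp'))
    rw [integral_add (mt h.QeDiss).integrable ((mt qY).integrable)] at e1
    have e2 := integral_muQ_mono hτ.2 qY.integrable
      (by filter_upwards [hρ] with p hp' using by linarith [(eY_nonneg hγ hp0 hε hp').1])
    linarith [(hes τ hτ).2.2.2]
  have hI : ∫ p, u.bdI ε p ∂muQ τ + ∫ p, u.bdDiss γ ε p ∂muQ τ
      ≤ bdC * ∫ p, u.bdErr p₀ ε p ∂muQ τ := by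
    have hNτ := hN τ hτ.2
    have e1 := Q.integral_mono ((mt h.QbdI).add (mt h.QbdDiss))
      ((Q.of_integrable hNτ.1).add ((mt h.QbdErr).const_mul bdC)) (ae_mono (muQ_mono hτ.2) hle)
    rw [integral_add (mt h.QbdI).integrable (mt h.QbdDiss).integrable,
      integral_add hNτ.1 ((mt h.QbdErr).integrable.const_mul _), hNτ.2, zero_add,
      integral_const_mul] at e1
    exact e1
  have hC : (0 : ℝ) ≤ bdC := by unfold bdC; norm_num
  have hErr' := mul_le_mul_of_nonneg_left hErr hC
  have hslice : ∫ x, (u.qq (τ, x) + ε * u.qq (τ, x) ^ 2) ∂muO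
      ≤ ∫ x, u.bdX (τ, x) ∂muO + ∫ x, u.bdY ε (τ, x) ∂muO + ∫ x, 2 * u.eY γ p₀ ε (τ, x) ∂muO := by
    have i1 : Integrable (fun x => u.qq (τ, x) + ε * u.qq (τ, x) ^ 2) muO :=
      integrable_of_Q_space (a := 1) (fq.mono.add (fq.sq.const_mul ε).mono) le_rfl
    have i2 : Integrable (fun x => u.bdY ε (τ, x)) muO :=
      integrable_of_Q_space (a := 1) (f := fun x => u.bdY ε (τ, x))
        ((fq.const_mul 2).mono.add (fq.sq.const_mul ε).mono) le_rfl
    have i3 : Integrable (fun x => u.bdX (τ, x)) muO :=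
      integrable_of_Q_space (a := 1) (f := fun x => u.bdX (τ, x)) (((fs.const_mul 2).mul
        (((fqj 0).mul (fv 0)).add ((fqj 1).mul (fv 1)))).mono) le_rfl
    rw [← integral_add' i3 i2, ← integral_add' (i3.add i2) ((h.eY_integrable hT hτ).const_mul 2)]
    refine integral_mono_ae i1 ((i3.add i2).add ((h.eY_integrable hT hτ).const_mul 2)) ?_
    filter_upwards [(hes τ hτ).1] with x hx
    have e1 := eY_ge (γ := γ) (ε := ε) (u := u) hγ hp0 hx
    have e2 : 0 ≤ u.pw (-p₀) (τ, x) := Real.rpow_nonneg hx _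
    have e3 : 0 ≤ (γ - 1)⁻¹ * u.pw γ (τ, x) :=
      mul_nonneg (inv_nonneg.2 (by linarith)) (Real.rpow_nonneg hx _)
    have e4 : u.s (τ, x) ^ 2 = u.ρ (τ, x) := by rw [h.sdef]; exact Real.sq_sqrt hx
    have e5 : -(u.qq (τ, x) + u.ρ (τ, x) * u.vv (τ, x)) ≤ u.bdX (τ, x) := by
      simp only [Fld.qq, Fld.vv, Fld.bdX, ← e4]
      nlinarith [sq_nonneg (u.q 0 (τ, x) + u.s (τ, x) * u.v 0 (τ, x)),
        sq_nonneg (u.q 1 (τ, x) + u.s (τ, x) * u.v 1 (τ, x))]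
    have e6 : 0 ≤ ε * u.pw (-p₀) (τ, x) := mul_nonneg hε.le e2
    simp only [Fld.bdY, Pi.add_apply]
    linarith only [e1, e3, e5, e6, hx]
  rw [integral_const_mul] at hslice
  linarith [(hes τ hτ).2.2.1]

theorem bdDiss_bound {B : ℝ} (hT : 0 < T) (hε : 0 < ε) (h : Reg γ p₀ ε T u)
    (hB : ∀ᵐ τ ∂volume.restrict (Ioo 0 T),
    ∫ x, (u.qq (τ, x) + ε * u.qq (τ, x) ^ 2) ∂muO + ∫ p, u.bdDiss γ ε p ∂muQ τ ≤ B) :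
    ∫ p, u.bdDiss γ ε p ∂muQ T ≤ B := by
  obtain ⟨t, ht, hlim⟩ := exists_seq_of_ae_Ioo hT hB (right_mem_Icc.2 hT.le)
  have hc := continuousOn_integral_muQ h.QbdDiss.integrable T (right_mem_Icc.2 hT.le)
  refine le_of_tendsto (hc.tendsto.comp (tendsto_nhdsWithin_iff.2 ⟨hlim,
    .of_forall fun n => Ioo_subset_Icc_self (ht n).1⟩)) (.of_forall fun n => ?_)
  have : 0 ≤ ∫ x, (u.qq (t n, x) + ε * u.qq (t n, x) ^ 2) ∂muO :=
    integral_nonneg fun x => by have := u.qq_nonneg (t n, x); positivity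
  have h2 := (ht n).2
  simp only [Function.comp_apply]
  linarith

end Reg

/-! ### Weak limits of the density gradients -/

/-- Bounded sequences in `L²` converge weakly along ultrafilters. -/
theorem exists_weak_limit {X : Type} [MeasurableSpace X] {μ : Measure X} {B : ℝ} {f : ℕ → X → ℝ}
    (hf : ∀ n, MemLp (f n) 2 μ) (hB : ∀ n, ∫ x, f n x ^ 2 ∂μ ≤ B) (𝒰 : Ultrafilter ℕ) :
    ∃ g : X → ℝ, Measurable g ∧ MemLp g 2 μ ∧ ∀ φ : X → ℝ, MemLp φ 2 μ →
      Tendsto (fun n => ∫ x, f n x * φ x ∂μ) 𝒰 (𝓝 (∫ x, g x * φ x ∂μ)) := by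
  have inn : ∀ {a b : X → ℝ} (ha : MemLp a 2 μ) (hb : MemLp b 2 μ),
      inner ℝ (ha.toLp a) (hb.toLp b) = ∫ x, a x * b x ∂μ := by
    intro a b ha hb
    rw [L2.inner_def]
    refine integral_congr_ae ?_
    filter_upwards [ha.coeFn_toLp, hb.coeFn_toLp] with x h1 h2
    rw [h1, h2]
    simp [mul_comm]
  let L : ℕ → WeakDual ℝ (Lp ℝ 2 μ) := fun n =>
    StrongDual.toWeakDual (InnerProductSpace.toDual ℝ (Lp ℝ 2 μ) ((hf n).toLp (f n)))
  have hc := WeakDual.isCompact_closedBall (0 : StrongDual ℝ (Lp ℝ 2 μ)) (√B)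
  have hmem : ∀ n, L n ∈ WeakDual.toStrongDual ⁻¹' Metric.closedBall (0 : StrongDual ℝ (Lp ℝ 2 μ)) (√B) := by
    intro n
    have : ‖InnerProductSpace.toDual ℝ (Lp ℝ 2 μ) ((hf n).toLp (f n))‖ ≤ √B := by
      rw [LinearIsometryEquiv.norm_map]
      apply Real.le_sqrt_of_sq_le
      rw [← real_inner_self_eq_norm_sq, inn]
      simpa [pow_two] using hB n
    simpa [L, Metric.mem_closedBall, dist_zero_right] using this
  obtain ⟨l, -, hl⟩ := hc.ultrafilter_le_nhds (𝒰.map L) (by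
    rw [le_principal_iff]; exact Eventually.of_forall (f := (𝒰 : Filter ℕ)) hmem)
  have hl' : Tendsto L 𝒰 (𝓝 l) := hl
  let y : Lp ℝ 2 μ := (InnerProductSpace.toDual ℝ (Lp ℝ 2 μ)).symm (WeakDual.toStrongDual l)
  have hy : MemLp (y : X → ℝ) 2 μ := Lp.memLp y
  refine ⟨y, (Lp.stronglyMeasurable y).measurable, hy, fun φ hφ => ?_⟩
  have h1 : Tendsto (fun n => L n (hφ.toLp φ)) 𝒰 (𝓝 (l (hφ.toLp φ))) :=
    ((WeakDual.eval_continuous (hφ.toLp φ)).tendsto l).comp hl'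
  have e1 : ∀ n, L n (hφ.toLp φ) = ∫ x, f n x * φ x ∂μ := fun n => inn (hf n) hφ
  have e2 : l (hφ.toLp φ) = ∫ x, y x * φ x ∂μ := by
    have : l (hφ.toLp φ) = inner ℝ y (hφ.toLp φ) :=
      (InnerProductSpace.toDual_symm_apply (𝕜 := ℝ)).symm
    rw [this, ← inn hy hφ, Lp.toLp_coeFn]
  simpa only [e1, e2] using h1

/-- Weak lower semicontinuity of the gradient functional. -/
theorem lintegral_weak_limit_le {ε B : ℝ} (hε : 0 ≤ ε) {𝒰 : Ultrafilter ℕ}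
    {f : ℕ → Fin 2 → Sp → ℝ} {g : Fin 2 → Sp → ℝ} (hf : ∀ n i, MemLp (f n i) 2 muO)
    (hint : ∀ n, Integrable (fun x => (2 * (f n 0 x ^ 2 + f n 1 x ^ 2)
    + ε * (f n 0 x ^ 2 + f n 1 x ^ 2) ^ 2)) muO)
    (hB : ∀ n, ∫ x, (2 * (f n 0 x ^ 2 + f n 1 x ^ 2) + ε * (f n 0 x ^ 2 + f n 1 x ^ 2) ^ 2) ∂muO ≤ B)
    (hg : ∀ i, Measurable (g i)) (hlim : ∀ i, ∀ φ : Sp → ℝ, MemLp φ 2 muO →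
    Tendsto (fun n => ∫ x, f n i x * φ x ∂muO) 𝒰 (𝓝 (∫ x, g i x * φ x ∂muO))) :
    ∫⁻ x, ENNReal.ofReal (2 * (g 0 x ^ 2 + g 1 x ^ 2) + ε * (g 0 x ^ 2 + g 1 x ^ 2) ^ 2) ∂muO
      ≤ ENNReal.ofReal B := by
  have hg0 := hg 0
  have hg1 := hg 1
  let A : ℕ → Set Sp := fun M => {x | g 0 x ^ 2 + g 1 x ^ 2 ≤ M}
  have hA : ∀ M, MeasurableSet (A M) := fun M =>
    measurableSet_le (by fun_prop) measurable_const
  have hmono : Monotone A := fun M M' h x hx => le_trans (b := (M : ℝ)) hx (by exact_mod_cast h)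
  have hU : ⋃ M, A M = univ := by
    refine eq_univ_of_forall fun x => mem_iUnion.2 ?_
    obtain ⟨M, hM⟩ := exists_nat_ge (g 0 x ^ 2 + g 1 x ^ 2)
    exact ⟨M, hM⟩
  rw [← setLIntegral_univ, ← hU, setLIntegral_iUnion_of_directed _ (hmono.directed_le)]
  refine iSup_le fun M => ?_
  have hbd : ∀ i, ∀ x ∈ A M, |g i x| ≤ M + 1 := by
    intro i x hx
    have hx' : g 0 x ^ 2 + g 1 x ^ 2 ≤ M := hx
    have hM : (0 : ℝ) ≤ M := Nat.cast_nonneg M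
    apply abs_le_of_sq_le_sq _ (by positivity)
    have : g i x ^ 2 ≤ M := by
      fin_cases i
      · exact (le_add_of_nonneg_right (sq_nonneg _)).trans hx'
      · exact (le_add_of_nonneg_left (sq_nonneg _)).trans hx'
    nlinarith
  let G : Fin 2 → Sp → ℝ := fun i => (A M).indicator (g i)
  have hGm : ∀ i, Measurable (G i) := fun i => (hg i).indicator (hA M)
  have hG : ∀ i, MemLp (G i) ⊤ muO := fun i => by
    refine memLp_top_of_bound (hGm i).aestronglyMeasurable (M + 1) (.of_forall fun x => ?_)
    simp only [G, indicator]
    split_ifs with hx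
    · exact hbd i x hx
    · simp; positivity
  let ψ : Fin 2 → Sp → ℝ := fun i x => 4 * (G i x + ε * ((G 0 x ^ 2 + G 1 x ^ 2) * G i x))
  have hψ : ∀ i, MemLp (ψ i) 2 muO := fun i => by
    have h2 : MemLp (fun x => (G 0 x ^ 2 + G 1 x ^ 2) * G i x) ⊤ muO := by
      have a0 : MemLp (fun x => G 0 x * G 0 x) ⊤ muO := (hG 0).mul (hG 0)
      have a1 : MemLp (fun x => G 1 x * G 1 x) ⊤ muO := (hG 1).mul (hG 1)
      have : MemLp (fun x => (G 0 x * G 0 x + G 1 x * G 1 x) * G i x) ⊤ muO := (hG i).mul (a0.add a1)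
      simpa only [← pow_two] using this
    exact ((((hG i).add (h2.const_mul ε)).const_mul 4)).mono_exponent le_top
  have hGi : ∀ i, MemLp (G i) 2 muO := fun i => (hG i).mono_exponent le_top
  have hind : ∀ x, 2 * (G 0 x ^ 2 + G 1 x ^ 2) + ε * (G 0 x ^ 2 + G 1 x ^ 2) ^ 2
      = (A M).indicator (fun x => 2 * (g 0 x ^ 2 + g 1 x ^ 2) + ε * (g 0 x ^ 2 + g 1 x ^ 2) ^ 2) x := by
    intro x
    simp only [G, indicator]
    split_ifs <;> simp
  have hpt : ∀ n x, (2 * (G 0 x ^ 2 + G 1 x ^ 2) + ε * (G 0 x ^ 2 + G 1 x ^ 2) ^ 2)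
      + ((f n 0 x * ψ 0 x - G 0 x * ψ 0 x) + (f n 1 x * ψ 1 x - G 1 x * ψ 1 x))
      ≤ 2 * (f n 0 x ^ 2 + f n 1 x ^ 2) + ε * (f n 0 x ^ 2 + f n 1 x ^ 2) ^ 2 := by
    intro n x
    have := quartic_convex hε (G 0 x) (G 1 x) (f n 0 x) (f n 1 x)
    simp only [ψ]
    linarith only [this]
  have hFI : Integrable (fun x => 2 * (G 0 x ^ 2 + G 1 x ^ 2) + ε * (G 0 x ^ 2 + G 1 x ^ 2) ^ 2) muO := by
    have a0 : MemLp (fun x => G 0 x * G 0 x) ⊤ muO := (hG 0).mul (hG 0)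
    have a1 : MemLp (fun x => G 1 x * G 1 x) ⊤ muO := (hG 1).mul (hG 1)
    have a2 := a0.add a1
    have a3 : MemLp (fun x => (G 0 x * G 0 x + G 1 x * G 1 x) * (G 0 x * G 0 x + G 1 x * G 1 x)) ⊤ muO :=
      a2.mul a2
    have a4 := (((a2.const_mul 2).add (a3.const_mul ε)).mono_exponent (p := 1) le_top).integrable
      le_rfl
    refine a4.congr (.of_forall fun x => ?_)
    simp only [Pi.add_apply]
    ring
  have hi1 : ∀ n i, Integrable (fun x => f n i x * ψ i x) muO := fun n i => (hf n i).integrable_mul (hψ i)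
  have hi2 : ∀ i, Integrable (fun x => G i x * ψ i x) muO := fun i => (hGi i).integrable_mul (hψ i)
  have hGψ : ∀ i, ∫ x, g i x * ψ i x ∂muO = ∫ x, G i x * ψ i x ∂muO := fun i => by
    refine integral_congr_ae (.of_forall fun x => ?_)
    simp only [ψ, G, indicator]
    split_ifs <;> simp
  have hn : ∀ n, ∫ x, (2 * (G 0 x ^ 2 + G 1 x ^ 2) + ε * (G 0 x ^ 2 + G 1 x ^ 2) ^ 2) ∂muO
      + ((∫ x, f n 0 x * ψ 0 x ∂muO - ∫ x, G 0 x * ψ 0 x ∂muO)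
        + (∫ x, f n 1 x * ψ 1 x ∂muO - ∫ x, G 1 x * ψ 1 x ∂muO)) ≤ B := by
    intro n
    refine le_trans ?_ (hB n)
    rw [← integral_sub' (hi1 n 0) (hi2 0), ← integral_sub' (hi1 n 1) (hi2 1),
      ← integral_add' ((hi1 n 0).sub (hi2 0)) ((hi1 n 1).sub (hi2 1)),
      ← integral_add' hFI (((hi1 n 0).sub (hi2 0)).add ((hi1 n 1).sub (hi2 1)))]
    exact integral_mono (hFI.add (((hi1 n 0).sub (hi2 0)).add ((hi1 n 1).sub (hi2 1)))) (hint n) (hpt n)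
  have hlimit : ∫ x, (2 * (G 0 x ^ 2 + G 1 x ^ 2) + ε * (G 0 x ^ 2 + G 1 x ^ 2) ^ 2) ∂muO ≤ B := by
    have l0 := (hlim 0 _ (hψ 0)).sub_const (∫ x, G 0 x * ψ 0 x ∂muO)
    have l1 := (hlim 1 _ (hψ 1)).sub_const (∫ x, G 1 x * ψ 1 x ∂muO)
    have l := (l0.add l1).const_add
      (∫ x, (2 * (G 0 x ^ 2 + G 1 x ^ 2) + ε * (G 0 x ^ 2 + G 1 x ^ 2) ^ 2) ∂muO)
    rw [hGψ 0, hGψ 1, sub_self, sub_self, add_zero, add_zero] at l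
    exact le_of_tendsto l (.of_forall hn)
  have hFnn : ∀ x, 0 ≤ 2 * (G 0 x ^ 2 + G 1 x ^ 2) + ε * (G 0 x ^ 2 + G 1 x ^ 2) ^ 2 := fun x => by
    positivity
  calc _ = ∫⁻ x, ENNReal.ofReal (2 * (G 0 x ^ 2 + G 1 x ^ 2) + ε * (G 0 x ^ 2 + G 1 x ^ 2) ^ 2) ∂muO := by
        rw [← lintegral_indicator (hA M)]
        refine lintegral_congr fun x => ?_
        rw [hind x]
        simp only [indicator]
        split_ifs <;> simp
    _ = ENNReal.ofReal (∫ x, (2 * (G 0 x ^ 2 + G 1 x ^ 2) + ε * (G 0 x ^ 2 + G 1 x ^ 2) ^ 2) ∂muO) :=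
        (ofReal_integral_eq_lintegral_ofReal hFI (.of_forall hFnn)).symm
    _ ≤ _ := ENNReal.ofReal_le_ofReal hlimit

namespace Reg

variable {γ p₀ ε T : ℝ} {u : Fld}

/-- The Bresch–Desjardins bound at every time. -/
theorem bd_everywhere {B t : ℝ} (hT : 0 < T) (hε : 0 < ε) (h : Reg γ p₀ ε T u)
    (hB : ∀ᵐ τ ∂volume.restrict (Ioo 0 T), ∫ x, (u.qq (τ, x) + ε * u.qq (τ, x) ^ 2) ∂muO ≤ B)
    (ht : t ∈ Icc 0 T) : ∃ g : Fin 2 → Sp → ℝ,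
      (∀ i, HasWeakDeriv Omega testO (Pi.single (hor i) 1) (fun x => u.s (t, x)) (g i)) ∧
      (∀ i, Measurable (g i)) ∧
      ∫⁻ x, ENNReal.ofReal ((g 0 x ^ 2 + g 1 x ^ 2) + ε * (g 0 x ^ 2 + g 1 x ^ 2) ^ 2) ∂muO
        ≤ ENNReal.ofReal B := by
  have hsQ : Q T (1 / 2) (fun p => 1 / 2 * (u.R p * u.ρt p)) :=
    (((h.DR 0).fn.mul h.qρt).const_mul (1 / 2)).mono
  have hslices : ∀ s ∈ Icc 0 T, Integrable (fun x => u.s (s, x)) muO := fun s hs =>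
    (h.Ts hT).slice_integrable hT (h.Ds 0).fn.integrable hsQ.integrable hs
  have hgood : ∀ᵐ τ ∂volume.restrict (Ioo 0 T), ∫ x, (u.qq (τ, x) + ε * u.qq (τ, x) ^ 2) ∂muO ≤ B ∧
      ∀ i, HasWeakDeriv Omega testO (Pi.single (hor i) 1) (fun x => u.s (τ, x))
        (fun x => u.q i (τ, x)) ∧ Q 1 (1 / 30) (fun p => u.q i (τ, p.2)) := by
    filter_upwards [hB, ae_all_iff.2 fun i => DQr.frozen (T' := 1) (h.Ds i),
      ae_restrict_mem measurableSet_Ioo] with τ h1 h2 hτ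
    refine ⟨h1, fun i => ⟨HD.space_weak (h2 i).ld (hslices τ (Ioo_subset_Icc_self hτ))
      (integrable_of_Q_space (h2 i).dv (by norm_num)), (h2 i).dv⟩⟩
  obtain ⟨τ, hτ, hlim⟩ := exists_seq_of_ae_Ioo hT hgood ht
  have hq2 : ∀ n i, MemLp (fun x => u.q i (τ n, x)) 2 muO := fun n i => by
    have h1 := ((hτ n).2.2 i).2.sq
    have h2 : Integrable (fun x => u.q i (τ n, x) ^ 2) muO :=
      integrable_of_Q_space (f := fun x => u.q i (τ n, x) ^ 2) h1 (by norm_num)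
    have h3 : Integrable (fun x => u.q i (τ n, x)) muO :=
      integrable_of_Q_space (f := fun x => u.q i (τ n, x)) ((hτ n).2.2 i).2 (by norm_num)
    exact (memLp_two_iff_integrable_sq h3.1).2 h2
  have hqq : ∀ n, Q 1 (1 / 15) (fun p => u.qq (τ n, p.2)) := fun n =>
    (((hτ n).2.2 0).2.sq.add ((hτ n).2.2 1).2.sq).mono
  have hqqi : ∀ n, Integrable (fun x => u.qq (τ n, x)) muO := fun n =>
    integrable_of_Q_space (f := fun x => u.qq (τ n, x)) (hqq n) (by norm_num)
  have hqq2 : ∀ n, Integrable (fun x => ε * u.qq (τ n, x) ^ 2) muO := fun n =>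
    integrable_of_Q_space (f := fun x => ε * u.qq (τ n, x) ^ 2) ((hqq n).sq.const_mul ε) (by norm_num)
  have hqB : ∀ n i, ∫ x, u.q i (τ n, x) ^ 2 ∂muO ≤ B := fun n i => by
    refine le_trans (integral_mono (hq2 n i).integrable_sq ((hqqi n).add (hqq2 n)) fun x => ?_) (hτ n).2.1
    have : 0 ≤ ε * u.qq (τ n, x) ^ 2 := by positivity
    have h3 : u.q i (τ n, x) ^ 2 ≤ u.qq (τ n, x) := by
      fin_cases i
      · exact le_add_of_nonneg_right (sq_nonneg _)
      · exact le_add_of_nonneg_left (sq_nonneg _)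
    simp only [Pi.add_apply]
    linarith
  let 𝒰 : Ultrafilter ℕ := Ultrafilter.of atTop
  have h𝒰 : (𝒰 : Filter ℕ) ≤ atTop := Ultrafilter.of_le atTop
  choose g hgm hg2 hgl using fun i => exists_weak_limit (fun n => hq2 n i) (fun n => hqB n i) 𝒰
  refine ⟨g, fun i => ⟨hslices t ht, (hg2 i).integrable (by norm_num), fun φ hφ => ?_⟩, hgm, ?_⟩
  · have hφ1 : ContDiff ℝ (⊤ : ℕ∞) φ := hφ.1
    have hb : ∀ {F : Sp → ℝ}, Continuous F → ∃ M : ℝ, ∀ x ∈ Omega, |F x| ≤ M := by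
      intro F hF
      have hc : IsCompact (Set.pi univ fun _ : Fin 3 => Icc (0 : ℝ) 1) :=
        isCompact_univ_pi fun _ => isCompact_Icc
      obtain ⟨M, hM⟩ := hc.exists_bound_of_continuousOn hF.continuousOn
      exact ⟨M, fun x hx => hM x fun i _ => Ioo_subset_Icc_self (hx i)⟩
    have htop : ∀ {F : Sp → ℝ}, Continuous F → MemLp F ⊤ muO := by
      intro F hF
      obtain ⟨M, hM⟩ := hb hF
      exact memLp_top_of_bound hF.aestronglyMeasurable M
        (by filter_upwards [ae_restrict_mem measurableSet_Omega] with x hx using hM x hx)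
    let ψ : Sp → ℝ := fun x => fderiv ℝ φ x (Pi.single (hor i) 1)
    have hψ : Continuous ψ := (hφ1.continuous_fderiv (by simp)).clm_apply continuous_const
    have h1 : Tendsto (fun n => ∫ x, u.q i (τ n, x) * φ x ∂muO) 𝒰 (𝓝 (∫ x, g i x * φ x ∂muO)) :=
      hgl i φ ((htop hφ1.continuous).mono_exponent le_top)
    have h2 : ∀ n, ∫ x, u.s (τ n, x) * ψ x ∂muO = - ∫ x, u.q i (τ n, x) * φ x ∂muO := fun n =>
      ((hτ n).2.2 i).1.2.2 φ hφ
    have hψQ : Q T 0 (fun p => ψ p.2) := by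
      obtain ⟨M, hM⟩ := hb hψ
      refine Q.of_bound (hψ.comp continuous_snd).aestronglyMeasurable M ?_
      filter_upwards [ae_restrict_mem (measurableSet_cyl T)] with p hp using hM _ hp.2
    have hψT : TD T (fun p => ψ p.2) (fun _ => 0) := by
      refine ⟨.of_forall fun x => ⟨fun _ => ψ x, AC1.const _, rfl,
        .of_forall fun _ => rfl⟩, fun s _ => .of_forall fun x => by simp⟩
    have hsψ := (h.Ts hT).mul hψT
    have iA := ((h.Ds 0).fn.mul hψQ).integrable
    have iB : Integrable (fun p => 1 / 2 * (u.R p * u.ρt p) * ψ p.2 + u.s p * 0) (muQ T) := by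
      refine (hsQ.mul hψQ).integrable.congr (.of_forall fun p => ?_)
      simp
    have hval : ∀ s ∈ Icc 0 T, _ := fun s hs => hsψ.integral_slice hT iA iB hs
    have hcont : ContinuousOn (fun s => ∫ x, u.s (s, x) * ψ x ∂muO) (Icc 0 T) :=
      (continuousOn_const.add (continuousOn_integral_muQ iB)).congr hval
    have h3 : Tendsto (fun n => ∫ x, u.s (τ n, x) * ψ x ∂muO) 𝒰 (𝓝 (∫ x, u.s (t, x) * ψ x ∂muO)) :=
      ((hcont t ht).tendsto.comp (tendsto_nhdsWithin_iff.2 ⟨hlim,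
        .of_forall fun n => Ioo_subset_Icc_self (hτ n).1⟩)).mono_left h𝒰
    simp only [h2] at h3
    exact tendsto_nhds_unique h3 h1.neg
  · have key := lintegral_weak_limit_le (ε := 2 * ε) (B := 2 * B) (by positivity)
      (f := fun n i x => u.q i (τ n, x)) (g := g) hq2
      (fun n => (((hqqi n).add (hqq2 n)).const_mul 2).congr
        (.of_forall fun x => by simp only [Fld.qq, Pi.add_apply]; ring))
      (fun n => ?_) hgm hgl
    · have e : ∀ x, 2 * (g 0 x ^ 2 + g 1 x ^ 2) + 2 * ε * (g 0 x ^ 2 + g 1 x ^ 2) ^ 2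
          = 2 * (g 0 x ^ 2 + g 1 x ^ 2 + ε * (g 0 x ^ 2 + g 1 x ^ 2) ^ 2) := fun x => by ring
      simp only [e, ENNReal.ofReal_mul (zero_le_two : (0 : ℝ) ≤ 2)] at key
      rw [lintegral_const_mul' _ _ ENNReal.ofReal_ne_top] at key
      exact (ENNReal.mul_le_mul_iff_right (by simp) ENNReal.ofReal_ne_top).1 key
    · have := mul_le_mul_of_nonneg_left (hτ n).2.1 zero_le_two
      rw [← integral_const_mul] at this
      refine le_trans (le_of_eq (integral_congr_ae (.of_forall fun x => ?_))) this
      simp only [Fld.qq]; ring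

end Reg

/-! ### The two-dimensional Sobolev inequality -/

/-- The mean over lines in direction `k`. -/
def lmean (k : Fin 3) (b : SpT → ℝ≥0∞) (p : SpT) : ℝ≥0∞ := ∫⁻ s, b (line k p s) ∂muI

section Means

variable {j k : Fin 3} {T : ℝ} {b : SpT → ℝ≥0∞}

theorem measurable_line (k : Fin 3) : Measurable (fun q : SpT × ℝ => line k q.1 q.2) :=
  (measurable_fst.comp measurable_fst).prodMk
    ((measurable_update_pair k).comp ((measurable_snd.comp measurable_fst).prodMk measurable_snd))

theorem measurable_lmean (hb : Measurable b) : Measurable (lmean k b) :=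
  (hb.comp (measurable_line k)).lintegral_prod_right'

theorem lintegral_lmean (k : Fin 3) (T : ℝ) (hb : Measurable b) :
    ∫⁻ p, lmean k b p ∂muQ T = ∫⁻ p, b p ∂muQ T := by
  rw [← (measurePreserving_line k T).lintegral_comp hb,
    lintegral_prod (fun q : SpT × ℝ => b (line k q.1 q.2))
      (hb.comp (measurable_line k)).aemeasurable]
  rfl

theorem lmean_line_self (p : SpT) (s : ℝ) : lmean k b (line k p s) = lmean k b p := by
  simp only [lmean, line_line]

theorem lmean_line_of_ne (hjk : j ≠ k) (h : ∀ p s, b (line k p s) = b p) (p : SpT) (s : ℝ) :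
    lmean j b (line k p s) = lmean j b p := by
  simp only [lmean]
  refine lintegral_congr fun s' => ?_
  rw [line_comm hjk, h]

theorem lmean_mul_of_invariant {a : SpT → ℝ≥0∞} (hb : Measurable b)
    (ha : ∀ p s, a (line k p s) = a p) (p : SpT) :
    lmean k (fun p => a p * b p) p = a p * lmean k b p := by
  simp only [lmean, ha]
  refine lintegral_const_mul _ ?_
  exact hb.comp ((measurable_line k).comp (measurable_const.prodMk measurable_id))

theorem eq_of_line_invariant (h : ∀ k p s, b (line k p s) = b p) (t : ℝ) (x y : Sp) :
    b (t, x) = b (t, y) := by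
  rw [← h 0 (t, x) (y 0), ← h 1 _ (y 1), ← h 2 _ (y 2)]
  congr 1
  simp only [line]
  congr 1
  funext i
  fin_cases i <;> simp [Function.update]

/-- Functions of different variables are independent. -/
theorem lintegral_lmean_mul {b₀ b₁ : SpT → ℝ≥0∞} (h0 : Measurable b₀) (h1 : Measurable b₁)
    (ht : ∀ t t' x, b₁ (t, x) = b₁ (t', x)) :
    ∫⁻ p, lmean 2 (lmean 0 b₀) p * lmean 2 (lmean 1 b₁) p ∂muQ 1
      = (∫⁻ p, b₀ p ∂muQ 1) * ∫⁻ p, b₁ p ∂muQ 1 := by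
  have m0 : Measurable (lmean 2 (lmean 0 b₀)) := measurable_lmean (measurable_lmean h0)
  have m1 : Measurable (lmean 2 (lmean 1 b₁)) := measurable_lmean (measurable_lmean h1)
  have i0 : ∀ p s, lmean 2 (lmean 0 b₀) (line 0 p s) = lmean 2 (lmean 0 b₀) p :=
    lmean_line_of_ne (by decide) lmean_line_self
  have inv : ∀ k p s, lmean 0 (lmean 2 (lmean 1 b₁)) (line k p s)
      = lmean 0 (lmean 2 (lmean 1 b₁)) p := by
    intro k
    fin_cases k
    · exact lmean_line_self
    · exact lmean_line_of_ne (by decide) (lmean_line_of_ne (by decide) lmean_line_self)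
    · exact lmean_line_of_ne (by decide) lmean_line_self
  have ht' : ∀ t t' x, lmean 0 (lmean 2 (lmean 1 b₁)) (t, x) = lmean 0 (lmean 2 (lmean 1 b₁)) (t', x) := by
    intro t t' x
    simp only [lmean, line, ht t t']
  have hc : ∀ p, lmean 0 (lmean 2 (lmean 1 b₁)) p = lmean 0 (lmean 2 (lmean 1 b₁)) 0 := fun p => by
    rw [← Prod.mk.eta (p := p), ht' p.1 0, eq_of_line_invariant inv 0 p.2 0]; rfl
  have hval : lmean 0 (lmean 2 (lmean 1 b₁)) 0 = ∫⁻ p, b₁ p ∂muQ 1 := by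
    rw [← lintegral_lmean 1 1 h1, ← lintegral_lmean 2 1 (measurable_lmean h1),
      ← lintegral_lmean 0 1 m1]
    simp only [hc]
    rw [lintegral_const]
    have : (muQ 1) univ = 1 := by rw [muQ_eq_prod]; exact measure_univ
    rw [this, mul_one]
  have e : ∀ p, lmean 0 ((lmean 2 (lmean 0 b₀)) * lmean 2 (lmean 1 b₁)) p
      = lmean 2 (lmean 0 b₀) p * ∫⁻ p, b₁ p ∂muQ 1 := fun p => by
    rw [← hval, ← hc p]
    exact lmean_mul_of_invariant m1 i0 p
  refine (lintegral_lmean 0 1 (m0.mul m1)).symm.trans ?_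
  simp only [e]
  rw [lintegral_mul_const _ m0, lintegral_lmean 2 1 (measurable_lmean h0), lintegral_lmean 0 1 h0]

theorem AC1.enorm_le {F g : ℝ → ℝ} (h : AC1 1 F g) {s : ℝ} (hs : s ∈ Ioo (0 : ℝ) 1) :
    ‖F s‖ₑ ≤ ∫⁻ s', ‖F s'‖ₑ ∂muI + ∫⁻ s', ‖g s'‖ₑ ∂muI := by
  have hi := h.integrable zero_le_one
  have h1 : ∀ s' ∈ Ioo (0 : ℝ) 1, ‖F s‖ₑ ≤ ‖F s'‖ₑ + ∫⁻ s', ‖g s'‖ₑ ∂muI := by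
    intro s' hs'
    have hm : ∀ x ∈ Ioo (0 : ℝ) 1, IntervalIntegrable g volume 0 x := fun x hx =>
      hi.mono_set (by rw [uIcc_of_le hx.1.le, uIcc_of_le zero_le_one]; exact Icc_subset_Icc_right hx.2.le)
    have e : F s = F s' + ∫ x in s'..s, g x := by
      rw [h.eq_add (Ioo_subset_Icc_self hs), h.eq_add (Ioo_subset_Icc_self hs'), add_assoc,
        intervalIntegral.integral_add_adjacent_intervals (hm s' hs') ((hm s' hs').symm.trans (hm s hs))]
    rw [e]
    refine (enorm_add_le _ _).trans (add_le_add le_rfl ?_)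
    have e2 : ‖∫ x in s'..s, g x‖ₑ = ‖∫ x in uIoc s' s, g x‖ₑ := by
      rw [← ofReal_norm, ← ofReal_norm, intervalIntegral.norm_integral_eq_norm_integral_uIoc]
    rw [e2]
    refine (enorm_integral_le_lintegral_enorm _).trans (lintegral_mono' (Measure.restrict_mono ?_ le_rfl) le_rfl)
    intro x hx
    rw [mem_uIoc] at hx
    rcases hx with hx | hx
    · exact ⟨hs'.1.trans hx.1, hx.2.trans_lt hs.2⟩
    · exact ⟨hs.1.trans hx.1, hx.2.trans_lt hs'.2⟩
  calc ‖F s‖ₑ = ∫⁻ _, ‖F s‖ₑ ∂muI := by simp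
    _ ≤ ∫⁻ s', (‖F s'‖ₑ + ∫⁻ s', ‖g s'‖ₑ ∂muI) ∂muI := by
        refine lintegral_mono_ae ?_
        filter_upwards [ae_restrict_mem measurableSet_Ioo] with s' hs' using h1 s' hs'
    _ = _ := by rw [lintegral_add_right _ measurable_const]; simp

theorem LD.enorm_le {c : ℝ → ℝ → Prop} (h : LD c k T f g) (hf : Measurable f) (hg : Measurable g)
    : ∀ᵐ p ∂muQ T, ‖f p‖ₑ ≤ lmean k (fun p => ‖f p‖ₑ + ‖g p‖ₑ) p := by
  have hl : ∀ {f : SpT → ℝ}, Measurable f → ∀ p, Measurable fun s => f (line k p s) := fun hf p =>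
    hf.comp ((measurable_line k).comp (measurable_const.prodMk measurable_id))
  refine ae_of_ae_line k (measurableSet_le hf.enorm (measurable_lmean (hf.enorm.add hg.enorm))) ?_
  filter_upwards [h] with p ⟨F, hF, hfF, _⟩
  filter_upwards [hfF, ae_restrict_mem measurableSet_Ioo] with s hs hsI
  rw [lmean_line_self, hs]
  refine (hF.enorm_le hsI).trans (le_of_eq ?_)
  simp only [lmean]
  rw [lintegral_add_left (hl hf p).enorm]
  congr 1
  refine lintegral_congr_ae ?_
  filter_upwards [hfF] with s' hs'
  rw [hs']

theorem LD.enorm_le_lmean {c : ℝ → ℝ → Prop} (h : LD c k T f (fun _ => 0)) (hf : Measurable f)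
    (hb : Measurable b) (hfb : ∀ᵐ p ∂muQ T, ‖f p‖ₑ ≤ b p) : ∀ᵐ p ∂muQ T, ‖f p‖ₑ ≤ lmean k b p := by
  refine ae_of_ae_line k (measurableSet_le hf.enorm (measurable_lmean hb)) ?_
  filter_upwards [h, ae_line k hfb] with p ⟨F, hF, hfF, _⟩ hp
  have hconst : ∀ s ∈ Ioo (0 : ℝ) 1, F s = F 0 := fun s hs => by
    rw [hF.eq_add (Ioo_subset_Icc_self hs)]; simp
  filter_upwards [hfF, ae_restrict_mem measurableSet_Ioo] with s hs hsI
  rw [lmean_line_self, hs, hconst s hsI]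
  calc ‖F 0‖ₑ = ∫⁻ _, ‖F 0‖ₑ ∂muI := by simp
    _ ≤ lmean k b p := by
      refine lintegral_mono_ae ?_
      filter_upwards [hp, hfF, ae_restrict_mem measurableSet_Ioo] with s' h1 h2 h3
      rwa [h2, hconst s' h3] at h1

end Means

/-- The Sobolev inequality for functions of the horizontal variables. -/
theorem sobolev_horizontal {f g₀ g₁ : Sp → ℝ}
    (h0 : HD (hor 0) 1 (fun p => f p.2) (fun p => g₀ p.2))
    (h1 : HD (hor 1) 1 (fun p => f p.2) (fun p => g₁ p.2))
    (h2 : VD 2 1 (fun p => f p.2) (fun _ => 0)) (hf : Integrable f muO) (hg₀ : Integrable g₀ muO)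
    (hg₁ : Integrable g₁ muO) : ∫⁻ x, ‖f x‖ₑ ^ 2 ∂muO
      ≤ (∫⁻ x, (‖f x‖ₑ + ‖g₀ x‖ₑ) ∂muO) * ∫⁻ x, (‖f x‖ₑ + ‖g₁ x‖ₑ) ∂muO := by
  have mk : ∀ {f : Sp → ℝ}, Integrable f muO → ∃ f' : Sp → ℝ, Measurable f' ∧ ∀ᵐ x ∂muO, f x = f' x :=
    fun hf => ⟨hf.1.mk _, hf.1.stronglyMeasurable_mk.measurable, hf.1.ae_eq_mk⟩
  obtain ⟨f', mf, ef⟩ := mk hf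
  obtain ⟨a, ma, ea⟩ := mk hg₀
  obtain ⟨b, mb, eb⟩ := mk hg₁
  have ef' := (quasiMP_snd 1).ae ef
  have h0' := LD.congr h0 ef' ((quasiMP_snd 1).ae ea)
  have h1' := LD.congr h1 ef' ((quasiMP_snd 1).ae eb)
  have h2' := LD.congr h2 ef' (.of_forall fun _ => rfl)
  have mf' : Measurable fun p : SpT => f' p.2 := mf.comp measurable_snd
  have ma' : Measurable fun p : SpT => a p.2 := ma.comp measurable_snd
  have mb' : Measurable fun p : SpT => b p.2 := mb.comp measurable_snd
  have m0 : Measurable fun p : SpT => ‖f' p.2‖ₑ + ‖a p.2‖ₑ := mf'.enorm.add ma'.enorm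
  have m1 : Measurable fun p : SpT => ‖f' p.2‖ₑ + ‖b p.2‖ₑ := mf'.enorm.add mb'.enorm
  have k0 := LD.enorm_le_lmean h2' mf' (measurable_lmean m0) (LD.enorm_le h0' mf' ma')
  have k1 := LD.enorm_le_lmean h2' mf' (measurable_lmean m1) (LD.enorm_le h1' mf' mb')
  have sp : ∀ {c : Sp → ℝ≥0∞}, Measurable c → ∫⁻ p : SpT, c p.2 ∂muQ 1 = ∫⁻ x, c x ∂muO := by
    intro c hc
    rw [muQ_eq_prod, lintegral_prod (fun p : SpT => c p.2) (hc.comp measurable_snd).aemeasurable]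
    simp
  have key : ∫⁻ p : SpT, ‖f' p.2‖ₑ ^ 2 ∂muQ 1
      ≤ (∫⁻ p : SpT, (‖f' p.2‖ₑ + ‖a p.2‖ₑ) ∂muQ 1) * ∫⁻ p : SpT, (‖f' p.2‖ₑ + ‖b p.2‖ₑ) ∂muQ 1 := by
    rw [← lintegral_lmean_mul m0 m1 fun _ _ _ => rfl]
    refine lintegral_mono_ae ?_
    filter_upwards [k0, k1] with p h h'
    rw [pow_two]
    exact mul_le_mul' h h'
  rw [sp (c := fun x => ‖f' x‖ₑ ^ 2) (mf.enorm.pow_const 2),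
    sp (c := fun x => ‖f' x‖ₑ + ‖a x‖ₑ) (mf.enorm.add ma.enorm),
    sp (c := fun x => ‖f' x‖ₑ + ‖b x‖ₑ) (mf.enorm.add mb.enorm)] at key
  have e1 : ∫⁻ x, ‖f x‖ₑ ^ 2 ∂muO = ∫⁻ x, ‖f' x‖ₑ ^ 2 ∂muO :=
    lintegral_congr_ae (by filter_upwards [ef] with x hx; rw [hx])
  have e2 : ∫⁻ x, (‖f x‖ₑ + ‖g₀ x‖ₑ) ∂muO = ∫⁻ x, (‖f' x‖ₑ + ‖a x‖ₑ) ∂muO :=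
    lintegral_congr_ae (by filter_upwards [ef, ea] with x hx hx'; rw [hx, hx'])
  have e3 : ∫⁻ x, (‖f x‖ₑ + ‖g₁ x‖ₑ) ∂muO = ∫⁻ x, (‖f' x‖ₑ + ‖b x‖ₑ) ∂muO :=
    lintegral_congr_ae (by filter_upwards [ef, eb] with x hx hx'; rw [hx, hx'])
  rw [e1, e2, e3]
  exact key

/-- The Sobolev inequality in terms of real integrals. -/
theorem sobolev_horizontal_real {f g₀ g₁ G : Sp → ℝ}
    (h0 : HD (hor 0) 1 (fun p => f p.2) (fun p => g₀ p.2))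
    (h1 : HD (hor 1) 1 (fun p => f p.2) (fun p => g₁ p.2))
    (h2 : VD 2 1 (fun p => f p.2) (fun _ => 0)) (hf : Integrable f muO)
    (hf2 : Integrable (fun x => f x ^ 2) muO) (hg₀ : Integrable g₀ muO) (hg₁ : Integrable g₁ muO)
    (hG : Integrable G muO) (hG0 : ∀ᵐ x ∂muO, |g₀ x| ≤ G x) (hG1 : ∀ᵐ x ∂muO, |g₁ x| ≤ G x) :
    ∫ x, f x ^ 2 ∂muO ≤ (∫ x, |f x| ∂muO + ∫ x, G x ∂muO) ^ 2 := by
  have key := sobolev_horizontal h0 h1 h2 hf hg₀ hg₁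
  have hGnn : ∀ᵐ x ∂muO, 0 ≤ |f x| + G x := by
    filter_upwards [hG0] with x hx
    have := (abs_nonneg _).trans hx
    positivity
  have hb : ∀ {g : Sp → ℝ}, (∀ᵐ x ∂muO, |g x| ≤ G x) →
      ∫⁻ x, (‖f x‖ₑ + ‖g x‖ₑ) ∂muO ≤ ENNReal.ofReal (∫ x, |f x| ∂muO + ∫ x, G x ∂muO) := by
    intro g hg
    rw [← integral_add' hf.abs hG, ofReal_integral_eq_lintegral_ofReal (hf.abs.add hG) hGnn]
    refine lintegral_mono_ae ?_
    filter_upwards [hg] with x hx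
    rw [Real.enorm_eq_ofReal_abs, Real.enorm_eq_ofReal_abs, ← ENNReal.ofReal_add (abs_nonneg _) (abs_nonneg _)]
    exact ENNReal.ofReal_le_ofReal (add_le_add_right hx _)
  have hnn : 0 ≤ ∫ x, |f x| ∂muO + ∫ x, G x ∂muO := by
    rw [← integral_add' hf.abs hG]
    exact integral_nonneg_of_ae hGnn
  have e : ∫⁻ x, ‖f x‖ₑ ^ 2 ∂muO = ENNReal.ofReal (∫ x, f x ^ 2 ∂muO) := by
    rw [ofReal_integral_eq_lintegral_ofReal hf2 (.of_forall fun x => sq_nonneg _)]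
    refine lintegral_congr fun x => ?_
    rw [Real.enorm_eq_ofReal_abs, ← ENNReal.ofReal_pow (abs_nonneg _), sq_abs]
  rw [e] at key
  have h3 := key.trans (mul_le_mul' (hb hG0) (hb hG1))
  rw [← ENNReal.ofReal_mul hnn, ← pow_two] at h3
  exact (ENNReal.ofReal_le_ofReal_iff (sq_nonneg _)).1 h3

theorem sq_integral_mul_le {X : Type} [MeasurableSpace X] {μ : Measure X} {a b : X → ℝ}
    (ha : Integrable (fun x => a x ^ 2) μ) (hb : Integrable (fun x => b x ^ 2) μ)
    (hab : Integrable (fun x => a x * b x) μ) :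
    (∫ x, a x * b x ∂μ) ^ 2 ≤ (∫ x, a x ^ 2 ∂μ) * ∫ x, b x ^ 2 ∂μ := by
  have h : ∀ y : ℝ, 0 ≤ (∫ x, a x ^ 2 ∂μ) * (y * y) + 2 * (∫ x, a x * b x ∂μ) * y
      + ∫ x, b x ^ 2 ∂μ := by
    intro y
    have : 0 ≤ ∫ x, (a x * y + b x) ^ 2 ∂μ := integral_nonneg fun x => sq_nonneg _
    have e : ∀ x, (a x * y + b x) ^ 2 = y * y * a x ^ 2 + 2 * y * (a x * b x) + b x ^ 2 := fun x => by ring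
    simp only [e] at this
    rw [integral_add (integrable_add' (ha.const_mul _) (hab.const_mul _)) hb,
      integral_add (ha.const_mul _) (hab.const_mul _), integral_const_mul, integral_const_mul] at this
    linarith
  have := discrim_le_zero h
  unfold discrim at this
  nlinarith

/-! ### Higher integrability of the density -/

/-- Bounds for `∫ ρ^{2ⁿ}` in terms of bounds for the mass and for `∫ |∇ρ^{1/2}|²`. -/
def powBound (K B : ℝ) : ℕ → ℝ
  | 0 => K
  | n + 1 => 4 * powBound K B n ^ 2 + (4 * (2 ^ (n + 1) : ℕ) ^ 2 * B) ^ (2 ^ (n + 1))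

theorem mul_pow_le_half {x b : ℝ} (hb : 0 ≤ b) (k : ℕ) :
    b * (x ^ 2) ^ k ≤ (x ^ 2) ^ (k + 1) + b ^ (k + 1) := by
  have hx := sq_nonneg x
  rcases le_total b (x ^ 2) with h | h
  · have := mul_le_mul_of_nonneg_right h (pow_nonneg hx k)
    have := pow_nonneg hb (k + 1)
    rw [pow_succ' (x ^ 2)]
    linarith
  · have := mul_le_mul_of_nonneg_left (pow_le_pow_left₀ hx h k) hb
    have := pow_nonneg hx (k + 1)
    rw [pow_succ' b]
    linarith

namespace Reg

variable {γ p₀ ε T : ℝ} {u : Fld}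

theorem Qsqrt_qq (h : Reg γ p₀ ε T u) : Q T (1 / 30) (fun p => √(u.qq p)) := by
  have hq : Q T (1 / 30) (fun p => |u.q 0 p| + |u.q 1 p|) := (h.Ds 0).dv.abs.add (h.Ds 1).dv.abs
  refine Q.of_le hq (Real.continuous_sqrt.comp_aestronglyMeasurable h.Qqq.aesm)
    (.of_forall fun p => ?_)
  rw [abs_of_nonneg (Real.sqrt_nonneg _), abs_of_nonneg (by positivity)]
  refine Real.sqrt_le_iff.2 ⟨by positivity, ?_⟩
  simp only [Fld.qq]
  nlinarith [mul_nonneg (abs_nonneg (u.q 0 p)) (abs_nonneg (u.q 1 p)), sq_abs (u.q 0 p),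
    sq_abs (u.q 1 p)]

theorem Dpow (h : Reg γ p₀ ε T u) (k : ℕ) (i : Fin 2) :
    DQr Eq (hor i) T 0 (1 / 30) (fun p => u.s p ^ k) (fun p => k * u.s p ^ (k - 1) * u.q i p) :=
  h.comp_s (φ := fun x => x ^ k) (fun a b hab => by simp only [hab]) (fun y _ => hasDerivAt_pow k y)
    (by fun_prop) (h.Ds i)

theorem Dpowz (h : Reg γ p₀ ε T u) (k : ℕ) : DQr cAny 2 T 0 0 (fun p => u.s p ^ k) (fun _ => 0) :=
  (h.comp_s (φ := fun x => x ^ k) (fun a b hab => trivial) (fun y _ => hasDerivAt_pow k y)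
    (by fun_prop) h.Dsz).of_eq (fun _ => rfl) (fun _ => mul_zero _)

theorem pow_step (h : Reg γ p₀ ε T u) {B : ℝ} (k : ℕ) :
    ∀ᵐ t ∂volume.restrict (Ioo 0 T), ∫ x, u.qq (t, x) ∂muO ≤ B →
      ∫ x, u.s (t, x) ^ (2 * (k + 1)) ∂muO
        ≤ 4 * (∫ x, u.s (t, x) ^ (k + 1) ∂muO) ^ 2 + (4 * (k + 1 : ℕ) ^ 2 * B) ^ (k + 1) := by
  have qpow : ∀ k, Q T 0 (fun p => u.s p ^ k) := fun k => (h.Dpow k 0).fn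
  filter_upwards [DQr.frozen (T' := 1) (h.Dpow (k + 1) 0), DQr.frozen (T' := 1) (h.Dpow (k + 1) 1),
    DQr.frozen (T' := 1) (h.Dpowz (k + 1)), Q.frozen (T' := 1) h.Qsqrt_qq, Q.frozen (T' := 1) (qpow k),
    Q.frozen (T' := 1) h.Qqq, ae_time_ae_space h.pos]
    with t d0 d1 dz qr qk hqq hpos hB
  have hsp : ∀ᵐ x ∂muO, 0 < u.s (t, x) := by filter_upwards [hpos] with x hx using hx.1
  have iS : Integrable (fun x => u.s (t, x) ^ (k + 1)) muO :=
    integrable_of_Q_space (f := fun x => u.s (t, x) ^ (k + 1)) d0.fn (by norm_num)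
  have iS2 : Integrable (fun x => (u.s (t, x) ^ (k + 1)) ^ 2) muO :=
    integrable_of_Q_space (f := fun x => (u.s (t, x) ^ (k + 1)) ^ 2) d0.fn.sq (by norm_num)
  have iK : Integrable (fun x => (u.s (t, x) ^ k) ^ 2) muO :=
    integrable_of_Q_space (f := fun x => (u.s (t, x) ^ k) ^ 2) qk.sq (by norm_num)
  have iR : Integrable (fun x => √(u.qq (t, x)) ^ 2) muO :=
    integrable_of_Q_space (f := fun x => √(u.qq (t, x)) ^ 2) qr.sq (by norm_num)
  have iKR : Integrable (fun x => u.s (t, x) ^ k * √(u.qq (t, x))) muO :=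
    integrable_of_Q_space (f := fun x => u.s (t, x) ^ k * √(u.qq (t, x))) (qk.mul qr) (by norm_num)
  have hG : ∀ i, ∀ᵐ x ∂muO, |((k + 1 : ℕ) : ℝ) * u.s (t, x) ^ (k + 1 - 1) * u.q i (t, x)|
      ≤ (k + 1 : ℕ) * (u.s (t, x) ^ k * √(u.qq (t, x))) := by
    intro i
    filter_upwards [hsp] with x hx
    have h1 : |u.q i (t, x)| ≤ √(u.qq (t, x)) := by
      apply Real.abs_le_sqrt
      fin_cases i
      · exact le_add_of_nonneg_right (sq_nonneg _)
      · exact le_add_of_nonneg_left (sq_nonneg _)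
    rw [abs_mul, abs_mul, abs_of_nonneg (pow_nonneg hx.le _), Nat.abs_cast, mul_assoc,
      Nat.add_sub_cancel]
    gcongr
  have sob := sobolev_horizontal_real (f := fun x => u.s (t, x) ^ (k + 1))
    (g₀ := fun x => ((k + 1 : ℕ) : ℝ) * u.s (t, x) ^ (k + 1 - 1) * u.q 0 (t, x))
    (g₁ := fun x => ((k + 1 : ℕ) : ℝ) * u.s (t, x) ^ (k + 1 - 1) * u.q 1 (t, x))
    (G := fun x => (k + 1 : ℕ) * (u.s (t, x) ^ k * √(u.qq (t, x)))) d0.ld d1.ld dz.ld iS iS2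
    (integrable_of_Q_space d0.dv (by norm_num)) (integrable_of_Q_space d1.dv (by norm_num))
    (iKR.const_mul _) (hG 0) (hG 1)
  have habs : ∫ x, |u.s (t, x) ^ (k + 1)| ∂muO = ∫ x, u.s (t, x) ^ (k + 1) ∂muO :=
    integral_congr_ae (by filter_upwards [hsp] with x hx; exact abs_of_nonneg (pow_nonneg hx.le _))
  have cs := sq_integral_mul_le iK iR iKR
  have hqe : ∫ x, √(u.qq (t, x)) ^ 2 ∂muO = ∫ x, u.qq (t, x) ∂muO :=
    integral_congr_ae (.of_forall fun x => Real.sq_sqrt (u.qq_nonneg _))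
  have hKn : 0 ≤ ∫ x, (u.s (t, x) ^ k) ^ 2 ∂muO := integral_nonneg fun x => sq_nonneg _
  have hBn : 0 ≤ B := (integral_nonneg fun x => u.qq_nonneg (t, x)).trans hB
  rw [hqe] at cs
  have cs' := cs.trans (mul_le_mul_of_nonneg_left hB hKn)
  rw [habs, integral_const_mul] at sob
  have abs1 : 4 * ((k + 1 : ℕ) : ℝ) ^ 2 * B * ∫ x, (u.s (t, x) ^ k) ^ 2 ∂muO
      ≤ ∫ x, (u.s (t, x) ^ (k + 1)) ^ 2 ∂muO + (4 * (k + 1 : ℕ) ^ 2 * B) ^ (k + 1) := by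
    rw [← integral_const_mul]
    have : ∫ x, ((u.s (t, x) ^ (k + 1)) ^ 2 + (4 * ((k + 1 : ℕ) : ℝ) ^ 2 * B) ^ (k + 1)) ∂muO
        = ∫ x, (u.s (t, x) ^ (k + 1)) ^ 2 ∂muO + (4 * (k + 1 : ℕ) ^ 2 * B) ^ (k + 1) := by
      rw [integral_add iS2 (integrable_const _)]
      simp
    rw [← this]
    refine integral_mono (iK.const_mul _) (iS2.add (integrable_const _)) fun x => ?_
    have := mul_pow_le_half (x := u.s (t, x)) (b := 4 * ((k + 1 : ℕ) : ℝ) ^ 2 * B) (by positivity) k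
    simp only [← pow_mul, mul_comm 2 (k + 1), mul_comm 2 k] at this ⊢
    exact this
  have e : ∫ x, u.s (t, x) ^ (2 * (k + 1)) ∂muO = ∫ x, (u.s (t, x) ^ (k + 1)) ^ 2 ∂muO := by
    simp only [← pow_mul, mul_comm 2 (k + 1)]
  rw [e]
  generalize ∫ x, (u.s (t, x) ^ (k + 1)) ^ 2 ∂muO = M2 at *
  generalize ∫ x, u.s (t, x) ^ (k + 1) ∂muO = M1 at *
  generalize ∫ x, (u.s (t, x) ^ k) ^ 2 ∂muO = M3 at *
  generalize ∫ x, u.s (t, x) ^ k * √(u.qq (t, x)) ∂muO = J at *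
  generalize (4 * ((k + 1 : ℕ) : ℝ) ^ 2 * B) ^ (k + 1) = c at *
  generalize ((k + 1 : ℕ) : ℝ) = κ at *
  have h1 : (M1 + κ * J) ^ 2 ≤ 2 * M1 ^ 2 + 2 * (κ ^ 2 * J ^ 2) := by
    linarith only [sq_nonneg (M1 - κ * J)]
  have h2 := mul_le_mul_of_nonneg_left cs' (sq_nonneg κ)
  linarith only [sob, h1, h2, abs1]

theorem pow_bound (h : Reg γ p₀ ε T u) {K B : ℝ} (n : ℕ) :
    ∀ᵐ t ∂volume.restrict (Ioo 0 T), ∫ x, u.ρ (t, x) ∂muO ≤ K → ∫ x, u.qq (t, x) ∂muO ≤ B →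
      ∫ x, u.s (t, x) ^ (2 ^ (n + 1)) ∂muO ≤ powBound K B n := by
  induction n with
  | zero =>
    filter_upwards [ae_time_ae_space h.pos] with t ht hK _
    refine le_trans (le_of_eq (integral_congr_ae ?_)) hK
    filter_upwards [ht] with x hx
    rw [hx.2.1]; norm_num
  | succ n ih =>
    filter_upwards [ih, h.pow_step (B := B) (2 ^ (n + 1) - 1), ae_time_ae_space h.pos]
      with t h1 h2 hpos hK hB
    have h3 := h1 hK hB
    have h4 := h2 hB
    have e : 2 ^ (n + 1) - 1 + 1 = 2 ^ (n + 1) := Nat.sub_add_cancel Nat.one_le_two_pow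
    rw [e, ← pow_succ'] at h4
    refine h4.trans ?_
    have h5 : 0 ≤ ∫ x, u.s (t, x) ^ (2 ^ (n + 1)) ∂muO := integral_nonneg_of_ae (by
      filter_upwards [hpos] with x hx using pow_nonneg hx.1.le _)
    have h6 := pow_le_pow_left₀ h5 h3 2
    simp only [powBound]
    linarith

end Reg

/-! ### The Mellet–Vasseur inequality -/

/-- `(e + ζ) log (e + ζ)`. -/
def mvF (ζ : ℝ) : ℝ := (Real.exp 1 + ζ) * Real.log (Real.exp 1 + ζ)

/-- The derivative of `mvF`. -/
def mvF' (ζ : ℝ) : ℝ := Real.log (Real.exp 1 + ζ) + 1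

section Elementary

variable {ζ : ℝ}

theorem exp_add_pos (h : 0 ≤ ζ) : 0 < Real.exp 1 + ζ := by positivity

theorem one_le_log (h : 0 ≤ ζ) : 1 ≤ Real.log (Real.exp 1 + ζ) := by
  rw [Real.le_log_iff_exp_le (exp_add_pos h)]; linarith

theorem hasDerivAt_mvF' (h : 0 ≤ ζ) : HasDerivAt mvF' (Real.exp 1 + ζ)⁻¹ ζ := by
  have := ((hasDerivAt_id' ζ).const_add (Real.exp 1)).log (exp_add_pos h).ne'
  rw [one_div] at this
  exact this.add_const 1

theorem hasDerivAt_mvF (h : 0 ≤ ζ) : HasDerivAt mvF (mvF' ζ) ζ := by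
  have h1 := (hasDerivAt_id' ζ).const_add (Real.exp 1)
  have h2 := h1.mul (h1.log (exp_add_pos h).ne')
  rw [one_mul, mul_one_div_cancel (exp_add_pos h).ne'] at h2
  exact h2

theorem mvF'_ge (h : 0 ≤ ζ) : 2 ≤ mvF' ζ := by
  have := one_le_log h; unfold mvF'; linarith

theorem mvF_nonneg (h : 0 ≤ ζ) : 0 ≤ mvF ζ :=
  mul_nonneg (exp_add_pos h).le (zero_le_one.trans (one_le_log h))

theorem mvF'_le (h : 0 ≤ ζ) : mvF' ζ ≤ 4 * √√(Real.exp 1 + ζ) := by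
  have h0 := exp_add_pos h
  set y := √√(Real.exp 1 + ζ) with hy
  have hy0 : 0 < y := Real.sqrt_pos.2 (Real.sqrt_pos.2 h0)
  have e : Real.exp 1 + ζ = y ^ 4 := by
    rw [hy, show (4 : ℕ) = 2 * 2 from rfl, pow_mul, Real.sq_sqrt (Real.sqrt_nonneg _),
      Real.sq_sqrt h0.le]
  have h1 := Real.log_le_sub_one_of_pos hy0
  unfold mvF'
  rw [e, Real.log_pow]
  push_cast
  linarith

theorem mvF'_pow_le (h : 0 ≤ ζ) : mvF' ζ ^ 4 ≤ 256 * (Real.exp 1 + ζ) := by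
  have h0 := exp_add_pos h
  have h1 := pow_le_pow_left₀ (by linarith [mvF'_ge h]) (mvF'_le h) 4
  rw [mul_pow, show √√(Real.exp 1 + ζ) ^ 4 = (√√(Real.exp 1 + ζ) ^ 2) ^ 2 by ring,
    Real.sq_sqrt (Real.sqrt_nonneg _), Real.sq_sqrt h0.le] at h1
  linarith

theorem mvF'_le_linear (h : 0 ≤ ζ) : mvF' ζ ≤ 8 + 4 * √ζ := by
  have he : Real.exp 1 < 3 := by linarith [Real.exp_one_lt_d9]
  have he2 : 1 ≤ Real.exp 1 := Real.one_le_exp (by norm_num)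
  have h1 : √(Real.exp 1 + ζ) ≤ 2 + √ζ := by
    rw [Real.sqrt_le_iff]
    refine ⟨by positivity, ?_⟩
    nlinarith [Real.sq_sqrt h, Real.sqrt_nonneg ζ]
  have h2 : √√(Real.exp 1 + ζ) ≤ √(Real.exp 1 + ζ) := by
    apply Real.sqrt_le_sqrt
    rw [Real.sqrt_le_iff]
    refine ⟨by positivity, ?_⟩
    nlinarith
  linarith [mvF'_le h]

theorem mvF_sub_le (h : 0 ≤ ζ) : mvF ζ - 2 * mvF' ζ * ζ ≤ Real.exp 1 := by
  have he : 0 < Real.exp 1 := Real.exp_pos 1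
  have h1 := one_le_log h
  have hlog : Real.log (Real.exp 1 + ζ) ≤ 1 + ζ / Real.exp 1 := by
    have := Real.log_le_sub_one_of_pos (show 0 < (Real.exp 1 + ζ) / Real.exp 1 by positivity)
    rw [Real.log_div (exp_add_pos h).ne' he.ne', Real.log_exp, add_div, div_self he.ne'] at this
    linarith
  have e : mvF ζ - 2 * mvF' ζ * ζ = (Real.exp 1 - ζ) * Real.log (Real.exp 1 + ζ) - 2 * ζ := by
    unfold mvF mvF'; ring
  rw [e]
  rcases le_total ζ (Real.exp 1) with h2 | h2
  · have h3 := mul_le_mul_of_nonneg_left hlog (sub_nonneg.2 h2)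
    have h4 : (Real.exp 1 - ζ) * (1 + ζ / Real.exp 1) = Real.exp 1 - ζ ^ 2 / Real.exp 1 := by
      field_simp; ring
    have h5 : 0 ≤ ζ ^ 2 / Real.exp 1 := by positivity
    linarith
  · have := mul_nonneg (sub_nonneg.2 h2) (zero_le_one.trans h1)
    linarith

theorem mvF'_sq_mul_le (h : 0 ≤ ζ) : mvF' ζ ^ 2 * ζ ≤ 2 * mvF' ζ * mvF ζ := by
  have h0 := exp_add_pos h
  have h1 := one_le_log h
  have h2 := mvF'_ge h
  have h3 : mvF' ζ * ζ ≤ 2 * mvF ζ := by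
    unfold mvF mvF'
    have : ζ ≤ Real.exp 1 + ζ := by linarith [Real.exp_pos 1]
    have h4 := mul_le_mul_of_nonneg_left this (by linarith : 0 ≤ Real.log (Real.exp 1 + ζ) + 1)
    have h5 := mul_le_mul_of_nonneg_left h1 h0.le
    linarith
  nlinarith

end Elementary

namespace Fld

variable (u : Fld)

/-- `F(|v|²)` for the Mellet–Vasseur function `F`. -/
def F0 (p : SpT) : ℝ := mvF (u.vv p)
/-- `F'(|v|²)`. -/
def F1 (p : SpT) : ℝ := mvF' (u.vv p)
/-- `F''(|v|²)`. -/
def F2 (p : SpT) : ℝ := (Real.exp 1 + u.vv p)⁻¹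

/-- The time derivative of the Mellet–Vasseur density. -/
def mvI (p : SpT) : ℝ :=
  u.ρt p * u.F0 p + u.ρ p * (u.F1 p * (2 * (u.v 0 p * u.vt 0 p + u.v 1 p * u.vt 1 p)))

/-- `v · (∇v) v`. -/
def vVv (p : SpT) : ℝ := u.v 0 p * u.vV 0 p + u.v 1 p * u.vV 1 p

/-- `𝒟(v) : (v ⊗ ∇|v|²/2)`. -/
def DvV (p : SpT) : ℝ :=
  u.vV 0 p * (u.D 0 0 p * u.v 0 p + u.D 0 1 p * u.v 1 p)
    + u.vV 1 p * (u.D 1 0 p * u.v 0 p + u.D 1 1 p * u.v 1 p)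

theorem vV_sq (p : SpT) : u.vV 0 p ^ 2 + u.vV 1 p ^ 2 ≤ u.vv p * u.V2 p := by
  simp only [vV, vv, V2]
  nlinarith [sq_nonneg (u.v 0 p * u.V 1 0 p - u.v 1 p * u.V 0 0 p),
    sq_nonneg (u.v 0 p * u.V 1 1 p - u.v 1 p * u.V 0 1 p)]

theorem vVv_sq (p : SpT) : u.vVv p ^ 2 ≤ u.vv p ^ 2 * u.V2 p := by
  have h1 : u.vVv p ^ 2 ≤ u.vv p * (u.vV 0 p ^ 2 + u.vV 1 p ^ 2) := by
    simp only [vVv, vv]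
    nlinarith [sq_nonneg (u.v 0 p * u.vV 1 p - u.v 1 p * u.vV 0 p)]
  nlinarith [mul_le_mul_of_nonneg_left (u.vV_sq p) (u.vv_nonneg p)]

theorem DvV_sq (p : SpT) : u.DvV p ^ 2 ≤ u.vv p ^ 2 * (u.D2 p * u.V2 p) := by
  have h1 : (u.D 0 0 p * u.v 0 p + u.D 0 1 p * u.v 1 p) ^ 2
      + (u.D 1 0 p * u.v 0 p + u.D 1 1 p * u.v 1 p) ^ 2 ≤ u.vv p * u.D2 p := by
    simp only [vv, D2]
    nlinarith [sq_nonneg (u.D 0 0 p * u.v 1 p - u.D 0 1 p * u.v 0 p),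
      sq_nonneg (u.D 1 0 p * u.v 1 p - u.D 1 1 p * u.v 0 p)]
  have h2 : u.DvV p ^ 2 ≤ (u.vV 0 p ^ 2 + u.vV 1 p ^ 2)
      * ((u.D 0 0 p * u.v 0 p + u.D 0 1 p * u.v 1 p) ^ 2
      + (u.D 1 0 p * u.v 0 p + u.D 1 1 p * u.v 1 p) ^ 2) := by
    simp only [DvV]
    nlinarith [sq_nonneg (u.vV 0 p * (u.D 1 0 p * u.v 0 p + u.D 1 1 p * u.v 1 p)
      - u.vV 1 p * (u.D 0 0 p * u.v 0 p + u.D 0 1 p * u.v 1 p))]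
  have hv := u.vv_nonneg p
  have hV := u.V2_nonneg p
  have h3 := mul_le_mul (u.vV_sq p) h1 (by positivity) (by positivity)
  linarith

theorem qvV_sq (p : SpT) : (u.q 0 p * u.vV 0 p + u.q 1 p * u.vV 1 p) ^ 2
    ≤ u.qq p * (u.vv p * u.V2 p) := by
  have h1 : (u.q 0 p * u.vV 0 p + u.q 1 p * u.vV 1 p) ^ 2
      ≤ u.qq p * (u.vV 0 p ^ 2 + u.vV 1 p ^ 2) := by
    simp only [qq]
    nlinarith [sq_nonneg (u.q 0 p * u.vV 1 p - u.q 1 p * u.vV 0 p)]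
  exact h1.trans (mul_le_mul_of_nonneg_left (u.vV_sq p) (u.qq_nonneg p))

end Fld

namespace Reg

variable {γ p₀ ε T : ℝ} {u : Fld}

theorem QF1 (h : Reg γ p₀ ε T u) : Q T (1 / 10) u.F1 := by
  have hl : Q T (1 / 10) (fun p => 8 + 4 * √(u.vv p)) := (Q.const 8).mono.add (h.Qlen.const_mul 4)
  have hm : Measurable mvF' := (Real.measurable_log.comp (measurable_const.add measurable_id)).add_const 1
  refine hl.of_le (hm.comp_aemeasurable h.Qvv.aesm.aemeasurable).aestronglyMeasurable
    (.of_forall fun p => ?_)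
  have h0 := u.vv_nonneg p
  have h2 := mvF'_ge h0
  rw [abs_of_nonneg (by positivity : 0 ≤ 8 + 4 * √(u.vv p)), abs_of_nonneg (by unfold Fld.F1; linarith)]
  exact mvF'_le_linear h0

theorem QF0 (h : Reg γ p₀ ε T u) : Q T (3 / 10) u.F0 := by
  have h1 : Q T (1 / 5) (fun p => Real.exp 1 + u.vv p) := (Q.const _).mono.add h.Qvv
  have h2 : Q T (1 / 10) (fun p => u.F1 p - 1) := h.QF1.sub (Q.const 1).mono
  refine (h1.mul h2).mono.of_eq fun p => ?_
  simp only [Fld.F0, Fld.F1, mvF, mvF']; ring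

theorem QF2 (h : Reg γ p₀ ε T u) : Q T 0 u.F2 := by
  have hm : Measurable fun ζ : ℝ => (Real.exp 1 + ζ)⁻¹ := (measurable_const.add measurable_id).inv
  refine Q.of_bound (hm.comp_aemeasurable h.Qvv.aesm.aemeasurable).aestronglyMeasurable 1
    (.of_forall fun p => ?_)
  have h0 := u.vv_nonneg p
  have h1 : 1 ≤ Real.exp 1 := Real.one_le_exp (by norm_num)
  simp only [Fld.F2]
  rw [abs_of_nonneg (by positivity)]
  exact inv_le_one_of_one_le₀ (by linarith)

theorem DF1_of {c : ℝ → ℝ → Prop} (h : Reg γ p₀ ε T u) (hc : ∀ a b, c a b → c (mvF' a) (mvF' b))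
    (hd : DQr c k T (1 / 5) (2 / 5) u.vv g) :
    DQr c k T (1 / 10) (2 / 5) u.F1 (fun p => u.F2 p * g p) :=
  ⟨LD.comp_gen (φ := mvF') (φ' := fun ζ => (Real.exp 1 + ζ)⁻¹) (S := Ici 0) isClosed_Ici
      (fun y hy => hasDerivAt_mvF' hy) (ContinuousOn.inv₀ (by fun_prop) fun y hy => (exp_add_pos hy).ne') hc hd.ld
      (.of_forall fun p => u.vv_nonneg p), h.QF1,
    (h.QF2.mul hd.dv).mono⟩

theorem DF0_of {c : ℝ → ℝ → Prop} (h : Reg γ p₀ ε T u) (hc : ∀ a b, c a b → c (mvF a) (mvF b))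
    (hd : DQr c k T (1 / 5) (2 / 5) u.vv g) :
    DQr c k T (3 / 10) (1 / 2) u.F0 (fun p => u.F1 p * g p) :=
  ⟨LD.comp_gen (φ := mvF) (φ' := mvF') (S := Ici 0) isClosed_Ici (fun y hy => hasDerivAt_mvF hy)
      (fun y hy => (hasDerivAt_mvF' hy).continuousAt.continuousWithinAt) hc hd.ld
      (.of_forall fun p => u.vv_nonneg p), h.QF0,
    (h.QF1.mul hd.dv).mono⟩

theorem DF1 (h : Reg γ p₀ ε T u) (i : Fin 2) :
    DQr Eq (hor i) T (1 / 10) (2 / 5) u.F1 (fun p => u.F2 p * (2 * u.vV i p)) :=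
  h.DF1_of (fun a b hab => by rw [hab]) (h.Dvv i)

theorem DF0 (h : Reg γ p₀ ε T u) (i : Fin 2) :
    DQr Eq (hor i) T (3 / 10) (1 / 2) u.F0 (fun p => u.F1 p * (2 * u.vV i p)) :=
  h.DF0_of (fun a b hab => by rw [hab]) (h.Dvv i)

theorem DF1z (h : Reg γ p₀ ε T u) :
    DQr cAny 2 T (1 / 10) (2 / 5) u.F1 (fun p => u.F2 p * (2 * u.vZ p)) :=
  h.DF1_of (fun _ _ _ => trivial) h.Dvvz

theorem DF0z (h : Reg γ p₀ ε T u) :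
    DQr cAny 2 T (3 / 10) (1 / 2) u.F0 (fun p => u.F1 p * (2 * u.vZ p)) :=
  h.DF0_of (fun _ _ _ => trivial) h.Dvvz

theorem mv_convective (h : Reg γ p₀ ε T u) : ∃ N, Nul T N ∧ ∀ p,
    u.F0 p * u.divρv p + 2 * u.F1 p * u.v 0 p * (u.ρ p * (u.v 0 p * u.V 0 0 p + u.v 1 p * u.V 0 1 p))
      + 2 * u.F1 p * u.v 1 p * (u.ρ p * (u.v 0 p * u.V 1 0 p + u.v 1 p * u.V 1 1 p)) = N p := by
  have n := WNull.div (fun i => (h.Dρ i).mul ((h.Dv i i).mul (h.DF0 i)))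
  refine ⟨_, n.nul, fun p => ?_⟩
  simp only [Fld.divρv, Fld.vV]
  ring

theorem mv_vertical (h : Reg γ p₀ ε T u) : ∃ N, Nul T N ∧ ∀ p,
    u.F0 p * (u.ρ p * u.wz p) + 2 * u.F1 p * u.v 0 p * (u.ρ p * u.w p * u.Z 0 p)
      + 2 * u.F1 p * u.v 1 p * (u.ρ p * u.w p * u.Z 1 p) = N p := by
  have n := ((h.Dw.mul h.Dρz).mul h.DF0z).wnullZ
  refine ⟨_, n.nul, fun p => ?_⟩
  simp only [Fld.vZ]
  ring

theorem mv_viscous (h : Reg γ p₀ ε T u) : ∃ N, Nul T N ∧ ∀ p,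
    2 * u.F1 p * u.v 0 p * (2 * u.s p * (u.q 0 p * u.D 0 0 p + u.q 1 p * u.D 1 0 p)
        + u.ρ p * (u.DD 0 0 0 p + u.DD 1 0 1 p))
      + 2 * u.F1 p * u.v 1 p * (2 * u.s p * (u.q 0 p * u.D 0 1 p + u.q 1 p * u.D 1 1 p)
        + u.ρ p * (u.DD 0 1 0 p + u.DD 1 1 1 p))
      = N p - 2 * u.ρ p * u.F1 p * u.D2 p - 4 * u.ρ p * u.F2 p * u.DvV p := by
  have n := fun j => WNull.div (fun i => (h.Dρ i).mul ((h.DD i j i).mul ((h.Dv j i).mul (h.DF1 i))))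
  refine ⟨_, (((n 0).add (n 1)).const_mul 2).nul, fun p => ?_⟩
  simp only [Fld.D2, Fld.DvV]
  generalize u.DD 0 0 0 p = x0; generalize u.DD 1 0 1 p = x1
  generalize u.DD 0 1 0 p = x2; generalize u.DD 1 1 1 p = x3
  generalize u.vV 0 p = y0; generalize u.vV 1 p = y1
  simp only [Fld.D]
  ring

theorem mv_vertical_viscous (h : Reg γ p₀ ε T u) : ∃ N, Nul T N ∧ ∀ p,
    2 * u.F1 p * u.v 0 p * (u.ρ p * u.ZZ 0 p) + 2 * u.F1 p * u.v 1 p * (u.ρ p * u.ZZ 1 p)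
      = N p - 2 * u.ρ p * u.F1 p * u.Z2 p - 4 * u.ρ p * u.F2 p * u.vZ p ^ 2 := by
  have n := fun j => (((h.DZ j).mul h.Dρz).mul ((h.Dvz j).mul h.DF1z)).wnullZ
  refine ⟨_, (((n 0).add (n 1)).const_mul 2).nul, fun p => ?_⟩
  simp only [Fld.Z2, Fld.vZ]
  ring

theorem mv_artificial (h : Reg γ p₀ ε T u) : ∃ N, Nul T N ∧ ∀ p,
    2 * u.F1 p * u.v 0 p * (2 * u.s p * (u.q 0 p * u.V 0 0 p + u.q 1 p * u.V 0 1 p)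
        + u.ρ p * (u.VV 0 0 0 p + u.VV 0 1 1 p))
      + 2 * u.F1 p * u.v 1 p * (2 * u.s p * (u.q 0 p * u.V 1 0 p + u.q 1 p * u.V 1 1 p)
        + u.ρ p * (u.VV 1 0 0 p + u.VV 1 1 1 p))
      = N p - 2 * u.ρ p * u.F1 p * u.V2 p - 4 * u.ρ p * u.F2 p * (u.vV 0 p ^ 2 + u.vV 1 p ^ 2) := by
  have n := fun j => WNull.div (fun i => (h.Dρ i).mul ((h.DV j i i).mul ((h.Dv j i).mul (h.DF1 i))))
  refine ⟨_, (((n 0).add (n 1)).const_mul 2).nul, fun p => ?_⟩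
  simp only [Fld.V2, Fld.vV]
  ring

theorem mv_density (h : Reg γ p₀ ε T u) : ∃ N, Nul T N ∧ ∀ p,
    u.F0 p * (u.s p * u.lap p + u.s p * u.dX p)
      + 2 * u.F1 p * u.s p * u.qq p * (u.q 0 p * u.vV 0 p + u.q 1 p * u.vV 1 p)
      = N p - (u.qq p + u.qq p ^ 2) * u.F0 p
        - 2 * u.s p * u.F1 p * (u.q 0 p * u.vV 0 p + u.q 1 p * u.vV 1 p) := by
  have n1 := WNull.div (fun i => (h.Ds i).mul ((h.Dq i i).mul (h.DF0 i)))
  have n2 := WNull.div (fun i => (h.Ds i).mul ((h.DX i i).mul (h.DF0 i)))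
  refine ⟨_, (n1.add n2).nul, fun p => ?_⟩
  simp only [Fld.lap, Fld.dX, Fld.X]
  generalize u.DX 0 0 p = x0; generalize u.DX 1 1 p = x1
  simp only [Fld.qq]
  ring

theorem mv_pressure (h : Reg γ p₀ ε T u) : ∃ N, Nul T N ∧ ∀ᵐ p ∂muQ T,
    2 * u.F1 p * u.v 0 p * (γ * u.pw (γ - 1) p * (2 * u.s p * u.q 0 p))
      + 2 * u.F1 p * u.v 1 p * (γ * u.pw (γ - 1) p * (2 * u.s p * u.q 1 p))
      = N p - 2 * u.pw γ p * (u.F1 p * u.dv p + 2 * u.F2 p * u.vVv p) := by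
  have n := WNull.div (fun i => (h.Dpw γ i).mul ((h.Dv i i).mul (h.DF1 i)))
  refine ⟨_, (n.const_mul 2).nul, ?_⟩
  filter_upwards [h.pos, h.pw_sub_one γ] with p ⟨hs, hρ, hR⟩ ⟨hg, _⟩
  rw [hg]
  simp only [Fld.dv, Fld.vVv]
  linear_combination (4 * γ * u.F1 p * u.pw γ p * u.R p * (u.v 0 p * u.q 0 p + u.v 1 p * u.q 1 p)) * hR

theorem mv_identity (h : Reg γ p₀ ε T u) : ∃ N, Nul T N ∧ ∀ᵐ p ∂muQ T,
    u.mvI p = N p - 2 * u.ρ p * u.F1 p * u.D2 p - 4 * u.ρ p * u.F2 p * u.DvV p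
      - 2 * u.ρ p * u.F1 p * u.Z2 p - 4 * u.ρ p * u.F2 p * u.vZ p ^ 2
      - √ε * (2 * u.ρ p * u.F1 p * u.V2 p + 4 * u.ρ p * u.F2 p * (u.vV 0 p ^ 2 + u.vV 1 p ^ 2))
      - ε * ((u.qq p + u.qq p ^ 2) * u.F0 p
        + 2 * u.s p * u.F1 p * (u.q 0 p * u.vV 0 p + u.q 1 p * u.vV 1 p))
      + ε * u.pw (-p₀) p * (u.F0 p - 2 * u.F1 p * u.vv p)
      - 2 * ε * u.ρ p * √(u.vv p) ^ 3 * u.F1 p * u.vv p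
      + 2 * u.pw γ p * (u.F1 p * u.dv p + 2 * u.F2 p * u.vVv p) := by
  obtain ⟨N1, n1, e1⟩ := h.mv_convective
  obtain ⟨N2, n2, e2⟩ := h.mv_vertical
  obtain ⟨N3, n3, e3⟩ := h.mv_viscous
  obtain ⟨N4, n4, e4⟩ := h.mv_vertical_viscous
  obtain ⟨N5, n5, e5⟩ := h.mv_artificial
  obtain ⟨N6, n6, e6⟩ := h.mv_density
  obtain ⟨N7, n7, e7⟩ := h.mv_pressure
  refine ⟨_, (((((((n1.const_mul (-1)).add (n2.const_mul (-1))).add n3).add n4).add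
    (n5.const_mul (√ε))).add (n6.const_mul ε)).add (n7.const_mul (-1))), ?_⟩
  filter_upwards [e7, h.mass, h.mom 0, h.mom 1] with p e7 mass m0 m1
  have hG : u.G p₀ ε p = ε * u.s p * u.lap p + ε * u.s p * u.dX p + ε * u.pw (-p₀) p := rfl
  have hvv : u.vv p = u.v 0 p ^ 2 + u.v 1 p ^ 2 := rfl
  rw [hG] at mass
  change _ + _ + _ + γ * u.pw (γ - 1) p * _ = _ + _ + _ + (_ + _ - ε * u.pw (-p₀) p * _ - _) at m0 m1
  have e1 := e1 p
  have e2 := e2 p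
  have e3 := e3 p
  have e4 := e4 p
  have e5 := e5 p
  have e6 := e6 p
  have hvV : ∀ i, u.vV i p = u.v 0 p * u.V 0 i p + u.v 1 p * u.V 1 i p := fun _ => rfl
  simp only [Fld.DD] at e3
  simp only [Fld.mvI]
  linear_combination u.F0 p * mass + 2 * u.F1 p * u.v 0 p * m0 + 2 * u.F1 p * u.v 1 p * m1
    - e1 - e2 + e3 + e4 + √ε * e5 + ε * e6 - e7
    - 2 * ε * u.F1 p * u.s p * u.qq p * (u.q 0 p * hvV 0 + u.q 1 p * hvV 1)
    + (2 * ε * u.pw (-p₀) p * u.F1 p + 2 * ε * u.ρ p * √(u.vv p) ^ 3 * u.F1 p) * hvv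

end Reg

/-! ### The Mellet–Vasseur bound -/

namespace Reg

variable {γ p₀ ε T : ℝ} {u : Fld}

set_option maxHeartbeats 1000000 in
theorem mv_le (h : Reg γ p₀ ε T u) (hε : 0 < ε) (hε1 : ε ≤ 1 / 4) :
    ∃ N, Nul T N ∧ ∀ᵐ p ∂muQ T, u.mvI p ≤ N p + (3 * (u.ρ p * u.D2 p) + 3 * (u.ρ p * u.V2 p)
      + 3 * (u.pw γ p ^ 4 * u.R p ^ 6) + 768 * (u.ρ p * (Real.exp 1 + u.vv p))
      + Real.exp 1 * (ε * u.pw (-p₀) p)) := by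
  obtain ⟨N, n, e⟩ := h.mv_identity
  refine ⟨N, n, ?_⟩
  filter_upwards [e, h.pos] with p e ⟨hs, hρ, hR⟩
  have hρ0 : 0 < u.ρ p := by rw [hρ]; positivity
  have hB : 0 ≤ u.pw (-p₀) p := Real.rpow_nonneg hρ0.le _
  have hvv := u.vv_nonneg p
  have hqq := u.qq_nonneg p
  have hV := u.V2_nonneg p
  have hD := u.D2_nonneg p
  have hZ : 0 ≤ u.Z2 p := by unfold Fld.Z2; positivity
  have hR2 : u.R p ^ 2 * u.ρ p = 1 := by rw [hρ, ← mul_pow, hR, one_pow]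
  have hF1 : 2 ≤ u.F1 p := mvF'_ge hvv
  have hF0 : 0 ≤ u.F0 p := mvF_nonneg hvv
  have hF10 : 0 ≤ u.F1 p := zero_le_two.trans hF1
  have hE := exp_add_pos hvv
  have hF2 : 0 ≤ u.F2 p := inv_nonneg.2 hE.le
  have hF2v : u.F2 p * u.vv p ≤ 1 := by
    unfold Fld.F2
    rw [inv_mul_le_one₀ hE]
    exact le_add_of_nonneg_left (Real.exp_pos 1).le
  have hF2v2 : u.F2 p ^ 2 * u.vv p ^ 2 ≤ 1 := by
    rw [← mul_pow]; exact pow_le_one₀ (by positivity) hF2v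
  have t1 : -(4 * u.ρ p * u.F2 p * u.DvV p) ≤ 2 * (u.ρ p * u.D2 p) + 2 * (u.ρ p * u.V2 p) := by
    refine le_add_of_sq_le_mul (by positivity) (by positivity) ?_
    have h1 := mul_le_mul_of_nonneg_left (u.DvV_sq p) (by positivity : 0 ≤ 16 * u.ρ p ^ 2 * u.F2 p ^ 2)
    have h2 := mul_le_mul_of_nonneg_left hF2v2
      (by positivity : 0 ≤ 16 * u.ρ p ^ 2 * (u.D2 p * u.V2 p))
    linarith only [h1, h2]
  have t2 : -(2 * u.s p * u.F1 p * (u.q 0 p * u.vV 0 p + u.q 1 p * u.vV 1 p))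
      ≤ u.qq p * u.F0 p + 2 * (u.ρ p * u.F1 p * u.V2 p) := by
    refine le_add_of_sq_le_mul (by positivity) (by positivity) ?_
    have h1 := mul_le_mul_of_nonneg_left (u.qvV_sq p) (by positivity : 0 ≤ 4 * u.ρ p * u.F1 p ^ 2)
    have h2 := mul_le_mul_of_nonneg_left (mvF'_sq_mul_le hvv)
      (by positivity : 0 ≤ 4 * u.ρ p * (u.qq p * u.V2 p))
    change _ * (u.F1 p ^ 2 * _) ≤ _ * (2 * u.F1 p * u.F0 p) at h2
    calc _ = 4 * u.s p ^ 2 * u.F1 p ^ 2 * (u.q 0 p * u.vV 0 p + u.q 1 p * u.vV 1 p) ^ 2 := by ring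
      _ = 4 * u.ρ p * u.F1 p ^ 2 * (u.q 0 p * u.vV 0 p + u.q 1 p * u.vV 1 p) ^ 2 := by rw [hρ]
      _ ≤ _ := by linarith only [h1, h2]
  have t3 : 2 * u.pw γ p * (u.F1 p * u.dv p)
      ≤ u.ρ p * u.D2 p + 2 * (u.pw γ p ^ 2 * u.R p ^ 2 * u.F1 p ^ 2) := by
    refine le_add_of_sq_le_mul (by positivity) (by positivity) ?_
    have h1 := mul_le_mul_of_nonneg_left (u.dv_sq p) (by positivity : 0 ≤ 4 * u.pw γ p ^ 2 * u.F1 p ^ 2)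
    calc _ = 4 * u.pw γ p ^ 2 * u.F1 p ^ 2 * u.dv p ^ 2 := by ring
      _ ≤ 4 * u.pw γ p ^ 2 * u.F1 p ^ 2 * (2 * u.D2 p) * (u.R p ^ 2 * u.ρ p) := by
        rw [hR2, mul_one]; exact h1
      _ = _ := by ring
  have t4 : 2 * u.pw γ p * (2 * u.F2 p * u.vVv p)
      ≤ u.ρ p * u.V2 p + 4 * (u.pw γ p ^ 2 * u.R p ^ 2) := by
    refine le_add_of_sq_le_mul (by positivity) (by positivity) ?_
    have h1 := mul_le_mul_of_nonneg_left (u.vVv_sq p) (by positivity : 0 ≤ 16 * u.pw γ p ^ 2 * u.F2 p ^ 2)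
    have h2 := mul_le_mul_of_nonneg_left hF2v2 (by positivity : 0 ≤ 16 * u.pw γ p ^ 2 * u.V2 p)
    calc _ = 16 * u.pw γ p ^ 2 * u.F2 p ^ 2 * u.vVv p ^ 2 := by ring
      _ ≤ 16 * u.pw γ p ^ 2 * u.V2 p * (u.R p ^ 2 * u.ρ p) := by
        rw [hR2]; linarith only [h1, h2]
      _ = _ := by ring
  have t5 : 4 * (u.pw γ p ^ 2 * u.R p ^ 2) ≤ 4 * (u.pw γ p ^ 2 * u.R p ^ 2 * u.F1 p ^ 2) := by
    have : (1 : ℝ) ≤ u.F1 p ^ 2 := one_le_pow₀ (by linarith only [hF1])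
    have := le_mul_of_one_le_right (by positivity : 0 ≤ u.pw γ p ^ 2 * u.R p ^ 2) this
    linarith only [this]
  have t6 : 6 * (u.pw γ p ^ 2 * u.R p ^ 2 * u.F1 p ^ 2)
      ≤ 3 * (u.pw γ p ^ 4 * u.R p ^ 6) + 768 * (u.ρ p * (Real.exp 1 + u.vv p)) := by
    have h1 := mul_le_mul_of_nonneg_left (mvF'_pow_le hvv) (by positivity : 0 ≤ 3 * u.ρ p)
    change _ * u.F1 p ^ 4 ≤ _ at h1
    have h2 : 6 * (u.pw γ p ^ 2 * u.R p ^ 2 * u.F1 p ^ 2)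
        ≤ 3 * (u.pw γ p ^ 4 * u.R p ^ 6) + 3 * u.ρ p * u.F1 p ^ 4 := by
      have h3 : u.pw γ p ^ 2 * u.R p ^ 2 * u.F1 p ^ 2
          = (u.pw γ p ^ 2 * u.R p ^ 3) * (u.s p * u.F1 p ^ 2) := by
        linear_combination (-(u.pw γ p ^ 2 * u.R p ^ 2 * u.F1 p ^ 2)) * hR
      rw [h3, hρ]
      linarith only [sq_nonneg (u.pw γ p ^ 2 * u.R p ^ 3 - u.s p * u.F1 p ^ 2)]
    linarith only [h1, h2]
  have t7 := mul_le_mul_of_nonneg_left (mvF_sub_le hvv) (by positivity : 0 ≤ ε * u.pw (-p₀) p)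
  change _ * (u.F0 p - 2 * u.F1 p * _) ≤ _ at t7
  have t8 := mul_le_mul_of_nonneg_left t2 hε.le
  have hsε : ε ≤ √ε := by
    have h1 : √ε ≤ 1 := Real.sqrt_le_one.2 (by linarith only [hε1])
    have h2 := mul_le_mul_of_nonneg_left h1 (Real.sqrt_nonneg ε)
    rw [Real.mul_self_sqrt hε.le, mul_one] at h2
    exact h2
  have t9 := mul_le_mul_of_nonneg_right hsε (by positivity : 0 ≤ 2 * (u.ρ p * u.F1 p * u.V2 p))
  have g1 : 0 ≤ u.ρ p * u.F1 p * u.D2 p := by positivity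
  have g2 : 0 ≤ u.ρ p * u.F1 p * u.Z2 p := by positivity
  have g3 : 0 ≤ u.ρ p * u.F2 p * u.vZ p ^ 2 := by positivity
  have g4 : 0 ≤ √ε * (4 * u.ρ p * u.F2 p * (u.vV 0 p ^ 2 + u.vV 1 p ^ 2)) := by positivity
  have g5 : 0 ≤ ε * (u.qq p ^ 2 * u.F0 p) := by positivity
  have g6 : 0 ≤ 2 * ε * u.ρ p * √(u.vv p) ^ 3 * u.F1 p * u.vv p := by positivity
  rw [e]
  clear e hvv hqq hV hD hZ hF1 hF0 hE hF2 hF2v hF2v2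
  linarith only [t1, t3, t4, t5, t6, t7, t8, t9, g1, g2, g3, g4, g5, g6]

theorem pw_high_le (h : Reg γ p₀ ε T u) (hγ : 1 < γ) {n : ℕ} (hn : 8 * γ - 6 ≤ (2 : ℝ) ^ (n + 1))
    : ∀ᵐ p ∂muQ T, u.pw γ p ^ 4 * u.R p ^ 6 ≤ 1 + u.s p ^ (2 ^ (n + 1)) := by
  filter_upwards [h.pos, h.pw_eq γ] with p ⟨hs, hρ, hR⟩ hpw
  have e : u.pw γ p ^ 4 * u.R p ^ 6 = u.s p ^ (8 * γ - 6) := by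
    rw [← hpw, ← Real.rpow_natCast, ← Real.rpow_mul hs.le, Real.rpow_sub hs]
    simp only [Fld.R]
    rw [inv_pow, div_eq_mul_inv, ← Real.rpow_natCast (u.s p) 6]
    norm_num
    left; congr 1; ring
  rw [e]
  rcases le_total (u.s p) 1 with h1 | h1
  · have := Real.rpow_le_one hs.le h1 (by linarith : 0 ≤ 8 * γ - 6)
    have := pow_nonneg hs.le (2 ^ (n + 1))
    linarith
  · have h2 := Real.rpow_le_rpow_of_exponent_le h1 hn
    have h3 : u.s p ^ ((2 : ℝ) ^ (n + 1)) = u.s p ^ (2 ^ (n + 1)) := by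
      rw [← Real.rpow_natCast (u.s p)]; push_cast; rfl
    rw [h3] at h2
    linarith

theorem TF0 (h : Reg γ p₀ ε T u) (hT : 0 < T) :
    TD T u.F0 (fun p => u.F1 p * (2 * (u.v 0 p * u.vt 0 p + u.v 1 p * u.vt 1 p))) := by
  have hvv : TD T u.vv (fun p => 2 * (u.v 0 p * u.vt 0 p + u.v 1 p * u.vt 1 p)) :=
    (((h.tv 0).mul (h.tv 0)).add ((h.tv 1).mul (h.tv 1))).of_eq
      (fun p => by simp only [Fld.vv]; ring) (fun p => by ring)
  exact TD.comp hT (φ := mvF) (φ' := mvF') (S := Ici 0) isClosed_Ici (fun y hy => hasDerivAt_mvF hy)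
    (fun y hy => (hasDerivAt_mvF' hy).continuousAt.continuousWithinAt) hvv
    (.of_forall fun p => u.vv_nonneg p)

theorem QmvI (h : Reg γ p₀ ε T u) : Q T 1 u.mvI := by
  have a : ∀ j, Q T (7 / 10) (fun p => 2 * (u.ρ p * (u.F1 p * u.v j p)) * u.vt j p) := fun j =>
    ((((h.Dρ 0).fn.mul (h.QF1.mul (h.Dv j j).fn)).const_mul 2).mul (h.qvt j)).mono
  refine (((h.qρt.mul h.QF0).add' ((a 0).add (a 1))).mono (b := 1)).of_eq fun p => ?_
  simp only [Fld.mvI]; ring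

/-- The Mellet–Vasseur bound. -/
theorem mv_bound {K B t : ℝ} (hT : 0 < T) (hγ : 1 < γ) (hp : 24 < p₀) (hε : 0 < ε)
    (hε1 : ε ≤ 1 / 4) (h : Reg γ p₀ ε T u) {n : ℕ} (hn : 8 * γ - 6 ≤ (2 : ℝ) ^ (n + 1))
    (hK : ∀ t ∈ Icc 0 T, ∫ x, u.eY γ p₀ ε (t, x) ∂muO + ∫ p, u.eDiss p₀ ε p ∂muQ t ≤ K)
    (hB : ∀ᵐ t ∂volume.restrict (Ioo 0 T), ∫ x, u.qq (t, x) ∂muO ≤ B)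
    (hD : ∫ p, u.bdDiss γ ε p ∂muQ T ≤ B) (ht : t ∈ Icc 0 T) :
    Integrable (fun x => u.ρ (t, x) * u.F0 (t, x)) muO ∧
    ∫ x, u.ρ (t, x) * u.F0 (t, x) ∂muO ≤ ∫ x, u.ρ (0, x) * u.F0 (0, x) ∂muO
      + (3 * K + 3 * B + 3 * (T * (1 + powBound K B n)) + 3843 * (T * K)) := by
  obtain ⟨N, hN, hle⟩ := h.mv_le hε hε1
  have hp0 : 0 < p₀ := by linarith
  have hTD := h.tρ.mul (h.TF0 hT)
  have q1 : Q T 1 (fun p => u.ρ p * u.F0 p) := ((h.Dρ 0).fn.mul h.QF0).mono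
  have q2 : Integrable (fun p => u.ρt p * u.F0 p
      + u.ρ p * (u.F1 p * (2 * (u.v 0 p * u.vt 0 p + u.v 1 p * u.vt 1 p)))) (muQ T) :=
    h.QmvI.integrable
  refine ⟨hTD.slice_integrable hT q1.integrable q2 ht, ?_⟩
  rw [hTD.integral_slice hT q1.integrable q2 ht]
  refine add_le_add le_rfl ?_
  change ∫ p, u.mvI p ∂muQ t ≤ _
  have hes := fun t ht => h.energy_split hT hγ hp0 hε hK (t := t) ht
  have qY : Q T 1 (u.eY γ p₀ ε) := h.QeY.mono
  have qS : Q T 0 (fun p => u.s p ^ (2 ^ (n + 1))) := (h.Dpow _ 0).fn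
  have qS1 : Q T 1 (fun p => 1 + u.s p ^ (2 ^ (n + 1))) := ((Q.const 1).add qS).mono zero_le_one
  have hYint : ∫ p, u.eY γ p₀ ε p ∂muQ T ≤ T * K := by
    refine integral_muQ_le_of_slices hT qY.integrable ?_
    filter_upwards [ae_restrict_mem measurableSet_Ioo] with t ht using (hes t (Ioo_subset_Icc_self ht)).2.2.1
  have hSint : ∫ p, (1 + u.s p ^ (2 ^ (n + 1))) ∂muQ T ≤ T * (1 + powBound K B n) := by
    refine integral_muQ_le_of_slices hT qS1.integrable ?_
    filter_upwards [ae_restrict_mem measurableSet_Ioo, h.pow_bound (K := K) (B := B) n, hB,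
      Q.frozen (T' := 1) qS] with t ht h1 h2 hq
    have ht' := Ioo_subset_Icc_self ht
    have iS : Integrable (fun x => u.s (t, x) ^ (2 ^ (n + 1))) muO :=
      integrable_of_Q_space (f := fun x => u.s (t, x) ^ (2 ^ (n + 1))) hq zero_le_one
    have iρ : Integrable (fun x => u.ρ (t, x)) muO :=
      h.tρ.slice_integrable hT ((h.Dρ 0).fn.integrable zero_le_one) h.qρt.integrable ht'
    have hρK : ∫ x, u.ρ (t, x) ∂muO ≤ K := by
      refine (integral_mono_ae iρ (h.eY_integrable hT ht') ?_).trans (hes t ht').2.2.1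
      filter_upwards [(hes t ht').1] with x hx
      have e1 := eY_ge (γ := γ) (ε := ε) (u := u) hγ hp0 hx
      have e2 : 0 ≤ ε * u.pw (-p₀) (t, x) := mul_nonneg hε.le (Real.rpow_nonneg hx _)
      have e3 : 0 ≤ (γ - 1)⁻¹ * u.pw γ (t, x) :=
        mul_nonneg (inv_nonneg.2 (by linarith)) (Real.rpow_nonneg hx _)
      have e4 := mul_nonneg hx (u.vv_nonneg (t, x))
      linarith
    rw [integral_add (integrable_const _) iS]
    simp only [integral_const, smul_eq_mul, mul_one, probReal_univ]
    linarith [h1 hρK h2]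
  have hNt := hN t ht.2
  have qErr : Q T 1 (fun p => 3 * u.eDiss p₀ ε p + 3 * u.bdDiss γ ε p
      + 3 * (1 + u.s p ^ (2 ^ (n + 1))) + 3843 * u.eY γ p₀ ε p) :=
    (((h.QeDiss.const_mul 3).add (h.QbdDiss.const_mul 3)).add (qS1.const_mul 3)).add
      (qY.const_mul 3843)
  have hpt : ∀ᵐ p ∂muQ T, u.mvI p ≤ N p + (3 * u.eDiss p₀ ε p + 3 * u.bdDiss γ ε p
      + 3 * (1 + u.s p ^ (2 ^ (n + 1))) + 3843 * u.eY γ p₀ ε p) := by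
    filter_upwards [hle, h.ρ_nonneg, h.pw_high_le hγ hn] with p h1 hρ h2
    refine h1.trans (add_le_add le_rfl ?_)
    have e1 := eY_ge (γ := γ) (p₀ := p₀) (ε := ε) (u := u) hγ hp0 hρ
    have e2 : 0 ≤ ε * u.pw (-p₀) p := mul_nonneg hε.le (Real.rpow_nonneg hρ _)
    have e3 : 0 ≤ (γ - 1)⁻¹ * u.pw γ p :=
      mul_nonneg (inv_nonneg.2 (by linarith)) (Real.rpow_nonneg hρ _)
    have e4 := mul_nonneg hρ (u.vv_nonneg p)
    have he : Real.exp 1 ≤ 3 := by linarith [Real.exp_one_lt_d9]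
    have e5 := mul_le_mul_of_nonneg_right he e2
    have e6 := mul_le_mul_of_nonneg_left he hρ
    have := u.vv_nonneg p
    have := u.qq_nonneg p
    have := u.H2_nonneg p
    have : ∀ a, 0 ≤ u.pw a p := fun a => Real.rpow_nonneg hρ a
    have hP := this (-p₀)
    have hB := this (γ - 1)
    have : 0 ≤ u.Z2 p := by unfold Fld.Z2; positivity
    have d1 : u.ρ p * u.D2 p ≤ u.eDiss p₀ ε p := by
      simp only [Fld.eDiss, add_assoc]
      exact le_add_of_nonneg_right (by positivity)
    have d2 : u.ρ p * u.V2 p ≤ u.bdDiss γ ε p := by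
      simp only [Fld.bdDiss, add_assoc]
      exact le_add_of_nonneg_right (by positivity)
    linarith only [e1, e2, e3, e4, e5, e6, d1, d2, h2, hρ]
  have hErrpos : ∀ᵐ p ∂muQ T, 0 ≤ 3 * u.eDiss p₀ ε p + 3 * u.bdDiss γ ε p
      + 3 * (1 + u.s p ^ (2 ^ (n + 1))) + 3843 * u.eY γ p₀ ε p := by
    filter_upwards [h.ρ_nonneg, h.pos] with p hρ hs
    have h1 := eDiss_nonneg (p₀ := p₀) (ε := ε) hp0 hε hρ
    have h2 := bdDiss_nonneg (γ := γ) (ε := ε) hγ hε hρ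
    have h3 := (eY_nonneg (γ := γ) (p₀ := p₀) (ε := ε) hγ hp0 hε hρ).1
    have h4 := pow_nonneg hs.1.le (2 ^ (n + 1))
    linarith
  have m1 := Q.integral_mono (h.QmvI.mono_time ht.2)
    ((Q.of_integrable hNt.1).add (qErr.mono_time ht.2)) (ae_mono (muQ_mono ht.2) hpt)
  rw [integral_add hNt.1 (qErr.mono_time ht.2).integrable, hNt.2, zero_add] at m1
  have m2 := integral_muQ_mono ht.2 qErr.integrable hErrpos
  have i1 := h.QeDiss.integrable |>.const_mul 3
  have i2 := h.QbdDiss.integrable |>.const_mul 3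
  have i3 := qS1.integrable |>.const_mul 3
  have i4 := qY.integrable |>.const_mul 3843
  rw [integral_add (integrable_add' (integrable_add' i1 i2) i3) i4,
    integral_add (integrable_add' i1 i2) i3, integral_add i1 i2, integral_const_mul,
    integral_const_mul, integral_const_mul, integral_const_mul] at m2
  have hKT := hK T (right_mem_Icc.2 hT.le)
  have hYT := (hes T (right_mem_Icc.2 hT.le)).2.1
  linarith only [m1, m2, hKT, hYT, hYint, hSint, hD]

end Reg

/-! ### The initial data -/

theorem integral_le_of_lintegral_le {X : Type} [MeasurableSpace X] {μ : Measure X} {f : X → ℝ}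
    {M : ℝ} (hM : 0 ≤ M) (hf : AEStronglyMeasurable f μ) (h0 : ∀ᵐ x ∂μ, 0 ≤ f x)
    (h : ∫⁻ x, ENNReal.ofReal (f x) ∂μ ≤ ENNReal.ofReal M) : Integrable f μ ∧ ∫ x, f x ∂μ ≤ M := by
  refine ⟨⟨hf, ?_⟩, ?_⟩
  · rw [hasFiniteIntegral_iff_ofReal h0]
    exact h.trans_lt ENNReal.ofReal_lt_top
  · rw [integral_eq_lintegral_of_nonneg_ae h0 hf]
    exact ENNReal.toReal_le_of_le_ofReal hM h

theorem integral_le_of_abs_le_sum {X : Type} [MeasurableSpace X] {μ : Measure X} {n : ℕ} {M : ℝ}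
    {F : Fin n → X → ℝ} {g : X → ℝ} (hF : ∀ k, Integrable (F k) μ ∧ ∫ x, F k x ∂μ ≤ M)
    (c : Fin n → ℝ) (hc : ∀ k, 0 ≤ c k) (h : ∀ᵐ x ∂μ, |g x| ≤ ∑ k, c k * F k x) :
    ∫ x, g x ∂μ ≤ (∑ k, c k) * M := by
  have hi : ∀ k ∈ Finset.univ, Integrable (fun x => c k * F k x) μ := fun k _ =>
    (hF k).1.const_mul _
  refine (le_abs_self _).trans
    (le_trans (norm_integral_le_of_norm_le (f := g) (integrable_finsetSum _ hi) h) ?_)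
  rw [integral_finsetSum _ hi, Finset.sum_mul]
  refine Finset.sum_le_sum fun k _ => ?_
  rw [integral_const_mul]
  exact mul_le_mul_of_nonneg_left (hF k).2 (hc k)

theorem mvF_le_rpow {ϖ ζ : ℝ} (hϖ : 0 < ϖ) (hζ : 0 ≤ ζ) :
    mvF ζ ≤ 2 ^ (1 + ϖ / 2) / (ϖ / 2) * (Real.exp 1 ^ (1 + ϖ / 2) + ζ ^ (1 + ϖ / 2)) := by
  have he := Real.exp_pos 1
  have h1 := Real.log_le_rpow_div (by positivity : 0 ≤ Real.exp 1 + ζ) (half_pos hϖ)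
  have h2 : (Real.exp 1 + ζ) ^ (1 + ϖ / 2)
      ≤ 2 ^ (1 + ϖ / 2) * (Real.exp 1 ^ (1 + ϖ / 2) + ζ ^ (1 + ϖ / 2)) := by
    have key : ∀ a b : ℝ, 0 ≤ a → a ≤ b → (a + b) ^ (1 + ϖ / 2)
        ≤ 2 ^ (1 + ϖ / 2) * (a ^ (1 + ϖ / 2) + b ^ (1 + ϖ / 2)) := by
      intro a b ha hab
      have hb := ha.trans hab
      rw [mul_add, ← Real.mul_rpow two_pos.le hb]
      have := Real.rpow_le_rpow (by positivity) (by linarith : a + b ≤ 2 * b)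
        (by positivity : 0 ≤ 1 + ϖ / 2)
      have : 0 ≤ (2 : ℝ) ^ (1 + ϖ / 2) * a ^ (1 + ϖ / 2) := by positivity
      linarith
    rcases le_total (Real.exp 1) ζ with h | h
    · exact key _ _ he.le h
    · rw [add_comm, add_comm (Real.exp 1 ^ _)]; exact key _ _ hζ h
  calc mvF ζ ≤ (Real.exp 1 + ζ) * ((Real.exp 1 + ζ) ^ (ϖ / 2) / (ϖ / 2)) :=
        mul_le_mul_of_nonneg_left h1 (by positivity)
    _ = (Real.exp 1 + ζ) ^ (1 + ϖ / 2) / (ϖ / 2) := by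
        rw [Real.rpow_add (by positivity), Real.rpow_one, mul_div_assoc]
    _ ≤ _ := by rw [div_mul_eq_mul_div]; gcongr

/-- The bound for the approximating initial data. -/
def iniM (E : ℝ) : ℝ := 2 * (E + max E (E ^ 2))

theorem iniM_nonneg {E : ℝ} (hE : 0 ≤ E) : 0 ≤ iniM E := by
  have := hE.trans (le_max_left E (E ^ 2)); unfold iniM; positivity

section Datum

variable {γ ϖ p₀ ε T E : ℝ} {ρ₀ r : Sp → ℝ} {m₀ u0 : Fin 2 → Sp → ℝ}
  {ρ : SpT → ℝ} {v : Fin 2 → SpT → ℝ}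

theorem IsApproxDatum.root_reg (hε : 0 < ε) (h : IsApproxDatum γ ϖ p₀ ε ρ₀ m₀ r u0) (i : Fin 2) :
    DQr Eq (hor i) 1 0 (1 / 4) (fun p => root r p.2) (fun p => gradhO (root r) i p.2) := by
  set lo := ε ^ (1 / p₀ + 1)
  set hi := ε ^ (-(1 / p₀) - 1)
  have hlo : 0 < lo := Real.rpow_pos_of_pos hε _
  have hm : ∀ᵐ p ∂muQ 1, r p.2 ∈ Icc lo hi :=
    (quasiMP_snd 1).ae (p := fun x => r x ∈ Icc lo hi) (h.bounds.mono fun x hx => ⟨hx.1.le, hx.2.le⟩)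
  have hw : HasWeakDeriv Omega testO (Pi.single (hor i) 1) r (dO (hor i) r) :=
    hasWeakDeriv_weakDeriv (h.dens.2 (hor i)).1
  have Qr : Q 1 0 (fun p : SpT => r p.2) := by
    refine Q.of_bound (MemLp.frozen h.dens.1).1 hi ?_
    filter_upwards [hm] with p hp
    rw [abs_of_nonneg (hlo.le.trans hp.1)]; exact hp.2
  have D := (DQr.of_weakH one_pos hw.space_to_cyl Qr (Q.of_memLp' (q := 4) (a := 1 / 4)
    (MemLp.frozen (h.dens.2 (hor i)).2) (by norm_num) (by simp) (by norm_num))).comp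
    (φ := Real.sqrt) (φ' := fun y => 1 / (2 * √y)) (fun a b hab => by rw [hab])
    (fun y hy => Real.hasDerivAt_sqrt (hlo.trans_le hy.1).ne')
    (continuousOn_const.div (by fun_prop)
      fun y hy => mul_ne_zero two_ne_zero (Real.sqrt_pos.2 (hlo.trans_le hy.1)).ne') hm
  have h1 := HD.space_weak (f := root r) (g := fun x => 1 / (2 * √(r x)) * dO (hor i) r x) D.ld
    (integrable_of_Q_space D.fn (by norm_num)) (integrable_of_Q_space D.dv (by norm_num))
  exact D.congr (.of_forall fun _ => rfl) ((quasiMP_snd 1).ae ((dO_eq h1).mono fun x hx => hx.symm))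

theorem IsApproxDatum.ini (hε : 0 < ε) (h : IsApproxDatum γ ϖ p₀ ε ρ₀ m₀ r u0)
    (hs : IsApproxSolution γ p₀ ε T r u0 ρ v) : Ini (fld T ρ v) (gradhO (root r)) := by
  refine ⟨fun i => (h.root_reg hε i).congr ((quasiMP_snd 1).ae
      (p := fun x => root r x = root ρ (0, x)) (hs.init_dens.mono fun x hx => ?_))
    (.of_forall fun _ => rfl), fun j => ?_⟩
  · show √(r x) = √(ρ (0, x))
    rw [hx]
  · exact (Q.two_of_memLp (MemLp.frozen (h.vel j).1)).congr
      ((quasiMP_snd 1).ae ((hs.init_vel j).mono fun x hx => hx.symm))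

/-- The densities bounded by the size of the approximating initial data. -/
def iniF (γ ϖ p₀ ε : ℝ) (r : Sp → ℝ) (u0 : Fin 2 → Sp → ℝ) : Fin 7 → Sp → ℝ :=
  ![fun x => r x * len u0 x ^ 2, fun x => r x ^ γ, r, fun x => len (gradhO (root r)) x ^ 2,
    fun x => r x * len u0 x ^ (2 + ϖ), fun x => ε * r x ^ (-p₀),
    fun x => ε * len (gradhO (root r)) x ^ 4]

theorem IsApproxDatum.iniF_bound (hγ : 1 < γ) (hE : 0 ≤ E) (hε : 0 < ε)
    (h0 : dataSize γ ϖ ρ₀ m₀ ≤ ENNReal.ofReal E) (h : IsApproxDatum γ ϖ p₀ ε ρ₀ m₀ r u0)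
    (k : Fin 7) :
    Integrable (iniF γ ϖ p₀ ε r u0 k) muO ∧ ∫ x, iniF γ ϖ p₀ ε r u0 k x ∂muO ≤ iniM E := by
  have hr : ∀ᵐ x ∂muO, 0 < r x := h.bounds.mono fun x hx => (Real.rpow_pos_of_pos hε _).trans hx.1
  have rm : AEMeasurable r muO := h.dens.1.1.aemeasurable
  have um : AEMeasurable (len u0) muO := by
    have := fun j => (h.vel j).1.1.aemeasurable
    unfold len; fun_prop
  have gm : AEMeasurable (len (gradhO (root r))) muO := by
    have := fun i =>
      (integrable_of_Q_space (h.root_reg hε i).dv (by norm_num)).aestronglyMeasurable.aemeasurable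
    unfold len; fun_prop
  have hsz : (2 : ℝ≥0∞) * (dataSize' γ ϖ ρ₀ m₀ + max (gradRootNorm ρ₀) (gradRootNorm ρ₀ ^ 2))
      ≤ ENNReal.ofReal (iniM E) := by
    have h1 : dataSize' γ ϖ ρ₀ m₀ ≤ ENNReal.ofReal E := le_self_add.trans h0
    have h2 : gradRootNorm ρ₀ ≤ ENNReal.ofReal E := le_add_self.trans h0
    have hm := hE.trans (le_max_left E (E ^ 2))
    rw [iniM, ENNReal.ofReal_mul two_pos.le, ENNReal.ofReal_add hE hm, ENNReal.ofReal_ofNat]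
    gcongr
    refine max_le (h2.trans (ENNReal.ofReal_le_ofReal (le_max_left _ _))) ?_
    refine (pow_le_pow_left' h2 2).trans ?_
    rw [← ENNReal.ofReal_pow hE]
    exact ENNReal.ofReal_le_ofReal (le_max_right _ _)
  have hs := h.size.le.trans hsz
  have eγ : eLpNorm r (ENNReal.ofReal γ) muO ^ γ = intO (fun x => r x ^ γ) := by
    have hγ0 : 0 < γ := by linarith
    rw [eLpNorm_eq_lintegral_rpow_enorm_toReal (by simpa using hγ0) ENNReal.ofReal_ne_top,
      ENNReal.toReal_ofReal hγ0.le, ← ENNReal.rpow_mul, one_div, inv_mul_cancel₀ hγ0.ne',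
      ENNReal.rpow_one]
    refine lintegral_congr_ae (hr.mono fun x hx => ?_)
    simp only
    rw [Real.enorm_eq_ofReal hx.le, ENNReal.ofReal_rpow_of_nonneg hx.le hγ0.le]
  have e1 : eLpNorm r 1 muO = intO r := by
    rw [eLpNorm_one_eq_lintegral_enorm]
    exact lintegral_congr_ae (hr.mono fun x hx => Real.enorm_eq_ofReal hx.le)
  have e2 : gradRootNorm r ^ 2 = intO (fun x => len (gradhO (root r)) x ^ 2) := by
    rw [gradRootNorm, eLpNorm_eq_lintegral_rpow_enorm_toReal two_ne_zero ENNReal.ofNat_ne_top,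
      ← ENNReal.rpow_natCast, ← ENNReal.rpow_mul]
    norm_num
    refine lintegral_congr fun x => ?_
    have h0 : 0 ≤ len (gradhO (root r)) x := Real.sqrt_nonneg _
    rw [Real.enorm_eq_ofReal h0, ENNReal.ofReal_pow h0]
  rw [eγ, e1, e2] at hs
  have hs' : ∑ k, intO (iniF γ ϖ p₀ ε r u0 k) ≤ ENNReal.ofReal (iniM E) := by
    simpa [iniF, Fin.sum_univ_succ, add_assoc] using hs
  refine integral_le_of_lintegral_le (iniM_nonneg hE) (AEMeasurable.aestronglyMeasurable ?_) ?_
    ((Finset.single_le_sum (fun _ _ => zero_le) (Finset.mem_univ k)).trans hs')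
  · fin_cases k <;> simp only [iniF] <;> simp <;> fun_prop
  · filter_upwards [hr] with x hx
    have hl : 0 ≤ len u0 x := Real.sqrt_nonneg _
    fin_cases k <;> simp [iniF] <;> positivity

theorem IsApproxDatum.init_ae (hε : 0 < ε) (h : IsApproxDatum γ ϖ p₀ ε ρ₀ m₀ r u0)
    (hs : IsApproxSolution γ p₀ ε T r u0 ρ v) : ∀ᵐ x ∂muO, 0 < r x ∧ ρ (0, x) = r x ∧
    (fld T ρ v).vv (0, x) = len u0 x ^ 2 ∧ ∀ j, v j (0, x) = u0 j x := by
  filter_upwards [h.bounds, hs.init_dens, hs.init_vel 0, hs.init_vel 1] with x h1 h2 h3 h4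
  refine ⟨(Real.rpow_pos_of_pos hε _).trans h1.1, h2, ?_, ?_⟩
  · rw [len_sq, ← h3, ← h4]; rfl
  · exact Fin.forall_fin_two.2 ⟨h3, h4⟩

theorem IsApproxDatum.energy_le (hγ : 1 < γ) (hp : 0 < p₀) (hE : 0 ≤ E) (hε : 0 < ε)
    (h0 : dataSize γ ϖ ρ₀ m₀ ≤ ENNReal.ofReal E) (h : IsApproxDatum γ ϖ p₀ ε ρ₀ m₀ r u0)
    (hs : IsApproxSolution γ p₀ ε T r u0 ρ v) : ∫ x, (fld T ρ v).eY γ p₀ ε (0, x) ∂muO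
      ≤ (Fld.eK p₀ / 2 + Fld.eK p₀ * (γ - 1)⁻¹ + 2) * iniM E := by
  have hγ1 : 0 < γ - 1 := by linarith
  have hK : 0 ≤ Fld.eK p₀ := by unfold Fld.eK; positivity
  refine (integral_le_of_abs_le_sum (h.iniF_bound hγ hE hε h0)
    ![Fld.eK p₀ / 2, Fld.eK p₀ * (γ - 1)⁻¹, 1, 0, 0, 1, 0] ?_ ?_).trans_eq ?_
  · intro k; fin_cases k <;> simp <;> positivity
  · filter_upwards [h.init_ae hε hs] with x ⟨h1, h2, h3, _⟩
    rw [abs_of_nonneg (Reg.eY_nonneg hγ hp hε (h1.le.trans_eq h2.symm)).1]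
    refine le_of_eq ?_
    simp only [Fld.eY, Fld.pw, h3, iniF, Fin.sum_univ_succ]
    simp [fld, h2]
    ring
  · simp [Fin.sum_univ_succ, -mul_eq_mul_right_iff]; ring

theorem IsApproxDatum.bd_le (hγ : 1 < γ) (hE : 0 ≤ E) (hε : 0 < ε)
    (h0 : dataSize γ ϖ ρ₀ m₀ ≤ ENNReal.ofReal E) (h : IsApproxDatum γ ϖ p₀ ε ρ₀ m₀ r u0)
    (hs : IsApproxSolution γ p₀ ε T r u0 ρ v) {q0 : Fin 2 → Sp → ℝ} (hq : q0 = gradhO (root r)) :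
    ∫ x, 2 * (fld T ρ v).s (0, x) * (q0 0 x * (fld T ρ v).v 0 (0, x)
        + q0 1 x * (fld T ρ v).v 1 (0, x)) ∂muO
      + ∫ x, (2 * (q0 0 x ^ 2 + q0 1 x ^ 2) + ε * (q0 0 x ^ 2 + q0 1 x ^ 2) ^ 2) ∂muO
      ≤ 5 * iniM E := by
  have e4 : ∀ x, len q0 x ^ 4 = (len q0 x ^ 2) ^ 2 := fun x => by ring
  have h1 := integral_le_of_abs_le_sum (g := fun x => 2 * (fld T ρ v).s (0, x)
      * (q0 0 x * (fld T ρ v).v 0 (0, x) + q0 1 x * (fld T ρ v).v 1 (0, x)))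
    (h.iniF_bound hγ hE hε h0) ![1, 0, 0, 1, 0, 0, 0] (by intro k; fin_cases k <;> simp) (by
      filter_upwards [h.init_ae hε hs] with x ⟨h1, h2, h3, h4⟩
      simp [iniF, Fin.sum_univ_succ, len_sq, fld, root, h2, h4, ← hq]
      have h5 := Real.sq_sqrt h1.le
      generalize √(r x) = s at *
      rw [← h5, ← abs_two, ← abs_mul, ← abs_mul, abs_le]
      constructor <;> nlinarith [sq_nonneg (s * u0 0 x + q0 0 x), sq_nonneg (s * u0 1 x + q0 1 x),
        sq_nonneg (s * u0 0 x - q0 0 x), sq_nonneg (s * u0 1 x - q0 1 x)])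
  have h2 := integral_le_of_abs_le_sum
    (g := fun x => (2 * (q0 0 x ^ 2 + q0 1 x ^ 2) + ε * (q0 0 x ^ 2 + q0 1 x ^ 2) ^ 2))
    (h.iniF_bound hγ hE hε h0) ![0, 0, 0, 2, 0, 0, 1] (by intro k; fin_cases k <;> simp)
    (.of_forall fun x => by
      rw [abs_of_nonneg (by positivity)]
      simp [iniF, Fin.sum_univ_succ, e4, len_sq, ← hq])
  simp [Fin.sum_univ_succ] at h1 h2
  linarith

theorem IsApproxDatum.mv_le (hγ : 1 < γ) (hϖ : 0 < ϖ) (hE : 0 ≤ E) (hε : 0 < ε)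
    (h0 : dataSize γ ϖ ρ₀ m₀ ≤ ENNReal.ofReal E) (h : IsApproxDatum γ ϖ p₀ ε ρ₀ m₀ r u0)
    (hs : IsApproxSolution γ p₀ ε T r u0 ρ v) :
    ∫ x, (fld T ρ v).ρ (0, x) * (fld T ρ v).F0 (0, x) ∂muO
      ≤ 2 ^ (1 + ϖ / 2) / (ϖ / 2) * (Real.exp 1 ^ (1 + ϖ / 2) + 1) * iniM E := by
  refine (integral_le_of_abs_le_sum (h.iniF_bound hγ hE hε h0)
    ![0, 0, 2 ^ (1 + ϖ / 2) / (ϖ / 2) * Real.exp 1 ^ (1 + ϖ / 2), 0,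
      2 ^ (1 + ϖ / 2) / (ϖ / 2), 0, 0] ?_ ?_).trans_eq ?_
  · intro k; fin_cases k <;> simp <;> positivity
  · filter_upwards [h.init_ae hε hs] with x ⟨h1, h2, h3, _⟩
    have hl : 0 ≤ len u0 x := Real.sqrt_nonneg _
    have h4 := mvF_le_rpow hϖ (sq_nonneg (len u0 x))
    have h5 : (len u0 x ^ 2) ^ (1 + ϖ / 2) = len u0 x ^ (2 + ϖ) := by
      rw [← Real.rpow_natCast, ← Real.rpow_mul hl]; congr 1; push_cast; ring
    rw [h5] at h4
    have h6 := mul_le_mul_of_nonneg_left h4 h1.le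
    have e : (fld T ρ v).ρ (0, x) * (fld T ρ v).F0 (0, x) = r x * mvF (len u0 x ^ 2) := by
      rw [← h2, ← h3]; rfl
    rw [e, abs_of_nonneg (mul_nonneg h1.le (mvF_nonneg (sq_nonneg _)))]
    refine h6.trans_eq ?_
    simp [iniF, Fin.sum_univ_succ]
    ring
  · simp [Fin.sum_univ_succ, -mul_eq_mul_right_iff]; ring

end Datum

/-! ### The estimates in terms of the extended integrals -/

theorem lintegral_ofReal_le {X : Type} [MeasurableSpace X] {μ : Measure X} {f g : X → ℝ} {M : ℝ}
    (hg : Integrable g μ) (h0 : ∀ᵐ x ∂μ, 0 ≤ g x) (h : ∀ᵐ x ∂μ, f x ≤ g x) (hM : ∫ x, g x ∂μ ≤ M)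
    : ∫⁻ x, ENNReal.ofReal (f x) ∂μ ≤ ENNReal.ofReal M := by
  refine (lintegral_mono_ae (h.mono fun x hx => ENNReal.ofReal_le_ofReal hx)).trans ?_
  rw [← ofReal_integral_eq_lintegral_ofReal hg h0]
  exact ENNReal.ofReal_le_ofReal hM

theorem ofReal_mul_lintegral_le {X : Type} [MeasurableSpace X] {μ : Measure X} {f g : X → ℝ}
    {c M : ℝ} (hc : 0 ≤ c) (hg : Integrable g μ) (h0 : ∀ᵐ x ∂μ, 0 ≤ g x)
    (h : ∀ᵐ x ∂μ, c * f x ≤ g x) (hM : ∫ x, g x ∂μ ≤ M) :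
    ENNReal.ofReal c * ∫⁻ x, ENNReal.ofReal (f x) ∂μ ≤ ENNReal.ofReal M := by
  rw [← lintegral_const_mul' _ _ ENNReal.ofReal_ne_top]
  simp only [← ENNReal.ofReal_mul hc]
  exact lintegral_ofReal_le hg h0 h hM

section Solution

variable {γ p₀ ε T K B t : ℝ} {ρ : SpT → ℝ} {v : Fin 2 → SpT → ℝ}

theorem basic_le (hT : 0 < T) (hγ : 1 < γ) (hp : 24 < p₀) (hε : 0 < ε)
    (h : Reg γ p₀ ε T (fld T ρ v)) (hK : ∀ t ∈ Icc 0 T, ∫ x, (fld T ρ v).eY γ p₀ ε (t, x) ∂muO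
    + ∫ p, (fld T ρ v).eDiss p₀ ε p ∂muQ t ≤ K) (ht : t ∈ Icc 0 T) :
    basicEnergy γ p₀ ε ρ v t + basicDissipation p₀ ε T ρ v ≤ ENNReal.ofReal ((9 + γ) * K) := by
  have hp0 : 0 < p₀ := by linarith
  have hγ1 : 0 < γ - 1 := by linarith
  obtain ⟨hρ0, hY0, hYK, -⟩ := h.energy_split hT hγ hp0 hε hK ht
  have hDK := (h.energy_split hT hγ hp0 hε hK ⟨hT.le, le_rfl⟩).2.2.2
  have hD0 : ∀ᵐ p ∂muQ T, 0 ≤ (fld T ρ v).eDiss p₀ ε p :=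
    h.ρ_nonneg.mono fun p hp => Reg.eDiss_nonneg hp0 hε hp
  have hK0 : 0 ≤ K := hY0.trans hYK
  have iY := h.eY_integrable hT ht
  have iD := h.QeDiss.integrable
  have hY : ∀ᵐ x ∂muO, ρ (t, x) * len v (t, x) ^ 2 ≤ 2 * (fld T ρ v).eY γ p₀ ε (t, x) ∧
      ρ (t, x) ^ γ ≤ (γ - 1) * (fld T ρ v).eY γ p₀ ε (t, x) ∧
      ε * ρ (t, x) ^ (-p₀) ≤ (fld T ρ v).eY γ p₀ ε (t, x) ∧
      ρ (t, x) ≤ (fld T ρ v).eY γ p₀ ε (t, x) ∧ 0 ≤ (fld T ρ v).eY γ p₀ ε (t, x) := by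
    filter_upwards [hρ0] with x (h0 : 0 ≤ ρ (t, x))
    have h1 : _ ≤ (fld T ρ v).eY γ p₀ ε (t, x) := Reg.eY_ge hγ hp0 h0
    have e1 : (fld T ρ v).ρ (t, x) * (fld T ρ v).vv (t, x) = ρ (t, x) * len v (t, x) ^ 2 := by
      rw [len_sq]; rfl
    have e2 : ∀ a, (fld T ρ v).pw a (t, x) = ρ (t, x) ^ a := fun _ => rfl
    rw [e1, e2, e2] at h1
    change _ + ρ (t, x) ≤ _ at h1
    have h2 : 0 ≤ ρ (t, x) * len v (t, x) ^ 2 := by positivity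
    have h3 : 0 ≤ (γ - 1)⁻¹ * ρ (t, x) ^ γ := by positivity
    have h4 : 0 ≤ ε * ρ (t, x) ^ (-p₀) := by positivity
    refine ⟨by linarith, ?_, by linarith, by linarith, by linarith⟩
    rw [← inv_mul_le_iff₀ hγ1]; linarith
  have hY' := hY.mono fun x h => h.2.2.2.2
  have b1 : intO (fun x => ρ (t, x) * len v (t, x) ^ 2) ≤ ENNReal.ofReal (2 * K) :=
    lintegral_ofReal_le (iY.const_mul 2) (hY'.mono fun x h => mul_nonneg two_pos.le h)
      (hY.mono fun x h => h.1) (by rw [integral_const_mul]; linarith)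
  have b2 : intO (fun x => ρ (t, x) ^ γ) ≤ ENNReal.ofReal ((γ - 1) * K) :=
    lintegral_ofReal_le (iY.const_mul (γ - 1)) (hY'.mono fun x h => mul_nonneg hγ1.le h)
      (hY.mono fun x h => h.2.1)
      (by rw [integral_const_mul]; exact mul_le_mul_of_nonneg_left hYK hγ1.le)
  have b3 := lintegral_ofReal_le iY hY' (hY.mono fun x h => h.2.2.2.1) hYK
  have b4 := ofReal_mul_lintegral_le hε.le iY hY' (hY.mono fun x h => h.2.2.1) hYK
  have hD : ∀ᵐ p ∂muQ T,
      (ρ p * symGradSq T v p + ρ p * (∑ j, dQ T 2 (v j) p ^ 2) ≤ (fld T ρ v).eDiss p₀ ε p) ∧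
      (ε * (ρ p ^ (-p₀) * len v p ^ 2 + ρ p * len v p ^ 5
        + len (gradh T (root ρ)) p ^ 4 * len v p ^ 2 + len (gradh T (root ρ)) p ^ 2 * len v p ^ 2
        + len (gradh T (root ρ)) p ^ 4) ≤ 4 * (fld T ρ v).eDiss p₀ ε p) ∧
      ε ^ 2 * ρ p ^ (-2 * p₀ - 1) ≤ (fld T ρ v).eDiss p₀ ε p := by
    filter_upwards [h.pos] with p ⟨h1, h2, h3⟩
    have hρ : 0 < ρ p := by have : ρ p = _ := h2; rw [this]; positivity
    have e1 : symGradSq T v p = (fld T ρ v).D2 p := by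
      simp only [symGradSq, symGrad, Fin.sum_univ_two, Fld.D2, Fld.D, fld]; ring
    have e2 : ∑ j, dQ T 2 (v j) p ^ 2 = (fld T ρ v).Z2 p := by
      simp only [Fin.sum_univ_two, Fld.Z2, fld]
    have e3 : len v p ^ 2 = (fld T ρ v).vv p := len_sq _ _
    have e4 : len v p ^ 5 = √((fld T ρ v).vv p) ^ 3 * (fld T ρ v).vv p := by
      have : len v p = √((fld T ρ v).vv p) := len_eq _ _
      rw [← this, ← e3]; ring
    have e5 : len (gradh T (root ρ)) p ^ 2 = (fld T ρ v).qq p := len_sq _ _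
    have e6 : len (gradh T (root ρ)) p ^ 4 = (fld T ρ v).qq p ^ 2 := by rw [← e5]; ring
    have e7 : ρ p ^ (-2 * p₀ - 1) = (fld T ρ v).pw (-p₀) p ^ 2 * (fld T ρ v).R p ^ 2 := by
      have : (fld T ρ v).R p ^ 2 = (ρ p)⁻¹ := by
        show ((fld T ρ v).s p)⁻¹ ^ 2 = _
        rw [inv_pow, ← h2]; rfl
      rw [this, Real.rpow_sub hρ, Real.rpow_one, div_eq_mul_inv, show -2 * p₀ = -p₀ * (2 : ℕ) by
        push_cast; ring, Real.rpow_mul_natCast hρ.le]; rfl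
    rw [e1, e2, e3, e4, e5, e6, e7]
    have hv := (fld T ρ v).vv_nonneg p
    have hq := (fld T ρ v).qq_nonneg p
    have hd := (fld T ρ v).D2_nonneg p
    have hz : 0 ≤ (fld T ρ v).Z2 p := by unfold Fld.Z2; positivity
    have hw : 0 ≤ (fld T ρ v).pw (-p₀) p := Real.rpow_nonneg hρ.le _
    have hR : 0 ≤ (fld T ρ v).R p ^ 2 := sq_nonneg _
    have e8 : ρ p ^ (-p₀) = (fld T ρ v).pw (-p₀) p := rfl
    rw [e8]
    have eD := Fld.eDiss.eq_1 (fld T ρ v) p₀ ε p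
    have e9 : (fld T ρ v).ρ p = ρ p := rfl
    rw [e9] at eD
    generalize (fld T ρ v).eDiss p₀ ε p = e at *
    generalize (fld T ρ v).D2 p = a1 at *
    generalize (fld T ρ v).Z2 p = a2 at *
    generalize (fld T ρ v).qq p = q at *
    generalize (fld T ρ v).vv p = w at *
    generalize (fld T ρ v).R p ^ 2 = R2 at *
    generalize (fld T ρ v).pw (-p₀) p = P at *
    have g1 : 0 ≤ ρ p * a1 := by positivity
    have g2 : 0 ≤ ρ p * a2 := by positivity
    have g3 : 0 ≤ ε * (q * w) := by positivity
    have g4 : 0 ≤ ε * (q ^ 2 * w) := by positivity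
    have g5 : 0 ≤ ε * (P * w) := by positivity
    have g6 : 0 ≤ ε * (ρ p * √w ^ 3 * w) := by positivity
    have g7 : 0 ≤ ε ^ 2 * (P ^ 2 * R2) := by
      have : 0 ≤ R2 := hR
      positivity
    have g8 := mul_le_mul_of_nonneg_right (by linarith : 1 ≤ p₀ / 2) g7
    have g9 : 0 ≤ ε * q := by positivity
    have g10 : 0 ≤ ε * q ^ 2 := by positivity
    refine ⟨?_, ?_, ?_⟩ <;> linarith only [eD, g1, g2, g3, g4, g5, g6, g7, g8, g9, g10]
  have b5 : intQ T (fun p => ρ p * symGradSq T v p + ρ p * (∑ j, dQ T 2 (v j) p ^ 2))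
      ≤ ENNReal.ofReal K := lintegral_ofReal_le iD hD0 (hD.mono fun p hp => hp.1) hDK
  have b6 := ofReal_mul_lintegral_le hε.le (iD.const_mul 4)
    (hD0.mono fun p hp => mul_nonneg four_pos.le hp) (hD.mono fun p hp => hp.2.1)
    (M := 4 * K) (by rw [integral_const_mul]; linarith)
  have b7 := ofReal_mul_lintegral_le (sq_nonneg ε) iD hD0 (hD.mono fun p hp => hp.2.2) hDK
  have e : (9 + γ) * K = (2 * K + (γ - 1) * K + K + K) + (K + 4 * K + K) := by ring
  have hgK := mul_nonneg hγ1.le hK0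
  rw [e, ENNReal.ofReal_add (by positivity) (by positivity),
    ENNReal.ofReal_add (by positivity) (by positivity),
    ENNReal.ofReal_add (by positivity) (by positivity),
    ENNReal.ofReal_add (by positivity) (by positivity),
    ENNReal.ofReal_add (by positivity) (by positivity),
    ENNReal.ofReal_add (by positivity) (by positivity)]
  exact add_le_add (add_le_add (add_le_add (add_le_add b1 b2) b3) b4)
    (add_le_add (add_le_add b5 b6) b7)

theorem bd_entropy_le (hT : 0 < T) (hε : 0 < ε) (h : Reg γ p₀ ε T (fld T ρ v))
    (hB : ∀ᵐ τ ∂volume.restrict (Ioo 0 T),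
    ∫ x, ((fld T ρ v).qq (τ, x) + ε * (fld T ρ v).qq (τ, x) ^ 2) ∂muO ≤ B) (ht : t ∈ Icc 0 T) :
    (∀ i : Fin 2, WeakDiffO (hor i) (fun x => root ρ (t, x))) ∧
      bdEntropy ε ρ t ≤ ENNReal.ofReal B := by
  obtain ⟨g, hg, hm, hl⟩ := h.bd_everywhere hT hε hB ht
  refine ⟨fun i => ⟨g i, hg i⟩, le_trans (le_of_eq ?_) hl⟩
  have e : ∀ᵐ x ∂muO, len (gradhO (fun y => root ρ (t, y))) x ^ 2 = g 0 x ^ 2 + g 1 x ^ 2 := by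
    filter_upwards [dO_eq (hg 0), dO_eq (hg 1)] with x h0 h1
    rw [len_sq, ← h0, ← h1]; rfl
  rw [bdEntropy, intO, intO, lintegral_congr_ae (g := fun x => ENNReal.ofReal (g 0 x ^ 2 + g 1 x ^ 2))
      (e.mono fun x hx => by simp only [hx]),
    lintegral_congr_ae (f := fun x => ENNReal.ofReal (len (gradhO (fun y => root ρ (t, y))) x ^ 4))
      (g := fun x => ENNReal.ofReal ((g 0 x ^ 2 + g 1 x ^ 2) ^ 2))
      (e.mono fun x hx => by simp only [← hx]; congr 1; ring),
    ← lintegral_const_mul' _ _ ENNReal.ofReal_ne_top,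
    ← lintegral_add_left (by have := hm 0; have := hm 1; fun_prop)]
  refine lintegral_congr fun x => ?_
  rw [← ENNReal.ofReal_mul hε.le, ← ENNReal.ofReal_add (by positivity) (by positivity)]

theorem bd_dissipation_le (hT : 0 < T) (hγ : 1 < γ) (hε : 0 < ε) (h : Reg γ p₀ ε T (fld T ρ v))
    (hB : ∫ p, (fld T ρ v).bdDiss γ ε p ∂muQ T ≤ B) :
    bdDissipation γ ε T ρ v ≤ ENNReal.ofReal (7 * B) := by
  have hD0 : ∀ᵐ p ∂muQ T, 0 ≤ (fld T ρ v).bdDiss γ ε p :=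
    h.ρ_nonneg.mono fun p hp => Reg.bdDiss_nonneg hγ hε hp
  have hB0 : 0 ≤ B := (integral_nonneg_of_ae hD0).trans hB
  have iD := (h.QbdDiss (γ := γ) (ε := ε)).integrable
  have hD : ∀ᵐ p ∂muQ T,
      (ρ p * gradSq T v p + ρ p * dQ T 2 (vert T ρ v) p ^ 2 ≤ (fld T ρ v).bdDiss γ ε p) ∧
      (ρ p ^ (γ - 2) * len (gradh T ρ) p ^ 2 ≤ (fld T ρ v).bdDiss γ ε p) ∧
      (ε * (laph T (root ρ) p ^ 2 + len (gradh T (root ρ)) p ^ 2 * hessSq T (root ρ) p)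
        ≤ 4 * (fld T ρ v).bdDiss γ ε p) ∧
      ε ^ 2 * (len (gradh T (root ρ)) p ^ 4 * hessSq T (root ρ) p) ≤ (fld T ρ v).bdDiss γ ε p := by
    filter_upwards [h.pos, (h.Dρ 0).dQ_eq hT, (h.Dρ 1).dQ_eq hT] with p ⟨h1, h2, h3⟩ d0 d1
    have hρ : 0 < ρ p := by have : ρ p = _ := h2; rw [this]; positivity
    have e1 : gradSq T v p = (fld T ρ v).V2 p := by
      simp only [gradSq, Fin.sum_univ_two, Fld.V2, fld]; ring
    have e2 : hessSq T (root ρ) p = (fld T ρ v).H2 p := by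
      simp only [hessSq, Fin.sum_univ_two, Fld.H2, fld]; ring
    have e3 : laph T (root ρ) p = (fld T ρ v).lap p := by
      simp only [laph, divh, Fin.sum_univ_two, Fld.lap, fld]; rfl
    have e5 : len (gradh T (root ρ)) p ^ 2 = (fld T ρ v).qq p := len_sq _ _
    have e6 : len (gradh T (root ρ)) p ^ 4 = (fld T ρ v).qq p ^ 2 := by rw [← e5]; ring
    have e7 : ρ p ^ (γ - 2) * len (gradh T ρ) p ^ 2
        = 4 * ((fld T ρ v).pw (γ - 1) p * (fld T ρ v).qq p) := by
      have h4 : ρ p ^ (γ - 1) = ρ p ^ (γ - 2) * ρ p := by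
        rw [← Real.rpow_add_one hρ.ne']; congr 1; ring
      have h5 : (fld T ρ v).pw (γ - 1) p = ρ p ^ (γ - 1) := rfl
      have h6 : ρ p = (fld T ρ v).s p ^ 2 := h2
      have d0' : gradh T ρ 0 p = _ := d0
      have d1' : gradh T ρ 1 p = _ := d1
      rw [len_sq, d0', d1', h5, h4, Fld.qq]
      generalize ρ p ^ (γ - 2) = P
      rw [h6]; ring
    have hl := (fld T ρ v).lap_sq p
    have hv := (fld T ρ v).V2_nonneg p
    have hq := (fld T ρ v).qq_nonneg p
    have hH := (fld T ρ v).H2_nonneg p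
    have hw : 0 ≤ (fld T ρ v).pw (γ - 1) p := Real.rpow_nonneg hρ.le _
    have eD := Fld.bdDiss.eq_1 (fld T ρ v) γ ε p
    have e9 : (fld T ρ v).ρ p = ρ p := rfl
    have e10 : (fld T ρ v).wz p = dQ T 2 (vert T ρ v) p := rfl
    rw [e9, e10] at eD
    rw [e7, e1, e2, e3, e5, e6]
    generalize (fld T ρ v).bdDiss γ ε p = e at *
    generalize dQ T 2 (vert T ρ v) p = a1 at *
    generalize (fld T ρ v).V2 p = a2 at *
    generalize (fld T ρ v).qq p = q at *
    generalize (fld T ρ v).H2 p = w at *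
    generalize (fld T ρ v).lap p = l at *
    generalize (fld T ρ v).pw (γ - 1) p = P at *
    have g1 : 0 ≤ ρ p * a2 := by positivity
    have g2 : 0 ≤ ρ p * a1 ^ 2 := by positivity
    have g3 : 0 ≤ ε / 2 * w := by positivity
    have g4 : 0 ≤ ε * (q * w) := by positivity
    have g5 : 0 ≤ ε ^ 2 * (q ^ 2 * w) := by positivity
    have g6 : 0 ≤ P * q := by positivity
    have g7 := mul_le_mul_of_nonneg_right hγ.le g6
    have g8 := mul_le_mul_of_nonneg_left hl hε.le
    refine ⟨?_, ?_, ?_, ?_⟩ <;> linarith only [eD, g1, g2, g3, g4, g5, g6, g7, g8]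
  have b1 : intQ T _ ≤ _ := lintegral_ofReal_le iD hD0 (hD.mono fun p hp => hp.1) hB
  have b2 : intQ T _ ≤ _ := lintegral_ofReal_le iD hD0 (hD.mono fun p hp => hp.2.1) hB
  have b3 := ofReal_mul_lintegral_le hε.le (iD.const_mul 4)
    (hD0.mono fun p hp => mul_nonneg four_pos.le hp) (hD.mono fun p hp => hp.2.2.1)
    (M := 4 * B) (by rw [integral_const_mul]; linarith)
  have b4 := ofReal_mul_lintegral_le (sq_nonneg ε) iD hD0 (hD.mono fun p hp => hp.2.2.2) hB
  have e : 7 * B = B + B + 4 * B + B := by ring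
  rw [e, ENNReal.ofReal_add (by positivity) (by positivity),
    ENNReal.ofReal_add (by positivity) (by positivity),
    ENNReal.ofReal_add (by positivity) (by positivity)]
  exact add_le_add (add_le_add (add_le_add b1 b2) b3) b4

end Solution

/-! ### The uniform bounds -/

/-- The bound for the basic energy. -/
def boundK (γ p₀ T E : ℝ) : ℝ :=
  Real.exp (Fld.eL γ p₀ * T) * ((Fld.eK p₀ / 2 + Fld.eK p₀ * (γ - 1)⁻¹ + 2) * iniM E + 1)

/-- The bound for the Bresch–Desjardins entropy. -/
def boundB (γ p₀ T E : ℝ) : ℝ :=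
  5 * iniM E + 2 * boundK γ p₀ T E + Reg.bdC * (boundK γ p₀ T E + T * (1 + boundK γ p₀ T E))

/-- The bound for the Mellet–Vasseur entropy. -/
def boundV (γ ϖ p₀ T E : ℝ) (n : ℕ) : ℝ :=
  2 ^ (1 + ϖ / 2) / (ϖ / 2) * (Real.exp 1 ^ (1 + ϖ / 2) + 1) * iniM E
    + (3 * boundK γ p₀ T E + 3 * boundB γ p₀ T E
      + 3 * (T * (1 + powBound (boundK γ p₀ T E) (boundB γ p₀ T E) n))
      + 3843 * (T * boundK γ p₀ T E))

theorem IsApproxSolution.bounds_le {γ ϖ p₀ ε E t : ℝ} {n : ℕ} {ρ₀ r : Sp → ℝ}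
    {m₀ u0 : Fin 2 → Sp → ℝ} {ρ : SpT → ℝ} {v : Fin 2 → SpT → ℝ} (hγ : 1 < γ) (hϖ : 0 < ϖ)
    (hp : 24 < p₀) (hpγ : γ - 1 < p₀) (hn : 8 * γ - 6 ≤ (2 : ℝ) ^ (n + 1)) (hT : 0 < T)
    (hE : 0 ≤ E) (h0 : dataSize γ ϖ ρ₀ m₀ ≤ ENNReal.ofReal E) (hε : 0 < ε) (hε1 : ε ≤ 1 / 4)
    (hd : IsApproxDatum γ ϖ p₀ ε ρ₀ m₀ r u0) (hs : IsApproxSolution γ p₀ ε T r u0 ρ v)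
    (ht : t ∈ Icc 0 T) : basicEnergy γ p₀ ε ρ v t + basicDissipation p₀ ε T ρ v
        ≤ ENNReal.ofReal ((9 + γ) * boundK γ p₀ T E) ∧
      (∀ i : Fin 2, WeakDiffO (hor i) (fun x => root ρ (t, x))) ∧
      bdEntropy ε ρ t + bdDissipation γ ε T ρ v ≤ ENNReal.ofReal (8 * boundB γ p₀ T E) ∧
      mvEntropy ρ v t ≤ ENNReal.ofReal (boundV γ ϖ p₀ T E n) := by
  have hp0 : 0 < p₀ := by linarith
  have h : Reg γ p₀ ε T (fld T ρ v) := hs.reg hT hγ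
  have hK : ∀ t ∈ Icc 0 T, ∫ x, (fld T ρ v).eY γ p₀ ε (t, x) ∂muO
      + ∫ p, (fld T ρ v).eDiss p₀ ε p ∂muQ t ≤ boundK γ p₀ T E := fun t ht =>
    (h.energy hT hγ hp0 hpγ hε hε1 ht).trans (mul_le_mul_of_nonneg_left
      (add_le_add (hd.energy_le hγ hp0 hE hε h0 hs) le_rfl) (Real.exp_pos _).le)
  have hB := h.bd_bound hT hγ hp hε hε1 (hd.ini hε hs) hK (hd.bd_le hγ hE hε h0 hs rfl)
  change ∀ᵐ τ ∂volume.restrict (Ioo 0 T), _ ≤ boundB γ p₀ T E at hB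
  have hD := h.bdDiss_bound hT hε hB
  have hD0 : ∀ᵐ p ∂muQ T, 0 ≤ (fld T ρ v).bdDiss γ ε p :=
    h.ρ_nonneg.mono fun p hp => Reg.bdDiss_nonneg hγ hε hp
  have hB0 : 0 ≤ boundB γ p₀ T E := (integral_nonneg_of_ae hD0).trans hD
  have hB1 : ∀ᵐ τ ∂volume.restrict (Ioo 0 T),
      ∫ x, ((fld T ρ v).qq (τ, x) + ε * (fld T ρ v).qq (τ, x) ^ 2) ∂muO ≤ boundB γ p₀ T E := by
    filter_upwards [hB, ae_restrict_mem measurableSet_Ioo] with τ h1 h2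
    have := integral_nonneg_of_ae (ae_mono (muQ_mono h2.2.le) hD0)
    linarith
  have hB2 : ∀ᵐ τ ∂volume.restrict (Ioo 0 T),
      ∫ x, (fld T ρ v).qq (τ, x) ∂muO ≤ boundB γ p₀ T E := by
    have q1 : Q T 1 (fun p => (fld T ρ v).qq p + ε * (fld T ρ v).qq p ^ 2) :=
      h.Qqq.mono.add (h.Qqq.sq.const_mul ε).mono
    filter_upwards [hB1, q1.frozen (T' := 1)] with τ h1 h2
    refine (integral_mono_of_nonneg (.of_forall fun x => (fld T ρ v).qq_nonneg _)
      (integrable_of_Q_space h2 le_rfl) (.of_forall fun x => ?_)).trans h1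
    exact le_add_of_nonneg_right (by positivity)
  obtain ⟨w1, w2⟩ := bd_entropy_le hT hε h hB1 ht
  refine ⟨basic_le hT hγ hp hε h hK ht, w1, ?_, ?_⟩
  · rw [show 8 * boundB γ p₀ T E = boundB γ p₀ T E + 7 * boundB γ p₀ T E by ring,
      ENNReal.ofReal_add hB0 (by positivity)]
    exact add_le_add w2 (bd_dissipation_le hT hγ hε h hD)
  · obtain ⟨m1, m2⟩ := h.mv_bound hT hγ hp hε hε1 hn hK hB2 hD ht
    obtain ⟨c, C, hc, hpos⟩ := h.posAll hT ht
    refine lintegral_ofReal_le m1 (hpos.mono fun x hx => mul_nonneg (hc.le.trans hx.1)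
      (mvF_nonneg ((fld T ρ v).vv_nonneg _))) (.of_forall fun x => ?_)
      (m2.trans (add_le_add (hd.mv_le hγ hϖ hE hε h0 hs) le_rfl))
    rw [len_sq, mul_assoc]; rfl

end CPE

end

open CPE
theorem mainTheorem3 (γ ϖ p₀ : ℝ) (hγ : 1 < γ) (hϖ : 0 < ϖ) (hp₀ : max 24 (γ - 1) < p₀) :
    ∃ ε₀ : ℝ, 0 < ε₀ ∧ ε₀ < 1 ∧ ∀ T : ℝ, 0 < T → ∀ E : ℝ, 0 ≤ E → ∃ C : ℝ, 0 < C ∧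
      ∀ (ρ₀ : Sp → ℝ) (m₀ : Fin 2 → Sp → ℝ), IsInitialData γ ϖ ρ₀ m₀ →
      dataSize γ ϖ ρ₀ m₀ ≤ ENNReal.ofReal E →
      ∀ (ε₁ : ℝ), 0 < ε₁ → ε₁ < 1 →
      ∀ (r : ℝ → Sp → ℝ) (u : ℝ → Fin 2 → Sp → ℝ), IsApproxData γ ϖ p₀ ε₁ ρ₀ m₀ r u →
      ∀ ε : ℝ, 0 < ε → ε < ε₀ → ε < ε₁ →
      ∀ (ρ : SpT → ℝ) (v : Fin 2 → SpT → ℝ), IsApproxSolution γ p₀ ε T (r ε) (u ε) ρ v →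
      ∀ t ∈ Set.Icc 0 T,
        basicEnergy γ p₀ ε ρ v t + basicDissipation p₀ ε T ρ v ≤ ENNReal.ofReal C ∧
        (∀ i : Fin 2, WeakDiffO (hor i) (fun x => root ρ (t, x))) ∧
        bdEntropy ε ρ t + bdDissipation γ ε T ρ v ≤ ENNReal.ofReal C ∧
        mvEntropy ρ v t ≤ ENNReal.ofReal C := by
  obtain ⟨hp, hpγ⟩ := max_lt_iff.1 hp₀
  obtain ⟨n, hn⟩ := pow_unbounded_of_one_lt (8 * γ - 6) (one_lt_two (α := ℝ))
  have hn' : 8 * γ - 6 ≤ (2 : ℝ) ^ (n + 1) :=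
    hn.le.trans (pow_le_pow_right₀ one_le_two n.le_succ)
  refine ⟨1 / 4, by norm_num, by norm_num, fun T hT E hE =>
    ⟨max 1 (max ((9 + γ) * boundK γ p₀ T E)
      (max (8 * boundB γ p₀ T E) (boundV γ ϖ p₀ T E n))), lt_max_of_lt_left one_pos, ?_⟩⟩
  intro ρ₀ m₀ _ h0 ε₁ _ _ r u hr ε hε hε0 hε1 ρ v hs t ht
  obtain ⟨h1, h2, h3, h4⟩ := hs.bounds_le hγ hϖ hp hpγ hn' hT hE h0 hε hε0.le
    (hr.datum ε ⟨hε, hε1⟩) ht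
  refine ⟨h1.trans (ENNReal.ofReal_le_ofReal ?_), h2, h3.trans (ENNReal.ofReal_le_ofReal ?_),
    h4.trans (ENNReal.ofReal_le_ofReal ?_)⟩ <;> simp
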